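/- **Setting.** Let $(G;A,B)$ be a double Lie group: $G$ is a (finite-dimensional, Hausdorff, second countable) Lie group and $A,B$ are closed Lie subgroups with $A\cap B=\{e\}$ and $G=AB$. Write $g=a_L(g)b_R(g)=b_L(g)a_R(g)$ with $a_L(g),a_R(g)\in A$, $b_L(g),b_R(g)\in B$. Let $G_A$ be the differential groupoid $G$ over $A$ with left and right projections $a_L,a_R$, product $(b_1a)\cdot(ab_2)=b_1ab_2$ and inverse $s_A(g)=a_R(g)b_R(g)^{-1}$; let $G_B$ be the analogous groupoid over $B$, with product $m_B$: $(a_1b)\cdot(ba_2)=a_1ba_2$. Let $F_l(g)=a_L(g)B$ and $F_r(g)=Ba_R(g)$ be the left and right fibers of $G_A$ through $g$, and $T^l_gG_A$, $T^r_gG_A$ their tangent spaces at $g$. Let $P_B$ be the projection of $\mathfrak g=\mathfrak a\oplus\mathfrak b$ onto $\mathfrak b$, and put $\psi_B(a)=\det(P_B\mathrm{Ad}(a)|_{\mathfrak b})$ for $a\in A$, $\varphi_B(b)=\det(P_B\mathrm{Ad}(b)|_{\mathfrak b})$ for $b\in B$. Fix a real half-density $\mu_0\ne0$ on $T_eB$,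 let $\mu_L^2$ be the corresponding left Haar measure of $B$, and put $\omega_0=\lambda_0\otimes\rho_0$, where $\lambda_0(g)(v)=\mu_0(g^{-1}v)$ and $\rho_0(g)(w)=|\psi_B(a_L(g))|^{-1/2}\mu_0(wg^{-1})$ are half-densities along the left and the right fibers. $\mathcal A(G_A)$ is the space of smooth compactly supported sections of $\Omega^{1/2}(T^lG_A)\otimes\Omega^{1/2}(T^rG_A)$ (bidensities); its elements are uniquely of the form $f\omega_0$. It is an algebra under $(f_1\omega_0)(f_2\omega_0)=(f_1*f_2)\omega_0$, $(f_1*f_2)(z)=\int_{F_l(z)}\lambda_0^2(x)f_1(x)f_2(s_A(x)\cdot z)$. The same applies to $G_A\times G_A$, with $\omega_0\otimes\omega_0$. $C_r^*(G_A\times G_A)$ is the norm closure of $\mathcal A(G_A\times G_A)$ in its regular representation $\pi$ by left convolution on $L^2(G\times G)$. Let $\delta=m_B^T$ be the transpose of $m_B$, a morphism of groupoids (in the sense of relations) from $G_A$ to $G_A\times G_A$. For $(a,a')\in A\times A$ and $x\in G_A$ with $a_R(x)=aa'$ there is a unique $\delta^R(x;a,a')\in\delta(x)$ with right projection $(a,a')$.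 For $y=(y_1,y_2)$ with $a_R(x)=a_L(y_1)a_L(y_2)$ put $m_\delta(x,y)=\delta^R(x;a_L(y_1),a_L(y_2))\cdot y$ (product in $G_A\times G_A$). For fixed $c\in A\times A$, with $F_r(c)$ the right fiber of $G_A\times G_A$ over $c$, the map $(x,y)\mapsto(x,m_\delta(x,y))$ is a diffeomorphism from $\{(x,y):y\in F_r(c),\,a_R(x)=a_L(y_1)a_L(y_2)\}$ onto $\{(x,z):z\in F_r(c),\,a_L(x)=a_L(z_1)a_L(z_2)\}$. Half-densities on the tangent space of the first manifold at $(x,y)$ are identified with $\Omega^{1/2}T^r_xG_A\otimes\Omega^{1/2}T^r_y(G_A\times G_A)$, and those on the tangent space of the second at $(x,z)$ with $\Omega^{1/2}T^l_xG_A\otimes\Omega^{1/2}T^r_z(G_A\times G_A)$ (in both cases through the exact sequence given by the second projection). Let $t_\delta(x,y)$ be the number such that this diffeomorphism carries $\rho_0(x)\otimes(\rho_0\otimes\rho_0)(y)$ to $t_\delta(x,y)\,\lambda_0(x)\otimes(\rho_0\otimes\rho_0)(z)$, $z=m_\delta(x,y)$. The operator $\hat\delta(f\omega_0)$ on $\mathcal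 A(G_A\times G_A)$ is $$\hat\delta(f\omega_0)\big(F(\omega_0\otimes\omega_0)\big)=(f*_\delta F)(\omega_0\otimes\omega_0),\qquad (f*_\delta F)(z)=\int_{F_l(a_L(z_1)a_L(z_2))}\lambda_0^2(x)\,f(x)\,t_\delta(x,y)\,F(y),\quad m_\delta(x,y)=z .$$ For $\omega,\omega_1\in\mathcal A(G_A)$ the maps $\hat\delta(\omega)$, $I\otimes\omega_1$ and $\omega_1\otimes I$ on $\mathcal A(G_A\times G_A)$ (the last two being left convolution by $\omega_1$ in the second, respectively first, variable) are the left multiplications by unique elements of the multiplier algebra $M(C_r^*(G_A\times G_A))$, denoted by the same symbols. **Proposition.** Let $\omega=f\omega_0$ and $\omega_1=f_1\omega_0$ be in $\mathcal A(G_A)$. Then the products $\hat\delta(\omega)(I\otimes\omega_1)$ and $\hat\delta(\omega)(\omega_1\otimes I)$ in $M(C_r^*(G_A\times G_A))$ belong to $\mathcal A(G_A\times G_A)$. Explicitly, $\hat\delta(f\omega_0)(I\otimes f_1\omega_0)=K_1\,(\omega_0\otimes\omega_0)$ and $\hat\delta(f\omega_0)(f_1\omega_0\otimes I)=K_2\,(\omega_0\otimes\omega_0)$,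 where $$K_1(g_1,g_2)=\big|\psi_B\big(a_L(b_R(g_1)^{-1}g_2)\big)\big|^{-1}\,\big|\varphi_B(b_R(g_1))\big|^{-1/2}\,f\big(g_1a_L(b_R(g_1)^{-1}g_2)\big)\,f_1\big(b_R(g_1)^{-1}g_2\big),$$ $$K_2(g_1,g_2)=\big|\varphi_B(b_L(g_2))\big|^{-1/2}\,f\big(a_L(g_1)g_2\big)\,f_1\big(b_L(a_L(g_1)g_2)^{-1}g_1\big).$$ -/

import Mathlib

open Set Filter Topology MeasureTheory
open scoped Manifold ContDiff MultiplierAlgebra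

noncomputable section

/-! ### Velocities of curves, tangent spaces of subsets, half-densities -/

section Tangent

variable {E H : Type*} [NormedAddCommGroup E] [NormedSpace ℝ E] [TopologicalSpace H]
  (I : ModelWithCorners ℝ E H) {M : Type*} [TopologicalSpace M] [ChartedSpace H M]

/-- The germ at `0` of the curve `γ` is smooth, starts at `p` and runs in the subset `S`. -/
def IsCurveIn (S : Set M) (p : M) (γ : ℝ → M) : Prop :=
  γ 0 = p ∧ ContMDiffAt 𝓘(ℝ, ℝ) I ∞ γ 0 ∧ ∀ᶠ t in 𝓝 (0 : ℝ), γ t ∈ S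

/-- The velocity `γ'(0)` of a curve with `γ 0 = p`, as a tangent vector at `p`. -/
def velocity (p : M) (γ : ℝ → M) : TangentSpace I p :=
  mfderiv 𝓘(ℝ, ℝ) I γ 0 (1 : ℝ)

/-- The tangent space at `p` of a subset `S` of a manifold: the span of the velocities at `p` of
the smooth curves running in `S`.  For an embedded submanifold this is the usual tangent space. -/
def tangentOf (S : Set M) (p : M) : Submodule ℝ (TangentSpace I p) :=
  Submodule.span ℝ {v | ∃ γ : ℝ → M, IsCurveIn I S p γ ∧ velocity I p γ = v}

end Tangent

/-- A real half-density on a vector space `V` whose dimension is the number of elements of `ι`: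
a function `σ` on families of vectors indexed by `ι` with `σ (T v) = |det T|^{1/2} σ (v)`. -/
structure HalfDensity (ι V : Type*) [AddCommGroup V] [Module ℝ V] where
  toFun : (ι → V) → ℝ
  map_comp : ∀ (T : V →ₗ[ℝ] V) (v : ι → V),
    toFun (fun i => T (v i)) = |LinearMap.det T| ^ (1 / 2 : ℝ) * toFun v

/-! ### Double Lie groups -/

/-- A double Lie group `(G; A, B)`: Lie groups `A`, `B` which are closed (embedded) Lie subgroups
of the Lie group `G`, through the inclusions `iA`, `iB`, with `A ∩ B = {e}` and `G = AB`. -/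
structure DoubleLieGroup
    {E H : Type*} [NormedAddCommGroup E] [NormedSpace ℝ E] [TopologicalSpace H]
    {EA HA : Type*} [NormedAddCommGroup EA] [NormedSpace ℝ EA] [TopologicalSpace HA]
    {EB HB : Type*} [NormedAddCommGroup EB] [NormedSpace ℝ EB] [TopologicalSpace HB]
    (I : ModelWithCorners ℝ E H) (JA : ModelWithCorners ℝ EA HA) (JB : ModelWithCorners ℝ EB HB)
    (G A B : Type*) [TopologicalSpace G] [ChartedSpace H G] [Group G]
    [TopologicalSpace A] [ChartedSpace HA A] [Group A]
    [TopologicalSpace B] [ChartedSpace HB B] [Group B] where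
  iA : A →* G
  iB : B →* G
  smooth_iA : ContMDiff JA I ∞ iA
  smooth_iB : ContMDiff JB I ∞ iB
  closedEmbedding_iA : IsClosedEmbedding iA
  closedEmbedding_iB : IsClosedEmbedding iB
  immersion_iA : ∀ a, Function.Injective (mfderiv JA I iA a)
  immersion_iB : ∀ b, Function.Injective (mfderiv JB I iB b)
  inter_trivial : ∀ a b, iA a = iB b → iA a = 1
  exists_factor : ∀ g, ∃ p : A × B, g = iA p.1 * iB p.2

namespace DoubleLieGroup

section General

variable {E H : Type*} [NormedAddCommGroup E] [NormedSpace ℝ E] [TopologicalSpace H]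
  {EA HA : Type*} [NormedAddCommGroup EA] [NormedSpace ℝ EA] [TopologicalSpace HA]
  {EB HB : Type*} [NormedAddCommGroup EB] [NormedSpace ℝ EB] [TopologicalSpace HB]
  {I : ModelWithCorners ℝ E H} {JA : ModelWithCorners ℝ EA HA} {JB : ModelWithCorners ℝ EB HB}
  {G A B : Type*} [TopologicalSpace G] [ChartedSpace H G] [Group G]
  [TopologicalSpace A] [ChartedSpace HA A] [Group A]
  [TopologicalSpace B] [ChartedSpace HB B] [Group B]
  (𝒟 : DoubleLieGroup I JA JB G A B)

theorem exists_factor' (g : G) : ∃ p : B × A, g = 𝒟.iB p.1 * 𝒟.iA p.2 := by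
  obtain ⟨p, hp⟩ := 𝒟.exists_factor g⁻¹
  refine ⟨(p.2⁻¹, p.1⁻¹), ?_⟩
  rw [map_inv, map_inv, ← mul_inv_rev, ← hp, inv_inv]

/-! The four projections: `g = a_L(g) b_R(g) = b_L(g) a_R(g)`. -/

def aL (g : G) : A := (Classical.choose (𝒟.exists_factor g)).1
def bR (g : G) : B := (Classical.choose (𝒟.exists_factor g)).2
def bL (g : G) : B := (Classical.choose (𝒟.exists_factor' g)).1
def aR (g : G) : A := (Classical.choose (𝒟.exists_factor' g)).2

theorem aL_mul_bR (g : G) : 𝒟.iA (𝒟.aL g) * 𝒟.iB (𝒟.bR g) = g :=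
  (Classical.choose_spec (𝒟.exists_factor g)).symm

theorem bL_mul_aR (g : G) : 𝒟.iB (𝒟.bL g) * 𝒟.iA (𝒟.aR g) = g :=
  (Classical.choose_spec (𝒟.exists_factor' g)).symm

/-! ### The groupoid `G_A` over `A`, and the multiplication relation of `G_B` -/

/-- `z ∈ m_A(x, y)`. -/
def mulA (x y z : G) : Prop :=
  ∃ (b₁ : B) (a : A) (b₂ : B),
    x = 𝒟.iB b₁ * 𝒟.iA a ∧ y = 𝒟.iA a * 𝒟.iB b₂ ∧ z = 𝒟.iB b₁ * 𝒟.iA a * 𝒟.iB b₂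

/-- `z ∈ m_B(x, y)`. -/
def mulB (x y z : G) : Prop :=
  ∃ (a₁ : A) (b : B) (a₂ : A),
    x = 𝒟.iA a₁ * 𝒟.iB b ∧ y = 𝒟.iB b * 𝒟.iA a₂ ∧ z = 𝒟.iA a₁ * 𝒟.iB b * 𝒟.iA a₂

/-- The product in `G_A` of composable elements. -/
def gmul (x y : G) : G := Classical.epsilon fun z => 𝒟.mulA x y z

/-- The groupoid inverse `s_A` of `G_A`. -/
def gInv (g : G) : G := 𝒟.iA (𝒟.aR g) * (𝒟.iB (𝒟.bR g))⁻¹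

/-- The set of units of `G_A`. -/
def units : Set G := Set.range 𝒟.iA

/-- The left (target) and right (source) projections of `G_A`, with values in `A ⊆ G`. -/
def eL (g : G) : G := 𝒟.iA (𝒟.aL g)
def eR (g : G) : G := 𝒟.iA (𝒟.aR g)

/-- The left and right fibers through `g`. -/
def fiberL (g : G) : Set G := {x | 𝒟.eL x = 𝒟.eL g}
def fiberR (g : G) : Set G := {x | 𝒟.eR x = 𝒟.eR g}

/-- `T_g^l G_A` and `T_g^r G_A`. -/
def tangentL (g : G) : Submodule ℝ (TangentSpace I g) := tangentOf I (𝒟.fiberL g) g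
def tangentR (g : G) : Submodule ℝ (TangentSpace I g) := tangentOf I (𝒟.fiberR g) g

/-! ### Adjoint representation and modular functions -/

/-- The differential of the inclusion of `A`, from `𝔞 = T_e A` to `𝔤 = T_e G`. -/
def dA : TangentSpace JA (1 : A) →L[ℝ] TangentSpace I (1 : G) := mfderiv JA I 𝒟.iA 1

/-- The differential of the inclusion of `B`, from `𝔟 = T_e B` to `𝔤 = T_e G`. -/
def dB : TangentSpace JB (1 : B) →L[ℝ] TangentSpace I (1 : G) := mfderiv JB I 𝒟.iB 1

/-- The projection `P_B` of `𝔤 = 𝔞 ⊕ 𝔟` onto `𝔟 = T_e B`. -/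
def projB : TangentSpace I (1 : G) →ₗ[ℝ] TangentSpace JB (1 : B) :=
  Classical.epsilon fun P : TangentSpace I (1 : G) →ₗ[ℝ] TangentSpace JB (1 : B) =>
    (∀ v, P (𝒟.dB v) = v) ∧ ∀ v, P (𝒟.dA v) = 0

variable (I) in
/-- The adjoint representation of `G` on `T_e G`. -/
def Ad (g : G) : TangentSpace I (1 : G) →L[ℝ] TangentSpace I (1 : G) :=
  mfderiv I I (fun x => g * x * g⁻¹) (1 : G)

/-- The determinant of the compression `P_B Ad(g) P_B`, as an endomorphism of `𝔟`. -/
def detB (g : G) : ℝ :=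
  LinearMap.det (𝒟.projB ∘ₗ (Ad I g : TangentSpace I (1 : G) →ₗ[ℝ] TangentSpace I (1 : G)) ∘ₗ
    (𝒟.dB : TangentSpace JB (1 : B) →ₗ[ℝ] TangentSpace I (1 : G)))

/-- `ψ_B` on `A` and `φ_B` on `B`. -/
def psiB (a : A) : ℝ := 𝒟.detB (𝒟.iA a)
def phiB (b : B) : ℝ := 𝒟.detB (𝒟.iB b)

/-! ### Half-densities along the fibers and bidensities -/

variable {ι : Type*} [Fintype ι] [DecidableEq ι]

section Densities

variable (X : Module.Basis ι ℝ (TangentSpace JB (1 : B)))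

/-- The half-density `μ₀` on `T_e B` with `μ₀ (X) = 1`. -/
def mu0 (v : ι → TangentSpace JB (1 : B)) : ℝ := |X.det v| ^ (1 / 2 : ℝ)

/-- `λ₀(g)(v) = μ₀(g⁻¹ v)` (for `v` tangent to the left fiber `g B`, the vectors `g⁻¹ v` lie in
`𝔟`, so that `P_B` is only the identification of `𝔟 ⊆ T_e G` with `T_e B`). -/
def lambda0 (g : G) (v : ι → TangentSpace I g) : ℝ :=
  mu0 X fun i => 𝒟.projB (mfderiv I I (fun x => g⁻¹ * x) g (v i))

/-- `ρ₀(g)(w) = |ψ_B(a_L(g))|^{-1/2} μ₀(w g⁻¹)`. -/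
def rho0 (g : G) (w : ι → TangentSpace I g) : ℝ :=
  |𝒟.psiB (𝒟.aL g)| ^ (-(1 / 2) : ℝ) *
    mu0 X fun i => 𝒟.projB (mfderiv I I (fun x => x * g⁻¹) g (w i))

end Densities

variable (ι) in
/-- Assignments to each `g` of a function of frames of `T_g^l G_A` and of `T_g^r G_A`. -/
abbrev BiSection : Type _ :=
  ∀ g : G, (ι → 𝒟.tangentL g) → (ι → 𝒟.tangentR g) → ℂ

/-- `Ω(g)` is in the tensor product of the half-densities on `T_g^l G_A` and on `T_g^r G_A` for every `g`. -/
def IsBidensity (Ω : 𝒟.BiSection ι) : Prop :=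
  (∀ g (T : 𝒟.tangentL g →ₗ[ℝ] 𝒟.tangentL g) v w,
    Ω g (fun i => T (v i)) w = ((|LinearMap.det T| ^ (1 / 2 : ℝ) : ℝ) : ℂ) * Ω g v w) ∧
  ∀ g (T : 𝒟.tangentR g →ₗ[ℝ] 𝒟.tangentR g) v w,
    Ω g v (fun i => T (w i)) = ((|LinearMap.det T| ^ (1 / 2 : ℝ) : ℝ) : ℂ) * Ω g v w

variable [IsManifold I 1 G]

/-- `v` is a smooth local frame, over `U`, of the subbundle `V` of the tangent bundle. -/
def IsSmoothFrame (V : ∀ g : G, Submodule ℝ (TangentSpace I g)) (U : Set G)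
    (v : ∀ g : G, ι → V g) : Prop :=
  (∀ i, ContMDiffOn I I.tangent ∞
    (fun g => (⟨g, (v g i : TangentSpace I g)⟩ : TangentBundle I G)) U) ∧
  ∀ g ∈ U, LinearIndependent ℝ (v g) ∧ Submodule.span ℝ (Set.range (v g)) = ⊤

/-- The section `Ω` is smooth: its value on smooth local frames is smooth. -/
def IsSmoothSection (Ω : 𝒟.BiSection ι) : Prop :=
  ∀ (U : Set G) (v : ∀ g, ι → 𝒟.tangentL g) (w : ∀ g, ι → 𝒟.tangentR g), IsOpen U →
    IsSmoothFrame 𝒟.tangentL U v → IsSmoothFrame 𝒟.tangentR U w →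
    ContMDiffOn I 𝓘(ℝ, ℂ) ∞ (fun g => Ω g (v g) (w g)) U

variable (ι) in
/-- `𝒜(G_A)`: smooth compactly supported bidensities. -/
def smoothBidensities : Set (𝒟.BiSection ι) :=
  {Ω | 𝒟.IsBidensity Ω ∧ 𝒟.IsSmoothSection Ω ∧ IsCompact (closure {g | Ω g ≠ 0})}

variable (X : Module.Basis ι ℝ (TangentSpace JB (1 : B)))

/-- The section `f ω₀`, where `ω₀ = λ₀ ⊗ ρ₀`. -/
def mulOmega0 (f : G → ℂ) : 𝒟.BiSection ι := fun g v w =>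
  f g * ((𝒟.lambda0 X g (fun i => v i) * 𝒟.rho0 X g (fun i => w i) : ℝ) : ℂ)

/-! ### Convolution, regular representation, reduced C*-algebra -/

section Measures

variable [MeasurableSpace G] [MeasurableSpace B] (μ : Measure B)

/-- The measure on the left fiber `e B` over the unit `e`, given by the density `λ₀²`: the image
of the left Haar measure `μ` (the density `μ_L²`) of `B` under `b ↦ e b`. -/
def fiberMeasure (e : G) : Measure G := μ.map fun b => e * 𝒟.iB b

/-- The product of `𝒜(G_A)` in terms of coefficients:
`(f₁ * f₂)(z) = ∫_{F_l(z)} λ₀²(x) f₁(x) f₂(s(x) z)`. -/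
def conv (f₁ f₂ : G → ℂ) (z : G) : ℂ :=
  ∫ x, f₁ x * f₂ (𝒟.gmul (𝒟.gInv x) z) ∂(𝒟.fiberMeasure μ (𝒟.eL z))

/-- The measure `Ψ₀²` on `G` for the half-density `Ψ₀ = ρ₀ ⊗ ν`, where
`Ψ₀(Y g ∧ g X) = |ψ_B(a_L(g))|^{-1/2} μ₀(Y) ν(X)`, and `μ`, `ν` are left Haar measures. -/
def refMeasure [MeasurableSpace A] (ν : Measure A) : Measure G :=
  ((μ.inv.prod ν).map fun p => 𝒟.iB p.1 * 𝒟.iA p.2).withDensity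
    fun g => ENNReal.ofReal |𝒟.psiB (𝒟.aL g)|⁻¹

variable [MeasurableSpace A] (ν : Measure A)

/-- The Hilbert space `L²(G)`: half-densities `ψ Ψ₀` with `ψ` square integrable for `Ψ₀²`. -/
abbrev L2 : Type _ := Lp ℂ 2 (𝒟.refMeasure μ ν)

/-- `T` is the operator `π_id (f ω₀)` of the regular representation: the bounded operator on
`L²(G)` with `T (ψ Ψ₀) = (f * ψ) Ψ₀` for smooth compactly supported `ψ`. -/
def IsRegRep (f : G → ℂ) (T : 𝒟.L2 μ ν →L[ℂ] 𝒟.L2 μ ν) : Prop :=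
  ∀ ψ : G → ℂ, ContMDiff I 𝓘(ℝ, ℂ) ∞ ψ → HasCompactSupport ψ →
    ∀ u : 𝒟.L2 μ ν, u =ᵐ[𝒟.refMeasure μ ν] ψ →
      T u =ᵐ[𝒟.refMeasure μ ν] 𝒟.conv μ f ψ

/-- The reduced C*-algebra of the groupoid: the norm closure of `π_id (𝒜(G_A))`. -/
def reducedAlgebra : NonUnitalStarSubalgebra ℂ (𝒟.L2 μ ν →L[ℂ] 𝒟.L2 μ ν) :=
  (NonUnitalStarAlgebra.adjoin ℂ
    {T | ∃ f : G → ℂ, 𝒟.mulOmega0 X f ∈ 𝒟.smoothBidensities ι ∧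
      𝒟.IsRegRep μ ν f T}).topologicalClosure

/-- `M` is the multiplier of the reduced C*-algebra that extends the linear map
`f ω₀ ↦ (Φ f) ω₀` of `𝒜(G_A)`, which is to be interpreted as a left multiplication. -/
def IsMultiplierOf (Φ : (G → ℂ) → (G → ℂ)) (M : 𝓜(ℂ, 𝒟.reducedAlgebra X μ ν)) : Prop :=
  ∀ f : G → ℂ, 𝒟.mulOmega0 X f ∈ 𝒟.smoothBidensities ι →
    𝒟.mulOmega0 X (Φ f) ∈ 𝒟.smoothBidensities ι ∧
    ∃ S S' : 𝒟.reducedAlgebra X μ ν,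
      𝒟.IsRegRep μ ν f S ∧ 𝒟.IsRegRep μ ν (Φ f) S' ∧ M.fst S = S'

end Measures

end General

/-! ### The action `ĥ` of a morphism of groupoids on bidensities -/

section Morphism

variable {E H : Type*} [NormedAddCommGroup E] [NormedSpace ℝ E] [TopologicalSpace H]
  {EA HA : Type*} [NormedAddCommGroup EA] [NormedSpace ℝ EA] [TopologicalSpace HA]
  {EB HB : Type*} [NormedAddCommGroup EB] [NormedSpace ℝ EB] [TopologicalSpace HB]
  {I : ModelWithCorners ℝ E H} {JA : ModelWithCorners ℝ EA HA} {JB : ModelWithCorners ℝ EB HB}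
  {G A B : Type*} [TopologicalSpace G] [ChartedSpace H G] [Group G]
  [TopologicalSpace A] [ChartedSpace HA A] [Group A]
  [TopologicalSpace B] [ChartedSpace HB B] [Group B]
  (𝒟 : DoubleLieGroup I JA JB G A B)
  {E' H' : Type*} [NormedAddCommGroup E'] [NormedSpace ℝ E'] [TopologicalSpace H']
  {EA' HA' : Type*} [NormedAddCommGroup EA'] [NormedSpace ℝ EA'] [TopologicalSpace HA']
  {EB' HB' : Type*} [NormedAddCommGroup EB'] [NormedSpace ℝ EB'] [TopologicalSpace HB']
  {I' : ModelWithCorners ℝ E' H'} {JA' : ModelWithCorners ℝ EA' HA'}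
  {JB' : ModelWithCorners ℝ EB' HB'}
  {G' A' B' : Type*} [TopologicalSpace G'] [ChartedSpace H' G'] [Group G']
  [TopologicalSpace A'] [ChartedSpace HA' A'] [Group A']
  [TopologicalSpace B'] [ChartedSpace HB' B'] [Group B']
  (𝒟' : DoubleLieGroup I' JA' JB' G' A' B')
  (h : G → G' → Prop)

/-! Here `Γ = G_A`, `Γ' = G'_{A'}`, and `h x y` means `y ∈ h(x)`, i.e. `(y, x) ∈ Gr(h)`. -/

/-- The map of units `f_h : E' → E`, with `b ∈ h(f_h(b))`. -/
def baseMap (b : G') : G := Classical.epsilon fun e => e ∈ 𝒟.units ∧ h e b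

/-- The map `h_b^R : F_r(f_h(b)) → F_r(b)`. -/
def mapR (b : G') (x : G) : G' := Classical.epsilon fun y => 𝒟'.eR y = b ∧ h x y

/-- `m_h(x, y) = m'(h^R(x, e_L'(y)), y)`. -/
def mh (x : G) (y : G') : G' := 𝒟'.gmul (𝒟'.mapR h (𝒟'.eL y) x) y

/-- `Γ ×_h F_r(a)`. -/
def fibProd (a : G') : Set (G × G') :=
  {p | 𝒟'.eR p.2 = a ∧ 𝒟.eR p.1 = 𝒟.baseMap h (𝒟'.eL p.2)}

/-- `Γ *_h F_r(a)`. -/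
def fibStar (a : G') : Set (G × G') :=
  {p | 𝒟'.eR p.2 = a ∧ 𝒟.eL p.1 = 𝒟.baseMap h (𝒟'.eL p.2)}

/-- The map `(x, y) ↦ (x, m_h(x, y))` from `Γ ×_h F_r(a)` to `Γ *_h F_r(a)`. -/
def transl (p : G × G') : G × G' := (p.1, 𝒟'.mh h p.1 p.2)

variable {ι ι' : Type*} [Fintype ι] [DecidableEq ι] [Fintype ι'] [DecidableEq ι']
  (X : Module.Basis ι ℝ (TangentSpace JB (1 : B)))
  (X' : Module.Basis ι' ℝ (TangentSpace JB' (1 : B')))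

variable (I I') in
/-- For a subspace `W` of `T_{(x,y)}(Γ × Γ')` projected by `π₂` onto a subspace `Q` of `T_y Γ'`,
with kernel a subspace `K` of `T_x Γ`: `σ` is the half-density on `W` that corresponds to `α ⊗ β`,
for half-densities `α` on `K`, `β` on `Q`, under `Ω^{1/2} K ⊗ Ω^{1/2} Q ≃ Ω^{1/2} W`, that is
`σ (u ∧ v) = α (π₁ u) β (π₂ v)` if all vectors of `u` are in the kernel of `π₂`. -/
def IsExtension {p : G × G'} {W : Submodule ℝ (TangentSpace (I.prod I') p)}
    (σ : HalfDensity (ι ⊕ ι') W)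
    (α : (ι → TangentSpace I p.1) → ℝ) (β : (ι' → TangentSpace I' p.2) → ℝ) : Prop :=
  ∀ (u : ι → W) (v : ι' → W),
    (∀ i, mfderiv (I.prod I') I' Prod.snd p (u i : TangentSpace (I.prod I') p) = 0) →
    σ.toFun (Sum.elim u v) =
      α (fun i => mfderiv (I.prod I') I Prod.fst p (u i : TangentSpace (I.prod I') p)) *
      β (fun j => mfderiv (I.prod I') I' Prod.snd p (v j : TangentSpace (I.prod I') p))

/-- `t` is the number with `(i₂)⁻¹ t_h i₁ (ρ₀(x) ⊗ ρ₀'(y)) = t λ₀(x) ⊗ ρ₀'(z)`,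
`z = m_h(x, y)`: for all vectors `w k` tangent to `Γ ×_h F_r(a)`, `a = e_R'(y)`, that are
velocities of curves `γ k`, and the velocities `w' k` of the image curves in `Γ *_h F_r(a)`,
`i₁(ρ₀(x) ⊗ ρ₀'(y))(w) = t · i₂(λ₀(x) ⊗ ρ₀'(z))(w')`. -/
def IsDensityRatio (x : G) (y : G') (t : ℝ) : Prop :=
  ∀ (σ : HalfDensity (ι ⊕ ι') (tangentOf (I.prod I') (𝒟.fibProd 𝒟' h (𝒟'.eR y)) (x, y)))
    (σ' : HalfDensity (ι ⊕ ι')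
      (tangentOf (I.prod I') (𝒟.fibStar 𝒟' h (𝒟'.eR y)) (x, 𝒟'.mh h x y))),
    IsExtension I I' σ (𝒟.rho0 X x) (𝒟'.rho0 X' y) →
    IsExtension I I' σ' (𝒟.lambda0 X x) (𝒟'.rho0 X' (𝒟'.mh h x y)) →
    ∀ (γ : ι ⊕ ι' → ℝ → G × G')
      (w : ι ⊕ ι' → tangentOf (I.prod I') (𝒟.fibProd 𝒟' h (𝒟'.eR y)) (x, y))
      (w' : ι ⊕ ι' → tangentOf (I.prod I') (𝒟.fibStar 𝒟' h (𝒟'.eR y)) (x, 𝒟'.mh h x y)),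
      (∀ k, IsCurveIn (I.prod I') (𝒟.fibProd 𝒟' h (𝒟'.eR y)) (x, y) (γ k)) →
      (∀ k, velocity (I.prod I') (x, y) (γ k) = w k) →
      (∀ k, velocity (I.prod I') (x, 𝒟'.mh h x y) (fun s => 𝒟'.transl h (γ k s)) = w' k) →
      σ.toFun w = t * σ'.toFun w'

/-- The function `t_h` on `Γ ×_h Γ'`. -/
def densityRatio (x : G) (y : G') : ℝ :=
  Classical.epsilon fun t => 𝒟.IsDensityRatio 𝒟' h X X' x y t

/-- The element `y` with `(x, y) ∈ Γ ×_h Γ'` and `m_h(x, y) = z`. -/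
def translInv (x : G) (z : G') : G' :=
  Classical.epsilon fun y => 𝒟.eR x = 𝒟.baseMap h (𝒟'.eL y) ∧ 𝒟'.mh h x y = z

/-- The action `ĥ` in terms of coefficients, `ĥ(f ω₀)(F ω₀') = (f *_h F) ω₀'`:
`(f *_h F)(z) = ∫_{F_l(f_h(b))} λ₀²(x) f(x) t_h(x, y) F(y)`, `b = e_L'(z)`, `m_h(x, y) = z`. -/
def hatAction [MeasurableSpace G] [MeasurableSpace B] (μ : Measure B)
    (f : G → ℂ) (F : G' → ℂ) (z : G') : ℂ :=
  ∫ x, f x * (𝒟.densityRatio 𝒟' h X X' x (𝒟.translInv 𝒟' h x z) : ℂ) *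
      F (𝒟.translInv 𝒟' h x z)
    ∂(𝒟.fiberMeasure μ (𝒟.baseMap h (𝒟'.eL z)))

/-! ### The product double Lie group, whose groupoid is the product groupoid -/

/-- The double Lie group `(G × G'; A × A', B × B')`.  Its groupoid is `G_A × G'_{A'}`. -/
def prod : DoubleLieGroup (I.prod I') (JA.prod JA') (JB.prod JB') (G × G') (A × A') (B × B') where
  iA := 𝒟.iA.prodMap 𝒟'.iA
  iB := 𝒟.iB.prodMap 𝒟'.iB
  smooth_iA := 𝒟.smooth_iA.prodMap 𝒟'.smooth_iA
  smooth_iB := 𝒟.smooth_iB.prodMap 𝒟'.smooth_iB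
  closedEmbedding_iA := 𝒟.closedEmbedding_iA.prodMap 𝒟'.closedEmbedding_iA
  closedEmbedding_iB := 𝒟.closedEmbedding_iB.prodMap 𝒟'.closedEmbedding_iB
  immersion_iA := fun p => by
    have h1 := (𝒟.smooth_iA p.1).mdifferentiableAt (by simp)
    have h2 := (𝒟'.smooth_iA p.2).mdifferentiableAt (by simp)
    have := mfderiv_prodMap h1 h2
    change Function.Injective (mfderiv (JA.prod JA') (I.prod I') (Prod.map 𝒟.iA 𝒟'.iA) p)
    rw [this]
    exact Function.Injective.prodMap (𝒟.immersion_iA p.1) (𝒟'.immersion_iA p.2)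
  immersion_iB := fun p => by
    have h1 := (𝒟.smooth_iB p.1).mdifferentiableAt (by simp)
    have h2 := (𝒟'.smooth_iB p.2).mdifferentiableAt (by simp)
    have := mfderiv_prodMap h1 h2
    change Function.Injective (mfderiv (JB.prod JB') (I.prod I') (Prod.map 𝒟.iB 𝒟'.iB) p)
    rw [this]
    exact Function.Injective.prodMap (𝒟.immersion_iB p.1) (𝒟'.immersion_iB p.2)
  inter_trivial := fun a b hab => Prod.ext
    (𝒟.inter_trivial a.1 b.1 (congrArg Prod.fst hab))
    (𝒟'.inter_trivial a.2 b.2 (congrArg Prod.snd hab))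
  exists_factor := fun g => by
    obtain ⟨p, hp⟩ := 𝒟.exists_factor g.1
    obtain ⟨q, hq⟩ := 𝒟'.exists_factor g.2
    exact ⟨((p.1, q.1), (p.2, q.2)), Prod.ext hp hq⟩

end Morphism

/-! ### The comultiplication `δ = m_Bᵀ` -/

section Comultiplication

variable {E H : Type*} [NormedAddCommGroup E] [NormedSpace ℝ E] [TopologicalSpace H]
  {EA HA : Type*} [NormedAddCommGroup EA] [NormedSpace ℝ EA] [TopologicalSpace HA]
  {EB HB : Type*} [NormedAddCommGroup EB] [NormedSpace ℝ EB] [TopologicalSpace HB]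
  {I : ModelWithCorners ℝ E H} {JA : ModelWithCorners ℝ EA HA} {JB : ModelWithCorners ℝ EB HB}
  {G A B : Type*} [TopologicalSpace G] [ChartedSpace H G] [Group G]
  [TopologicalSpace A] [ChartedSpace HA A] [Group A]
  [TopologicalSpace B] [ChartedSpace HB B] [Group B]
  (𝒟 : DoubleLieGroup I JA JB G A B)

/-- The double Lie group `(G × G; A × A, B × B)`. -/
abbrev sq : DoubleLieGroup (I.prod I) (JA.prod JA) (JB.prod JB) (G × G) (A × A) (B × B) :=
  𝒟.prod 𝒟

/-- The relation `δ = m_Bᵀ` from `G_A` to `G_A × G_A`: `p ∈ δ(g)` iff `g ∈ m_B(p)`. -/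
def delta (g : G) (p : G × G) : Prop := 𝒟.mulB p.1 p.2 g

variable {ι : Type*} [Fintype ι] [DecidableEq ι]

/-- The basis `(X, 0), (0, X)` of `T_e (B × B)`; the associated `ω₀` on `G_A × G_A` is
`ω₀ ⊗ ω₀`. -/
def sqBasis (X : Module.Basis ι ℝ (TangentSpace JB (1 : B))) :
    Module.Basis (ι ⊕ ι) ℝ (TangentSpace (JB.prod JB) (1 : B × B)) :=
  X.prod X

variable [MeasurableSpace G] [MeasurableSpace B] (μ : Measure B)

/-- `δ̂` in terms of coefficients: `δ̂(f ω₀)(F (ω₀ ⊗ ω₀)) = (f *_δ F)(ω₀ ⊗ ω₀)`. -/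
def deltaHat (X : Module.Basis ι ℝ (TangentSpace JB (1 : B)))
    (f : G → ℂ) (F : G × G → ℂ) : G × G → ℂ :=
  𝒟.hatAction 𝒟.sq 𝒟.delta X (sqBasis X) μ f F

/-- Left multiplication by `I ⊗ f₁ ω₀`: convolution in the second variable. -/
def oneTensor (f₁ : G → ℂ) (F : G × G → ℂ) : G × G → ℂ :=
  fun z => 𝒟.conv μ f₁ (fun y => F (z.1, y)) z.2

/-- Left multiplication by `f₁ ω₀ ⊗ I`: convolution in the first variable. -/
def tensorOne (f₁ : G → ℂ) (F : G × G → ℂ) : G × G → ℂ :=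
  fun z => 𝒟.conv μ f₁ (fun x => F (x, z.2)) z.1

end Comultiplication

end DoubleLieGroup

end

/-! Write a ▷ b and a ◁ b for the B-part and the A-part of the product ab with respect to G = BA
(`act` and `coact`). A left fiber of the groupoid is parametrized by b ↦ ab, and groupoid
multiplication of z by the inverse of ab is the group translation z ↦ (a ▷ b)⁻¹z, where a = a_L(z).
All operators involved are therefore integrals over B. Left convolution by f is ψ ↦ ∫ f(ab) ψ((a ▷
b)⁻¹z) db (`conv_apply`). With aᵢ = a_L(zᵢ), the operator of δ is F ↦ ∫ f(a₁a₂b) |φ_B(a₂ ▷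
b)|^{-1/2} F((a₁ ▷ (a₂ ▷ b))⁻¹z₁, (a₂ ▷ b)⁻¹z₂) db (`deltaHat_apply`).

Given these formulas, the kernels are read off by composing and using left invariance of Haar
measure (`conv_inv_mul`) and Fubini. For f₁ in the first variable the composite is a convolution
with g₁ = a₁b', g₂ = a₂b, and the factor is φ_B(a₂ ▷ b) = φ_B(b_L(g₂)). For f₁ in the second
variable one first substitutes β = a₂ ▷ b, so that g₁ = a₁β; the Jacobian of this substitution is
the factor |ψ_B|⁻¹ (`deltaHat_tensorOne`, `deltaHat_oneTensor`).

Three things have to be supplied. First, the four projections must be smooth. The bijection A × B →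
G is open, because it is essentially an orbit map of a transitive action of a σ-compact group. It is
an immersion, because 𝔞 ∩ 𝔟 = 0, and it is a local diffeomorphism because an open smooth map cannot
raise dimension (`contMDiff_mulHomeo_symm`). It follows that bidensities fω₀ in the algebra
correspond exactly to smooth compactly supported f (`mulOmega0_mem_smoothBidensities_iff`).

Second, the number t_δ must be computed. In coordinates on B × (B × B) the map (x, y) ↦ (x, m_δ(x,
y)) becomes block triangular after a change of variables, and its Jacobian is φ_B(β)/ψ_B(a_R(x)),
with β the B-part of x a_L(y₂)⁻¹ (`jac_ratioMap`). The ψ_B-weights in ρ₀ cancel the denominator,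
leaving |φ_B(β)|^{-1/2} (`densityRatio_delta`).

Third, the operators must be multipliers of the reduced algebra. Each is of the form ψ ↦ ∫ q(z, y)
w(z, y) ψ(θ(z, y)) dy, where (z, y) ↦ (θ(z, y), y⁻¹) is an involution that transforms the measure by
w² (`Shift`). Cauchy–Schwarz bounds such an operator, and its adjoint has the same form. If θ, q and
w are compatible with right translations by B, the operator commutes with right convolutions, so it
multiplies the reduced algebra into itself (`existsUnique_isMultiplierOf`). The required invariance
of the reference measure rests on a change of variables formula for the Haar measure of a Lie group
under diffeomorphisms (`lintegral_haar_comp`), which shows how the action of A and right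
translations scale the Haar measure of B. -/

set_option linter.unusedSectionVars false

/-! ### Algebra of the factorizations, the groupoid structure maps and the relation δ -/

noncomputable section

namespace DoubleLieGroup

section Algebra

variable {E H : Type*} [NormedAddCommGroup E] [NormedSpace ℝ E] [TopologicalSpace H]
  {EA HA : Type*} [NormedAddCommGroup EA] [NormedSpace ℝ EA] [TopologicalSpace HA]
  {EB HB : Type*} [NormedAddCommGroup EB] [NormedSpace ℝ EB] [TopologicalSpace HB]
  {I : ModelWithCorners ℝ E H} {JA : ModelWithCorners ℝ EA HA} {JB : ModelWithCorners ℝ EB HB}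
  {G A B : Type*} [TopologicalSpace G] [ChartedSpace H G] [Group G]
  [TopologicalSpace A] [ChartedSpace HA A] [Group A]
  [TopologicalSpace B] [ChartedSpace HB B] [Group B]
  (𝒟 : DoubleLieGroup I JA JB G A B)

theorem iA_injective : Function.Injective 𝒟.iA := 𝒟.closedEmbedding_iA.injective

theorem iB_injective : Function.Injective 𝒟.iB := 𝒟.closedEmbedding_iB.injective

theorem eq_one_of_iA_eq_iB {a : A} {b : B} (h : 𝒟.iA a = 𝒟.iB b) : a = 1 ∧ b = 1 := by
  have h1 := 𝒟.inter_trivial a b h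
  exact ⟨𝒟.iA_injective (by rw [h1, map_one]), 𝒟.iB_injective (by rw [← h, h1, map_one])⟩

theorem eq_of_iA_mul_iB_eq {a a' : A} {b b' : B} (h : 𝒟.iA a * 𝒟.iB b = 𝒟.iA a' * 𝒟.iB b') :
    a = a' ∧ b = b' := by
  have h1 : 𝒟.iA (a'⁻¹ * a) = 𝒟.iB (b' * b⁻¹) := by
    rw [map_mul, map_mul, map_inv, map_inv, inv_mul_eq_iff_eq_mul, ← mul_assoc,
      eq_mul_inv_iff_mul_eq, h]
  obtain ⟨h2, h3⟩ := 𝒟.eq_one_of_iA_eq_iB h1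
  exact ⟨(inv_mul_eq_one.1 h2).symm, (mul_inv_eq_one.1 h3).symm⟩

theorem eq_of_iB_mul_iA_eq {a a' : A} {b b' : B} (h : 𝒟.iB b * 𝒟.iA a = 𝒟.iB b' * 𝒟.iA a') :
    b = b' ∧ a = a' := by
  have h1 : 𝒟.iA (a * a'⁻¹) = 𝒟.iB (b⁻¹ * b') := by
    rw [map_mul, map_mul, map_inv, map_inv, mul_inv_eq_iff_eq_mul, mul_assoc, ← h,
      inv_mul_cancel_left]
  obtain ⟨h2, h3⟩ := 𝒟.eq_one_of_iA_eq_iB h1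
  exact ⟨inv_mul_eq_one.1 h3, mul_inv_eq_one.1 h2⟩

@[simp] theorem aL_iA_mul_iB (a : A) (b : B) : 𝒟.aL (𝒟.iA a * 𝒟.iB b) = a :=
  (𝒟.eq_of_iA_mul_iB_eq (𝒟.aL_mul_bR _)).1

@[simp] theorem bR_iA_mul_iB (a : A) (b : B) : 𝒟.bR (𝒟.iA a * 𝒟.iB b) = b :=
  (𝒟.eq_of_iA_mul_iB_eq (𝒟.aL_mul_bR _)).2

@[simp] theorem bL_iB_mul_iA (b : B) (a : A) : 𝒟.bL (𝒟.iB b * 𝒟.iA a) = b :=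
  (𝒟.eq_of_iB_mul_iA_eq (𝒟.bL_mul_aR _)).1

@[simp] theorem aR_iB_mul_iA (b : B) (a : A) : 𝒟.aR (𝒟.iB b * 𝒟.iA a) = a :=
  (𝒟.eq_of_iB_mul_iA_eq (𝒟.bL_mul_aR _)).2

theorem aL_eq_of {g : G} {a : A} {b : B} (h : g = 𝒟.iA a * 𝒟.iB b) : 𝒟.aL g = a := by
  rw [h, aL_iA_mul_iB]

theorem bR_eq_of {g : G} {a : A} {b : B} (h : g = 𝒟.iA a * 𝒟.iB b) : 𝒟.bR g = b := by
  rw [h, bR_iA_mul_iB]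

theorem bL_eq_of {g : G} {a : A} {b : B} (h : g = 𝒟.iB b * 𝒟.iA a) : 𝒟.bL g = b := by
  rw [h, bL_iB_mul_iA]

theorem aR_eq_of {g : G} {a : A} {b : B} (h : g = 𝒟.iB b * 𝒟.iA a) : 𝒟.aR g = a := by
  rw [h, aR_iB_mul_iA]

@[simp] theorem aL_mul_iB (g : G) (b : B) : 𝒟.aL (g * 𝒟.iB b) = 𝒟.aL g :=
  𝒟.aL_eq_of (b := 𝒟.bR g * b) (by rw [map_mul, ← mul_assoc, aL_mul_bR])

@[simp] theorem bR_mul_iB (g : G) (b : B) : 𝒟.bR (g * 𝒟.iB b) = 𝒟.bR g * b :=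
  𝒟.bR_eq_of (a := 𝒟.aL g) (by rw [map_mul, ← mul_assoc, aL_mul_bR])

@[simp] theorem aL_iA_mul (a : A) (g : G) : 𝒟.aL (𝒟.iA a * g) = a * 𝒟.aL g :=
  𝒟.aL_eq_of (b := 𝒟.bR g) (by rw [map_mul, mul_assoc, aL_mul_bR])

@[simp] theorem bR_iA_mul (a : A) (g : G) : 𝒟.bR (𝒟.iA a * g) = 𝒟.bR g :=
  𝒟.bR_eq_of (a := a * 𝒟.aL g) (by rw [map_mul, mul_assoc, aL_mul_bR])

@[simp] theorem bL_iB_mul (b : B) (g : G) : 𝒟.bL (𝒟.iB b * g) = b * 𝒟.bL g :=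
  𝒟.bL_eq_of (a := 𝒟.aR g) (by rw [map_mul, mul_assoc, bL_mul_aR])

@[simp] theorem aR_iB_mul (b : B) (g : G) : 𝒟.aR (𝒟.iB b * g) = 𝒟.aR g :=
  𝒟.aR_eq_of (b := b * 𝒟.bL g) (by rw [map_mul, mul_assoc, bL_mul_aR])

@[simp] theorem bL_mul_iA (g : G) (a : A) : 𝒟.bL (g * 𝒟.iA a) = 𝒟.bL g :=
  𝒟.bL_eq_of (a := 𝒟.aR g * a) (by rw [map_mul, ← mul_assoc, bL_mul_aR])

@[simp] theorem aR_mul_iA (g : G) (a : A) : 𝒟.aR (g * 𝒟.iA a) = 𝒟.aR g * a :=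
  𝒟.aR_eq_of (b := 𝒟.bL g) (by rw [map_mul, ← mul_assoc, bL_mul_aR])

theorem aL_mul_eq (g y : G) : 𝒟.aL (g * y) = 𝒟.aL (g * 𝒟.iA (𝒟.aL y)) := by
  conv_lhs => rw [← 𝒟.aL_mul_bR y, ← mul_assoc, aL_mul_iB]

@[simp] theorem aL_iA (a : A) : 𝒟.aL (𝒟.iA a) = a := 𝒟.aL_eq_of (b := 1) (by simp)

@[simp] theorem bR_iA (a : A) : 𝒟.bR (𝒟.iA a) = 1 := 𝒟.bR_eq_of (a := a) (by simp)

@[simp] theorem bL_iA (a : A) : 𝒟.bL (𝒟.iA a) = 1 := 𝒟.bL_eq_of (a := a) (by simp)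

@[simp] theorem aR_iA (a : A) : 𝒟.aR (𝒟.iA a) = a := 𝒟.aR_eq_of (b := 1) (by simp)

@[simp] theorem bR_iB (b : B) : 𝒟.bR (𝒟.iB b) = b := 𝒟.bR_eq_of (a := 1) (by simp)

@[simp] theorem bL_iB (b : B) : 𝒟.bL (𝒟.iB b) = b := 𝒟.bL_eq_of (a := 1) (by simp)

@[simp] theorem aR_iB (b : B) : 𝒟.aR (𝒟.iB b) = 1 := 𝒟.aR_eq_of (b := b) (by simp)

theorem iA_aL (g : G) : 𝒟.iA (𝒟.aL g) = g * (𝒟.iB (𝒟.bR g))⁻¹ := by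
  rw [eq_mul_inv_iff_mul_eq, aL_mul_bR]

theorem iB_bR (g : G) : 𝒟.iB (𝒟.bR g) = (𝒟.iA (𝒟.aL g))⁻¹ * g := by
  rw [eq_inv_mul_iff_mul_eq, aL_mul_bR]

theorem iB_bL (g : G) : 𝒟.iB (𝒟.bL g) = g * (𝒟.iA (𝒟.aR g))⁻¹ := by
  rw [eq_mul_inv_iff_mul_eq, bL_mul_aR]

theorem iA_aR (g : G) : 𝒟.iA (𝒟.aR g) = (𝒟.iB (𝒟.bL g))⁻¹ * g := by
  rw [eq_inv_mul_iff_mul_eq, bL_mul_aR]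

theorem bL_inv (g : G) : 𝒟.bL g⁻¹ = (𝒟.bR g)⁻¹ :=
  𝒟.bL_eq_of (a := (𝒟.aL g)⁻¹) (by rw [map_inv, map_inv, ← mul_inv_rev, aL_mul_bR])

theorem aR_inv (g : G) : 𝒟.aR g⁻¹ = (𝒟.aL g)⁻¹ :=
  𝒟.aR_eq_of (b := (𝒟.bR g)⁻¹) (by rw [map_inv, map_inv, ← mul_inv_rev, aL_mul_bR])

/-- The left action of `A` on `B ≃ G / A`. -/
def act (a : A) (b : B) : B := 𝒟.bL (𝒟.iA a * 𝒟.iB b)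

/-- The right action of `B` on `A ≃ B \ G`. -/
def coact (a : A) (b : B) : A := 𝒟.aR (𝒟.iA a * 𝒟.iB b)

theorem iA_mul_iB (a : A) (b : B) :
    𝒟.iA a * 𝒟.iB b = 𝒟.iB (𝒟.act a b) * 𝒟.iA (𝒟.coact a b) := (𝒟.bL_mul_aR _).symm

theorem bL_iA_mul (a : A) (g : G) : 𝒟.bL (𝒟.iA a * g) = 𝒟.act a (𝒟.bL g) := by
  conv_lhs => rw [← 𝒟.bL_mul_aR g, ← mul_assoc, bL_mul_iA]
  rfl

theorem act_mul (a a' : A) (b : B) : 𝒟.act (a * a') b = 𝒟.act a (𝒟.act a' b) := by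
  rw [act, map_mul, mul_assoc, bL_iA_mul]
  rfl

@[simp] theorem act_one_left (b : B) : 𝒟.act 1 b = b := by simp [act]

@[simp] theorem act_one_right (a : A) : 𝒟.act a 1 = 1 := by simp [act]

@[simp] theorem act_inv_act (a : A) (b : B) : 𝒟.act a⁻¹ (𝒟.act a b) = b := by
  rw [← act_mul, inv_mul_cancel, act_one_left]

@[simp] theorem act_act_inv (a : A) (b : B) : 𝒟.act a (𝒟.act a⁻¹ b) = b := by
  rw [← act_mul, mul_inv_cancel, act_one_left]

/-- The right unit of `ab` is the left unit of `β⁻¹ a`, `β = a ▷ b`. -/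
theorem aL_inv_act_mul (a : A) (b : B) (g : G) (hg : 𝒟.aL g = a) :
    𝒟.aL ((𝒟.iB (𝒟.act a b))⁻¹ * g) = 𝒟.coact a b := by
  rw [← 𝒟.aL_mul_bR g, hg, ← mul_assoc, aL_mul_iB]
  refine 𝒟.aL_eq_of (b := b⁻¹) ?_
  rw [map_inv, inv_mul_eq_iff_eq_mul, ← mul_assoc, ← iA_mul_iB, mul_inv_cancel_right]

/-- Groupoid inversion in coordinates: acting with the inverse of `ab`. -/
theorem act_coact_inv (a : A) (b : B) : 𝒟.act (𝒟.coact a b) b⁻¹ = (𝒟.act a b)⁻¹ := by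
  refine 𝒟.bL_eq_of (a := a) ?_
  rw [map_inv, map_inv, mul_inv_eq_iff_eq_mul, mul_assoc, iA_mul_iB, inv_mul_cancel_left]

/-! ### The groupoid structure maps -/

theorem mulA_iff {x y z : G} : 𝒟.mulA x y z ↔ 𝒟.aR x = 𝒟.aL y ∧ z = x * 𝒟.iB (𝒟.bR y) := by
  constructor
  · rintro ⟨b₁, a, b₂, rfl, rfl, rfl⟩
    simp
  · rintro ⟨h, rfl⟩
    exact ⟨𝒟.bL x, 𝒟.aR x, 𝒟.bR y, (𝒟.bL_mul_aR x).symm, by rw [h, aL_mul_bR],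
      by rw [bL_mul_aR]⟩

theorem gmul_eq {x y : G} (h : 𝒟.aR x = 𝒟.aL y) : 𝒟.gmul x y = x * 𝒟.iB (𝒟.bR y) := by
  have h1 : ∃ z, 𝒟.mulA x y z := ⟨_, 𝒟.mulA_iff.2 ⟨h, rfl⟩⟩
  exact (𝒟.mulA_iff.1 (Classical.epsilon_spec h1)).2

theorem gmul_eq' {x y : G} (h : 𝒟.aR x = 𝒟.aL y) : 𝒟.gmul x y = 𝒟.iB (𝒟.bL x) * y := by
  rw [gmul_eq _ h, iB_bR, ← h, iB_bL, mul_assoc]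

theorem gInv_eq' (x : G) : 𝒟.gInv x = 𝒟.iB (𝒟.bL x)⁻¹ * 𝒟.iA (𝒟.aL x) := by
  rw [gInv, map_inv, iA_aR, iA_aL, mul_assoc]

@[simp] theorem aR_gInv (x : G) : 𝒟.aR (𝒟.gInv x) = 𝒟.aL x := by rw [gInv_eq', aR_iB_mul_iA]

@[simp] theorem aL_gInv (x : G) : 𝒟.aL (𝒟.gInv x) = 𝒟.aR x := by
  rw [gInv, ← map_inv, aL_iA_mul_iB]

@[simp] theorem bL_gInv (x : G) : 𝒟.bL (𝒟.gInv x) = (𝒟.bL x)⁻¹ := by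
  rw [gInv_eq', bL_iB_mul_iA]

@[simp] theorem gInv_gInv (x : G) : 𝒟.gInv (𝒟.gInv x) = x := by
  rw [gInv_eq' _ (𝒟.gInv x), bL_gInv, aL_gInv, inv_inv, bL_mul_aR]

/-- Composability makes the groupoid product a group translation by an element of B. This is what
turns groupoid convolution into an integral of left translates. -/
theorem gmul_gInv {x z : G} (h : 𝒟.aL x = 𝒟.aL z) :
    𝒟.gmul (𝒟.gInv x) z = (𝒟.iB (𝒟.bL x))⁻¹ * z := by
  rw [gmul_eq' _ (by rw [aR_gInv, h]), bL_gInv, map_inv]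

theorem eL_eq_iff {x y : G} : 𝒟.eL x = 𝒟.eL y ↔ 𝒟.aL x = 𝒟.aL y := 𝒟.iA_injective.eq_iff

theorem eR_eq_iff {x y : G} : 𝒟.eR x = 𝒟.eR y ↔ 𝒟.aR x = 𝒟.aR y := 𝒟.iA_injective.eq_iff

/-! ### The relation `δ` -/

theorem delta_iff {g : G} {p : G × G} :
    𝒟.delta g p ↔ 𝒟.bR p.1 = 𝒟.bL p.2 ∧ g = p.1 * 𝒟.iA (𝒟.aR p.2) := by
  constructor
  · rintro ⟨a₁, b, a₂, h1, h2, rfl⟩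
    simp [h1, h2]
  · rintro ⟨h, rfl⟩
    exact ⟨𝒟.aL p.1, 𝒟.bR p.1, 𝒟.aR p.2, (𝒟.aL_mul_bR _).symm, by rw [h, bL_mul_aR],
      by rw [aL_mul_bR]⟩

theorem sq_iA (p : A × A) : 𝒟.sq.iA p = (𝒟.iA p.1, 𝒟.iA p.2) := rfl

theorem sq_iB (p : B × B) : 𝒟.sq.iB p = (𝒟.iB p.1, 𝒟.iB p.2) := rfl

theorem sq_aL (z : G × G) : 𝒟.sq.aL z = (𝒟.aL z.1, 𝒟.aL z.2) :=
  𝒟.sq.aL_eq_of (b := (𝒟.bR z.1, 𝒟.bR z.2))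
    (by rw [sq_iA, sq_iB]; exact Prod.ext (𝒟.aL_mul_bR _).symm (𝒟.aL_mul_bR _).symm)

theorem sq_bL (z : G × G) : 𝒟.sq.bL z = (𝒟.bL z.1, 𝒟.bL z.2) :=
  𝒟.sq.bL_eq_of (a := (𝒟.aR z.1, 𝒟.aR z.2))
    (by rw [sq_iA, sq_iB]; exact Prod.ext (𝒟.bL_mul_aR _).symm (𝒟.bL_mul_aR _).symm)

theorem sq_aR (z : G × G) : 𝒟.sq.aR z = (𝒟.aR z.1, 𝒟.aR z.2) :=
  𝒟.sq.aR_eq_of (b := (𝒟.bL z.1, 𝒟.bL z.2))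
    (by rw [sq_iA, sq_iB]; exact Prod.ext (𝒟.bL_mul_aR _).symm (𝒟.bL_mul_aR _).symm)

/-- An element of δ(g) determines g, so the choice in `baseMap` is forced as soon as one unit is
exhibited. -/
theorem baseMap_delta (a : A × A) :
    𝒟.baseMap 𝒟.delta (𝒟.sq.iA a) = 𝒟.iA (a.1 * a.2) := by
  have h1 : ∃ e, e ∈ 𝒟.units ∧ 𝒟.delta e (𝒟.sq.iA a) :=
    ⟨𝒟.iA (a.1 * a.2), ⟨_, rfl⟩, 𝒟.delta_iff.2 (by simp [sq_iA])⟩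
  have h2 := (𝒟.delta_iff.1 (Classical.epsilon_spec h1).2).2
  rw [baseMap, h2]
  simp [sq_iA]

theorem baseMap_delta_eL (z : G × G) :
    𝒟.baseMap 𝒟.delta (𝒟.sq.eL z) = 𝒟.iA (𝒟.aL z.1 * 𝒟.aL z.2) := by
  rw [eL, baseMap_delta, sq_aL]

/-- If y ∈ δ(x) has right unit c, then x = y₁c₂, which fixes y₁; composability in `G_B` then makes
the left B-part of y₂ equal to the right B-part of y₁, which fixes y₂. -/
theorem mapR_delta {x : G} {c : A × A} (h : 𝒟.aR x = c.1 * c.2) :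
    𝒟.sq.mapR 𝒟.delta (𝒟.sq.iA c) x =
      (x * (𝒟.iA c.2)⁻¹, 𝒟.iB (𝒟.bR (x * (𝒟.iA c.2)⁻¹)) * 𝒟.iA c.2) := by
  have key : ∀ y : G × G, (𝒟.sq.eR y = 𝒟.sq.iA c ∧ 𝒟.delta x y) ↔
      y = (x * (𝒟.iA c.2)⁻¹, 𝒟.iB (𝒟.bR (x * (𝒟.iA c.2)⁻¹)) * 𝒟.iA c.2) := by
    rintro ⟨y₁, y₂⟩
    rw [delta_iff, eR, 𝒟.sq.iA_injective.eq_iff, sq_aR, Prod.mk.injEq]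
    obtain ⟨c₁, c₂⟩ := c
    simp only [Prod.mk.injEq]
    constructor
    · rintro ⟨⟨rfl, rfl⟩, h2, rfl⟩
      refine ⟨by simp, ?_⟩
      rw [mul_inv_cancel_right, h2, bL_mul_aR]
    · rintro ⟨rfl, rfl⟩
      refine ⟨⟨?_, by simp⟩, by simp, by simp⟩
      rw [← map_inv, aR_mul_iA, h]
      simp
  exact (key _).1 (Classical.epsilon_spec (p := fun y => 𝒟.sq.eR y = 𝒟.sq.iA c ∧ 𝒟.delta x y)
    ⟨_, (key _).2 rfl⟩)

theorem mh_delta {x : G} {y : G × G} (h : 𝒟.aR x = 𝒟.aL y.1 * 𝒟.aL y.2) :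
    𝒟.sq.mh 𝒟.delta x y =
      (𝒟.iB (𝒟.bL x) * y.1, 𝒟.iB (𝒟.bR (x * (𝒟.iA (𝒟.aL y.2))⁻¹)) * y.2) := by
  rw [mh, eL, sq_aL, mapR_delta (h := h), gmul_eq', sq_bL, sq_iB]
  · rw [← map_inv, bL_mul_iA, bL_iB_mul_iA]
    rfl
  · rw [sq_aR, sq_aL]
    rw [← map_inv, aR_mul_iA, aR_iB_mul_iA, h, mul_inv_cancel_right]

/-- The element `y` with `m_δ(x, y) = z`. -/
theorem mh_delta_eq_iff {x : G} {y z : G × G} :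
    (𝒟.aR x = 𝒟.aL y.1 * 𝒟.aL y.2 ∧ 𝒟.sq.mh 𝒟.delta x y = z) ↔
      (𝒟.aL x = 𝒟.aL z.1 * 𝒟.aL z.2 ∧ y = ((𝒟.iB (𝒟.bL x))⁻¹ * z.1,
        (𝒟.iB (𝒟.bL ((𝒟.iA (𝒟.aL z.1))⁻¹ * x)))⁻¹ * z.2)) := by
  obtain ⟨y₁, y₂⟩ := y
  obtain ⟨z₁, z₂⟩ := z
  constructor
  · rintro ⟨h, h2⟩
    rw [mh_delta _ h, Prod.mk.injEq] at h2
    simp only at h h2 ⊢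
    obtain ⟨rfl, rfl⟩ := h2
    have e1 : 𝒟.aL (𝒟.iB (𝒟.bL x) * y₁) = 𝒟.aL (x * (𝒟.iA (𝒟.aL y₂))⁻¹) := by
      rw [← 𝒟.aL_mul_bR y₁, ← mul_assoc, aL_mul_iB, iB_bL, h, map_mul]
      group
    have e2 : (𝒟.iA (𝒟.aL (x * (𝒟.iA (𝒟.aL y₂))⁻¹)))⁻¹ * x =
        𝒟.iB (𝒟.bR (x * (𝒟.iA (𝒟.aL y₂))⁻¹)) * 𝒟.iA (𝒟.aL y₂) := by
      rw [iB_bR]; group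
    refine ⟨?_, ?_⟩
    · rw [e1]
      conv_lhs => rw [show x = 𝒟.iA (𝒟.aL (x * (𝒟.iA (𝒟.aL y₂))⁻¹)) *
        (𝒟.iB (𝒟.bR (x * (𝒟.iA (𝒟.aL y₂))⁻¹)) * 𝒟.iA (𝒟.aL y₂)) by rw [← e2]; group]
      rw [aL_iA_mul]
      congr 1
      exact (𝒟.aL_mul_eq _ y₂).symm
    · rw [e1, e2, bL_iB_mul_iA]
      simp
  · rintro ⟨h, h2⟩
    simp only at h h2 ⊢
    rw [Prod.mk.injEq] at h2
    obtain ⟨rfl, rfl⟩ := h2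
    set a₁ := 𝒟.aL z₁ with ha₁
    set a₂ := 𝒟.aL z₂ with ha₂
    -- With x = a₁a₂b everything is expressed by the two actions: b_L(x) = a₁ ▷ (a₂ ▷ b) and a_R(x)
    -- = (a₁ ◁ (a₂ ▷ b))(a₂ ◁ b). The two factors of a_R(x) are the left units of the components of
    -- y.
    obtain ⟨b, rfl⟩ : ∃ b, x = 𝒟.iA (a₁ * a₂) * 𝒟.iB b := ⟨𝒟.bR x, by rw [← h, aL_mul_bR]⟩
    have e0 : (𝒟.iA a₁)⁻¹ * (𝒟.iA (a₁ * a₂) * 𝒟.iB b) = 𝒟.iA a₂ * 𝒟.iB b := by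
      rw [map_mul]; group
    rw [e0]
    have e1 : 𝒟.bL (𝒟.iA a₂ * 𝒟.iB b) = 𝒟.act a₂ b := rfl
    have e2 : 𝒟.bL (𝒟.iA (a₁ * a₂) * 𝒟.iB b) = 𝒟.act a₁ (𝒟.act a₂ b) := by
      rw [← act_mul]; rfl
    have e3 : 𝒟.aR (𝒟.iA (a₁ * a₂) * 𝒟.iB b) =
        𝒟.coact a₁ (𝒟.act a₂ b) * 𝒟.coact a₂ b := by
      refine 𝒟.aR_eq_of (b := 𝒟.act a₁ (𝒟.act a₂ b)) ?_
      rw [map_mul, map_mul, mul_assoc, iA_mul_iB, ← mul_assoc, iA_mul_iB, mul_assoc]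
    have h3 : 𝒟.aR (𝒟.iA (a₁ * a₂) * 𝒟.iB b) =
        𝒟.aL ((𝒟.iB (𝒟.act a₁ (𝒟.act a₂ b)))⁻¹ * z₁) * 𝒟.aL ((𝒟.iB (𝒟.act a₂ b))⁻¹ * z₂) := by
      rw [aL_inv_act_mul _ _ _ _ ha₁.symm, aL_inv_act_mul _ _ _ _ ha₂.symm, e3]
    rw [e1, e2]
    refine ⟨h3, ?_⟩
    rw [mh_delta _ h3]
    simp only [e2]
    rw [aL_inv_act_mul _ _ _ _ ha₂.symm, mul_inv_cancel_left, Prod.mk.injEq]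
    refine ⟨rfl, ?_⟩
    have e4 : 𝒟.iA (a₁ * a₂) * 𝒟.iB b * (𝒟.iA (𝒟.coact a₂ b))⁻¹ =
        𝒟.iA a₁ * 𝒟.iB (𝒟.act a₂ b) := by
      rw [mul_inv_eq_iff_eq_mul, map_mul, mul_assoc, iA_mul_iB, mul_assoc]
    rw [e4, bR_iA_mul_iB, mul_inv_cancel_left]

theorem translInv_delta {x : G} {z : G × G} (h : 𝒟.aL x = 𝒟.aL z.1 * 𝒟.aL z.2) :
    𝒟.translInv 𝒟.sq 𝒟.delta x z = ((𝒟.iB (𝒟.bL x))⁻¹ * z.1,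
      (𝒟.iB (𝒟.bL ((𝒟.iA (𝒟.aL z.1))⁻¹ * x)))⁻¹ * z.2) := by
  have key : ∀ y, (𝒟.eR x = 𝒟.baseMap 𝒟.delta (𝒟.sq.eL y) ∧ 𝒟.sq.mh 𝒟.delta x y = z) ↔
      (𝒟.aR x = 𝒟.aL y.1 * 𝒟.aL y.2 ∧ 𝒟.sq.mh 𝒟.delta x y = z) := by
    intro y
    rw [baseMap_delta_eL, eR, 𝒟.iA_injective.eq_iff]
  have h1 : ∃ y, 𝒟.eR x = 𝒟.baseMap 𝒟.delta (𝒟.sq.eL y) ∧ 𝒟.sq.mh 𝒟.delta x y = z :=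
    ⟨_, (key _).2 (𝒟.mh_delta_eq_iff.2 ⟨h, rfl⟩)⟩
  exact (𝒟.mh_delta_eq_iff.1 ((key _).1 (Classical.epsilon_spec h1))).2

theorem mem_fibProd_delta {c : G × G} {p : G × G × G} :
    p ∈ 𝒟.fibProd 𝒟.sq 𝒟.delta (𝒟.sq.eR c) ↔ (𝒟.aR p.2.1 = 𝒟.aR c.1 ∧ 𝒟.aR p.2.2 = 𝒟.aR c.2) ∧
      𝒟.aR p.1 = 𝒟.aL p.2.1 * 𝒟.aL p.2.2 := by
  rw [fibProd, Set.mem_ofPred_eq, eR_eq_iff, sq_aR, sq_aR, Prod.mk.injEq, baseMap_delta_eL, eR,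
    𝒟.iA_injective.eq_iff]

theorem mem_fibStar_delta {c : G × G} {p : G × G × G} :
    p ∈ 𝒟.fibStar 𝒟.sq 𝒟.delta (𝒟.sq.eR c) ↔ (𝒟.aR p.2.1 = 𝒟.aR c.1 ∧ 𝒟.aR p.2.2 = 𝒟.aR c.2) ∧
      𝒟.aL p.1 = 𝒟.aL p.2.1 * 𝒟.aL p.2.2 := by
  rw [fibStar, Set.mem_ofPred_eq, eR_eq_iff, sq_aR, sq_aR, Prod.mk.injEq, baseMap_delta_eL, eL,
    𝒟.iA_injective.eq_iff]

end Algebra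

end DoubleLieGroup

end

/-! ### Inverse function theorem and dimension for smooth maps of manifolds -/

noncomputable section

section InverseFunction

variable {E H : Type*} [NormedAddCommGroup E] [NormedSpace ℝ E] [FiniteDimensional ℝ E]
  [TopologicalSpace H] {I : ModelWithCorners ℝ E H} [I.Boundaryless]
  {E' H' : Type*} [NormedAddCommGroup E'] [NormedSpace ℝ E'] [FiniteDimensional ℝ E']
  [TopologicalSpace H'] {J : ModelWithCorners ℝ E' H'} [J.Boundaryless]
  {M N : Type*} [TopologicalSpace M] [ChartedSpace H M] [TopologicalSpace N] [ChartedSpace H' N]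

/-- The expression of a homeomorphism between manifolds in the preferred charts. -/
def Homeomorph.inCharts (J : ModelWithCorners ℝ E' H') [J.Boundaryless]
    (I : ModelWithCorners ℝ E H) [I.Boundaryless] (h : N ≃ₜ M) (x : N) :
    OpenPartialHomeomorph E' E :=
  ((J.toHomeomorph.symm.toOpenPartialHomeomorph.trans (chartAt H' x).symm).trans
    h.toOpenPartialHomeomorph).trans
    ((chartAt H (h x)).trans I.toHomeomorph.toOpenPartialHomeomorph)

/-- Because h is already a homeomorphism, its expression in charts is a partial homeomorphism, and
the inverse function theorem applies to that expression at each point; its inverse is the expression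
of `h.symm`. -/
theorem Homeomorph.contMDiff_symm_of_bijective_mfderiv (h : N ≃ₜ M) (hs : ContMDiff J I ∞ h)
    (hd : ∀ x, Function.Bijective (mfderiv J I h x)) : ContMDiff I J ∞ h.symm := by
  intro y
  obtain ⟨x, rfl⟩ := h.surjective y
  rw [contMDiffAt_iff]
  refine ⟨h.symm.continuous.continuousAt, ?_⟩
  set e := h.inCharts J I x with he
  have h1 := (contMDiffAt_iff.1 (hs x)).2
  have hm := (hs x).mdifferentiableAt (by simp)
  have h2 : HasFDerivWithinAt (E := E') (F := E) (writtenInExtChartAt J I x h)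
    (mfderiv J I h x) (range J) (extChartAt J x x) := hm.hasMFDerivAt.2
  rw [J.range_eq_univ, contDiffWithinAt_univ] at h1
  rw [J.range_eq_univ] at h2
  replace h2 := hasFDerivWithinAt_univ.1 h2
  rw [I.range_eq_univ, contDiffWithinAt_univ]
  have hx : h.symm (h x) = x := h.symm_apply_apply x
  have hsymm : e.symm (extChartAt I (h x) (h x)) = extChartAt J x x := by
    simp [he, Homeomorph.inCharts, extChartAt]
  have ht : extChartAt I (h x) (h x) ∈ e.target := by
    simp [he, Homeomorph.inCharts, extChartAt]
  let L : E' ≃L[ℝ] E :=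
    (LinearEquiv.ofBijective (show E' →L[ℝ] E from mfderiv J I h x : E' →ₗ[ℝ] E)
      (hd x)).toContinuousLinearEquiv
  have h3 : HasFDerivAt e (L : E' →L[ℝ] E) (e.symm (extChartAt I (h x) (h x))) := by
    rw [hsymm]
    have hL : (L : E' →L[ℝ] E) = (show E' →L[ℝ] E from mfderiv J I h x) := by ext; rfl
    rw [hL]
    exact h2
  have h4 : ContDiffAt ℝ ∞ e (e.symm (extChartAt I (h x) (h x))) := by
    rw [hsymm]; exact h1
  have h5 := e.contDiffAt_symm ht h3 h4
  rw [hx]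
  exact h5

/-- The dimension does not increase under smooth open maps. -/
theorem finrank_le_of_contMDiff_of_isOpenMap [IsManifold J ∞ N] [IsManifold I ∞ M] {f : N → M}
    (hf : ContMDiff J I ∞ f)
    (ho : IsOpenMap f) (x : N) : Module.finrank ℝ E ≤ Module.finrank ℝ E' := by
  by_contra hlt
  push Not at hlt
  have h1 := (contMDiffAt_iff.1 (hf x)).2
  rw [J.range_eq_univ, contDiffWithinAt_univ] at h1
  set g := extChartAt I (f x) ∘ f ∘ (extChartAt J x).symm
  obtain ⟨u, hu, hgu⟩ := (h1.of_le (m := 1) (by simp)).contDiffOn le_rfl (by simp)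
  have hcont : ContinuousAt (f ∘ (extChartAt J x).symm) (extChartAt J x x) :=
    ContinuousAt.comp (by simpa using hf.continuous.continuousAt)
      (continuousAt_extChartAt_symm x)
  have hv : u ∩ ((extChartAt J x).target ∩
      (f ∘ (extChartAt J x).symm) ⁻¹' (extChartAt I (f x)).source) ∈ 𝓝 (extChartAt J x x) := by
    refine inter_mem hu (inter_mem (extChartAt_target_mem_nhds x) (hcont ?_))
    simpa using extChartAt_source_mem_nhds (I := I) (f x)
  obtain ⟨r, hr, hball⟩ := Metric.mem_nhds_iff.1 hv
  set s := Metric.ball (extChartAt J x x) r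
  -- Were the target of larger dimension, the C¹ image of a ball would have Hausdorff dimension
  -- below that of the target, hence dense complement; this contradicts openness of the image.
  have hd : Dense (g '' s)ᶜ := by
    refine (hgu.mono fun y hy => (hball hy).1).dense_compl_image_of_dimH_lt_finrank
      (convex_ball _ _) Subset.rfl ?_
    calc dimH s ≤ dimH (univ : Set E') := dimH_mono (subset_univ _)
      _ = Module.finrank ℝ E' := Real.dimH_univ_eq_finrank E'
      _ < _ := by exact_mod_cast hlt
  have hopen : IsOpen (g '' s) := by
    have e1 : (extChartAt J x).symm '' s = (extChartAt J x).source ∩ extChartAt J x ⁻¹' s :=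
      (extChartAt J x).symm_image_eq_source_inter_preimage fun y hy => (hball hy).2.1
    have o1 : IsOpen ((extChartAt J x).symm '' s) := by
      rw [e1]
      exact (continuousOn_extChartAt x).isOpen_inter_preimage (isOpen_extChartAt_source x)
        Metric.isOpen_ball
    have o2 := ho _ o1
    have hsub : f '' ((extChartAt J x).symm '' s) ⊆ (extChartAt I (f x)).source := by
      rintro _ ⟨_, ⟨y, hy, rfl⟩, rfl⟩
      exact (hball hy).2.2
    have e2 : g '' s = extChartAt I (f x) '' (f '' ((extChartAt J x).symm '' s)) := by
      rw [image_image, image_image]; rfl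
    rw [e2]
    rw [(extChartAt I (f x)).image_eq_target_inter_inv_preimage hsub]
    exact (continuousOn_extChartAt_symm (f x)).isOpen_inter_preimage
      (isOpen_extChartAt_target (f x)) o2
  have hne : (g '' s).Nonempty := (Metric.nonempty_ball.2 hr).image g
  obtain ⟨y, hy, hy'⟩ := hd.inter_open_nonempty _ hopen hne
  exact hy' hy

end InverseFunction

/-! ### Smoothness of derivatives in families -/

section TangentPartial

variable {E H : Type*} [NormedAddCommGroup E] [NormedSpace ℝ E]
  [TopologicalSpace H] {I : ModelWithCorners ℝ E H}
  {M : Type*} [TopologicalSpace M] [ChartedSpace H M] [IsManifold I ∞ M]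
  {E₁ H₁ : Type*} [NormedAddCommGroup E₁] [NormedSpace ℝ E₁]
  [TopologicalSpace H₁] {I₁ : ModelWithCorners ℝ E₁ H₁}
  {M₁ : Type*} [TopologicalSpace M₁] [ChartedSpace H₁ M₁] [IsManifold I₁ ∞ M₁]
  {E₂ H₂ : Type*} [NormedAddCommGroup E₂] [NormedSpace ℝ E₂]
  [TopologicalSpace H₂] {I₂ : ModelWithCorners ℝ E₂ H₂}
  {M₂ : Type*} [TopologicalSpace M₂] [ChartedSpace H₂ M₂] [IsManifold I₂ ∞ M₂]
  {E₃ H₃ : Type*} [NormedAddCommGroup E₃] [NormedSpace ℝ E₃]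
  [TopologicalSpace H₃] {I₃ : ModelWithCorners ℝ E₃ H₃}
  {K : Type*} [TopologicalSpace K] [ChartedSpace H₃ K]

/-- Partial derivatives of a smooth map along a smooth family of tangent vectors. -/
theorem contMDiffOn_mfderiv_left {f : M₁ × M₂ → M} (hf : ContMDiff (I₁.prod I₂) I ∞ f)
    {m : K → M₁} {v : ∀ k, TangentSpace I₁ (m k)} {n : K → M₂} {U : Set K}
    (hv : ContMDiffOn I₃ I₁.tangent ∞ (fun k => (⟨m k, v k⟩ : TangentBundle I₁ M₁)) U)
    (hn : ContMDiffOn I₃ I₂ ∞ n U) :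
    ContMDiffOn I₃ I.tangent ∞ (fun k => (⟨f (m k, n k),
      mfderiv I₁ I (fun x => f (x, n k)) (m k) (v k)⟩ : TangentBundle I M)) U := by
  -- The partial derivative is the full derivative of f at the vector (v, 0), so smoothness reduces
  -- to that of the tangent map and of the zero section.
  have s0 : ContMDiffOn I₃ I₂.tangent ∞
      (fun k => (⟨n k, 0⟩ : TangentBundle I₂ M₂)) U :=
    (Bundle.contMDiff_zeroSection (𝕜 := ℝ) (E := (TangentSpace I₂ : M₂ → Type _)) (IB := I₂)
      (F := E₂) (n := ∞)).comp_contMDiffOn hn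
  have s1 := hv.prodMk s0
  have s2 := (contMDiff_equivTangentBundleProd_symm (I := I₁) (M := M₁) (I' := I₂) (M' := M₂)
    (n := ∞)).comp_contMDiffOn s1
  have s3 := (hf.contMDiff_tangentMap (m := ∞) le_rfl).comp_contMDiffOn s2
  refine s3.congr fun k _ => Bundle.TotalSpace.ext rfl (heq_of_eq ?_)
  have h1 := mfderiv_prod_eq_add_apply (I := I₁) (I' := I₂) (I'' := I) (f := f) (p := (m k, n k))
    (v := (v k, (0 : TangentSpace I₂ (n k)))) (hf.mdifferentiableAt (by simp))
  refine Eq.trans ?_ h1.symm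
  exact ((congrArg₂ _ rfl (map_zero _)).trans (add_zero _)).symm

/-- The trivialization of the tangent bundle centred at c is the identity on the fiber over c, so a
family of vectors at the fixed point c is smooth as a map to the model space. -/
theorem contMDiffOn_fiber_of_const {c : M} {w : K → E} {U : Set K}
    (hw : ContMDiffOn I₃ I.tangent ∞ (fun k => (⟨c, (w k : TangentSpace I c)⟩ : TangentBundle I M)) U) :
    ContMDiffOn I₃ 𝓘(ℝ, E) ∞ w U := by
  intro k hk
  have h1 := (Bundle.contMDiffWithinAt_totalSpace.1 (hw k hk)).2
  have key : ∀ y, w y = (trivializationAt E (TangentSpace I) c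
      (⟨c, (w y : TangentSpace I c)⟩ : TangentBundle I M)).2 := fun y =>
    (tangentCoordChange_self (I := I) (mem_extChartAt_source c)).symm
  exact h1.congr (fun y _ => key y) (key k)

end TangentPartial

end

/-! ### One-parameter curves in Lie groups and smoothness of the four projections -/

noncomputable section

section

variable {E H : Type*} [NormedAddCommGroup E] [NormedSpace ℝ E]
  [TopologicalSpace H] {I : ModelWithCorners ℝ E H}
  {M : Type*} [TopologicalSpace M] [ChartedSpace H M]
  {E' H' : Type*} [NormedAddCommGroup E'] [NormedSpace ℝ E']
  [TopologicalSpace H'] {J : ModelWithCorners ℝ E' H'}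
  {N : Type*} [TopologicalSpace N] [ChartedSpace H' N]

theorem mfderiv_comp_eq_id_of_leftInverse {f : N → M} {g : M → N} {x : N}
    (hf : MDifferentiableAt J I f x) (hg : MDifferentiableAt I J g (f x))
    (h : ∀ y, g (f y) = y) (v : TangentSpace J x) :
    (mfderiv I J g (f x) (mfderiv J I f x v) : E') = v := by
  have h1 := mfderiv_comp_apply x hg hf v
  have h2 : g ∘ f = id := funext h
  rw [h2, mfderiv_id] at h1
  exact h1.symm

theorem mfderiv_injective_of_leftInverse {f : N → M} {g : M → N} {x : N}
    (hf : MDifferentiableAt J I f x) (hg : MDifferentiableAt I J g (f x))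
    (h : ∀ y, g (f y) = y) : Function.Injective (mfderiv J I f x) := fun v w hvw => by
  have h1 := mfderiv_comp_eq_id_of_leftInverse hf hg h v
  have h2 := mfderiv_comp_eq_id_of_leftInverse hf hg h w
  rw [hvw] at h1
  exact h1.symm.trans h2

end

section LieGroupHom

variable {E H : Type*} [NormedAddCommGroup E] [NormedSpace ℝ E]
  [TopologicalSpace H] {I : ModelWithCorners ℝ E H}
  {G : Type*} [TopologicalSpace G] [ChartedSpace H G] [Group G] [LieGroup I ∞ G]
  {E' H' : Type*} [NormedAddCommGroup E'] [NormedSpace ℝ E']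
  [TopologicalSpace H'] {J : ModelWithCorners ℝ E' H'}
  {K : Type*} [TopologicalSpace K] [ChartedSpace H' K] [Group K] [LieGroup J ∞ K]

theorem mdifferentiableAt_mul_const (g x : G) : MDifferentiableAt I I (fun y => y * g) x :=
  (contMDiff_mul_right (I := I) (n := ∞) (a := g)).mdifferentiableAt (by simp)

theorem mdifferentiableAt_const_mul (g x : G) : MDifferentiableAt I I (fun y => g * y) x :=
  (contMDiff_mul_left (I := I) (n := ∞) (a := g)).mdifferentiableAt (by simp)

theorem contMDiff_leftInvariant (v : TangentSpace I (1 : G)) :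
    ContMDiff I I.tangent ∞
      (fun g : G => (⟨g, mulInvariantVectorField v g⟩ : TangentBundle I G)) := by
  have hf : ContMDiff (I.prod I) I ∞ (fun p : G × G => p.2 * p.1) :=
    contMDiff_snd.mul contMDiff_fst
  have h := contMDiffOn_mfderiv_left (I₃ := I) (K := G) (m := fun _ => (1 : G)) (v := fun _ => v)
    (n := fun g => g) (U := univ) hf contMDiffOn_const contMDiffOn_id
  rw [contMDiffOn_univ] at h
  refine h.congr fun g => ?_
  have h1 : g * 1 = g := mul_one g
  exact Bundle.TotalSpace.ext h1.symm (by rw [mulInvariantVectorField]; exact HEq.rfl)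

/-- Differentiate φ(kx) = φ(k)φ(x) at x = 1. This is what makes φ carry integral curves of
left-invariant fields to integral curves of left-invariant fields. -/
theorem mfderiv_hom_mulInvariantVectorField {φ : K →* G} (hφ : ContMDiff J I ∞ φ)
    (v : TangentSpace J (1 : K)) (u : TangentSpace I (1 : G)) (hu : (mfderiv J I φ 1 v : E) = u)
    (k : K) :
    mfderiv J I φ k (mulInvariantVectorField v k) = mulInvariantVectorField u (φ k) := by
  have hd : ∀ x, MDifferentiableAt J I φ x := fun x => hφ.mdifferentiableAt (by simp)
  have h1 := mfderiv_comp_apply_of_eq (f := fun x => k * x) (g := φ) (x := (1 : K)) (y := k)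
    (hd _) (mdifferentiableAt_const_mul k 1) (mul_one k) v
  have h2 := mfderiv_comp_apply_of_eq (f := φ) (g := fun x => φ k * x) (x := (1 : K)) (y := 1)
    (mdifferentiableAt_const_mul (φ k) 1) (hd _) (map_one φ) v
  have h3 : (φ : K → G) ∘ (fun x => k * x) = (fun x => φ k * x) ∘ φ := by
    ext x; simp
  rw [h3] at h1
  have h4 := h1.symm.trans h2
  rw [mulInvariantVectorField, mulInvariantVectorField, ← hu]
  exact h4

theorem isMIntegralCurveAt_hom {φ : K →* G} (hφ : ContMDiff J I ∞ φ)
    (v : TangentSpace J (1 : K)) (u : TangentSpace I (1 : G)) (hu : (mfderiv J I φ 1 v : E) = u)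
    {γ : ℝ → K} {t : ℝ} (h : IsMIntegralCurveAt γ (mulInvariantVectorField v) t) :
    IsMIntegralCurveAt (fun t => φ (γ t)) (mulInvariantVectorField u) t := by
  filter_upwards [h] with s hs
  have h1 := (hφ.mdifferentiableAt (x := γ s) (by simp)).hasMFDerivAt.comp s hs
  have h2 := mfderiv_hom_mulInvariantVectorField hφ v u hu (γ s)
  have h3 : ∀ r : ℝ, mfderiv J I φ (γ s) (r • mulInvariantVectorField v (γ s)) =
      r • mfderiv J I φ (γ s) (mulInvariantVectorField v (γ s)) := fun r => map_smul _ r _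
  rw [h2] at h3
  exact h1.congr_mfderiv (ContinuousLinearMap.ext fun r => h3 r)

/-- One-parameter subgroups with the same velocity in the ambient Lie algebra agree near `0`. -/
theorem exists_curves_eventuallyEq [CompleteSpace E] [CompleteSpace E'] [I.Boundaryless]
    [J.Boundaryless]
    [T2Space G] {E'' H'' : Type*} [NormedAddCommGroup E''] [NormedSpace ℝ E'']
    [CompleteSpace E''] [TopologicalSpace H''] {J' : ModelWithCorners ℝ E'' H''} [J'.Boundaryless]
    {K' : Type*} [TopologicalSpace K'] [ChartedSpace H'' K'] [Group K'] [LieGroup J' ∞ K']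
    {φ : K →* G} (hφ : ContMDiff J I ∞ φ) {φ' : K' →* G} (hφ' : ContMDiff J' I ∞ φ')
    (v : TangentSpace J (1 : K)) (w : TangentSpace J' (1 : K'))
    (hvw : (mfderiv J I φ 1 v : E) = mfderiv J' I φ' 1 w) :
    ∃ (γ : ℝ → K) (γ' : ℝ → K'), γ 0 = 1 ∧ γ' 0 = 1 ∧
      IsMIntegralCurveAt γ (mulInvariantVectorField v) 0 ∧
      IsMIntegralCurveAt γ' (mulInvariantVectorField w) 0 ∧
      ∀ᶠ t in 𝓝 (0 : ℝ), φ (γ t) = φ' (γ' t) := by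
  obtain ⟨γ, h0, hγ⟩ := exists_isMIntegralCurveAt_of_contMDiffAt_boundaryless (I := J) (t₀ := 0)
    (x₀ := (1 : K)) (((contMDiff_leftInvariant v).of_le (by simp)) 1)
  obtain ⟨γ', h0', hγ'⟩ := exists_isMIntegralCurveAt_of_contMDiffAt_boundaryless (I := J')
    (t₀ := 0) (x₀ := (1 : K')) (((contMDiff_leftInvariant w).of_le (by simp)) 1)
  refine ⟨γ, γ', h0, h0', hγ, hγ', ?_⟩
  have h1 := isMIntegralCurveAt_hom hφ v (mfderiv J I φ 1 v : E) rfl hγ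
  have h2 := isMIntegralCurveAt_hom hφ' w (mfderiv J I φ 1 v : E) hvw.symm hγ'
  refine isMIntegralCurveAt_eventuallyEq_of_contMDiffAt_boundaryless (I := I) (t₀ := 0)
    (((contMDiff_leftInvariant (I := I) (G := G) (mfderiv J I φ 1 v : E)).of_le (by simp)) _)
    h1 h2 ?_
  rw [h0, h0', map_one, map_one]

theorem eq_zero_of_isMIntegralCurveAt_const (v : TangentSpace J (1 : K)) {γ : ℝ → K}
    (h : IsMIntegralCurveAt γ (mulInvariantVectorField v) 0) (h1 : ∀ᶠ t in 𝓝 (0 : ℝ), γ t = 1) :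
    v = 0 := by
  have h0 : γ 0 = 1 := h1.self_of_nhds
  have h2 := h.hasMFDerivAt
  have h3 : HasMFDerivAt 𝓘(ℝ, ℝ) J γ 0 (0 : TangentSpace 𝓘(ℝ, ℝ) (0 : ℝ) →L[ℝ] _) :=
    (hasMFDerivAt_const (1 : K) (0 : ℝ)).congr_of_eventuallyEq h1
  have h4 := hasMFDerivAt_unique h2 h3
  have h5 := congrArg (fun L : ℝ →L[ℝ] E' => L 1) h4
  have h6 : (mulInvariantVectorField v (γ 0) : E') = 0 := by
    refine Eq.trans ?_ h5
    exact (one_smul ℝ _).symm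
  rw [h0, mulInvariantVectorField] at h6
  have h7 : (fun x : K => 1 * x) = id := by ext; simp
  rw [h7, mfderiv_id] at h6
  exact h6

end LieGroupHom

namespace DoubleLieGroup

section Smooth

variable {E H : Type*} [NormedAddCommGroup E] [NormedSpace ℝ E] [FiniteDimensional ℝ E]
  [TopologicalSpace H]
  {EA HA : Type*} [NormedAddCommGroup EA] [NormedSpace ℝ EA] [FiniteDimensional ℝ EA]
  [TopologicalSpace HA]
  {EB HB : Type*} [NormedAddCommGroup EB] [NormedSpace ℝ EB] [FiniteDimensional ℝ EB]
  [TopologicalSpace HB]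
  {I : ModelWithCorners ℝ E H} [I.Boundaryless]
  {JA : ModelWithCorners ℝ EA HA} [JA.Boundaryless]
  {JB : ModelWithCorners ℝ EB HB} [JB.Boundaryless]
  {G A B : Type*} [TopologicalSpace G] [ChartedSpace H G] [Group G] [LieGroup I ∞ G]
  [T2Space G] [SecondCountableTopology G]
  [TopologicalSpace A] [ChartedSpace HA A] [Group A] [LieGroup JA ∞ A]
  [TopologicalSpace B] [ChartedSpace HB B] [Group B] [LieGroup JB ∞ B]
  (𝒟 : DoubleLieGroup I JA JB G A B)

/-- The integral curves through 1 of the two left-invariant fields have images in G that solve the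
same equation, so they agree near 0. The common image lies in A ∩ B = {e}, so both curves are
locally constant and both vectors vanish. -/
theorem dA_eq_dB {v : TangentSpace JA (1 : A)} {w : TangentSpace JB (1 : B)}
    (h : 𝒟.dA v = 𝒟.dB w) : v = 0 ∧ w = 0 := by
  obtain ⟨γ, γ', -, -, hγ, hγ', he⟩ := exists_curves_eventuallyEq 𝒟.smooth_iA 𝒟.smooth_iB v w
    (by exact h)
  exact ⟨eq_zero_of_isMIntegralCurveAt_const v hγ
      (he.mono fun t ht => (𝒟.eq_one_of_iA_eq_iB ht).1),
    eq_zero_of_isMIntegralCurveAt_const w hγ' (he.mono fun t ht => (𝒟.eq_one_of_iA_eq_iB ht).2)⟩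

/-- The bijection `A × B ≃ G`, `(a, b) ↦ ab`. -/
def mulEquiv : A × B ≃ G where
  toFun p := 𝒟.iA p.1 * 𝒟.iB p.2
  invFun g := (𝒟.aL g, 𝒟.bR g)
  left_inv p := by simp
  right_inv g := 𝒟.aL_mul_bR g

theorem contMDiff_mulEquiv : ContMDiff (JA.prod JB) I ∞ 𝒟.mulEquiv :=
  (𝒟.smooth_iA.comp contMDiff_fst).mul (𝒟.smooth_iB.comp contMDiff_snd)

include 𝒟 in
theorem t2Space_A : T2Space A := 𝒟.closedEmbedding_iA.isEmbedding.t2Space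

include 𝒟 in
theorem t2Space_B : T2Space B := 𝒟.closedEmbedding_iB.isEmbedding.t2Space

include 𝒟 in
theorem secondCountable_A : SecondCountableTopology A :=
  𝒟.closedEmbedding_iA.isEmbedding.secondCountableTopology

include 𝒟 in
theorem secondCountable_B : SecondCountableTopology B :=
  𝒟.closedEmbedding_iB.isEmbedding.secondCountableTopology

/-- A × B acts transitively on G by (a, b) · g = agb⁻¹. It is σ-compact and G is locally compact, so
the orbit map at 1 is open by Baire category; the map (a, b) ↦ ab is this orbit map after inversion
in B. -/
theorem isOpenMap_mulEquiv : IsOpenMap 𝒟.mulEquiv := by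
  have : IsTopologicalGroup G := topologicalGroup_of_lieGroup I ∞
  have : IsTopologicalGroup A := topologicalGroup_of_lieGroup JA ∞
  have : IsTopologicalGroup B := topologicalGroup_of_lieGroup JB ∞
  have := 𝒟.secondCountable_A
  have := 𝒟.secondCountable_B
  have := Manifold.locallyCompact_of_finiteDimensional (M := G) I
  have := Manifold.locallyCompact_of_finiteDimensional (M := A) JA
  have := Manifold.locallyCompact_of_finiteDimensional (M := B) JB
  let act : MulAction (A × B) G :=
    { smul := fun p g => 𝒟.iA p.1 * g * 𝒟.iB p.2⁻¹
      one_smul := fun g => by change 𝒟.iA 1 * g * 𝒟.iB 1⁻¹ = g; simp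
      mul_smul := fun p q g => by
        change 𝒟.iA (p.1 * q.1) * g * 𝒟.iB (p.2 * q.2)⁻¹ =
          𝒟.iA p.1 * (𝒟.iA q.1 * g * 𝒟.iB q.2⁻¹) * 𝒟.iB p.2⁻¹
        simp [mul_assoc] }
  have hA := 𝒟.smooth_iA.continuous
  have hB := 𝒟.smooth_iB.continuous
  have : ContinuousSMul (A × B) G := ⟨by
    change Continuous fun q : (A × B) × G => 𝒟.iA q.1.1 * q.2 * 𝒟.iB q.1.2⁻¹
    fun_prop⟩
  have hone : ∀ g : G, ((𝒟.aL g, (𝒟.bR g)⁻¹) : A × B) • (1 : G) = g := fun g => by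
    change 𝒟.iA (𝒟.aL g) * 1 * 𝒟.iB (𝒟.bR g)⁻¹⁻¹ = g
    simp [aL_mul_bR]
  have : MulAction.IsPretransitive (A × B) G := ⟨fun x y =>
    ⟨(𝒟.aL y, (𝒟.bR y)⁻¹) * (𝒟.aL x, (𝒟.bR x)⁻¹)⁻¹, by
      rw [mul_smul, inv_smul_eq_iff.2 (hone x).symm, hone]⟩⟩
  have h1 := isOpenMap_smul_of_sigmaCompact (G := A × B) (1 : G)
  have h2 : (𝒟.mulEquiv : A × B → G) =
      (fun p : A × B => p • (1 : G)) ∘ (Prod.map id (fun b => b⁻¹)) := by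
    ext p
    change 𝒟.iA p.1 * 𝒟.iB p.2 = 𝒟.iA p.1 * 1 * 𝒟.iB p.2⁻¹⁻¹
    simp
  rw [h2]
  exact h1.comp (IsOpenMap.id.prodMap (Homeomorph.inv B).isOpenMap)

/-- `(a, b) ↦ ab` as a homeomorphism `A × B ≃ₜ G`. -/
def mulHomeo : A × B ≃ₜ G :=
  𝒟.mulEquiv.toHomeomorphOfContinuousOpen 𝒟.contMDiff_mulEquiv.continuous 𝒟.isOpenMap_mulEquiv

theorem mfderiv_mulEquiv_one (v : TangentSpace (JA.prod JB) ((1, 1) : A × B)) :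
    (mfderiv (JA.prod JB) I 𝒟.mulEquiv (1, 1) v : E) = (𝒟.dA v.1 : E) + (𝒟.dB v.2 : E) := by
  have h := mfderiv_prod_eq_add_apply (I := JA) (I' := JB) (I'' := I) (f := 𝒟.mulEquiv)
    (p := (1, 1)) (v := v) (𝒟.contMDiff_mulEquiv.mdifferentiableAt (by simp))
  refine h.trans ?_
  have h1 : (fun z : A => 𝒟.mulEquiv (z, ((1, 1) : A × B).2)) = 𝒟.iA := by
    ext z; simp [mulEquiv]
  have h2 : (fun z : B => 𝒟.mulEquiv (((1, 1) : A × B).1, z)) = 𝒟.iB := by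
    ext z; simp [mulEquiv]
  rw [h1, h2]
  rfl

/-- At (1, 1) the derivative is (v, w) ↦ v + w, injective since 𝔞 ∩ 𝔟 = 0. Elsewhere, multiplying on
the left by A and on the right by B moves the point to (1, 1). -/
theorem injective_mfderiv_mulEquiv (p : A × B) :
    Function.Injective (mfderiv (JA.prod JB) I 𝒟.mulEquiv p) := by
  have h1 : Function.Injective (mfderiv (JA.prod JB) I 𝒟.mulEquiv (1, 1)) := by
    rw [injective_iff_map_eq_zero]
    intro v hv
    have h2 : (𝒟.dA v.1 : E) + (𝒟.dB v.2 : E) = 0 := (𝒟.mfderiv_mulEquiv_one v).symm.trans hv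
    have h3 : 𝒟.dA v.1 = 𝒟.dB (-v.2) :=
      (eq_neg_of_add_eq_zero_left h2).trans (map_neg 𝒟.dB _).symm
    obtain ⟨h4, h5⟩ := 𝒟.dA_eq_dB h3
    exact Prod.ext h4 (neg_eq_zero.1 h5)
  let l : A × B → A × B := fun q => (p.1⁻¹ * q.1, q.2 * p.2⁻¹)
  let r : G → G := fun g => 𝒟.iA p.1 * g * 𝒟.iB p.2
  have hl : ContMDiff (JA.prod JB) (JA.prod JB) ∞ l :=
    (contMDiff_const.mul contMDiff_fst).prodMk (contMDiff_snd.mul contMDiff_const)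
  have hr : ContMDiff I I ∞ r := (contMDiff_const.mul contMDiff_id).mul contMDiff_const
  have hl' : ContMDiff (JA.prod JB) (JA.prod JB) ∞
      (fun q : A × B => (p.1 * q.1, q.2 * p.2)) :=
    (contMDiff_const.mul contMDiff_fst).prodMk (contMDiff_snd.mul contMDiff_const)
  have hr' : ContMDiff I I ∞ (fun g => (𝒟.iA p.1)⁻¹ * g * (𝒟.iB p.2)⁻¹) :=
    (contMDiff_const.mul contMDiff_id).mul contMDiff_const
  have hlp : l p = (1, 1) := by simp [l]
  have he : (𝒟.mulEquiv : A × B → G) = r ∘ (𝒟.mulEquiv ∘ l) := by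
    ext q
    simp [mulEquiv, l, r, mul_assoc]
  have il : Function.Injective (mfderiv (JA.prod JB) (JA.prod JB) l p) :=
    mfderiv_injective_of_leftInverse (hl.mdifferentiableAt (by simp))
      (hl'.mdifferentiableAt (by simp)) (fun q => by simp [l])
  have ir : Function.Injective (mfderiv I I r ((𝒟.mulEquiv ∘ l) p)) :=
    mfderiv_injective_of_leftInverse (hr.mdifferentiableAt (by simp))
      (hr'.mdifferentiableAt (by simp)) (fun q => by simp [r, mul_assoc])
  have hm : ∀ q, MDifferentiableAt (JA.prod JB) I 𝒟.mulEquiv q := fun q =>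
    𝒟.contMDiff_mulEquiv.mdifferentiableAt (by simp)
  have c1 := mfderiv_comp (f := l) (g := 𝒟.mulEquiv) p (hm _)
    (hl.mdifferentiableAt (by simp))
  have c2 := mfderiv_comp (f := 𝒟.mulEquiv ∘ l) (g := r) p
    (hr.mdifferentiableAt (by simp)) ((hm _).comp p (hl.mdifferentiableAt (by simp)))
  rw [← hlp] at h1
  rw [he, c2, c1]
  exact ir.comp (h1.comp il)

/-- Injectivity gives dim A + dim B ≤ dim G, and openness of the map gives the reverse inequality,
so the derivative is also surjective. -/
theorem bijective_mfderiv_mulEquiv (p : A × B) :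
    Function.Bijective (mfderiv (JA.prod JB) I 𝒟.mulEquiv p) := by
  have hi := 𝒟.injective_mfderiv_mulEquiv p
  refine ⟨hi, ?_⟩
  have h1 : Module.finrank ℝ E ≤ Module.finrank ℝ (EA × EB) :=
    finrank_le_of_contMDiff_of_isOpenMap 𝒟.contMDiff_mulEquiv 𝒟.isOpenMap_mulEquiv p
  let L : (EA × EB) →ₗ[ℝ] E :=
    (show (EA × EB) →L[ℝ] E from mfderiv (JA.prod JB) I 𝒟.mulEquiv p : (EA × EB) →ₗ[ℝ] E)
  have hL : Function.Injective L := hi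
  have h2 := LinearMap.finrank_le_finrank_of_injective hL
  exact (LinearMap.injective_iff_surjective_of_finrank_eq_finrank (le_antisymm h2 h1)).1 hL

theorem contMDiff_mulHomeo_symm : ContMDiff I (JA.prod JB) ∞ 𝒟.mulHomeo.symm :=
  𝒟.mulHomeo.contMDiff_symm_of_bijective_mfderiv 𝒟.contMDiff_mulEquiv
    𝒟.bijective_mfderiv_mulEquiv

theorem contMDiff_aL : ContMDiff I JA ∞ 𝒟.aL := contMDiff_fst.comp 𝒟.contMDiff_mulHomeo_symm

theorem contMDiff_bR : ContMDiff I JB ∞ 𝒟.bR := contMDiff_snd.comp 𝒟.contMDiff_mulHomeo_symm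

theorem bL_eq_bR_inv (g : G) : 𝒟.bL g = (𝒟.bR g⁻¹)⁻¹ := by
  rw [← bL_inv, inv_inv]

theorem aR_eq_aL_inv (g : G) : 𝒟.aR g = (𝒟.aL g⁻¹)⁻¹ := by
  rw [← aR_inv, inv_inv]

theorem contMDiff_bL : ContMDiff I JB ∞ 𝒟.bL := by
  rw [show 𝒟.bL = fun g => (𝒟.bR g⁻¹)⁻¹ from funext 𝒟.bL_eq_bR_inv]
  exact (contMDiff_inv JB ∞).comp (𝒟.contMDiff_bR.comp (contMDiff_inv I ∞))

theorem contMDiff_aR : ContMDiff I JA ∞ 𝒟.aR := by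
  rw [show 𝒟.aR = fun g => (𝒟.aL g⁻¹)⁻¹ from funext 𝒟.aR_eq_aL_inv]
  exact (contMDiff_inv JA ∞).comp (𝒟.contMDiff_aL.comp (contMDiff_inv I ∞))

theorem contMDiff_gInv : ContMDiff I I ∞ 𝒟.gInv :=
  (𝒟.smooth_iA.comp 𝒟.contMDiff_aR).mul
    ((contMDiff_inv I ∞).comp (𝒟.smooth_iB.comp 𝒟.contMDiff_bR))

theorem contMDiff_act : ContMDiff (JA.prod JB) JB ∞ (fun p : A × B => 𝒟.act p.1 p.2) :=
  𝒟.contMDiff_bL.comp 𝒟.contMDiff_mulEquiv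

theorem contMDiff_coact : ContMDiff (JA.prod JB) JA ∞ (fun p : A × B => 𝒟.coact p.1 p.2) :=
  𝒟.contMDiff_aR.comp 𝒟.contMDiff_mulEquiv

end Smooth

end DoubleLieGroup

end

/-! ### Velocities of curves and trivializations of the tangent spaces of the fibers -/

noncomputable section

section Curves

variable {E H : Type*} [NormedAddCommGroup E] [NormedSpace ℝ E]
  [TopologicalSpace H] {I : ModelWithCorners ℝ E H}
  {M : Type*} [TopologicalSpace M] [ChartedSpace H M]
  {E' H' : Type*} [NormedAddCommGroup E'] [NormedSpace ℝ E']
  [TopologicalSpace H'] {J : ModelWithCorners ℝ E' H'} [J.Boundaryless]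
  {N : Type*} [TopologicalSpace N] [ChartedSpace H' N] [IsManifold J ∞ N]

theorem exists_curve_velocity (n : N) (v : TangentSpace J n) :
    ∃ γ : ℝ → N, IsCurveIn J univ n γ ∧ velocity J n γ = v := by
  let v' : E' := v
  let c : ℝ → E' := fun t => extChartAt J n n + t • v'
  let γ : ℝ → N := fun t => (extChartAt J n).symm (c t)
  have hc0 : c 0 = extChartAt J n n := by simp [c]
  have hcd : ContDiff ℝ ∞ c := contDiff_const.add (contDiff_id.smul contDiff_const)
  have h0 : γ 0 = n := by simp [γ, hc0]
  have hs : ContMDiffAt 𝓘(ℝ, ℝ) J ∞ γ 0 := by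
    have h1 := contMDiffOn_extChartAt_symm (I := J) (n := ∞) n
    have h2 : ContMDiffAt 𝓘(ℝ, E') J ∞ (extChartAt J n).symm (c 0) := by
      refine (h1 _ ?_).contMDiffAt ?_
      · rw [hc0]; exact mem_extChartAt_target n
      · rw [hc0]; exact extChartAt_target_mem_nhds n
    exact h2.comp 0 hcd.contMDiff.contMDiffAt
  refine ⟨γ, ⟨h0, hs, by simp⟩, ?_⟩
  have hev : ∀ᶠ t in 𝓝 (0 : ℝ), extChartAt J n (γ t) = c t := by
    have h3 : ∀ᶠ t in 𝓝 (0 : ℝ), c t ∈ (extChartAt J n).target :=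
      hcd.continuous.continuousAt (by rw [hc0]; exact extChartAt_target_mem_nhds n)
    exact h3.mono fun t ht => (extChartAt J n).right_inv ht
  have hder : HasFDerivAt c ((1 : ℝ →L[ℝ] ℝ).smulRight v') 0 := by
    have h4 : HasDerivAt c v' 0 := by
      simpa [c] using ((hasDerivAt_id (0 : ℝ)).smul_const v').const_add (extChartAt J n n)
    exact h4.hasFDerivAt
  have h5 : HasMFDerivAt 𝓘(ℝ, ℝ) J γ 0 ((1 : ℝ →L[ℝ] ℝ).smulRight v') := by
    refine ⟨hs.continuousAt, ?_⟩
    have h6 : writtenInExtChartAt 𝓘(ℝ, ℝ) J 0 γ =ᶠ[𝓝 (0 : ℝ)] c := by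
      refine hev.mono fun t ht => ?_
      change extChartAt J (γ 0) (γ t) = c t
      rw [h0, ht]
    exact (hder.congr_of_eventuallyEq h6).hasFDerivWithinAt
  rw [velocity, h5.mfderiv]
  exact one_smul ℝ v'

theorem mfderiv_velocity {Φ : N → M} {n : N} (hΦ : ContMDiff J I ∞ Φ) {γ : ℝ → N} (h0 : γ 0 = n)
    (hγ : ContMDiffAt 𝓘(ℝ, ℝ) J ∞ γ 0) :
    (velocity I (Φ n) (fun t => Φ (γ t)) : E) = mfderiv J I Φ n (velocity J n γ) := by
  subst h0
  exact mfderiv_comp_apply (0 : ℝ) (hΦ.mdifferentiableAt (by simp))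
    (hγ.mdifferentiableAt (by simp)) (1 : ℝ)

/-- The tangent space of a subset with a smooth global parametrization. -/
theorem mem_tangentOf_iff {S : Set M} {Φ : N → M} {r : M → N} (hΦ : ContMDiff J I ∞ Φ)
    (hr : ContMDiff I J ∞ r) (hS : ∀ n, Φ n ∈ S) (hrS : ∀ x ∈ S, Φ (r x) = x) {n : N} {p : M}
    (hp : Φ n = p) (hrp : r p = n) (v : TangentSpace I p) :
    v ∈ tangentOf I S p ↔ ∃ w : TangentSpace J n, (mfderiv J I Φ n w : E) = v := by
  subst hp
  constructor
  · intro hv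
    have hle : tangentOf I S (Φ n) ≤ LinearMap.range (mfderiv J I Φ n).toLinearMap := by
      refine Submodule.span_le.2 ?_
      rintro _ ⟨γ, ⟨h0, hγ, hev⟩, rfl⟩
      have hδ : ContMDiffAt 𝓘(ℝ, ℝ) J ∞ (fun t => r (γ t)) 0 := (hr (γ 0)).comp 0 hγ
      have hδ0 : r (γ 0) = n := by rw [h0, hrp]
      refine ⟨velocity J n fun t => r (γ t), ?_⟩
      have h1 := mfderiv_velocity (I := I) hΦ hδ0 hδ
      refine Eq.trans h1.symm ?_
      have h2 : (fun t => Φ (r (γ t))) =ᶠ[𝓝 0] γ := hev.mono fun t ht => hrS _ ht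
      have h3 := h2.mfderiv_eq (I := 𝓘(ℝ, ℝ)) (I' := I)
      exact congrArg (fun L : ℝ →L[ℝ] E => L 1) h3
    obtain ⟨w, hw⟩ := hle hv
    exact ⟨w, hw⟩
  · rintro ⟨w, rfl⟩
    obtain ⟨γ, ⟨h0, hγ, -⟩, rfl⟩ := exists_curve_velocity n w
    refine Submodule.subset_span ⟨fun t => Φ (γ t), ⟨by simp [h0], ?_, ?_⟩, ?_⟩
    · exact (hΦ (γ 0)).comp 0 hγ
    · exact Eventually.of_forall fun t => hS _
    · exact mfderiv_velocity (I := I) hΦ h0 hγ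

end Curves

namespace DoubleLieGroup

section Triv

variable {E H : Type*} [NormedAddCommGroup E] [NormedSpace ℝ E] [FiniteDimensional ℝ E]
  [TopologicalSpace H]
  {EA HA : Type*} [NormedAddCommGroup EA] [NormedSpace ℝ EA] [FiniteDimensional ℝ EA]
  [TopologicalSpace HA]
  {EB HB : Type*} [NormedAddCommGroup EB] [NormedSpace ℝ EB] [FiniteDimensional ℝ EB]
  [TopologicalSpace HB]
  {I : ModelWithCorners ℝ E H} [I.Boundaryless]
  {JA : ModelWithCorners ℝ EA HA} [JA.Boundaryless]
  {JB : ModelWithCorners ℝ EB HB} [JB.Boundaryless]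
  {G A B : Type*} [TopologicalSpace G] [ChartedSpace H G] [Group G] [LieGroup I ∞ G]
  [T2Space G] [SecondCountableTopology G]
  [TopologicalSpace A] [ChartedSpace HA A] [Group A] [LieGroup JA ∞ A]
  [TopologicalSpace B] [ChartedSpace HB B] [Group B] [LieGroup JB ∞ B]
  (𝒟 : DoubleLieGroup I JA JB G A B)

theorem exists_dA_add_dB (u : TangentSpace I (1 : G)) : ∃ v w, u = 𝒟.dA v + 𝒟.dB w := by
  obtain ⟨p, hp⟩ := (𝒟.bijective_mfderiv_mulEquiv (1, 1)).2 (u : E)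
  exact ⟨p.1, p.2, hp.symm.trans (𝒟.mfderiv_mulEquiv_one p)⟩

/-- Since 𝔞 ⊕ 𝔟 → 𝔤 is bijective, the choice defining `projB` is that of an existing map, and
`projB` has the two characteristic properties. -/
theorem exists_projB : ∃ P : TangentSpace I (1 : G) →ₗ[ℝ] TangentSpace JB (1 : B),
    (∀ v, P (𝒟.dB v) = v) ∧ ∀ v, P (𝒟.dA v) = 0 := by
  let T : TangentSpace JA (1 : A) × TangentSpace JB (1 : B) →ₗ[ℝ] TangentSpace I (1 : G) :=
    LinearMap.coprod 𝒟.dA 𝒟.dB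
  have hT : Function.Bijective T := by
    constructor
    · rw [injective_iff_map_eq_zero]
      rintro ⟨v, w⟩ h
      have h1 : 𝒟.dA v + 𝒟.dB w = 0 := h
      obtain ⟨h2, h3⟩ := 𝒟.dA_eq_dB (v := v) (w := -w)
        ((eq_neg_of_add_eq_zero_left h1).trans (map_neg 𝒟.dB _).symm)
      exact Prod.ext h2 (neg_eq_zero.1 h3)
    · intro u
      obtain ⟨v, w, rfl⟩ := 𝒟.exists_dA_add_dB u
      exact ⟨(v, w), rfl⟩
  let e := LinearEquiv.ofBijective T hT
  refine ⟨LinearMap.snd ℝ (TangentSpace JA (1 : A)) (TangentSpace JB (1 : B)) ∘ₗ e.symm.toLinearMap, fun v => ?_, fun v => ?_⟩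
  · have h1 : 𝒟.dB v = e (0, v) := by
      change _ = 𝒟.dA 0 + 𝒟.dB v
      rw [map_zero, zero_add]
    rw [h1]
    change (e.symm (e (0, v))).2 = v
    rw [e.symm_apply_apply]
  · have h1 : 𝒟.dA v = e (v, 0) := by
      change _ = 𝒟.dA v + 𝒟.dB 0
      rw [map_zero, add_zero]
    rw [h1]
    change (e.symm (e (v, 0))).2 = 0
    rw [e.symm_apply_apply]

@[simp] theorem projB_dB (v : TangentSpace JB (1 : B)) : 𝒟.projB (𝒟.dB v) = v :=
  (Classical.epsilon_spec 𝒟.exists_projB).1 v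

@[simp] theorem projB_dA (v : TangentSpace JA (1 : A)) : 𝒟.projB (𝒟.dA v) = 0 :=
  (Classical.epsilon_spec 𝒟.exists_projB).2 v

/-- The vector `g · w`, `w ∈ 𝔟`. -/
def leftVec (g : G) (w : TangentSpace JB (1 : B)) : TangentSpace I g :=
  mfderiv JB I (fun b => g * 𝒟.iB b) 1 w

/-- The vector `w · g`, `w ∈ 𝔟`. -/
def rightVec (g : G) (w : TangentSpace JB (1 : B)) : TangentSpace I g :=
  mfderiv JB I (fun b => 𝒟.iB b * g) 1 w

/-- The map `v ↦ P_B (g⁻¹ v)`. -/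
def trivL (g : G) : TangentSpace I g →ₗ[ℝ] TangentSpace JB (1 : B) :=
  𝒟.projB ∘ₗ (show TangentSpace I g →L[ℝ] TangentSpace I (1 : G) from
    mfderiv I I (fun x => g⁻¹ * x) g).toLinearMap

/-- The map `v ↦ P_B (v g⁻¹)`. -/
def trivR (g : G) : TangentSpace I g →ₗ[ℝ] TangentSpace JB (1 : B) :=
  𝒟.projB ∘ₗ (show TangentSpace I g →L[ℝ] TangentSpace I (1 : G) from
    mfderiv I I (fun x => x * g⁻¹) g).toLinearMap

theorem trivL_leftVec (g : G) (w : TangentSpace JB (1 : B)) : 𝒟.trivL g (𝒟.leftVec g w) = w := by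
  have h1 := mfderiv_comp_apply_of_eq (I := JB) (I' := I) (I'' := I) (f := fun b : B => g * 𝒟.iB b)
    (g := fun x => g⁻¹ * x) (x := (1 : B)) (y := g)
    (mdifferentiableAt_const_mul g⁻¹ g)
    (((contMDiff_const (I := JB) (c := g)).mul 𝒟.smooth_iB).mdifferentiableAt (by simp)) (by simp) w
  have h2 : (fun x => g⁻¹ * x) ∘ (fun b : B => g * 𝒟.iB b) = 𝒟.iB := by ext b; simp
  rw [h2] at h1
  exact (congrArg 𝒟.projB h1.symm).trans (𝒟.projB_dB w)

theorem trivR_rightVec (g : G) (w : TangentSpace JB (1 : B)) :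
    𝒟.trivR g (𝒟.rightVec g w) = w := by
  have h1 := mfderiv_comp_apply_of_eq (I := JB) (I' := I) (I'' := I) (f := fun b : B => 𝒟.iB b * g)
    (g := fun x => x * g⁻¹) (x := (1 : B)) (y := g)
    (mdifferentiableAt_mul_const g⁻¹ g)
    ((𝒟.smooth_iB.mul (contMDiff_const (I := JB) (c := g))).mdifferentiableAt (by simp)) (by simp) w
  have h2 : (fun x => x * g⁻¹) ∘ (fun b : B => 𝒟.iB b * g) = 𝒟.iB := by ext b; simp
  rw [h2] at h1
  exact (congrArg 𝒟.projB h1.symm).trans (𝒟.projB_dB w)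

/-- The left fiber through g is the image of b ↦ gb, and x ↦ b_R(g⁻¹x) is a smooth map on G that
inverts this parametrization on the fiber. -/
theorem mem_tangentL_iff (g : G) (v : TangentSpace I g) :
    v ∈ 𝒟.tangentL g ↔ ∃ w, 𝒟.leftVec g w = v := by
  refine mem_tangentOf_iff (I := I) (J := JB) (Φ := fun b => g * 𝒟.iB b)
    (r := fun x => 𝒟.bR (g⁻¹ * x)) ?_ ?_ ?_ ?_ ?_ ?_ v
  · exact contMDiff_const.mul 𝒟.smooth_iB
  · exact 𝒟.contMDiff_bR.comp (contMDiff_const.mul contMDiff_id)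
  · intro b
    exact 𝒟.eL_eq_iff.2 (by simp)
  · intro x hx
    have h1 : 𝒟.aL x = 𝒟.aL g := 𝒟.eL_eq_iff.1 hx
    have h2 : g⁻¹ * x = 𝒟.iB ((𝒟.bR g)⁻¹ * 𝒟.bR x) := by
      rw [map_mul, map_inv, inv_mul_eq_iff_eq_mul, ← mul_assoc, ← iA_aL, ← h1, aL_mul_bR]
    change _ = _
    rw [h2, bR_iB, ← h2, mul_inv_cancel_left]
  · simp
  · simpa using 𝒟.bR_iB 1

theorem mem_tangentR_iff (g : G) (v : TangentSpace I g) :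
    v ∈ 𝒟.tangentR g ↔ ∃ w, 𝒟.rightVec g w = v := by
  refine mem_tangentOf_iff (I := I) (J := JB) (Φ := fun b => 𝒟.iB b * g)
    (r := fun x => 𝒟.bL (x * g⁻¹)) ?_ ?_ ?_ ?_ ?_ ?_ v
  · exact 𝒟.smooth_iB.mul contMDiff_const
  · exact 𝒟.contMDiff_bL.comp (contMDiff_id.mul contMDiff_const)
  · intro b
    exact 𝒟.eR_eq_iff.2 (by simp)
  · intro x hx
    have h1 : 𝒟.aR x = 𝒟.aR g := 𝒟.eR_eq_iff.1 hx
    have h2 : x * g⁻¹ = 𝒟.iB (𝒟.bL x * (𝒟.bL g)⁻¹) := by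
      rw [map_mul, map_inv, mul_inv_eq_iff_eq_mul, mul_assoc, ← iA_aR, ← h1, bL_mul_aR]
    change _ = _
    rw [h2, bL_iB, ← h2, inv_mul_cancel_right]
  · simp
  · simpa using 𝒟.bL_iB 1

/-- Left trivialization of the tangent spaces of the left fibers. -/
def tangentLEquiv (g : G) : 𝒟.tangentL g ≃ₗ[ℝ] TangentSpace JB (1 : B) where
  toFun v := 𝒟.trivL g v
  map_add' v w := by simp
  map_smul' c v := by simp
  invFun w := ⟨𝒟.leftVec g w, (𝒟.mem_tangentL_iff g _).2 ⟨w, rfl⟩⟩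
  left_inv v := by
    obtain ⟨w, hw⟩ := (𝒟.mem_tangentL_iff g v).1 v.2
    refine Subtype.ext ?_
    change 𝒟.leftVec g (𝒟.trivL g v) = v
    rw [← hw, trivL_leftVec]
  right_inv w := 𝒟.trivL_leftVec g w

/-- Right trivialization of the tangent spaces of the right fibers. -/
def tangentREquiv (g : G) : 𝒟.tangentR g ≃ₗ[ℝ] TangentSpace JB (1 : B) where
  toFun v := 𝒟.trivR g v
  map_add' v w := by simp
  map_smul' c v := by simp
  invFun w := ⟨𝒟.rightVec g w, (𝒟.mem_tangentR_iff g _).2 ⟨w, rfl⟩⟩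
  left_inv v := by
    obtain ⟨w, hw⟩ := (𝒟.mem_tangentR_iff g v).1 v.2
    refine Subtype.ext ?_
    change 𝒟.rightVec g (𝒟.trivR g v) = v
    rw [← hw, trivR_rightVec]
  right_inv w := 𝒟.trivR_rightVec g w

end Triv

end DoubleLieGroup

end

/-! ### Modular functions, the half-densities λ₀ and ρ₀, and coefficients of bidensities -/

noncomputable section

section Det

variable {F : Type*} [NormedAddCommGroup F] [NormedSpace ℝ F] [FiniteDimensional ℝ F]
  {ι : Type*} [Fintype ι] [DecidableEq ι]

theorem Module.Basis.contDiff_det (X : Module.Basis ι ℝ F) :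
    ContDiff ℝ ∞ (fun w : ι → F => X.det w) := by
  have h1 : (fun w : ι → F => X.det w) = fun w => ∑ σ : Equiv.Perm ι,
      (Equiv.Perm.sign σ : ℤ) • ∏ i, (X.coord (σ i)).toContinuousLinearMap (w i) := by
    ext w
    rw [Module.Basis.det_apply, Matrix.det_apply]
    rfl
  rw [h1]
  refine ContDiff.sum fun σ _ => ContDiff.const_smul _ (contDiff_prod fun i _ => ?_)
  exact (ContinuousLinearMap.contDiff _).comp (contDiff_apply ℝ F i)

theorem contDiffAt_abs_rpow {x : ℝ} (hx : x ≠ 0) (r : ℝ) :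
    ContDiffAt ℝ ∞ (fun y : ℝ => |y| ^ r) x :=
  (contDiffAt_abs hx).rpow_const_of_ne (abs_ne_zero.2 hx)

end Det

namespace DoubleLieGroup

section Densities

variable {E H : Type*} [NormedAddCommGroup E] [NormedSpace ℝ E] [FiniteDimensional ℝ E]
  [TopologicalSpace H]
  {EA HA : Type*} [NormedAddCommGroup EA] [NormedSpace ℝ EA] [FiniteDimensional ℝ EA]
  [TopologicalSpace HA]
  {EB HB : Type*} [NormedAddCommGroup EB] [NormedSpace ℝ EB] [FiniteDimensional ℝ EB]
  [TopologicalSpace HB]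
  {I : ModelWithCorners ℝ E H} [I.Boundaryless]
  {JA : ModelWithCorners ℝ EA HA} [JA.Boundaryless]
  {JB : ModelWithCorners ℝ EB HB} [JB.Boundaryless]
  {G A B : Type*} [TopologicalSpace G] [ChartedSpace H G] [Group G] [LieGroup I ∞ G]
  [T2Space G] [SecondCountableTopology G]
  [TopologicalSpace A] [ChartedSpace HA A] [Group A] [LieGroup JA ∞ A]
  [TopologicalSpace B] [ChartedSpace HB B] [Group B] [LieGroup JB ∞ B]
  (𝒟 : DoubleLieGroup I JA JB G A B)

/-- The map b_L is constant on A and the identity on B, so its differential at e is the projection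
along 𝔞. Compressions P_B Ad(g) thereby become differentials of maps from B to B. -/
theorem mfderiv_bL_one (u : TangentSpace I (1 : G)) :
    (mfderiv I JB 𝒟.bL 1 u : EB) = 𝒟.projB u := by
  obtain ⟨v, w, rfl⟩ := 𝒟.exists_dA_add_dB u
  have hd : MDifferentiableAt I JB 𝒟.bL 1 := 𝒟.contMDiff_bL.mdifferentiableAt (by simp)
  have h1 : (mfderiv I JB 𝒟.bL 1 (𝒟.dA v) : EB) = 0 := by
    have h2 := mfderiv_comp_apply_of_eq (f := 𝒟.iA) (g := 𝒟.bL) (x := 1) (y := 1) hd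
      (𝒟.smooth_iA.mdifferentiableAt (by simp)) (map_one _) v
    have h3 : 𝒟.bL ∘ 𝒟.iA = fun _ => 1 := by ext a; simp
    rw [h3, mfderiv_const] at h2
    exact h2.symm
  have h4 : (mfderiv I JB 𝒟.bL 1 (𝒟.dB w) : EB) = w := by
    have h2 := mfderiv_comp_apply_of_eq (f := 𝒟.iB) (g := 𝒟.bL) (x := 1) (y := 1) hd
      (𝒟.smooth_iB.mdifferentiableAt (by simp)) (map_one _) w
    have h3 : 𝒟.bL ∘ 𝒟.iB = id := by ext a; simp
    rw [h3, mfderiv_id] at h2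
    exact h2.symm
  have h5 : 𝒟.projB (𝒟.dA v + 𝒟.dB w) = w := by rw [map_add, projB_dA, projB_dB, zero_add]
  rw [h5]
  refine (map_add (mfderiv I JB 𝒟.bL 1) _ _).trans ?_
  exact (congrArg₂ (fun x y : EB => x + y) h1 h4).trans (zero_add (w : EB))

/-- Conjugation by `g`, followed by the projection to `B`. -/
def conjB (g : G) (b : B) : B := 𝒟.bL (g * 𝒟.iB b * g⁻¹)

theorem contMDiff_conjB (g : G) : ContMDiff JB JB ∞ (𝒟.conjB g) :=
  𝒟.contMDiff_bL.comp ((contMDiff_const.mul 𝒟.smooth_iB).mul contMDiff_const)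

/-- The compression of `Ad(g)` to `𝔟`. -/
def compB (g : G) : TangentSpace JB (1 : B) →ₗ[ℝ] TangentSpace JB (1 : B) :=
  𝒟.projB ∘ₗ (Ad I g : TangentSpace I (1 : G) →ₗ[ℝ] TangentSpace I (1 : G)) ∘ₗ
    (𝒟.dB : TangentSpace JB (1 : B) →ₗ[ℝ] TangentSpace I (1 : G))

theorem mfderiv_conjB (g : G) (w : TangentSpace JB (1 : B)) :
    (mfderiv JB JB (𝒟.conjB g) 1 w : EB) = 𝒟.compB g w := by
  have hc : MDifferentiableAt I I (fun x : G => g * x * g⁻¹) 1 :=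
    ((contMDiff_const.mul (contMDiff_id (I := I) (n := ∞))).mul
      contMDiff_const).mdifferentiableAt (by simp)
  have hb : MDifferentiableAt JB I 𝒟.iB 1 := 𝒟.smooth_iB.mdifferentiableAt (by simp)
  have h1 := mfderiv_comp_apply_of_eq (f := 𝒟.iB) (g := fun x : G => g * x * g⁻¹) (x := 1) (y := 1)
    hc hb (map_one _) w
  have h2 := mfderiv_comp_apply_of_eq (f := (fun x : G => g * x * g⁻¹) ∘ 𝒟.iB) (g := 𝒟.bL)
    (x := (1 : B)) (y := 1) (𝒟.contMDiff_bL.mdifferentiableAt (by simp))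
    ((((contMDiff_const (I := JB)).mul 𝒟.smooth_iB).mul contMDiff_const).mdifferentiableAt
      (by simp))
    (by simp) w
  refine Eq.trans h2 ?_
  refine Eq.trans ?_ (𝒟.mfderiv_bL_one (Ad I g (𝒟.dB w)))
  exact congrArg (fun u : TangentSpace I (1 : G) => (mfderiv I JB 𝒟.bL 1 u : EB)) h1

/-- A smooth left inverse of `conjB g` makes its differential at 1 injective. The hypothesis is
needed because for general g the compression can degenerate; for g in A or in B the inverse element
supplies the left inverse. -/
theorem detB_ne_zero_of_conjB {g g' : G} (h : ∀ b, 𝒟.conjB g' (𝒟.conjB g b) = b) :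
    𝒟.detB g ≠ 0 := by
  intro h0
  have : FiniteDimensional ℝ (TangentSpace JB (1 : B)) := inferInstanceAs (FiniteDimensional ℝ EB)
  have h1 := LinearMap.bot_lt_ker_of_det_eq_zero (f := 𝒟.compB g) h0
  refine h1.ne' (LinearMap.ker_eq_bot.2 fun v w hvw => ?_)
  refine mfderiv_injective_of_leftInverse (J := JB) (I := JB) (f := 𝒟.conjB g) (g := 𝒟.conjB g')
    ((𝒟.contMDiff_conjB g).mdifferentiableAt (by simp))
    ((𝒟.contMDiff_conjB g').mdifferentiableAt (by simp)) h ?_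
  exact (𝒟.mfderiv_conjB g v).trans (Eq.trans hvw (𝒟.mfderiv_conjB g w).symm)

theorem conjB_iA (a : A) (b : B) : 𝒟.conjB (𝒟.iA a) b = 𝒟.act a b := by
  rw [conjB, ← map_inv, bL_mul_iA]
  rfl

theorem conjB_iB (b b' : B) : 𝒟.conjB (𝒟.iB b) b' = b * b' * b⁻¹ := by
  rw [conjB, ← map_inv, ← map_mul, ← map_mul, bL_iB]

theorem psiB_ne_zero (a : A) : 𝒟.psiB a ≠ 0 :=
  𝒟.detB_ne_zero_of_conjB (g' := 𝒟.iA a⁻¹) fun b => by rw [conjB_iA, conjB_iA, act_inv_act]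

theorem phiB_ne_zero (b : B) : 𝒟.phiB b ≠ 0 :=
  𝒟.detB_ne_zero_of_conjB (g' := 𝒟.iB b⁻¹) fun b' => by rw [conjB_iB, conjB_iB]; group

theorem contMDiff_Ad (v : TangentSpace I (1 : G)) :
    ContMDiff (M' := E) I 𝓘(ℝ, E) ∞ (fun g : G => Ad I g v) := by
  have hf : ContMDiff (I.prod I) I ∞ (fun p : G × G => p.2 * p.1 * p.2⁻¹) :=
    (contMDiff_snd.mul contMDiff_fst).mul ((contMDiff_inv I ∞).comp contMDiff_snd)
  have h := contMDiffOn_mfderiv_left (I₃ := I) (K := G) (m := fun _ => (1 : G)) (v := fun _ => v)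
    (n := fun g => g) (U := univ) hf contMDiffOn_const contMDiffOn_id
  refine contMDiffOn_univ.1
    (contMDiffOn_fiber_of_const (I := I) (M := G) (c := 1) (h.congr fun g _ => ?_))
  have h1 : g * 1 * g⁻¹ = 1 := by simp
  exact Bundle.TotalSpace.ext h1.symm HEq.rfl

theorem contMDiff_projB {E₃ H₃ : Type*} [NormedAddCommGroup E₃] [NormedSpace ℝ E₃]
    [TopologicalSpace H₃] {I₃ : ModelWithCorners ℝ E₃ H₃} {K : Type*} [TopologicalSpace K]
    [ChartedSpace H₃ K] {w : K → E} {U : Set K} (hw : ContMDiffOn I₃ 𝓘(ℝ, E) ∞ w U) :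
    ContMDiffOn (M' := EB) I₃ 𝓘(ℝ, EB) ∞
      (fun k => 𝒟.projB (w k : TangentSpace I (1 : G))) U := by
  let P : E →ₗ[ℝ] EB := 𝒟.projB
  exact (P.toContinuousLinearMap.contDiff.contMDiff (n := ∞)).comp_contMDiffOn hw

theorem contMDiff_detB : ContMDiff I 𝓘(ℝ, ℝ) ∞ 𝒟.detB := by
  let X : Module.Basis _ ℝ EB := Module.finBasis ℝ EB
  let X' : Module.Basis _ ℝ (TangentSpace JB (1 : B)) := X
  have h1 : ∀ g, X'.det (fun i => 𝒟.compB g (X' i)) = 𝒟.detB g := fun g => by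
    have h := X'.det_comp (𝒟.compB g) X'
    rw [X'.det_self, mul_one] at h
    exact h
  have h2 : ContMDiff (M' := Fin (Module.finrank ℝ EB) → EB) I 𝓘(ℝ, Fin (Module.finrank ℝ EB) → EB)
      ∞ (fun g i => 𝒟.compB g (X' i)) :=
    contMDiff_pi_space.2 fun i => contMDiffOn_univ.1
      (𝒟.contMDiff_projB (contMDiff_Ad (I := I) (G := G) (𝒟.dB (X' i))).contMDiffOn)
  exact (X.contDiff_det.contMDiff.comp h2).congr fun g => (h1 g).symm

theorem contMDiff_psiB : ContMDiff JA 𝓘(ℝ, ℝ) ∞ 𝒟.psiB := 𝒟.contMDiff_detB.comp 𝒟.smooth_iA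

theorem contMDiff_phiB : ContMDiff JB 𝓘(ℝ, ℝ) ∞ 𝒟.phiB := 𝒟.contMDiff_detB.comp 𝒟.smooth_iB

theorem contMDiff_abs_psiB_rpow (r : ℝ) : ContMDiff JA 𝓘(ℝ, ℝ) ∞ (fun a => |𝒟.psiB a| ^ r) :=
  fun a => (contDiffAt_abs_rpow (𝒟.psiB_ne_zero a) r).contMDiffAt.comp a (𝒟.contMDiff_psiB a)

theorem contMDiff_abs_phiB_rpow (r : ℝ) : ContMDiff JB 𝓘(ℝ, ℝ) ∞ (fun b => |𝒟.phiB b| ^ r) :=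
  fun b => (contDiffAt_abs_rpow (𝒟.phiB_ne_zero b) r).contMDiffAt.comp b (𝒟.contMDiff_phiB b)

theorem contMDiff_leftVec (w : TangentSpace JB (1 : B)) :
    ContMDiff I I.tangent ∞ (fun g : G => (⟨g, 𝒟.leftVec g w⟩ : TangentBundle I G)) := by
  have hf : ContMDiff (JB.prod I) I ∞ (fun p : B × G => p.2 * 𝒟.iB p.1) :=
    contMDiff_snd.mul (𝒟.smooth_iB.comp contMDiff_fst)
  have h := contMDiffOn_mfderiv_left (I₃ := I) (K := G) (m := fun _ => (1 : B)) (v := fun _ => w)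
    (n := fun g => g) (U := univ) hf contMDiffOn_const contMDiffOn_id
  rw [contMDiffOn_univ] at h
  refine h.congr fun g => ?_
  have h1 : g * 𝒟.iB 1 = g := by simp
  exact Bundle.TotalSpace.ext h1.symm HEq.rfl

theorem contMDiff_rightVec (w : TangentSpace JB (1 : B)) :
    ContMDiff I I.tangent ∞ (fun g : G => (⟨g, 𝒟.rightVec g w⟩ : TangentBundle I G)) := by
  have hf : ContMDiff (JB.prod I) I ∞ (fun p : B × G => 𝒟.iB p.1 * p.2) :=
    (𝒟.smooth_iB.comp contMDiff_fst).mul contMDiff_snd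
  have h := contMDiffOn_mfderiv_left (I₃ := I) (K := G) (m := fun _ => (1 : B)) (v := fun _ => w)
    (n := fun g => g) (U := univ) hf contMDiffOn_const contMDiffOn_id
  rw [contMDiffOn_univ] at h
  refine h.congr fun g => ?_
  have h1 : 𝒟.iB 1 * g = g := by simp
  exact Bundle.TotalSpace.ext h1.symm HEq.rfl

theorem contMDiffOn_trivL {v : ∀ g : G, TangentSpace I g} {U : Set G}
    (hv : ContMDiffOn I I.tangent ∞ (fun g => (⟨g, v g⟩ : TangentBundle I G)) U) :
    ContMDiffOn (M' := EB) I 𝓘(ℝ, EB) ∞ (fun g => 𝒟.trivL g (v g)) U := by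
  have hf : ContMDiff (I.prod I) I ∞ (fun p : G × G => p.2⁻¹ * p.1) :=
    ((contMDiff_inv I ∞).comp contMDiff_snd).mul contMDiff_fst
  have h := contMDiffOn_mfderiv_left (I₃ := I) (n := fun g => g) hf hv contMDiffOn_id
  refine 𝒟.contMDiff_projB (w := fun g => mfderiv I I (fun x => g⁻¹ * x) g (v g))
    (contMDiffOn_fiber_of_const (I := I) (M := G) (c := 1) (h.congr fun g _ => ?_))
  have h1 : g⁻¹ * g = 1 := by simp
  exact Bundle.TotalSpace.ext h1.symm HEq.rfl

theorem contMDiffOn_trivR {v : ∀ g : G, TangentSpace I g} {U : Set G}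
    (hv : ContMDiffOn I I.tangent ∞ (fun g => (⟨g, v g⟩ : TangentBundle I G)) U) :
    ContMDiffOn (M' := EB) I 𝓘(ℝ, EB) ∞ (fun g => 𝒟.trivR g (v g)) U := by
  have hf : ContMDiff (I.prod I) I ∞ (fun p : G × G => p.1 * p.2⁻¹) :=
    contMDiff_fst.mul ((contMDiff_inv I ∞).comp contMDiff_snd)
  have h := contMDiffOn_mfderiv_left (I₃ := I) (n := fun g => g) hf hv contMDiffOn_id
  refine 𝒟.contMDiff_projB (w := fun g => mfderiv I I (fun x => x * g⁻¹) g (v g))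
    (contMDiffOn_fiber_of_const (I := I) (M := G) (c := 1) (h.congr fun g _ => ?_))
  have h1 : g * g⁻¹ = 1 := by simp
  exact Bundle.TotalSpace.ext h1.symm HEq.rfl

variable {ι : Type*} [Fintype ι] [DecidableEq ι]
variable (X : Module.Basis ι ℝ (TangentSpace JB (1 : B)))

theorem lambda0_eq (g : G) (v : ι → TangentSpace I g) :
    𝒟.lambda0 X g v = |X.det fun i => 𝒟.trivL g (v i)| ^ (1 / 2 : ℝ) := rfl

theorem rho0_eq (g : G) (v : ι → TangentSpace I g) :
    𝒟.rho0 X g v = |𝒟.psiB (𝒟.aL g)| ^ (-(1 / 2) : ℝ) *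
      |X.det fun i => 𝒟.trivR g (v i)| ^ (1 / 2 : ℝ) := rfl

theorem lambda0_leftVec (g : G) : 𝒟.lambda0 X g (fun i => 𝒟.leftVec g (X i)) = 1 := by
  rw [lambda0_eq]
  simp_rw [trivL_leftVec]
  rw [show (fun i => X i) = X from rfl, Module.Basis.det_self]
  simp

theorem rho0_rightVec (g : G) : 𝒟.rho0 X g (fun i => 𝒟.rightVec g (X i)) =
    |𝒟.psiB (𝒟.aL g)| ^ (-(1 / 2) : ℝ) := by
  rw [rho0_eq]
  simp_rw [trivR_rightVec]
  rw [show (fun i => X i) = X from rfl, Module.Basis.det_self]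
  simp

theorem det_conj_apply {V W : Type*} [AddCommGroup V] [Module ℝ V] [AddCommGroup W] [Module ℝ W]
    (e : V ≃ₗ[ℝ] W) (Y : Module.Basis ι ℝ W) (T : V →ₗ[ℝ] V) (v : ι → V) :
    Y.det (fun i => e (T (v i))) = LinearMap.det T * Y.det (fun i => e (v i)) := by
  have h := Module.Basis.det_comp Y (e.toLinearMap ∘ₗ T ∘ₗ e.symm.toLinearMap) (fun i => e (v i))
  have h2 : (⇑(e.toLinearMap ∘ₗ T ∘ₗ e.symm.toLinearMap) ∘ fun i => e (v i)) =
      fun i => e (T (v i)) := by ext i; simp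
  rw [h2, LinearMap.det_conj] at h
  exact h

theorem isBidensity_mulOmega0 (f : G → ℂ) : 𝒟.IsBidensity (𝒟.mulOmega0 X f) := by
  constructor
  · intro g T v w
    have h1 : 𝒟.lambda0 X g (fun i => (T (v i) : TangentSpace I g)) =
        |LinearMap.det T| ^ (1 / 2 : ℝ) * 𝒟.lambda0 X g (fun i => (v i : TangentSpace I g)) := by
      have := det_conj_apply (𝒟.tangentLEquiv g) X T v
      rw [lambda0_eq, lambda0_eq, ← Real.mul_rpow (abs_nonneg _) (abs_nonneg _), ← abs_mul]
      exact congrArg (fun x : ℝ => |x| ^ (1 / 2 : ℝ)) this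
    simp only [mulOmega0, h1]
    push_cast
    ring
  · intro g T v w
    have h1 : 𝒟.rho0 X g (fun i => (T (w i) : TangentSpace I g)) =
        |LinearMap.det T| ^ (1 / 2 : ℝ) * 𝒟.rho0 X g (fun i => (w i : TangentSpace I g)) := by
      have h2 := det_conj_apply (𝒟.tangentREquiv g) X T w
      rw [rho0_eq, rho0_eq, mul_left_comm, ← Real.mul_rpow (abs_nonneg _) (abs_nonneg _),
        ← abs_mul]
      exact congrArg (fun x : ℝ => |𝒟.psiB (𝒟.aL g)| ^ (-(1 / 2) : ℝ) * |x| ^ (1 / 2 : ℝ)) h2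
    simp only [mulOmega0, h1]
    push_cast
    ring

/-- The frame `g X_i` of the left fibers. -/
def frameL (g : G) (i : ι) : 𝒟.tangentL g := (𝒟.tangentLEquiv g).symm (X i)

/-- The frame `X_i g` of the right fibers. -/
def frameR (g : G) (i : ι) : 𝒟.tangentR g := (𝒟.tangentREquiv g).symm (X i)

theorem isSmoothFrame_frameL : IsSmoothFrame (I := I) 𝒟.tangentL univ (𝒟.frameL X) := by
  refine ⟨fun i => (𝒟.contMDiff_leftVec (X i)).contMDiffOn, fun g _ => ?_⟩
  let Y := X.map (𝒟.tangentLEquiv g).symm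
  have h : 𝒟.frameL X g = Y := by ext i; simp [Y, frameL]
  rw [h]
  exact ⟨Y.linearIndependent, Y.span_eq⟩

theorem isSmoothFrame_frameR : IsSmoothFrame (I := I) 𝒟.tangentR univ (𝒟.frameR X) := by
  refine ⟨fun i => (𝒟.contMDiff_rightVec (X i)).contMDiffOn, fun g _ => ?_⟩
  let Y := X.map (𝒟.tangentREquiv g).symm
  have h : 𝒟.frameR X g = Y := by ext i; simp [Y, frameR]
  rw [h]
  exact ⟨Y.linearIndependent, Y.span_eq⟩

theorem mulOmega0_frame (f : G → ℂ) (g : G) :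
    𝒟.mulOmega0 X f g (𝒟.frameL X g) (𝒟.frameR X g) =
      f g * ((|𝒟.psiB (𝒟.aL g)| ^ (-(1 / 2) : ℝ) : ℝ) : ℂ) := by
  have h1 := 𝒟.lambda0_leftVec X g
  have h2 := 𝒟.rho0_rightVec X g
  rw [mulOmega0]
  change f g * ((𝒟.lambda0 X g (fun i => 𝒟.leftVec g (X i)) *
    𝒟.rho0 X g (fun i => 𝒟.rightVec g (X i)) : ℝ) : ℂ) = _
  rw [h1, h2, one_mul]

theorem det_ne_zero_of_isBasis {V W : Type*} [AddCommGroup V] [Module ℝ V] [AddCommGroup W]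
    [Module ℝ W] (e : V ≃ₗ[ℝ] W) (Y : Module.Basis ι ℝ W) {v : ι → V}
    (hv : LinearIndependent ℝ v ∧ Submodule.span ℝ (Set.range v) = ⊤) :
    Y.det (fun i => e (v i)) ≠ 0 := by
  let Z := (Module.Basis.mk hv.1 hv.2.ge).map e
  have h := Y.isUnit_det Z
  have h2 : (fun i => e (v i)) = Z := by ext i; simp [Z]
  rw [h2]
  exact h.ne_zero

theorem contMDiffOn_lambda0 {U : Set G} {v : ∀ g, ι → 𝒟.tangentL g}
    (hv : IsSmoothFrame (I := I) 𝒟.tangentL U v) :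
    ContMDiffOn I 𝓘(ℝ, ℝ) ∞
      (fun g => 𝒟.lambda0 X g (fun i => (v g i : TangentSpace I g))) U := by
  have h1 : ContMDiffOn (M' := ι → EB) I 𝓘(ℝ, ι → EB) ∞
      (fun g i => 𝒟.trivL g (v g i : TangentSpace I g)) U :=
    contMDiffOn_pi_space.2 fun i => 𝒟.contMDiffOn_trivL (hv.1 i)
  let X' : Module.Basis ι ℝ EB := X
  have h2 := X'.contDiff_det.contMDiff.comp_contMDiffOn h1
  intro g hg
  refine (contDiffAt_abs_rpow ?_ (1 / 2)).contMDiffAt.comp_contMDiffWithinAt g (h2 g hg)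
  exact det_ne_zero_of_isBasis (𝒟.tangentLEquiv g) X (hv.2 g hg)

theorem contMDiffOn_rho0 {U : Set G} {v : ∀ g, ι → 𝒟.tangentR g}
    (hv : IsSmoothFrame (I := I) 𝒟.tangentR U v) :
    ContMDiffOn I 𝓘(ℝ, ℝ) ∞
      (fun g => 𝒟.rho0 X g (fun i => (v g i : TangentSpace I g))) U := by
  have h1 : ContMDiffOn (M' := ι → EB) I 𝓘(ℝ, ι → EB) ∞
      (fun g i => 𝒟.trivR g (v g i : TangentSpace I g)) U :=
    contMDiffOn_pi_space.2 fun i => 𝒟.contMDiffOn_trivR (hv.1 i)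
  let X' : Module.Basis ι ℝ EB := X
  have h2 := X'.contDiff_det.contMDiff.comp_contMDiffOn h1
  refine ContMDiffOn.mul (((𝒟.contMDiff_abs_psiB_rpow (-(1 / 2))).comp
    𝒟.contMDiff_aL).contMDiffOn) ?_
  intro g hg
  refine (contDiffAt_abs_rpow ?_ (1 / 2)).contMDiffAt.comp_contMDiffWithinAt g (h2 g hg)
  exact det_ne_zero_of_isBasis (𝒟.tangentREquiv g) X (hv.2 g hg)

theorem contMDiff_ofReal {K E₃ H₃ : Type*} [NormedAddCommGroup E₃] [NormedSpace ℝ E₃]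
    [TopologicalSpace H₃] {I₃ : ModelWithCorners ℝ E₃ H₃} [TopologicalSpace K]
    [ChartedSpace H₃ K] {w : K → ℝ} {U : Set K} (hw : ContMDiffOn I₃ 𝓘(ℝ, ℝ) ∞ w U) :
    ContMDiffOn I₃ 𝓘(ℝ, ℂ) ∞ (fun k => (w k : ℂ)) U :=
  (Complex.ofRealCLM.contDiff.contMDiff (n := ∞)).comp_contMDiffOn hw

theorem contMDiffOn_complex_mul {K E₃ H₃ : Type*} [NormedAddCommGroup E₃] [NormedSpace ℝ E₃]
    [TopologicalSpace H₃] {I₃ : ModelWithCorners ℝ E₃ H₃} [TopologicalSpace K]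
    [ChartedSpace H₃ K] {w w' : K → ℂ} {U : Set K} (hw : ContMDiffOn I₃ 𝓘(ℝ, ℂ) ∞ w U)
    (hw' : ContMDiffOn I₃ 𝓘(ℝ, ℂ) ∞ w' U) :
    ContMDiffOn I₃ 𝓘(ℝ, ℂ) ∞ (fun k => w k * w' k) U :=
  (ContDiff.mul contDiff_fst contDiff_snd : ContDiff ℝ ∞ fun p : ℂ × ℂ => p.1 * p.2).contMDiff.comp_contMDiffOn
    (hw.prodMk_space hw')

/-- The sections `f ω₀` of `𝒜(G_A)` are those with smooth compactly supported coefficient. -/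
theorem mulOmega0_mem_smoothBidensities_iff (f : G → ℂ) :
    𝒟.mulOmega0 X f ∈ 𝒟.smoothBidensities ι ↔ ContMDiff I 𝓘(ℝ, ℂ) ∞ f ∧ HasCompactSupport f := by
  have hne : ∀ g, ((|𝒟.psiB (𝒟.aL g)| ^ (-(1 / 2) : ℝ) : ℝ) : ℂ) ≠ 0 := fun g => by
    have h : 0 < |𝒟.psiB (𝒟.aL g)| ^ (-(1 / 2) : ℝ) :=
      Real.rpow_pos_of_pos (abs_pos.2 (𝒟.psiB_ne_zero _)) _
    exact_mod_cast h.ne'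
  have hsupp : {g | 𝒟.mulOmega0 X f g ≠ 0} = Function.support f := by
    ext g
    rw [Set.mem_ofPred_eq, Function.mem_support, not_iff_not]
    constructor
    -- The value on the frames gXᵢ, Xᵢg is f(g) times a nonzero number, so the section vanishes only
    -- where f does.
    · intro h
      have h1 := 𝒟.mulOmega0_frame X f g
      rw [h] at h1
      exact (mul_eq_zero.1 h1.symm).resolve_right (hne g)
    · intro h
      ext v w
      simp [mulOmega0, h]
  have hsm : ContMDiff I 𝓘(ℝ, ℝ) ∞ (fun g => |𝒟.psiB (𝒟.aL g)| ^ (1 / 2 : ℝ)) :=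
    (𝒟.contMDiff_abs_psiB_rpow (1 / 2)).comp 𝒟.contMDiff_aL
  constructor
  · rintro ⟨-, hs, hc⟩
    rw [hsupp] at hc
    refine ⟨?_, hc⟩
    have h1 := hs univ (𝒟.frameL X) (𝒟.frameR X) isOpen_univ (𝒟.isSmoothFrame_frameL X)
      (𝒟.isSmoothFrame_frameR X)
    -- On the global frames gXᵢ and Xᵢg the section takes the value f |ψ_B|^{-1/2}; multiplication
    -- by |ψ_B|^{1/2} recovers f.
    have h2 := contMDiffOn_complex_mul h1 (contMDiff_ofReal hsm.contMDiffOn)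
    rw [← contMDiffOn_univ]
    refine h2.congr fun g _ => ?_
    rw [mulOmega0_frame, mul_assoc, ← Complex.ofReal_mul,
      ← Real.rpow_add (abs_pos.2 (𝒟.psiB_ne_zero _))]
    simp
  · rintro ⟨hs, hc⟩
    refine ⟨𝒟.isBidensity_mulOmega0 X f, ?_, by rw [hsupp]; exact hc⟩
    intro U v w _ hv hw
    refine contMDiffOn_complex_mul hs.contMDiffOn (contMDiff_ofReal ?_)
    exact (𝒟.contMDiffOn_lambda0 X hv).mul (𝒟.contMDiffOn_rho0 X hw)

end Densities

end DoubleLieGroup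

end

/-! ### Determinants of derivatives at fixed points and the line of half-densities -/

noncomputable section

section Jac

variable {E H : Type*} [NormedAddCommGroup E] [NormedSpace ℝ E] [TopologicalSpace H]
  {I : ModelWithCorners ℝ E H}
  {M : Type*} [TopologicalSpace M] [ChartedSpace H M]
  {E' H' : Type*} [NormedAddCommGroup E'] [NormedSpace ℝ E'] [TopologicalSpace H']
  {J : ModelWithCorners ℝ E' H'}
  {N : Type*} [TopologicalSpace N] [ChartedSpace H' N]

variable (I) in
/-- The determinant of the derivative of `f` at `p`; it is meaningful if `f p = p`. -/
def jac (f : M → M) (p : M) : ℝ :=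
  LinearMap.det (show E →L[ℝ] E from mfderiv I I f p).toLinearMap

theorem jac_comp {f g : M → M} {p : M} (hg : MDifferentiableAt I I g p)
    (hf : MDifferentiableAt I I f p) (hp : f p = p) :
    jac I (fun x => g (f x)) p = jac I g p * jac I f p := by
  rw [jac, jac, jac, ← LinearMap.det_comp]
  congr 1
  ext v
  exact mfderiv_comp_apply_of_eq (f := f) (g := g) (x := p) (y := p) hg hf hp v

theorem jac_id (p : M) : jac I (fun x => x) p = 1 := by
  have h : (show E →L[ℝ] E from mfderiv I I (fun x : M => x) p).toLinearMap = LinearMap.id := by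
    ext v
    exact congrArg (fun L : E →L[ℝ] E => L v) (mfderiv_id (I := I) (x := p))
  rw [jac, h, LinearMap.det_id]

theorem det_prod_of_lower {V W : Type*} [AddCommGroup V] [Module ℝ V] [FiniteDimensional ℝ V]
    [AddCommGroup W] [Module ℝ W] [FiniteDimensional ℝ W] (L : V × W →ₗ[ℝ] V × W)
    (h : ∀ w, (L (0, w)).1 = 0) :
    LinearMap.det L = LinearMap.det (LinearMap.fst ℝ V W ∘ₗ L ∘ₗ LinearMap.inl ℝ V W) *
      LinearMap.det (LinearMap.snd ℝ V W ∘ₗ L ∘ₗ LinearMap.inr ℝ V W) := by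
  let bV := Module.finBasis ℝ V
  let bW := Module.finBasis ℝ W
  rw [← LinearMap.det_toMatrix (bV.prod bW), ← LinearMap.det_toMatrix bV,
    ← LinearMap.det_toMatrix bW, ← Matrix.det_fromBlocks_zero₁₂ _
      (Matrix.of fun i j => (bW.repr (L (bV j, 0)).2 i)) _]
  congr 1
  ext (i | i) (j | j) <;>
    simp [LinearMap.toMatrix_apply, h]

theorem det_prod_of_upper {V W : Type*} [AddCommGroup V] [Module ℝ V] [FiniteDimensional ℝ V]
    [AddCommGroup W] [Module ℝ W] [FiniteDimensional ℝ W] (L : V × W →ₗ[ℝ] V × W)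
    (h : ∀ v, (L (v, 0)).2 = 0) :
    LinearMap.det L = LinearMap.det (LinearMap.fst ℝ V W ∘ₗ L ∘ₗ LinearMap.inl ℝ V W) *
      LinearMap.det (LinearMap.snd ℝ V W ∘ₗ L ∘ₗ LinearMap.inr ℝ V W) := by
  let bV := Module.finBasis ℝ V
  let bW := Module.finBasis ℝ W
  rw [← LinearMap.det_toMatrix (bV.prod bW), ← LinearMap.det_toMatrix bV,
    ← LinearMap.det_toMatrix bW, ← Matrix.det_fromBlocks_zero₂₁ _
      (Matrix.of fun i j => (bV.repr (L (0, bW j)).1 i)) _]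
  congr 1
  ext (i | i) (j | j) <;>
    simp [LinearMap.toMatrix_apply, h]

theorem mfderiv_inl_fst {f : M × N → M × N} {p : M} {q : N}
    (hf : MDifferentiableAt (I.prod J) (I.prod J) f (p, q)) (v : E) :
    ((mfderiv (I.prod J) (I.prod J) f (p, q) ((v, 0) : E × E') : E × E').1) =
      (mfderiv I I (fun s => (f (s, q)).1) p v : E) := by
  have h1 : MDifferentiableAt I (I.prod J) (fun s : M => (s, q)) p :=
    mdifferentiableAt_id.prodMk mdifferentiableAt_const
  have h2 := mfderiv_comp_apply (I := I) (I' := I.prod J) (I'' := I.prod J) p hf h1 v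
  have h3 : (mfderiv I (I.prod J) (fun s : M => (s, q)) p v : E × E') = (v, 0) :=
    congrArg (fun L : E →L[ℝ] E × E' => L v) (mfderiv_prod_left (I := I) (I' := J))
  have h4 := mfderiv_comp_apply (I := I) (I' := I.prod J) (I'' := I) (g := Prod.fst) p
    mdifferentiableAt_fst (hf.comp p h1) v
  have h5 : ∀ y : M × N, mfderiv (I.prod J) I Prod.fst y = ContinuousLinearMap.fst ℝ E E' :=
    fun y => mfderiv_fst
  refine Eq.symm (Eq.trans h4 ?_)
  refine Eq.trans (congrArg (fun L : E × E' →L[ℝ] E => L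
    (mfderiv I (I.prod J) (f ∘ fun s : M => (s, q)) p v : E × E')) (h5 _)) ?_
  refine congrArg Prod.fst (Eq.trans h2 ?_)
  exact congrArg (fun w : E × E' => (mfderiv (I.prod J) (I.prod J) f (p, q) w : E × E')) h3

theorem mfderiv_inl_snd {f : M × N → M × N} {p : M} {q : N}
    (hf : MDifferentiableAt (I.prod J) (I.prod J) f (p, q)) (v : E) :
    ((mfderiv (I.prod J) (I.prod J) f (p, q) ((v, 0) : E × E') : E × E').2) =
      (mfderiv I J (fun s => (f (s, q)).2) p v : E') := by
  have h1 : MDifferentiableAt I (I.prod J) (fun s : M => (s, q)) p :=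
    mdifferentiableAt_id.prodMk mdifferentiableAt_const
  have h2 := mfderiv_comp_apply (I := I) (I' := I.prod J) (I'' := I.prod J) p hf h1 v
  have h3 : (mfderiv I (I.prod J) (fun s : M => (s, q)) p v : E × E') = (v, 0) :=
    congrArg (fun L : E →L[ℝ] E × E' => L v) (mfderiv_prod_left (I := I) (I' := J))
  have h4 := mfderiv_comp_apply (I := I) (I' := I.prod J) (I'' := J) (g := Prod.snd) p
    mdifferentiableAt_snd (hf.comp p h1) v
  have h5 : ∀ y : M × N, mfderiv (I.prod J) J Prod.snd y = ContinuousLinearMap.snd ℝ E E' :=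
    fun y => mfderiv_snd
  refine Eq.symm (Eq.trans h4 ?_)
  refine Eq.trans (congrArg (fun L : E × E' →L[ℝ] E' => L
    (mfderiv I (I.prod J) (f ∘ fun s : M => (s, q)) p v : E × E')) (h5 _)) ?_
  refine congrArg Prod.snd (Eq.trans h2 ?_)
  exact congrArg (fun w : E × E' => (mfderiv (I.prod J) (I.prod J) f (p, q) w : E × E')) h3

theorem mfderiv_inr_fst {f : M × N → M × N} {p : M} {q : N}
    (hf : MDifferentiableAt (I.prod J) (I.prod J) f (p, q)) (v : E') :
    ((mfderiv (I.prod J) (I.prod J) f (p, q) ((0, v) : E × E') : E × E').1) =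
      (mfderiv J I (fun s => (f (p, s)).1) q v : E) := by
  have h1 : MDifferentiableAt J (I.prod J) (fun s : N => (p, s)) q :=
    mdifferentiableAt_const.prodMk mdifferentiableAt_id
  have h2 := mfderiv_comp_apply (I := J) (I' := I.prod J) (I'' := I.prod J) q hf h1 v
  have h3 : (mfderiv J (I.prod J) (fun s : N => (p, s)) q v : E × E') = (0, v) :=
    congrArg (fun L : E' →L[ℝ] E × E' => L v) (mfderiv_prod_right (I := I) (I' := J))
  have h4 := mfderiv_comp_apply (I := J) (I' := I.prod J) (I'' := I) (g := Prod.fst) q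
    mdifferentiableAt_fst (hf.comp q h1) v
  have h5 : ∀ y : M × N, mfderiv (I.prod J) I Prod.fst y = ContinuousLinearMap.fst ℝ E E' :=
    fun y => mfderiv_fst
  refine Eq.symm (Eq.trans h4 ?_)
  refine Eq.trans (congrArg (fun L : E × E' →L[ℝ] E => L
    (mfderiv J (I.prod J) (f ∘ fun s : N => (p, s)) q v : E × E')) (h5 _)) ?_
  refine congrArg Prod.fst (Eq.trans h2 ?_)
  exact congrArg (fun w : E × E' => (mfderiv (I.prod J) (I.prod J) f (p, q) w : E × E')) h3

theorem mfderiv_inr_snd {f : M × N → M × N} {p : M} {q : N}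
    (hf : MDifferentiableAt (I.prod J) (I.prod J) f (p, q)) (v : E') :
    ((mfderiv (I.prod J) (I.prod J) f (p, q) ((0, v) : E × E') : E × E').2) =
      (mfderiv J J (fun s => (f (p, s)).2) q v : E') := by
  have h1 : MDifferentiableAt J (I.prod J) (fun s : N => (p, s)) q :=
    mdifferentiableAt_const.prodMk mdifferentiableAt_id
  have h2 := mfderiv_comp_apply (I := J) (I' := I.prod J) (I'' := I.prod J) q hf h1 v
  have h3 : (mfderiv J (I.prod J) (fun s : N => (p, s)) q v : E × E') = (0, v) :=
    congrArg (fun L : E' →L[ℝ] E × E' => L v) (mfderiv_prod_right (I := I) (I' := J))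
  have h4 := mfderiv_comp_apply (I := J) (I' := I.prod J) (I'' := J) (g := Prod.snd) q
    mdifferentiableAt_snd (hf.comp q h1) v
  have h5 : ∀ y : M × N, mfderiv (I.prod J) J Prod.snd y = ContinuousLinearMap.snd ℝ E E' :=
    fun y => mfderiv_snd
  refine Eq.symm (Eq.trans h4 ?_)
  refine Eq.trans (congrArg (fun L : E × E' →L[ℝ] E' => L
    (mfderiv J (I.prod J) (f ∘ fun s : N => (p, s)) q v : E × E')) (h5 _)) ?_
  refine congrArg Prod.snd (Eq.trans h2 ?_)
  exact congrArg (fun w : E × E' => (mfderiv (I.prod J) (I.prod J) f (p, q) w : E × E')) h3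

variable [FiniteDimensional ℝ E] [FiniteDimensional ℝ E']

/-- The first component is constant along the second factor through (p, q), so one off-diagonal
block of the derivative vanishes and only the diagonal blocks contribute. -/
theorem jac_prod_of_lower {f : M × N → M × N} {p : M} {q : N}
    (hf : MDifferentiableAt (I.prod J) (I.prod J) f (p, q)) (h : ∀ s, (f (p, s)).1 = p) :
    jac (I.prod J) f (p, q) =
      jac I (fun s => (f (s, q)).1) p * jac J (fun s => (f (p, s)).2) q := by
  rw [jac, det_prod_of_lower]
  · congr 2
    · ext v
      exact mfderiv_inl_fst hf v
    · ext v
      exact mfderiv_inr_snd hf v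
  · intro w
    refine Eq.trans (mfderiv_inr_fst hf w) ?_
    rw [show (fun s => (f (p, s)).1) = fun _ => p from funext h]
    exact congrArg (fun L : E' →L[ℝ] E => L w) (mfderiv_const (I := J) (I' := I))

theorem jac_prod_of_upper {f : M × N → M × N} {p : M} {q : N}
    (hf : MDifferentiableAt (I.prod J) (I.prod J) f (p, q)) (h : ∀ s, (f (s, q)).2 = q) :
    jac (I.prod J) f (p, q) =
      jac I (fun s => (f (s, q)).1) p * jac J (fun s => (f (p, s)).2) q := by
  rw [jac, det_prod_of_upper]
  · congr 2
    · ext v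
      exact mfderiv_inl_fst hf v
    · ext v
      exact mfderiv_inr_snd hf v
  · intro w
    refine Eq.trans (mfderiv_inl_snd hf w) ?_
    rw [show (fun s => (f (s, q)).2) = fun _ => q from funext h]
    exact congrArg (fun L : E →L[ℝ] E' => L w) (mfderiv_const (I := I) (I' := J))

end Jac

section HalfDensities

variable {κ W V : Type*} [AddCommGroup W] [Module ℝ W] [AddCommGroup V] [Module ℝ V]
  [Fintype κ] [DecidableEq κ]

/-- The half-density on `W` that corresponds to `k |det_Y|^{1/2}` on `V`. -/
def HalfDensity.ofEquiv (e : W ≃ₗ[ℝ] V) (Y : Module.Basis κ ℝ V) (k : ℝ) : HalfDensity κ W where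
  toFun w := k * |Y.det fun i => e (w i)| ^ (1 / 2 : ℝ)
  map_comp T v := by
    rw [DoubleLieGroup.det_conj_apply, abs_mul, Real.mul_rpow (abs_nonneg _) (abs_nonneg _)]
    ring

/-- Half-densities form a line: the endomorphism sending the reference basis to w transports the
value on that basis to the value on w, including when w is degenerate. -/
theorem HalfDensity.eq_ofEquiv (e : W ≃ₗ[ℝ] V) (Y : Module.Basis κ ℝ V) (σ : HalfDensity κ W)
    (w : κ → W) :
    σ.toFun w = σ.toFun (fun i => e.symm (Y i)) * |Y.det fun i => e (w i)| ^ (1 / 2 : ℝ) := by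
  let T : W →ₗ[ℝ] W := (Y.constr ℝ w) ∘ₗ e.toLinearMap
  have hT : ∀ i, T (e.symm (Y i)) = w i := fun i => by simp [T]
  have h1 := σ.map_comp T (fun i => e.symm (Y i))
  have h2 := DoubleLieGroup.det_conj_apply e Y T (fun i => e.symm (Y i))
  simp only [hT, LinearEquiv.apply_symm_apply] at h1 h2
  rw [show (fun i => Y i) = Y from rfl, Y.det_self, mul_one] at h2
  rw [h1, h2, mul_comm]

/-- In coordinates this is the identification of half-densities on an extension with the tensor
product of those on the kernel and on the quotient: the matrix is block triangular when u lies in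
the kernel. -/
theorem det_prod_sumElim {κ' V' : Type*} [AddCommGroup V'] [Module ℝ V'] [Fintype κ']
    [DecidableEq κ'] (Y : Module.Basis κ ℝ V) (Y' : Module.Basis κ' ℝ V') (u : κ → V × V')
    (v : κ' → V × V') (hu : ∀ i, (u i).2 = 0) :
    (Y.prod Y').det (Sum.elim u v) = Y.det (fun i => (u i).1) * Y'.det (fun j => (v j).2) := by
  rw [Module.Basis.det_apply, Module.Basis.det_apply, Module.Basis.det_apply,
    ← Matrix.det_fromBlocks_zero₂₁ _ (Matrix.of fun i j => Y.repr (v j).1 i) _]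
  congr 1
  ext (i | i) (j | j) <;> simp [Module.Basis.toMatrix_apply, hu]

end HalfDensities

end

/-! ### Multiplicativity of the modular functions, and half-densities on the fibered products -/

noncomputable section

section Param

variable {E H : Type*} [NormedAddCommGroup E] [NormedSpace ℝ E]
  [TopologicalSpace H] {I : ModelWithCorners ℝ E H}
  {M : Type*} [TopologicalSpace M] [ChartedSpace H M]
  {E' H' : Type*} [NormedAddCommGroup E'] [NormedSpace ℝ E']
  [TopologicalSpace H'] {J : ModelWithCorners ℝ E' H'} [J.Boundaryless]
  {N : Type*} [TopologicalSpace N] [ChartedSpace H' N] [IsManifold J ∞ N]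

/-- The coordinates on the tangent space of a subset given by a smooth global parametrization. -/
theorem exists_tangentOf_equiv {S : Set M} {Φ : N → M} {r : M → N} (hΦ : ContMDiff J I ∞ Φ)
    (hr : ContMDiff I J ∞ r) (hS : ∀ n, Φ n ∈ S) (hrS : ∀ x ∈ S, Φ (r x) = x)
    (hrΦ : ∀ n, r (Φ n) = n) {n : N} {p : M} (hp : Φ n = p) :
    ∃ e : tangentOf I S p ≃ₗ[ℝ] E', (∀ v, e v = (mfderiv I J r p (v : TangentSpace I p) : E')) ∧
      ∀ v, (mfderiv J I Φ n (e v : TangentSpace J n) : E) = (v : TangentSpace I p) := by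
  subst hp
  let L : TangentSpace I (Φ n) →ₗ[ℝ] E' :=
    (show TangentSpace I (Φ n) →L[ℝ] E' from mfderiv I J r (Φ n)).toLinearMap
  have hL : ∀ w : E', L (mfderiv J I Φ n (w : TangentSpace J n)) = w := fun w =>
    mfderiv_comp_eq_id_of_leftInverse (hΦ.mdifferentiableAt (by simp))
      (hr.mdifferentiableAt (by simp)) hrΦ w
  have hW : ∀ v : TangentSpace I (Φ n), v ∈ tangentOf I S (Φ n) ↔
      ∃ w : TangentSpace J n, (mfderiv J I Φ n w : E) = v :=
    mem_tangentOf_iff hΦ hr hS hrS rfl (hrΦ n)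
  have hinj : Function.Injective (L ∘ₗ (tangentOf I S (Φ n)).subtype) := by
    rintro ⟨v, hv⟩ ⟨v', hv'⟩ h
    obtain ⟨w, rfl⟩ := (hW v).1 hv
    obtain ⟨w', rfl⟩ := (hW v').1 hv'
    have h1 : w = w' := (hL w).symm.trans (Eq.trans h (hL w'))
    subst h1
    rfl
  have hsurj : Function.Surjective (L ∘ₗ (tangentOf I S (Φ n)).subtype) := fun w =>
    ⟨⟨mfderiv J I Φ n (w : TangentSpace J n), (hW _).2 ⟨w, rfl⟩⟩, hL w⟩
  refine ⟨LinearEquiv.ofBijective _ ⟨hinj, hsurj⟩, fun v => rfl, ?_⟩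
  rintro ⟨v, hv⟩
  obtain ⟨w, rfl⟩ := (hW v).1 hv
  exact congrArg (fun w : E' => (mfderiv J I Φ n (w : TangentSpace J n) : E)) (hL w)

end Param

namespace DoubleLieGroup

section Ratio

variable {E H : Type*} [NormedAddCommGroup E] [NormedSpace ℝ E] [FiniteDimensional ℝ E]
  [TopologicalSpace H]
  {EA HA : Type*} [NormedAddCommGroup EA] [NormedSpace ℝ EA] [FiniteDimensional ℝ EA]
  [TopologicalSpace HA]
  {EB HB : Type*} [NormedAddCommGroup EB] [NormedSpace ℝ EB] [FiniteDimensional ℝ EB]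
  [TopologicalSpace HB]
  {I : ModelWithCorners ℝ E H} [I.Boundaryless]
  {JA : ModelWithCorners ℝ EA HA} [JA.Boundaryless]
  {JB : ModelWithCorners ℝ EB HB} [JB.Boundaryless]
  {G A B : Type*} [TopologicalSpace G] [ChartedSpace H G] [Group G] [LieGroup I ∞ G]
  [T2Space G] [SecondCountableTopology G]
  [TopologicalSpace A] [ChartedSpace HA A] [Group A] [LieGroup JA ∞ A]
  [TopologicalSpace B] [ChartedSpace HB B] [Group B] [LieGroup JB ∞ B]
  (𝒟 : DoubleLieGroup I JA JB G A B)

theorem jac_conjB (g : G) : jac JB (𝒟.conjB g) 1 = 𝒟.detB g := by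
  rw [jac, detB]
  have h : (show EB →L[ℝ] EB from mfderiv JB JB (𝒟.conjB g) 1).toLinearMap =
      (𝒟.compB g : EB →ₗ[ℝ] EB) := by
    ext v
    exact 𝒟.mfderiv_conjB g v
  rw [h]
  rfl

/-- Since b_L ignores right factors from A, the map b ↦ b_L(aba⁻¹) is the action of a on B, which
fixes 1. This makes ψ_B multiplicative by the chain rule. -/
theorem jac_act (a : A) : jac JB (𝒟.act a) 1 = 𝒟.psiB a := by
  rw [psiB, ← jac_conjB]
  congr 1
  ext b
  rw [conjB_iA]

theorem jac_conj (b : B) : jac JB (fun b' => b * b' * b⁻¹) 1 = 𝒟.phiB b := by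
  rw [phiB, ← jac_conjB]
  congr 1
  ext b
  rw [conjB_iB]

theorem mdifferentiableAt_act (a : A) (b : B) : MDifferentiableAt JB JB (𝒟.act a) b :=
  (𝒟.contMDiff_act.comp ((contMDiff_const (I := JB) (c := a)).prodMk contMDiff_id)).mdifferentiableAt
    (by simp)

include 𝒟 in
theorem mdifferentiableAt_conj (b b' : B) :
    MDifferentiableAt JB JB (fun b' => b * b' * b⁻¹) b' :=
  (((contMDiff_const (I := JB) (c := b)).mul contMDiff_id).mul contMDiff_const).mdifferentiableAt
    (n := ∞) (by simp)

theorem psiB_mul (a a' : A) : 𝒟.psiB (a * a') = 𝒟.psiB a * 𝒟.psiB a' := by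
  rw [← jac_act, ← jac_act, ← jac_act, ← jac_comp (𝒟.mdifferentiableAt_act a 1)
    (𝒟.mdifferentiableAt_act a' 1) (𝒟.act_one_right a')]
  congr 1
  ext b
  rw [act_mul]

theorem phiB_mul (b b' : B) : 𝒟.phiB (b * b') = 𝒟.phiB b * 𝒟.phiB b' := by
  rw [← jac_conj, ← jac_conj, ← jac_conj, ← jac_comp (𝒟.mdifferentiableAt_conj b 1)
    (𝒟.mdifferentiableAt_conj b' 1) (by simp)]
  congr 1
  ext b
  group

@[simp] theorem phiB_one : 𝒟.phiB 1 = 1 := by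
  rw [← jac_conj]
  simp only [one_mul, inv_one, mul_one]
  rw [jac_id]

theorem phiB_inv (b : B) : 𝒟.phiB b⁻¹ = (𝒟.phiB b)⁻¹ :=
  eq_inv_of_mul_eq_one_left (by rw [← phiB_mul, inv_mul_cancel, phiB_one])

variable {E' H' : Type*} [NormedAddCommGroup E'] [NormedSpace ℝ E'] [FiniteDimensional ℝ E']
  [TopologicalSpace H']
  {EA' HA' : Type*} [NormedAddCommGroup EA'] [NormedSpace ℝ EA'] [FiniteDimensional ℝ EA']
  [TopologicalSpace HA']
  {EB' HB' : Type*} [NormedAddCommGroup EB'] [NormedSpace ℝ EB'] [FiniteDimensional ℝ EB']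
  [TopologicalSpace HB']
  {I' : ModelWithCorners ℝ E' H'} [I'.Boundaryless]
  {JA' : ModelWithCorners ℝ EA' HA'} [JA'.Boundaryless]
  {JB' : ModelWithCorners ℝ EB' HB'} [JB'.Boundaryless]
  {G' A' B' : Type*} [TopologicalSpace G'] [ChartedSpace H' G'] [Group G'] [LieGroup I' ∞ G']
  [T2Space G'] [SecondCountableTopology G']
  [TopologicalSpace A'] [ChartedSpace HA' A'] [Group A'] [LieGroup JA' ∞ A']
  [TopologicalSpace B'] [ChartedSpace HB' B'] [Group B'] [LieGroup JB' ∞ B']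
  (𝒟' : DoubleLieGroup I' JA' JB' G' A' B')
  {ι ι' : Type*} [Fintype ι] [DecidableEq ι] [Fintype ι'] [DecidableEq ι']
  (X : Module.Basis ι ℝ (TangentSpace JB (1 : B)))
  (X' : Module.Basis ι' ℝ (TangentSpace JB' (1 : B')))

/-- Coordinates on the tangent space of a fibration over a right fiber of `G'_{A'}`, and the
extensions of half-densities in these coordinates. -/
theorem exists_equiv_isExtension_iff {x : G} {y : G'} {S : Set (G × G')} {Φ : B × B' → G × G'}
    {r₁ : G → B} {r₂ : G' → B'} (hΦ : ContMDiff (JB.prod JB') (I.prod I') ∞ Φ)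
    (hr₁ : ContMDiff I JB ∞ r₁) (hr₂ : ContMDiff I' JB' ∞ r₂) (hS : ∀ n, Φ n ∈ S)
    (hrS : ∀ p ∈ S, Φ (r₁ p.1, r₂ p.2) = p) (hrΦ : ∀ n, (r₁ (Φ n).1, r₂ (Φ n).2) = n)
    (hΦ1 : Φ (1, 1) = (x, y)) (hΦ2 : ∀ n, (Φ n).2 = 𝒟'.iB n.2 * y)
    (τ : TangentSpace I x →ₗ[ℝ] TangentSpace JB (1 : B))
    (hτ : ∀ ξ : TangentSpace JB (1 : B),
      τ (mfderiv JB I (fun s => (Φ (s, 1)).1) (1 : B) ξ : E) = ξ)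
    (k : ℝ) (α : (ι → TangentSpace I x) → ℝ)
    (hα : ∀ u, α u = k * |X.det fun i => τ (u i)| ^ (1 / 2 : ℝ)) :
    ∃ e : tangentOf (I.prod I') S (x, y) ≃ₗ[ℝ] TangentSpace JB (1 : B) × TangentSpace JB' (1 : B'),
      (∀ (γ : ℝ → G × G') (w : tangentOf (I.prod I') S (x, y)),
        IsCurveIn (I.prod I') S (x, y) γ → velocity (I.prod I') (x, y) γ = w →
        (e w : EB × EB') = velocity (JB.prod JB') ((1, 1) : B × B')
          fun t => (r₁ (γ t).1, r₂ (γ t).2)) ∧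
      ∀ σ : HalfDensity (ι ⊕ ι') (tangentOf (I.prod I') S (x, y)),
        IsExtension I I' σ α (𝒟'.rho0 X' y) ↔
          ∀ w, σ.toFun w = k * |𝒟'.psiB (𝒟'.aL y)| ^ (-(1 / 2) : ℝ) *
            |(X.prod X').det fun i => e (w i)| ^ (1 / 2 : ℝ) := by
  have hr : ContMDiff (I.prod I') (JB.prod JB') ∞ (fun p : G × G' => (r₁ p.1, r₂ p.2)) :=
    (hr₁.comp contMDiff_fst).prodMk (hr₂.comp contMDiff_snd)
  obtain ⟨e, he, he'⟩ := exists_tangentOf_equiv (I := I.prod I') (J := JB.prod JB') hΦ hr hS hrS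
    hrΦ hΦ1
  -- The second component of Φ is a left translate of y by n.2, so in the coordinates e the map dπ₂
  -- is right translation of the second coordinate, and the kernel of dπ₂ is the set where that
  -- coordinate vanishes.
  have hsnd : ∀ w : tangentOf (I.prod I') S (x, y),
      (mfderiv (I.prod I') I' Prod.snd (x, y) (w : TangentSpace (I.prod I') (x, y)) : E') =
        𝒟'.rightVec y (e w).2 := by
    intro w
    have h1 := mfderiv_comp_apply_of_eq (I := JB.prod JB') (I' := I.prod I') (I'' := I')
      (f := Φ) (g := Prod.snd) (x := (1, 1)) (y := (x, y)) mdifferentiableAt_snd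
      (hΦ.mdifferentiableAt (by simp)) hΦ1 (e w : EB × EB')
    have h2 : Prod.snd ∘ Φ = (fun b => 𝒟'.iB b * y) ∘ (Prod.snd : B × B' → B') := funext hΦ2
    rw [h2] at h1
    have h3 := mfderiv_comp_apply (I := JB.prod JB') (I' := JB') (I'' := I')
      (f := (Prod.snd : B × B' → B')) (g := fun b => 𝒟'.iB b * y) (1, 1)
      ((𝒟'.smooth_iB.mul (contMDiff_const (I := JB') (c := y))).mdifferentiableAt (by simp))
      mdifferentiableAt_snd (e w : EB × EB')
    have h4 : (mfderiv (JB.prod JB') JB' Prod.snd ((1, 1) : B × B') (e w : EB × EB') : EB') =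
        (e w).2 := congrArg (fun L : EB × EB' →L[ℝ] EB' => L (e w)) mfderiv_snd
    refine Eq.trans (congrArg (fun v : E × E' =>
      (mfderiv (I.prod I') I' Prod.snd (x, y) v : E')) (he' w).symm) ?_
    refine Eq.trans h1.symm (Eq.trans h3 ?_)
    exact congrArg (fun v : EB' => (mfderiv JB' I' (fun b => 𝒟'.iB b * y) 1 v : E')) h4
  have hfst : ∀ w : tangentOf (I.prod I') S (x, y), (e w).2 = 0 →
      τ (mfderiv (I.prod I') I Prod.fst (x, y) (w : TangentSpace (I.prod I') (x, y)) : E) =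
        (e w).1 := by
    intro w hw
    have h1 := mfderiv_comp_apply_of_eq (I := JB.prod JB') (I' := I.prod I') (I'' := I)
      (f := Φ) (g := Prod.fst) (x := (1, 1)) (y := (x, y)) mdifferentiableAt_fst
      (hΦ.mdifferentiableAt (by simp)) hΦ1 (e w : EB × EB')
    have h5 : MDifferentiableAt JB (JB.prod JB') (fun s : B => (s, (1 : B'))) 1 :=
      mdifferentiableAt_id.prodMk mdifferentiableAt_const
    have h2 := mfderiv_comp_apply (I := JB) (I' := JB.prod JB') (I'' := I)
      (f := fun s : B => (s, (1 : B'))) (g := Prod.fst ∘ Φ) 1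
      (contMDiff_fst.comp hΦ |>.mdifferentiableAt (by simp)) h5 (e w).1
    have h3 : (mfderiv JB (JB.prod JB') (fun s : B => (s, (1 : B'))) 1 (e w).1 : EB × EB') =
        e w := by
      refine Eq.trans (congrArg (fun L : EB →L[ℝ] EB × EB' => L (e w).1)
        (mfderiv_prod_left (I := JB) (I' := JB'))) ?_
      exact Prod.ext rfl hw.symm
    refine Eq.trans ?_ (hτ (e w).1)
    refine congrArg τ ?_
    refine Eq.trans (congrArg (fun v : E × E' =>
      (mfderiv (I.prod I') I Prod.fst (x, y) v : E)) (he' w).symm) ?_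
    refine Eq.trans h1.symm (Eq.trans ?_ h2.symm)
    exact congrArg (fun v : EB × EB' => (mfderiv (JB.prod JB') I (Prod.fst ∘ Φ) (1, 1) v : E))
      h3.symm
  have hker : ∀ w : tangentOf (I.prod I') S (x, y),
      (mfderiv (I.prod I') I' Prod.snd (x, y) (w : TangentSpace (I.prod I') (x, y)) : E') = 0 ↔
        (e w).2 = 0 := by
    intro w
    have h1 := hsnd w
    constructor
    · intro h
      rw [h] at h1
      have h2 := congrArg (fun v : TangentSpace I' y => 𝒟'.trivR y v) h1
      refine (𝒟'.trivR_rightVec y _).symm.trans (h2.symm.trans ?_)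
      exact map_zero (𝒟'.trivR y)
    · intro h
      rw [h] at h1
      refine h1.trans ?_
      exact map_zero (mfderiv JB' I' (fun b => 𝒟'.iB b * y) 1)
  have hext : IsExtension I I' (HalfDensity.ofEquiv e (X.prod X')
      (k * |𝒟'.psiB (𝒟'.aL y)| ^ (-(1 / 2) : ℝ))) α (𝒟'.rho0 X' y) := by
    intro u v hu
    have hu' : ∀ i, (e (u i)).2 = 0 := fun i => (hker _).1 (hu i)
    rw [hα, rho0_eq]
    have h1 : (fun i => e (Sum.elim u v i)) = Sum.elim (fun i => e (u i)) (fun j => e (v j)) := by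
      ext (i | i) <;> rfl
    have h2 := det_prod_sumElim X X' (fun i => e (u i)) (fun j => e (v j)) hu'
    have h3 : ∀ i, τ (mfderiv (I.prod I') I Prod.fst (x, y)
        (u i : TangentSpace (I.prod I') (x, y)) : E) = (e (u i)).1 := fun i => hfst _ (hu' i)
    have h4 : ∀ j, 𝒟'.trivR y (mfderiv (I.prod I') I' Prod.snd (x, y)
        (v j : TangentSpace (I.prod I') (x, y)) : E') = (e (v j)).2 := fun j =>
      (congrArg (fun v : TangentSpace I' y => 𝒟'.trivR y v) (hsnd (v j))).trans
        (𝒟'.trivR_rightVec y _)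
    have h3' := congrArg (fun u : ι → TangentSpace JB (1 : B) => |X.det u| ^ (1 / 2 : ℝ))
      (funext h3)
    have h4' := congrArg (fun u : ι' → TangentSpace JB' (1 : B') => |X'.det u| ^ (1 / 2 : ℝ))
      (funext h4)
    refine Eq.trans ?_ (congrArg₂ (fun s t : ℝ => (k * s) *
      (|𝒟'.psiB (𝒟'.aL y)| ^ (-(1 / 2) : ℝ) * t)) h3'.symm h4'.symm)
    have h5 : |(X.prod X').det fun i => e (Sum.elim u v i)| ^ (1 / 2 : ℝ) =
        |X.det fun i => (e (u i)).1| ^ (1 / 2 : ℝ) *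
          |X'.det fun j => (e (v j)).2| ^ (1 / 2 : ℝ) := by
      rw [h1, ← Real.mul_rpow (abs_nonneg _) (abs_nonneg _), ← abs_mul]
      exact congrArg (fun s : ℝ => |s| ^ (1 / 2 : ℝ)) h2
    change k * _ * |(X.prod X').det fun i => e (Sum.elim u v i)| ^ (1 / 2 : ℝ) = _
    rw [h5]
    ring
  refine ⟨e, ?_, ?_⟩
  · rintro γ w ⟨h0, hγ, -⟩ hw
    have h1 := mfderiv_velocity (I := JB.prod JB') (J := I.prod I') (N := G × G')
      (Φ := fun p : G × G' => (r₁ p.1, r₂ p.2)) (n := (x, y)) hr (γ := γ) h0 hγ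
    refine (he w).trans (Eq.trans ?_ h1.symm)
    exact congrArg (fun v : E × E' => (mfderiv (I.prod I') (JB.prod JB')
      (fun p : G × G' => (r₁ p.1, r₂ p.2)) (x, y) v : EB × EB')) hw.symm
  · intro σ
    constructor
    -- A half-density is determined by its value on one basis. For the basis `X.prod X'` the first
    -- block lies in the kernel of dπ₂, so the extension property prescribes that value, and it
    -- agrees with the explicit half-density of `hext`.
    · intro h w
      rw [HalfDensity.eq_ofEquiv e (X.prod X') σ w]
      congr 1
      have hu : ∀ i, (mfderiv (I.prod I') I' Prod.snd (x, y)
          (e.symm ((X.prod X') (Sum.inl i)) : TangentSpace (I.prod I') (x, y)) : E') = 0 :=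
        fun i => (hker _).2 ((congrArg Prod.snd (e.apply_symm_apply _)).trans
          (by simp : ((X.prod X') (Sum.inl i)).2 = 0))
      have h1 := (h (fun i => e.symm ((X.prod X') (Sum.inl i)))
        (fun j => e.symm ((X.prod X') (Sum.inr j))) hu).trans
        (hext (fun i => e.symm ((X.prod X') (Sum.inl i)))
        (fun j => e.symm ((X.prod X') (Sum.inr j))) hu).symm
      have h2 : Sum.elim (fun i => e.symm ((X.prod X') (Sum.inl i)))
        (fun j => e.symm ((X.prod X') (Sum.inr j))) = fun i => e.symm ((X.prod X') i) := by
        ext (i | i) <;> rfl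
      rw [h2] at h1
      refine h1.trans ?_
      have h3 : (fun i => e (e.symm ((X.prod X') i))) = X.prod X' :=
        funext fun i => e.apply_symm_apply _
      refine (congrArg (fun u : ι ⊕ ι' → TangentSpace JB (1 : B) × TangentSpace JB' (1 : B') =>
        k * |𝒟'.psiB (𝒟'.aL y)| ^ (-(1 / 2) : ℝ) * |(X.prod X').det u| ^ (1 / 2 : ℝ)) h3).trans ?_
      simp only [Module.Basis.det_self, abs_one, Real.one_rpow, mul_one]
    · intro h u v hu
      rw [h]
      exact hext u v hu

end Ratio

end DoubleLieGroup

end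

/-! ### Jacobian of (x, y) ↦ (x, m_δ(x, y)) in coordinates -/

noncomputable section

namespace DoubleLieGroup

section Ratio

variable {E H : Type*} [NormedAddCommGroup E] [NormedSpace ℝ E] [FiniteDimensional ℝ E]
  [TopologicalSpace H]
  {EA HA : Type*} [NormedAddCommGroup EA] [NormedSpace ℝ EA] [FiniteDimensional ℝ EA]
  [TopologicalSpace HA]
  {EB HB : Type*} [NormedAddCommGroup EB] [NormedSpace ℝ EB] [FiniteDimensional ℝ EB]
  [TopologicalSpace HB]
  {I : ModelWithCorners ℝ E H} [I.Boundaryless]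
  {JA : ModelWithCorners ℝ EA HA} [JA.Boundaryless]
  {JB : ModelWithCorners ℝ EB HB} [JB.Boundaryless]
  {G A B : Type*} [TopologicalSpace G] [ChartedSpace H G] [Group G] [LieGroup I ∞ G]
  [T2Space G] [SecondCountableTopology G]
  [TopologicalSpace A] [ChartedSpace HA A] [Group A] [LieGroup JA ∞ A]
  [TopologicalSpace B] [ChartedSpace HB B] [Group B] [LieGroup JB ∞ B]
  (𝒟 : DoubleLieGroup I JA JB G A B)

theorem sq_act (a : A × A) (b : B × B) :
    𝒟.sq.act a b = (𝒟.act a.1 b.1, 𝒟.act a.2 b.2) := by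
  rw [act, sq_bL]
  rfl

theorem sq_psiB (a : A × A) : 𝒟.sq.psiB a = 𝒟.psiB a.1 * 𝒟.psiB a.2 := by
  rw [← jac_act, ← jac_act, ← jac_act]
  have h : 𝒟.sq.act a = fun b => (𝒟.act a.1 b.1, 𝒟.act a.2 b.2) := funext fun b => 𝒟.sq_act a b
  have h1 := 𝒟.sq.mdifferentiableAt_act a 1
  rw [h] at h1 ⊢
  exact jac_prod_of_lower (p := (1 : B)) (q := (1 : B)) h1 fun s => 𝒟.act_one_right _

/-- The action of `δ` on the fibered product, in the coordinates given by `B × (B × B)`. -/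
def ratioMap (x : G) (y : G × G) (n : B × (B × B)) : B × (B × B) :=
  ((𝒟.bR x)⁻¹ * 𝒟.bR (𝒟.iB (n.1 * 𝒟.bL x) *
      𝒟.iA (𝒟.aL (𝒟.iB n.2.1 * y.1) * 𝒟.aL (𝒟.iB n.2.2 * y.2))),
    (n.1 * 𝒟.bL x * n.2.1 * (𝒟.bL x)⁻¹,
      𝒟.bR (𝒟.iB (n.1 * 𝒟.bL x) * 𝒟.iA (𝒟.aL (𝒟.iB n.2.1 * y.1))) * n.2.2 *
        (𝒟.bR (𝒟.iB (𝒟.bL x) * 𝒟.iA (𝒟.aL y.1)))⁻¹))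

/-- The change of coordinates on `B × (B × B)` after which `ratioMap` is block triangular. -/
def ratioCoord (x : G) (y : G × G) (n : B × (B × B)) : B × (B × B) :=
  (n.1, ((𝒟.bL x)⁻¹ * n.1⁻¹ * n.2.1 * 𝒟.bL x,
    (𝒟.bR (𝒟.iB (n.1 * 𝒟.bL x) *
      𝒟.iA (𝒟.aL (𝒟.iB ((𝒟.bL x)⁻¹ * n.1⁻¹ * n.2.1 * 𝒟.bL x) * y.1))))⁻¹ * n.2.2 *
        𝒟.bR (𝒟.iB (𝒟.bL x) * 𝒟.iA (𝒟.aL y.1))))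

theorem contMDiff_ratioMap (x : G) (y : G × G) :
    ContMDiff (JB.prod (JB.prod JB)) (JB.prod (JB.prod JB)) ∞ (𝒟.ratioMap x y) := by
  have hs : ContMDiff (JB.prod (JB.prod JB)) JB ∞ (fun n : B × (B × B) => n.1) := contMDiff_fst
  have hu : ContMDiff (JB.prod (JB.prod JB)) JB ∞ (fun n : B × (B × B) => n.2.1) :=
    contMDiff_fst.comp contMDiff_snd
  have hv : ContMDiff (JB.prod (JB.prod JB)) JB ∞ (fun n : B × (B × B) => n.2.2) :=
    contMDiff_snd.comp contMDiff_snd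
  have hsb := hs.mul (contMDiff_const (c := 𝒟.bL x))
  have h1 := 𝒟.contMDiff_aL.comp ((𝒟.smooth_iB.comp hu).mul (contMDiff_const (c := y.1)))
  have h2 := 𝒟.contMDiff_aL.comp ((𝒟.smooth_iB.comp hv).mul (contMDiff_const (c := y.2)))
  exact (contMDiff_const.mul (𝒟.contMDiff_bR.comp ((𝒟.smooth_iB.comp hsb).mul
    (𝒟.smooth_iA.comp (h1.mul h2))))).prodMk (((hsb.mul hu).mul contMDiff_const).prodMk
    (((𝒟.contMDiff_bR.comp ((𝒟.smooth_iB.comp hsb).mul (𝒟.smooth_iA.comp h1))).mul hv).mul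
      contMDiff_const))

theorem contMDiff_ratioCoord (x : G) (y : G × G) :
    ContMDiff (JB.prod (JB.prod JB)) (JB.prod (JB.prod JB)) ∞ (𝒟.ratioCoord x y) := by
  have hs : ContMDiff (JB.prod (JB.prod JB)) JB ∞ (fun n : B × (B × B) => n.1) := contMDiff_fst
  have hu : ContMDiff (JB.prod (JB.prod JB)) JB ∞ (fun n : B × (B × B) => n.2.1) :=
    contMDiff_fst.comp contMDiff_snd
  have hv : ContMDiff (JB.prod (JB.prod JB)) JB ∞ (fun n : B × (B × B) => n.2.2) :=
    contMDiff_snd.comp contMDiff_snd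
  have hsb := hs.mul (contMDiff_const (c := 𝒟.bL x))
  have hi : ContMDiff JB JB ∞ (fun b : B => b⁻¹) := contMDiff_inv JB ∞
  have hu' := ((contMDiff_const (c := (𝒟.bL x)⁻¹)).mul (hi.comp hs)).mul hu |>.mul
    (contMDiff_const (c := 𝒟.bL x))
  have h1 := 𝒟.contMDiff_aL.comp ((𝒟.smooth_iB.comp hu').mul (contMDiff_const (c := y.1)))
  exact hs.prodMk (hu'.prodMk (((hi.comp (𝒟.contMDiff_bR.comp ((𝒟.smooth_iB.comp hsb).mul
    (𝒟.smooth_iA.comp h1)))).mul hv).mul contMDiff_const))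

/-- The map is triangular with the identity as first component. On the other two coordinates, at n.1
= 1, the diagonal parts are conjugations by b_L(x)⁻¹ and by the inverse of the B-part of
b_L(x)a_L(y₁), hence two factors φ_B⁻¹. -/
theorem jac_ratioCoord (x : G) (y : G × G) :
    jac (JB.prod (JB.prod JB)) (𝒟.ratioCoord x y) ((1, (1, 1)) : B × (B × B)) =
      (𝒟.phiB (𝒟.bL x))⁻¹ * (𝒟.phiB (𝒟.bR (𝒟.iB (𝒟.bL x) * 𝒟.iA (𝒟.aL y.1))))⁻¹ := by
  have hd := 𝒟.contMDiff_ratioCoord x y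
  have hd' : ContMDiff (JB.prod JB) (JB.prod JB) ∞
      (fun s : B × B => (𝒟.ratioCoord x y (1, s)).2) :=
    contMDiff_snd.comp (hd.comp (contMDiff_const.prodMk contMDiff_id))
  rw [jac_prod_of_lower (hd.mdifferentiableAt (by simp)) (fun s => rfl)]
  have h1 : (fun s => (𝒟.ratioCoord x y (s, ((1, 1) : B × B))).1) = fun s => s := rfl
  rw [h1, jac_id, one_mul, jac_prod_of_lower (hd'.mdifferentiableAt (by simp))
    (fun s => by simp [ratioCoord])]
  have h2 : (fun s => (𝒟.ratioCoord x y ((1 : B), (s, (1 : B)))).2.1) =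
      fun s => (𝒟.bL x)⁻¹ * s * (𝒟.bL x)⁻¹⁻¹ := by
    ext s; simp [ratioCoord]
  have h3 : (fun s => (𝒟.ratioCoord x y ((1 : B), ((1 : B), s))).2.2) =
      fun s => (𝒟.bR (𝒟.iB (𝒟.bL x) * 𝒟.iA (𝒟.aL y.1)))⁻¹ * s *
        (𝒟.bR (𝒟.iB (𝒟.bL x) * 𝒟.iA (𝒟.aL y.1)))⁻¹⁻¹ := by
    ext s; simp [ratioCoord]
  rw [h2, h3, 𝒟.jac_conj, 𝒟.jac_conj, phiB_inv, phiB_inv]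

theorem ratioCoord_one (x : G) (y : G × G) : 𝒟.ratioCoord x y (1, (1, 1)) = (1, (1, 1)) := by
  simp [ratioCoord]

theorem ratioMap_ratioCoord_snd (x : G) (y : G × G) (n : B × (B × B)) :
    (𝒟.ratioMap x y (𝒟.ratioCoord x y n)).2 = n.2 := by
  refine Prod.ext ?_ ?_
  · simp [ratioMap, ratioCoord, mul_assoc]
  · simp only [ratioMap, ratioCoord]
    group

/-- Hold z = m_δ(x, y) fixed and move x in its left fiber to xr. The coordinate of xr on the source
side is b_L(xr)b_L(x)⁻¹ and on the target side it is r, so the first component of the composite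
inverts r ↦ b_L(xr)b_L(x)⁻¹. -/
theorem ratioMap_ratioCoord_fst {x : G} {y : G × G} (h : 𝒟.aR x = 𝒟.aL y.1 * 𝒟.aL y.2) (r : B) :
    (𝒟.ratioMap x y (𝒟.ratioCoord x y (𝒟.bL (x * 𝒟.iB r) * (𝒟.bL x)⁻¹, (1, 1)))).1 = r := by
  obtain ⟨h1, h2⟩ := 𝒟.mh_delta_eq_iff.1 ⟨h, 𝒟.mh_delta h⟩
  set b := 𝒟.bL x with hb
  set β := 𝒟.bR (𝒟.iB b * 𝒟.iA (𝒟.aL y.1)) with hβ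
  have hx : x * (𝒟.iA (𝒟.aL y.2))⁻¹ = 𝒟.iB b * 𝒟.iA (𝒟.aL y.1) := by
    rw [mul_inv_eq_iff_eq_mul, mul_assoc, ← map_mul, ← h, bL_mul_aR]
  rw [hx] at h1
  simp only at h1
  set a₁ := 𝒟.aL (𝒟.iB b * y.1) with ha₁
  set a₂ := 𝒟.aL (𝒟.iB β * y.2) with ha₂
  set β₀ := 𝒟.bR x * r with hβ₀
  have hxr : x * 𝒟.iB r = 𝒟.iA a₁ * (𝒟.iA a₂ * 𝒟.iB β₀) := by
    rw [← mul_assoc, ← map_mul, ← h1, hβ₀, map_mul, ← mul_assoc, aL_mul_bR]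
  have hb' : 𝒟.bL (x * 𝒟.iB r) = 𝒟.act a₁ (𝒟.act a₂ β₀) := by
    rw [hxr, bL_iA_mul]; rfl
  rw [hb']
  set β₁ := 𝒟.act a₂ β₀ with hβ₁
  have e1 : 𝒟.aL (𝒟.iB ((𝒟.act a₁ β₁)⁻¹ * b) * y.1) = 𝒟.coact a₁ β₁ := by
    rw [map_mul, map_inv, mul_assoc]
    exact 𝒟.aL_inv_act_mul a₁ β₁ _ ha₁.symm
  have e2 : 𝒟.aL (𝒟.iB (β₁⁻¹ * β) * y.2) = 𝒟.coact a₂ β₀ := by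
    rw [map_mul, map_inv, mul_assoc]
    exact 𝒟.aL_inv_act_mul a₂ β₀ _ ha₂.symm
  have e3 : b⁻¹ * (𝒟.act a₁ β₁ * b⁻¹)⁻¹ * 1 * b = (𝒟.act a₁ β₁)⁻¹ * b := by group
  have e4 : 𝒟.act a₁ β₁ * b⁻¹ * b = 𝒟.act a₁ β₁ := by group
  simp only [ratioMap, ratioCoord, ← hb, ← hβ]
  rw [e3, e4, e1, ← iA_mul_iB, bR_iA_mul_iB, mul_one, e2, map_mul, ← mul_assoc, ← iA_mul_iB,
    mul_assoc, ← iA_mul_iB, bR_iA_mul, bR_iA_mul_iB, hβ₀, inv_mul_cancel_left]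

/-- After `ratioCoord` the map leaves the last two coordinates unchanged, so the determinant of the
composite is that of its first component. That component has the inverse r ↦ b(a_R(x) ▷ r)b⁻¹, b =
b_L(x), with Jacobian φ_B(b)ψ_B(a_R(x)). Dividing by the Jacobian of `ratioCoord` cancels φ_B(b). -/
theorem jac_ratioMap {x : G} {y : G × G} (h : 𝒟.aR x = 𝒟.aL y.1 * 𝒟.aL y.2) :
    jac (JB.prod (JB.prod JB)) (𝒟.ratioMap x y) ((1, (1, 1)) : B × (B × B)) =
      𝒟.phiB (𝒟.bR (x * (𝒟.iA (𝒟.aL y.2))⁻¹)) * (𝒟.psiB (𝒟.aR x))⁻¹ := by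
  have hd := 𝒟.contMDiff_ratioMap x y
  have hd' := 𝒟.contMDiff_ratioCoord x y
  have hx : x * (𝒟.iA (𝒟.aL y.2))⁻¹ = 𝒟.iB (𝒟.bL x) * 𝒟.iA (𝒟.aL y.1) := by
    rw [mul_inv_eq_iff_eq_mul, mul_assoc, ← map_mul, ← h, bL_mul_aR]
  have h1 := jac_comp (p := ((1, (1, 1)) : B × (B × B))) (hd.mdifferentiableAt (by simp))
    (hd'.mdifferentiableAt (by simp)) (𝒟.ratioCoord_one x y)
  have h2 := jac_prod_of_upper (p := (1 : B)) (q := ((1, 1) : B × B))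
    ((hd.comp hd').mdifferentiableAt (by simp)) (fun s => 𝒟.ratioMap_ratioCoord_snd x y (s, (1, 1)))
  have h3 : (fun s : B × B => ((𝒟.ratioMap x y ∘ 𝒟.ratioCoord x y) (1, s)).2) = fun s => s :=
    funext fun s => 𝒟.ratioMap_ratioCoord_snd x y (1, s)
  rw [h3, jac_id, mul_one] at h2
  have hV : ∀ r, 𝒟.bL (x * 𝒟.iB r) * (𝒟.bL x)⁻¹ = 𝒟.bL x * 𝒟.act (𝒟.aR x) r * (𝒟.bL x)⁻¹ := by
    intro r
    conv_lhs => rw [← 𝒟.bL_mul_aR x, mul_assoc, bL_iB_mul, bL_mul_aR]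
    rfl
  have hS : ContMDiff JB JB ∞
      (fun s : B => ((𝒟.ratioMap x y ∘ 𝒟.ratioCoord x y) (s, ((1, 1) : B × B))).1) :=
    contMDiff_fst.comp ((hd.comp hd').comp (contMDiff_id.prodMk contMDiff_const))
  have h4 := jac_comp (p := (1 : B)) (f := fun r => 𝒟.bL x * 𝒟.act (𝒟.aR x) r * (𝒟.bL x)⁻¹)
    (hS.mdifferentiableAt (by simp))
    ((𝒟.mdifferentiableAt_conj (𝒟.bL x) _).comp 1 (𝒟.mdifferentiableAt_act (𝒟.aR x) 1))
    (by simp)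
  have h5 := jac_comp (p := (1 : B)) (𝒟.mdifferentiableAt_conj (𝒟.bL x) 1)
    (𝒟.mdifferentiableAt_act (𝒟.aR x) 1) (by simp)
  simp only [Function.comp_apply, ← hV, 𝒟.ratioMap_ratioCoord_fst h] at h4
  simp only [hV] at h4
  rw [jac_id, h5, 𝒟.jac_conj, 𝒟.jac_act] at h4
  simp only [Function.comp_apply] at h2
  rw [jac_ratioCoord, ← hx] at h1
  have h6 : jac (JB.prod (JB.prod JB)) (fun n => 𝒟.ratioMap x y (𝒟.ratioCoord x y n))
      ((1, (1, 1)) : B × (B × B)) = (𝒟.phiB (𝒟.bL x) * 𝒟.psiB (𝒟.aR x))⁻¹ :=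
    Eq.trans h2 (eq_inv_of_mul_eq_one_left h4.symm)
  rw [h6] at h1
  have n1 := 𝒟.phiB_ne_zero (𝒟.bL x)
  have n2 := 𝒟.phiB_ne_zero (𝒟.bR (x * (𝒟.iA (𝒟.aL y.2))⁻¹))
  have n3 := 𝒟.psiB_ne_zero (𝒟.aR x)
  field_simp at h1 ⊢
  linarith

end Ratio

end DoubleLieGroup

end

/-! ### The density ratio t_δ -/

noncomputable section

namespace DoubleLieGroup

section Ratio

variable {E H : Type*} [NormedAddCommGroup E] [NormedSpace ℝ E] [FiniteDimensional ℝ E]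
  [TopologicalSpace H]
  {EA HA : Type*} [NormedAddCommGroup EA] [NormedSpace ℝ EA] [FiniteDimensional ℝ EA]
  [TopologicalSpace HA]
  {EB HB : Type*} [NormedAddCommGroup EB] [NormedSpace ℝ EB] [FiniteDimensional ℝ EB]
  [TopologicalSpace HB]
  {I : ModelWithCorners ℝ E H} [I.Boundaryless]
  {JA : ModelWithCorners ℝ EA HA} [JA.Boundaryless]
  {JB : ModelWithCorners ℝ EB HB} [JB.Boundaryless]
  {G A B : Type*} [TopologicalSpace G] [ChartedSpace H G] [Group G] [LieGroup I ∞ G]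
  [T2Space G] [SecondCountableTopology G]
  [TopologicalSpace A] [ChartedSpace HA A] [Group A] [LieGroup JA ∞ A]
  [TopologicalSpace B] [ChartedSpace HB B] [Group B] [LieGroup JB ∞ B]
  (𝒟 : DoubleLieGroup I JA JB G A B)

/-- The explicit form of the map `(x, y) ↦ (x, m_δ(x, y))`. -/
def shift (p : G × (G × G)) : G × (G × G) :=
  (p.1, (𝒟.iB (𝒟.bL p.1) * p.2.1, 𝒟.iB (𝒟.bR (p.1 * (𝒟.iA (𝒟.aL p.2.2))⁻¹)) * p.2.2))

theorem contMDiff_shift : ContMDiff (I.prod (I.prod I)) (I.prod (I.prod I)) ∞ 𝒟.shift := by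
  have h1 : ContMDiff (I.prod (I.prod I)) I ∞ (fun p : G × (G × G) => p.1) := contMDiff_fst
  have h2 : ContMDiff (I.prod (I.prod I)) I ∞ (fun p : G × (G × G) => p.2.1) :=
    contMDiff_fst.comp contMDiff_snd
  have h3 : ContMDiff (I.prod (I.prod I)) I ∞ (fun p : G × (G × G) => p.2.2) :=
    contMDiff_snd.comp contMDiff_snd
  have hi : ContMDiff I I ∞ (fun b : G => b⁻¹) := contMDiff_inv I ∞
  exact h1.prodMk (((𝒟.smooth_iB.comp (𝒟.contMDiff_bL.comp h1)).mul h2).prodMk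
    ((𝒟.smooth_iB.comp (𝒟.contMDiff_bR.comp (h1.mul (hi.comp (𝒟.smooth_iA.comp
      (𝒟.contMDiff_aL.comp h3)))))).mul h3))

theorem transl_delta {c : G × G} {p : G × (G × G)}
    (hp : p ∈ 𝒟.fibProd 𝒟.sq 𝒟.delta (𝒟.sq.eR c)) :
    𝒟.sq.transl 𝒟.delta p = 𝒟.shift p :=
  Prod.ext rfl (𝒟.mh_delta (𝒟.mem_fibProd_delta.1 hp).2)

theorem shift_mem {c : G × G} {p : G × (G × G)}
    (hp : p ∈ 𝒟.fibProd 𝒟.sq 𝒟.delta (𝒟.sq.eR c)) :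
    𝒟.shift p ∈ 𝒟.fibStar 𝒟.sq 𝒟.delta (𝒟.sq.eR c) := by
  have h := 𝒟.mem_fibProd_delta.1 hp
  refine 𝒟.mem_fibStar_delta.2 ⟨by simpa [shift] using h.1, ?_⟩
  have h1 := (𝒟.mh_delta_eq_iff.1 ⟨h.2, 𝒟.mh_delta h.2⟩).1
  exact h1

/-- The parametrization of `Γ ×_δ F_r` by `B × (B × B)` around `(x, y)`. -/
def paramProd (x : G) (y : G × G) (n : B × (B × B)) : G × (G × G) :=
  (𝒟.iB (n.1 * 𝒟.bL x) * 𝒟.iA (𝒟.aL (𝒟.iB n.2.1 * y.1) * 𝒟.aL (𝒟.iB n.2.2 * y.2)),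
    𝒟.sq.iB n.2 * y)

/-- The parametrization of `Γ *_δ F_r` by `B × (B × B)` around `(x, z)`. -/
def paramStar (x : G) (z : G × G) (n : B × (B × B)) : G × (G × G) :=
  (𝒟.iA (𝒟.aL (𝒟.iB n.2.1 * z.1) * 𝒟.aL (𝒟.iB n.2.2 * z.2)) * 𝒟.iB (𝒟.bR x * n.1),
    𝒟.sq.iB n.2 * z)

theorem contMDiff_paramProd (x : G) (y : G × G) :
    ContMDiff (JB.prod (JB.prod JB)) (I.prod (I.prod I)) ∞ (𝒟.paramProd x y) := by
  have hs : ContMDiff (JB.prod (JB.prod JB)) JB ∞ (fun n : B × (B × B) => n.1) := contMDiff_fst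
  have hu : ContMDiff (JB.prod (JB.prod JB)) JB ∞ (fun n : B × (B × B) => n.2.1) :=
    contMDiff_fst.comp contMDiff_snd
  have hv : ContMDiff (JB.prod (JB.prod JB)) JB ∞ (fun n : B × (B × B) => n.2.2) :=
    contMDiff_snd.comp contMDiff_snd
  have hsb := hs.mul (contMDiff_const (c := 𝒟.bL x))
  have h1 := (𝒟.smooth_iB.comp hu).mul (contMDiff_const (c := y.1))
  have h2 := (𝒟.smooth_iB.comp hv).mul (contMDiff_const (c := y.2))
  exact ((𝒟.smooth_iB.comp hsb).mul (𝒟.smooth_iA.comp ((𝒟.contMDiff_aL.comp h1).mul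
    (𝒟.contMDiff_aL.comp h2)))).prodMk (h1.prodMk h2)

theorem contMDiff_paramStar (x : G) (y : G × G) :
    ContMDiff (JB.prod (JB.prod JB)) (I.prod (I.prod I)) ∞ (𝒟.paramStar x y) := by
  have hs : ContMDiff (JB.prod (JB.prod JB)) JB ∞ (fun n : B × (B × B) => n.1) := contMDiff_fst
  have hu : ContMDiff (JB.prod (JB.prod JB)) JB ∞ (fun n : B × (B × B) => n.2.1) :=
    contMDiff_fst.comp contMDiff_snd
  have hv : ContMDiff (JB.prod (JB.prod JB)) JB ∞ (fun n : B × (B × B) => n.2.2) :=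
    contMDiff_snd.comp contMDiff_snd
  have hsb := (contMDiff_const (c := 𝒟.bR x)).mul hs
  have h1 := (𝒟.smooth_iB.comp hu).mul (contMDiff_const (c := y.1))
  have h2 := (𝒟.smooth_iB.comp hv).mul (contMDiff_const (c := y.2))
  exact ((𝒟.smooth_iA.comp ((𝒟.contMDiff_aL.comp h1).mul
    (𝒟.contMDiff_aL.comp h2))).mul (𝒟.smooth_iB.comp hsb)).prodMk (h1.prodMk h2)

variable {ι : Type*} [Fintype ι] [DecidableEq ι]
  (X : Module.Basis ι ℝ (TangentSpace JB (1 : B)))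

theorem exists_equiv_fibProd {x : G} {y : G × G} (h : 𝒟.aR x = 𝒟.aL y.1 * 𝒟.aL y.2) :
    ∃ e : tangentOf (I.prod (I.prod I)) (𝒟.fibProd 𝒟.sq 𝒟.delta (𝒟.sq.eR y)) (x, y) ≃ₗ[ℝ]
        TangentSpace JB (1 : B) × TangentSpace (JB.prod JB) (1 : B × B),
      (∀ (γ : ℝ → G × (G × G)) (w : tangentOf (I.prod (I.prod I)) _ (x, y)),
        IsCurveIn (I.prod (I.prod I)) (𝒟.fibProd 𝒟.sq 𝒟.delta (𝒟.sq.eR y)) (x, y) γ →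
        velocity (I.prod (I.prod I)) (x, y) γ = w →
        (e w : EB × (EB × EB)) = velocity (JB.prod (JB.prod JB)) ((1, 1) : B × (B × B))
          fun t => (𝒟.bL (γ t).1 * (𝒟.bL x)⁻¹, 𝒟.sq.bL (γ t).2 * (𝒟.sq.bL y)⁻¹)) ∧
      ∀ σ : HalfDensity (ι ⊕ (ι ⊕ ι)) (tangentOf (I.prod (I.prod I)) _ (x, y)),
        IsExtension I (I.prod I) σ (𝒟.rho0 X x) (𝒟.sq.rho0 (sqBasis X) y) ↔
          ∀ w, σ.toFun w = |𝒟.psiB (𝒟.aL x)| ^ (-(1 / 2) : ℝ) *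
            |𝒟.sq.psiB (𝒟.sq.aL y)| ^ (-(1 / 2) : ℝ) *
            |(X.prod (sqBasis X)).det fun i => e (w i)| ^ (1 / 2 : ℝ) := by
  refine exists_equiv_isExtension_iff 𝒟.sq X (sqBasis X) (Φ := 𝒟.paramProd x y)
    (r₁ := fun x' => 𝒟.bL x' * (𝒟.bL x)⁻¹) (r₂ := fun y' => 𝒟.sq.bL y' * (𝒟.sq.bL y)⁻¹)
    (𝒟.contMDiff_paramProd x y) (𝒟.contMDiff_bL.mul contMDiff_const)
    (𝒟.sq.contMDiff_bL.mul contMDiff_const) ?_ ?_ ?_ ?_ (fun n => rfl) (𝒟.trivR x) ?_ _ _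
    (𝒟.rho0_eq X x)
  · intro n
    exact 𝒟.mem_fibProd_delta.2 ⟨by simp [paramProd, sq_iB], 𝒟.aR_iB_mul_iA _ _⟩
  · rintro ⟨x', y'₁, y'₂⟩ hp
    obtain ⟨⟨h1, h2⟩, h3⟩ := 𝒟.mem_fibProd_delta.1 hp
    simp only at h1 h2 h3
    have e1 : 𝒟.iB (𝒟.bL y'₁ * (𝒟.bL y.1)⁻¹) * y.1 = y'₁ := by
      rw [map_mul, map_inv, mul_assoc, ← iA_aR, ← h1, bL_mul_aR]
    have e2 : 𝒟.iB (𝒟.bL y'₂ * (𝒟.bL y.2)⁻¹) * y.2 = y'₂ := by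
      rw [map_mul, map_inv, mul_assoc, ← iA_aR, ← h2, bL_mul_aR]
    refine Prod.ext ?_ (Prod.ext ?_ ?_)
    · simp only [paramProd, sq_bL, Prod.fst_mul, Prod.snd_mul, Prod.fst_inv, Prod.snd_inv, e1, e2,
        inv_mul_cancel_right]
      rw [← h3, bL_mul_aR]
    · simpa [paramProd, sq_bL, sq_iB, mul_assoc] using e1
    · simpa [paramProd, sq_bL, sq_iB, mul_assoc] using e2
  · intro n
    refine Prod.ext ?_ ?_
    · simp only [paramProd, bL_iB_mul_iA, mul_inv_cancel_right]
    · simp [paramProd]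
  · refine Prod.ext ?_ ?_
    · simp only [paramProd, Prod.fst_one, Prod.snd_one, map_one, one_mul, ← h, bL_mul_aR]
    · simp [paramProd]
  · intro ξ
    have h1 : (fun s => (𝒟.paramProd x y (s, 1)).1) = fun s => 𝒟.iB s * x := by
      ext s
      simp only [paramProd, Prod.fst_one, Prod.snd_one, map_one, one_mul, ← h]
      rw [map_mul, mul_assoc, bL_mul_aR]
    rw [h1]
    exact 𝒟.trivR_rightVec x ξ

/-- For fixed z the point x now runs in a left fiber, so its coordinate is a right translation by B
and carries λ₀. In `exists_equiv_fibProd`, for fixed y, it runs in a right fiber, its coordinate is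
a left translation, and it carries ρ₀ with its ψ_B-weight. -/
theorem exists_equiv_fibStar {x : G} {z c : G × G} (hc1 : 𝒟.aR z.1 = 𝒟.aR c.1)
    (hc2 : 𝒟.aR z.2 = 𝒟.aR c.2) (h : 𝒟.aL x = 𝒟.aL z.1 * 𝒟.aL z.2) :
    ∃ e : tangentOf (I.prod (I.prod I)) (𝒟.fibStar 𝒟.sq 𝒟.delta (𝒟.sq.eR c)) (x, z) ≃ₗ[ℝ]
        TangentSpace JB (1 : B) × TangentSpace (JB.prod JB) (1 : B × B),
      (∀ (γ : ℝ → G × (G × G)) (w : tangentOf (I.prod (I.prod I)) _ (x, z)),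
        IsCurveIn (I.prod (I.prod I)) (𝒟.fibStar 𝒟.sq 𝒟.delta (𝒟.sq.eR c)) (x, z) γ →
        velocity (I.prod (I.prod I)) (x, z) γ = w →
        (e w : EB × (EB × EB)) = velocity (JB.prod (JB.prod JB)) ((1, 1) : B × (B × B))
          fun t => ((𝒟.bR x)⁻¹ * 𝒟.bR (γ t).1, 𝒟.sq.bL (γ t).2 * (𝒟.sq.bL z)⁻¹)) ∧
      ∀ σ : HalfDensity (ι ⊕ (ι ⊕ ι)) (tangentOf (I.prod (I.prod I)) _ (x, z)),
        IsExtension I (I.prod I) σ (𝒟.lambda0 X x) (𝒟.sq.rho0 (sqBasis X) z) ↔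
          ∀ w, σ.toFun w = 1 * |𝒟.sq.psiB (𝒟.sq.aL z)| ^ (-(1 / 2) : ℝ) *
            |(X.prod (sqBasis X)).det fun i => e (w i)| ^ (1 / 2 : ℝ) := by
  refine exists_equiv_isExtension_iff 𝒟.sq X (sqBasis X) (Φ := 𝒟.paramStar x z)
    (r₁ := fun x' => (𝒟.bR x)⁻¹ * 𝒟.bR x') (r₂ := fun y' => 𝒟.sq.bL y' * (𝒟.sq.bL z)⁻¹)
    (𝒟.contMDiff_paramStar x z) (contMDiff_const.mul 𝒟.contMDiff_bR)
    (𝒟.sq.contMDiff_bL.mul contMDiff_const) ?_ ?_ ?_ ?_ (fun n => rfl) (𝒟.trivL x) ?_ _ _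
    (fun u => (𝒟.lambda0_eq X x u).trans (one_mul _).symm)
  · intro n
    exact 𝒟.mem_fibStar_delta.2 ⟨by simp [paramStar, sq_iB, hc1, hc2], 𝒟.aL_iA_mul_iB _ _⟩
  · rintro ⟨x', y'₁, y'₂⟩ hp
    obtain ⟨⟨h1, h2⟩, h3⟩ := 𝒟.mem_fibStar_delta.1 hp
    simp only at h1 h2 h3
    have e1 : 𝒟.iB (𝒟.bL y'₁ * (𝒟.bL z.1)⁻¹) * z.1 = y'₁ := by
      rw [map_mul, map_inv, mul_assoc, ← iA_aR, hc1, ← h1, bL_mul_aR]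
    have e2 : 𝒟.iB (𝒟.bL y'₂ * (𝒟.bL z.2)⁻¹) * z.2 = y'₂ := by
      rw [map_mul, map_inv, mul_assoc, ← iA_aR, hc2, ← h2, bL_mul_aR]
    refine Prod.ext ?_ (Prod.ext ?_ ?_)
    · simp only [paramStar, sq_bL, Prod.fst_mul, Prod.snd_mul, Prod.fst_inv, Prod.snd_inv, e1, e2,
        mul_inv_cancel_left]
      rw [← h3, aL_mul_bR]
    · simpa [paramStar, sq_bL, sq_iB, mul_assoc] using e1
    · simpa [paramStar, sq_bL, sq_iB, mul_assoc] using e2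
  · intro n
    refine Prod.ext ?_ ?_
    · simp only [paramStar, bR_iA_mul_iB, inv_mul_cancel_left]
    · simp [paramStar]
  · refine Prod.ext ?_ ?_
    · simp only [paramStar, Prod.fst_one, Prod.snd_one, map_one, one_mul, mul_one, ← h, aL_mul_bR]
    · simp [paramStar]
  · intro ξ
    have h1 : (fun s => (𝒟.paramStar x z (s, 1)).1) = fun s => x * 𝒟.iB s := by
      ext s
      simp only [paramStar, Prod.fst_one, Prod.snd_one, map_one, one_mul, ← h]
      rw [map_mul, ← mul_assoc, aL_mul_bR]
    rw [h1]
    exact 𝒟.trivL_leftVec x ξ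

/-- The density ratio `t_δ`. -/
theorem densityRatio_delta {x : G} {y : G × G} (h : 𝒟.aR x = 𝒟.aL y.1 * 𝒟.aL y.2) :
    𝒟.densityRatio 𝒟.sq 𝒟.delta X (sqBasis X) x y =
      |𝒟.phiB (𝒟.bR (x * (𝒟.iA (𝒟.aL y.2))⁻¹))| ^ (-(1 / 2) : ℝ) := by
  have hm := 𝒟.mh_delta h
  set z := 𝒟.sq.mh 𝒟.delta x y with hz
  have hz1 : 𝒟.aR z.1 = 𝒟.aR y.1 := by simp [hm]
  have hz2 : 𝒟.aR z.2 = 𝒟.aR y.2 := by simp [hm]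
  have hz3 : 𝒟.aL x = 𝒟.aL z.1 * 𝒟.aL z.2 := (𝒟.mh_delta_eq_iff.1 ⟨h, hz.symm⟩).1
  obtain ⟨e, he, hσ⟩ := 𝒟.exists_equiv_fibProd X h
  obtain ⟨e', he', hσ'⟩ := 𝒟.exists_equiv_fibStar X (c := y) hz1 hz2 hz3
  set D : EB × (EB × EB) →L[ℝ] EB × (EB × EB) :=
    mfderiv (JB.prod (JB.prod JB)) (JB.prod (JB.prod JB)) (𝒟.ratioMap x y)
      ((1, (1, 1)) : B × (B × B)) with hD
  have hxy : (x, y) ∈ 𝒟.fibProd 𝒟.sq 𝒟.delta (𝒟.sq.eR y) :=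
    𝒟.mem_fibProd_delta.2 ⟨⟨rfl, rfl⟩, h⟩
  have hsh : 𝒟.shift (x, y) = (x, z) := (𝒟.transl_delta hxy).symm
  -- coordinates of the image vectors
  have hcoord : ∀ p ∈ 𝒟.fibProd 𝒟.sq 𝒟.delta (𝒟.sq.eR y),
      ((𝒟.bR x)⁻¹ * 𝒟.bR (𝒟.shift p).1, 𝒟.sq.bL (𝒟.shift p).2 * (𝒟.sq.bL z)⁻¹) =
        𝒟.ratioMap x y (𝒟.bL p.1 * (𝒟.bL x)⁻¹, 𝒟.sq.bL p.2 * (𝒟.sq.bL y)⁻¹) := by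
    rintro ⟨x', y'₁, y'₂⟩ hp
    obtain ⟨⟨h1, h2⟩, h3⟩ := 𝒟.mem_fibProd_delta.1 hp
    simp only at h1 h2 h3
    have e1 : 𝒟.iB (𝒟.bL y'₁ * (𝒟.bL y.1)⁻¹) * y.1 = y'₁ := by
      rw [map_mul, map_inv, mul_assoc, ← iA_aR, ← h1, bL_mul_aR]
    have e2 : 𝒟.iB (𝒟.bL y'₂ * (𝒟.bL y.2)⁻¹) * y.2 = y'₂ := by
      rw [map_mul, map_inv, mul_assoc, ← iA_aR, ← h2, bL_mul_aR]
    have hx : x * (𝒟.iA (𝒟.aL y.2))⁻¹ = 𝒟.iB (𝒟.bL x) * 𝒟.iA (𝒟.aL y.1) := by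
      rw [mul_inv_eq_iff_eq_mul, mul_assoc, ← map_mul, ← h, bL_mul_aR]
    have hx' : x' * (𝒟.iA (𝒟.aL y'₂))⁻¹ = 𝒟.iB (𝒟.bL x') * 𝒟.iA (𝒟.aL y'₁) := by
      rw [mul_inv_eq_iff_eq_mul, mul_assoc, ← map_mul, ← h3, bL_mul_aR]
    rw [hm, hx]
    simp only [ratioMap, shift, sq_bL, Prod.fst_mul, Prod.snd_mul, Prod.fst_inv, Prod.snd_inv, e1,
      e2, inv_mul_cancel_right, hx', bL_iB_mul]
    rw [← h3, bL_mul_aR]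
    refine Prod.ext rfl (Prod.ext ?_ ?_)
    · simp [mul_assoc]
    · simp [mul_assoc]
  have himg : ∀ γ, IsCurveIn (I.prod (I.prod I)) (𝒟.fibProd 𝒟.sq 𝒟.delta (𝒟.sq.eR y)) (x, y) γ →
      IsCurveIn (I.prod (I.prod I)) (𝒟.fibStar 𝒟.sq 𝒟.delta (𝒟.sq.eR y)) (x, z)
        (fun s => 𝒟.sq.transl 𝒟.delta (γ s)) := by
    rintro γ ⟨h0, hγ, hev⟩
    have h1 : (fun s => 𝒟.sq.transl 𝒟.delta (γ s)) =ᶠ[𝓝 0] fun s => 𝒟.shift (γ s) :=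
      hev.mono fun s hs => 𝒟.transl_delta hs
    refine ⟨?_, ?_, ?_⟩
    · change 𝒟.sq.transl 𝒟.delta (γ 0) = _
      rw [h0]
      rfl
    · exact ((𝒟.contMDiff_shift (γ 0)).comp 0 hγ).congr_of_eventuallyEq h1
    · filter_upwards [hev, h1] with s hs hs1
      rw [hs1]
      exact 𝒟.shift_mem hs
  have himgv : ∀ γ w w',
      IsCurveIn (I.prod (I.prod I)) (𝒟.fibProd 𝒟.sq 𝒟.delta (𝒟.sq.eR y)) (x, y) γ →
      velocity (I.prod (I.prod I)) (x, y) γ =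
        (w : tangentOf (I.prod (I.prod I)) (𝒟.fibProd 𝒟.sq 𝒟.delta (𝒟.sq.eR y)) (x, y)) →
      velocity (I.prod (I.prod I)) (x, z) (fun s => 𝒟.sq.transl 𝒟.delta (γ s)) =
        (w' : tangentOf (I.prod (I.prod I)) (𝒟.fibStar 𝒟.sq 𝒟.delta (𝒟.sq.eR y)) (x, z)) →
      (e' w' : EB × (EB × EB)) = D (e w) := by
    intro γ w w' hγ hw hw'
    refine (he' _ w' (himg γ hγ) hw').trans ?_
    have h1 : (fun t => ((𝒟.bR x)⁻¹ * 𝒟.bR (𝒟.sq.transl 𝒟.delta (γ t)).1,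
        𝒟.sq.bL (𝒟.sq.transl 𝒟.delta (γ t)).2 * (𝒟.sq.bL z)⁻¹)) =ᶠ[𝓝 (0 : ℝ)] fun t =>
        𝒟.ratioMap x y (𝒟.bL (γ t).1 * (𝒟.bL x)⁻¹, 𝒟.sq.bL (γ t).2 * (𝒟.sq.bL y)⁻¹) := by
      filter_upwards [hγ.2.2] with t ht
      rw [𝒟.transl_delta ht]
      exact hcoord _ ht
    have h2 := h1.mfderiv_eq (I := 𝓘(ℝ, ℝ)) (I' := JB.prod (JB.prod JB))
    have hr : ContMDiff (I.prod (I.prod I)) (JB.prod (JB.prod JB)) ∞ (fun p : G × (G × G) =>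
        (𝒟.bL p.1 * (𝒟.bL x)⁻¹, 𝒟.sq.bL p.2 * (𝒟.sq.bL y)⁻¹)) :=
      ((𝒟.contMDiff_bL.mul contMDiff_const).comp contMDiff_fst).prodMk
        ((𝒟.sq.contMDiff_bL.mul contMDiff_const).comp contMDiff_snd)
    have h3 := mfderiv_velocity (I := JB.prod (JB.prod JB)) (J := JB.prod (JB.prod JB))
      (n := ((1, (1, 1)) : B × (B × B))) (𝒟.contMDiff_ratioMap x y)
      (γ := fun t => (𝒟.bL (γ t).1 * (𝒟.bL x)⁻¹, 𝒟.sq.bL (γ t).2 * (𝒟.sq.bL y)⁻¹))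
      (by simp only [hγ.1, mul_inv_cancel]; rfl) ((hr _).comp 0 hγ.2.1)
    refine Eq.trans (congrArg (fun L : ℝ →L[ℝ] EB × (EB × EB) => L 1) h2) (h3.trans ?_)
    exact congrArg D (he γ w hγ hw).symm
  -- existence of frames consisting of velocities of curves
  have hex : ∀ v : EB × (EB × EB), ∃ γ, IsCurveIn (I.prod (I.prod I))
      (𝒟.fibProd 𝒟.sq 𝒟.delta (𝒟.sq.eR y)) (x, y) γ ∧
      ∃ w : tangentOf (I.prod (I.prod I)) (𝒟.fibProd 𝒟.sq 𝒟.delta (𝒟.sq.eR y)) (x, y),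
        velocity (I.prod (I.prod I)) (x, y) γ = w ∧ (e w : EB × (EB × EB)) = v := by
    intro v
    obtain ⟨c, ⟨hc0, hc, -⟩, hcv⟩ := exists_curve_velocity (J := JB.prod (JB.prod JB))
      ((1, (1, 1)) : B × (B × B)) v
    have hγ : IsCurveIn (I.prod (I.prod I)) (𝒟.fibProd 𝒟.sq 𝒟.delta (𝒟.sq.eR y)) (x, y)
        (fun t => 𝒟.paramProd x y (c t)) := by
      refine ⟨?_, ((𝒟.contMDiff_paramProd x y) _).comp 0 hc, Eventually.of_forall fun t =>
        𝒟.mem_fibProd_delta.2 ⟨by simp [paramProd, sq_iB], 𝒟.aR_iB_mul_iA _ _⟩⟩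
      simp only [hc0]
      refine Prod.ext ?_ ?_
      · simp only [paramProd, map_one, one_mul, ← h, bL_mul_aR]
      · change (𝒟.sq.iB 1) * y = y
        rw [map_one, one_mul]
    refine ⟨_, hγ, ⟨_, Submodule.subset_span ⟨_, hγ, rfl⟩⟩, rfl, ?_⟩
    refine (he _ _ hγ rfl).trans ?_
    have h1 : (fun t => (𝒟.bL (𝒟.paramProd x y (c t)).1 * (𝒟.bL x)⁻¹,
        𝒟.sq.bL (𝒟.paramProd x y (c t)).2 * (𝒟.sq.bL y)⁻¹)) = c := by
      ext t : 1
      refine Prod.ext ?_ ?_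
      · simp only [paramProd, bL_iB_mul_iA, mul_inv_cancel_right]
      · simp [paramProd]
    rw [h1]
    exact hcv
  have hdet : ∀ (w : ι ⊕ (ι ⊕ ι) →
        tangentOf (I.prod (I.prod I)) (𝒟.fibProd 𝒟.sq 𝒟.delta (𝒟.sq.eR y)) (x, y))
      (w' : ι ⊕ (ι ⊕ ι) →
        tangentOf (I.prod (I.prod I)) (𝒟.fibStar 𝒟.sq 𝒟.delta (𝒟.sq.eR y)) (x, z)),
      (∀ k, (e' (w' k) : EB × (EB × EB)) = D (e (w k))) →
      |(X.prod (sqBasis X)).det fun i => e' (w' i)| ^ (1 / 2 : ℝ) =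
        |jac (JB.prod (JB.prod JB)) (𝒟.ratioMap x y) ((1, (1, 1)) : B × (B × B))| ^ (1 / 2 : ℝ) *
          |(X.prod (sqBasis X)).det fun i => e (w i)| ^ (1 / 2 : ℝ) := by
    intro w w' hw
    let Y : Module.Basis (ι ⊕ (ι ⊕ ι)) ℝ (EB × (EB × EB)) := X.prod (sqBasis X)
    have h1 := Y.det_comp D.toLinearMap (fun i => e (w i))
    have h2 : ⇑D.toLinearMap ∘ (fun i => (e (w i) : EB × (EB × EB))) = fun i => e' (w' i) :=
      funext fun i => (hw i).symm
    rw [h2] at h1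
    rw [← Real.mul_rpow (abs_nonneg _) (abs_nonneg _), ← abs_mul]
    exact congrArg (fun s : ℝ => |s| ^ (1 / 2 : ℝ)) h1
  set K := |𝒟.psiB (𝒟.aL x)| ^ (-(1 / 2) : ℝ) * |𝒟.sq.psiB (𝒟.sq.aL y)| ^ (-(1 / 2) : ℝ) with hK
  set K' := 1 * |𝒟.sq.psiB (𝒟.sq.aL z)| ^ (-(1 / 2) : ℝ) with hK'
  set j := |jac (JB.prod (JB.prod JB)) (𝒟.ratioMap x y) ((1, (1, 1)) : B × (B × B))| ^ (1 / 2 : ℝ)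
    with hj
  -- Both extensions are explicit multiples K and K' of |det|^{1/2}, and the coordinates of w and w'
  -- differ by the derivative of `ratioMap`. The condition on all frames is thus one scalar
  -- equation, tested on a frame of velocities with determinant 1.
  have hratio : ∀ t, 𝒟.IsDensityRatio 𝒟.sq 𝒟.delta X (sqBasis X) x y t ↔ K = t * (K' * j) := by
    intro t
    constructor
    · intro ht
      let Y : Module.Basis (ι ⊕ (ι ⊕ ι)) ℝ (EB × (EB × EB)) := X.prod (sqBasis X)
      choose γ hγ w hw hew using fun k => hex (Y k)
      have h1 := ht (HalfDensity.ofEquiv e (X.prod (sqBasis X)) K)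
        (HalfDensity.ofEquiv e' (X.prod (sqBasis X)) K') ((hσ _).2 fun w => rfl)
        ((hσ' _).2 fun w => rfl) γ w
        (fun k => ⟨_, Submodule.subset_span ⟨_, himg _ (hγ k), rfl⟩⟩) hγ hw (fun k => rfl)
      have h2 := hdet w _ (fun k => himgv (γ k) (w k)
        ⟨_, Submodule.subset_span ⟨_, himg _ (hγ k), rfl⟩⟩ (hγ k) (hw k) rfl)
      have h3 : |(X.prod (sqBasis X)).det fun i => e (w i)| ^ (1 / 2 : ℝ) = 1 := by
        have h4 : (fun i => (e (w i) : EB × (EB × EB))) = Y := funext hew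
        have h5 : Y.det (fun i => e (w i)) = 1 := by rw [h4, Y.det_self]
        refine (congrArg (fun s : ℝ => |s| ^ (1 / 2 : ℝ)) h5).trans ?_
        simp
      change K * _ = t * (K' * _) at h1
      rw [h2, h3] at h1
      linarith
    · intro ht σ σ' h1 h2 γ w w' hγ hw hw'
      rw [(hσ σ).1 h1, (hσ' σ').1 h2,
        hdet w w' (fun k => himgv (γ k) (w k) (w' k) (hγ k) (hw k) (hw' k)), ht]
      ring
  -- Because a_L(y₁)a_L(y₂) = a_R(x) and a_L(z₁)a_L(z₂) = a_L(x), multiplicativity of ψ_B cancels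
  -- every ψ_B-factor against the denominator of the Jacobian; only φ_B remains.
  have hval : K = |𝒟.phiB (𝒟.bR (x * (𝒟.iA (𝒟.aL y.2))⁻¹))| ^ (-(1 / 2) : ℝ) * (K' * j) := by
    rw [hK, hK', hj, 𝒟.jac_ratioMap h, sq_psiB, sq_psiB, sq_aL, sq_aL]
    simp only
    rw [← psiB_mul, ← psiB_mul, ← hz3, ← h, abs_mul, abs_inv, one_mul,
      Real.mul_rpow (abs_nonneg _) (by positivity), Real.inv_rpow (abs_nonneg _),
      Real.rpow_neg (abs_nonneg _), Real.rpow_neg (abs_nonneg _), Real.rpow_neg (abs_nonneg _)]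
    have hpos : 0 < |𝒟.phiB (𝒟.bR (x * (𝒟.iA (𝒟.aL y.2))⁻¹))| ^ (1 / 2 : ℝ) :=
      Real.rpow_pos_of_pos (abs_pos.2 (𝒟.phiB_ne_zero _)) _
    field_simp
  have hpos : 0 < K' * j := by
    have h1 : ∀ s : ℝ, s ≠ 0 → ∀ r : ℝ, 0 < |s| ^ r := fun s hs r =>
      Real.rpow_pos_of_pos (abs_pos.2 hs) r
    refine mul_pos (mul_pos one_pos (h1 _ (𝒟.sq.psiB_ne_zero _) _)) (h1 _ ?_ _)
    rw [𝒟.jac_ratioMap h]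
    exact mul_ne_zero (𝒟.phiB_ne_zero _) (inv_ne_zero (𝒟.psiB_ne_zero _))
  -- The scalar equation has a solution, so the chosen number solves it, and it is the only solution
  -- since K'j > 0.
  have h1 := (hratio _).1 (Classical.epsilon_spec ⟨_, (hratio _).2 hval⟩)
  exact mul_right_cancel₀ hpos.ne' (h1.symm.trans hval)

end Ratio

end DoubleLieGroup

end

/-! ### Left Haar density in a chart at the identity -/

noncomputable section

section HaarJacobian

variable {E H : Type*} [NormedAddCommGroup E] [NormedSpace ℝ E] [FiniteDimensional ℝ E]
  [TopologicalSpace H] {J : ModelWithCorners ℝ E H} [J.Boundaryless]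
  {K : Type*} [TopologicalSpace K] [ChartedSpace H K] [Group K] [LieGroup J ∞ K]

variable (J) in
/-- The map `T` in the preferred chart at `1`. -/
def inChartOne (T : K → K) (v : E) : E :=
  extChartAt J (1 : K) (T ((extChartAt J (1 : K)).symm v))

variable (J) in
/-- The derivative of `x ↦ b x` at `1`, in the preferred chart at `1`. -/
def leftFrame (b : K) : E →L[ℝ] E :=
  fderiv ℝ (inChartOne J fun x => b * x) (extChartAt J (1 : K) 1)

theorem contDiffAt_inChartOne {T : K → K} {b : K} (hT : ContMDiffAt J J ∞ T b)
    (hb : b ∈ (extChartAt J (1 : K)).source) (hTb : T b ∈ (extChartAt J (1 : K)).source) :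
    ContDiffAt ℝ ∞ (inChartOne J T) (extChartAt J (1 : K) b) := by
  rw [← contMDiffAt_iff_contDiffAt]
  have h1 : ContMDiffAt 𝓘(ℝ, E) J ∞ (extChartAt J (1 : K)).symm (extChartAt J (1 : K) b) :=
    (contMDiffOn_extChartAt_symm (I := J) (n := ∞) (1 : K)).contMDiffAt
      (extChartAt_target_mem_nhds' ((extChartAt J (1 : K)).map_source hb))
  have hs : (extChartAt J (1 : K)).symm (extChartAt J (1 : K) b) = b :=
    (extChartAt J (1 : K)).left_inv hb
  have h2 : ContMDiffAt J 𝓘(ℝ, E) ∞ (extChartAt J (1 : K)) (T b) :=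
    contMDiffAt_extChartAt' (by simpa using hTb)
  rw [← hs] at hT h2
  exact (h2.comp _ hT).comp _ h1

theorem hasFDerivAt_inChartOne {T : K → K} {b : K} (hT : ContMDiffAt J J ∞ T b)
    (hb : b ∈ (extChartAt J (1 : K)).source) (hTb : T b ∈ (extChartAt J (1 : K)).source) :
    HasFDerivAt (inChartOne J T) (fderiv ℝ (inChartOne J T) (extChartAt J (1 : K) b))
      (extChartAt J (1 : K) b) :=
  ((contDiffAt_inChartOne hT hb hTb).differentiableAt (by simp)).hasFDerivAt

theorem det_fderiv_inChartOne {τ : K → K} (h1 : τ 1 = 1) :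
    (fderiv ℝ (inChartOne J τ) (extChartAt J (1 : K) 1)).det = jac J τ 1 ∨
      ¬ MDifferentiableAt J J τ 1 := by
  by_cases hd : MDifferentiableAt J J τ 1
  · left
    have h2 : (mfderiv J J τ 1 : E →L[ℝ] E) = fderiv ℝ (inChartOne J τ) (extChartAt J (1 : K) 1) := by
      rw [hd.mfderiv, J.range_eq_univ, fderivWithin_univ]
      congr 1
      ext v
      simp only [writtenInExtChartAt, Function.comp_apply, inChartOne, h1]
    rw [jac, ← h2]
  · exact Or.inr hd

theorem eventually_inChartOne {b : K} (hb : b ∈ (extChartAt J (1 : K)).source) :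
    ∀ᶠ v in 𝓝 (extChartAt J (1 : K) 1), (extChartAt J (1 : K)).symm
      (inChartOne J (fun x => b * x) v) = b * (extChartAt J (1 : K)).symm v := by
  have h1 : ContinuousAt (fun v => b * (extChartAt J (1 : K)).symm v) (extChartAt J (1 : K) 1) := by
    have : IsTopologicalGroup K := topologicalGroup_of_lieGroup J ∞
    exact continuousAt_const.mul (continuousAt_extChartAt_symm (I := J) (1 : K))
  have h2 : ∀ᶠ v in 𝓝 (extChartAt J (1 : K) 1),
      b * (extChartAt J (1 : K)).symm v ∈ (extChartAt J (1 : K)).source := by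
    refine h1 ((isOpen_extChartAt_source (1 : K)).mem_nhds ?_)
    simpa using hb
  filter_upwards [h2] with v hv
  exact (extChartAt J (1 : K)).left_inv hv

/-- Differentiate T(bx) = T(b)τ(x) at x = 1, where τ(x) = T(b)⁻¹T(bx) fixes 1, and take
determinants. The Jacobian of τ is the intrinsic Jacobian of T at b, measured in left-invariant
frames. -/
theorem fderiv_inChartOne_comp_leftFrame {T : K → K} {b : K} (hT : ContMDiffAt J J ∞ T b)
    (hb : b ∈ (extChartAt J (1 : K)).source) (hTb : T b ∈ (extChartAt J (1 : K)).source) :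
    (fderiv ℝ (inChartOne J T) (extChartAt J (1 : K) b)).det * (leftFrame J b).det =
      (leftFrame J (T b)).det * jac J (fun x => (T b)⁻¹ * T (b * x)) 1 := by
  set φ := extChartAt J (1 : K) with hφ
  have h1s : (1 : K) ∈ φ.source := mem_extChartAt_source (1 : K)
  have hL : ∀ c : K, ContMDiffAt J J ∞ (fun x => c * x) 1 := fun c => contMDiff_mul_left.contMDiffAt
  have e1 := hasFDerivAt_inChartOne (J := J) (hL b) h1s (by rw [mul_one]; exact hb)
  have e2 := hasFDerivAt_inChartOne hT hb hTb
  set τ := fun x => (T b)⁻¹ * T (b * x) with hτ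
  have hτ1 : τ 1 = 1 := by simp [hτ]
  have hτs : ContMDiffAt J J ∞ τ 1 := by
    have h3 : ContMDiffAt J J ∞ T (b * 1) := by rwa [mul_one]
    exact (contMDiff_mul_left (I := J) (n := ∞) (a := (T b)⁻¹)).contMDiffAt.comp (1 : K)
      (h3.comp (1 : K) (hL b))
  have e3 := hasFDerivAt_inChartOne (J := J) hτs h1s (by rw [hτ1]; exact h1s)
  have e4 := hasFDerivAt_inChartOne (J := J) (hL (T b)) h1s (by rw [mul_one]; exact hTb)
  have hb1 : inChartOne J (fun x => b * x) (φ 1) = φ b := by simp [inChartOne, φ]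
  have hτ2 : inChartOne J τ (φ 1) = φ 1 := by simp [inChartOne, φ, hτ1]
  have e5 : HasFDerivAt (inChartOne J T ∘ inChartOne J fun x => b * x)
      ((fderiv ℝ (inChartOne J T) (φ b)).comp (leftFrame J b)) (φ 1) := by
    refine HasFDerivAt.comp (φ 1) ?_ e1
    rw [hb1]
    exact e2
  have e6 : HasFDerivAt ((inChartOne J fun x => T b * x) ∘ inChartOne J τ)
      ((leftFrame J (T b)).comp (fderiv ℝ (inChartOne J τ) (φ 1))) (φ 1) := by
    refine HasFDerivAt.comp (φ 1) ?_ e3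
    rw [hτ2]
    exact e4
  have e7 : (inChartOne J T ∘ inChartOne J fun x => b * x) =ᶠ[𝓝 (φ 1)]
      ((inChartOne J fun x => T b * x) ∘ inChartOne J τ) := by
    have hc : ContinuousAt (fun v => τ (φ.symm v)) (φ 1) := by
      have h5 : ContinuousAt τ (φ.symm (φ 1)) := by
        rw [φ.left_inv h1s]; exact hτs.continuousAt
      exact h5.comp (continuousAt_extChartAt_symm (I := J) (1 : K))
    have h6 : ∀ᶠ v in 𝓝 (φ 1), τ (φ.symm v) ∈ φ.source := by
      refine hc ((isOpen_extChartAt_source (1 : K)).mem_nhds ?_)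
      beta_reduce
      rw [φ.left_inv h1s, hτ1]
      exact h1s
    filter_upwards [eventually_inChartOne hb, h6] with v hv hv'
    change φ (T (φ.symm (inChartOne J (fun x => b * x) v))) =
      φ (T b * φ.symm (φ (τ (φ.symm v))))
    have hv2 : φ.symm (inChartOne J (fun x => b * x) v) = b * φ.symm v := hv
    rw [hv2, φ.left_inv hv', hτ, mul_inv_cancel_left]
  have e8 := e5.unique (e6.congr_of_eventuallyEq e7)
  have e9 := congrArg ContinuousLinearMap.det e8
  have e10 : ∀ S S' : E →L[ℝ] E, (S.comp S').det = S.det * S'.det := fun S S' =>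
    LinearMap.det_comp _ _
  rw [e10, e10] at e9
  rw [e9]
  congr 1
  exact (det_fderiv_inChartOne hτ1).resolve_right (not_not.2 (hτs.mdifferentiableAt (by simp)))

/-- Applied to left translation by b⁻¹, the frame relation writes 1 as a product with the
determinant at b as a factor. -/
theorem det_leftFrame_ne_zero {b : K} (hb : b ∈ (extChartAt J (1 : K)).source) :
    (leftFrame J b).det ≠ 0 := by
  have h := fderiv_inChartOne_comp_leftFrame (J := J) (T := fun x => b⁻¹ * x) (b := b)
    contMDiff_mul_left.contMDiffAt hb (by simp)
  simp only [inv_mul_cancel, inv_one, one_mul, inv_mul_cancel_left] at h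
  rw [jac_id, mul_one] at h
  have h2 : leftFrame J (1 : K) = ContinuousLinearMap.id ℝ E := by
    have h3 : (inChartOne J fun x : K => 1 * x) =ᶠ[𝓝 (extChartAt J (1 : K) 1)] id := by
      filter_upwards [extChartAt_target_mem_nhds (I := J) (1 : K)] with v hv
      rw [inChartOne, one_mul, (extChartAt J (1 : K)).right_inv hv, id]
    rw [leftFrame, h3.fderiv_eq, fderiv_id]
  intro h0
  rw [h0, mul_zero, h2] at h
  have h4 : (ContinuousLinearMap.id ℝ E).det = 1 := LinearMap.det_id
  rw [h4] at h
  exact zero_ne_one h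

theorem continuousOn_leftFrame :
    ContinuousOn (leftFrame J : K → E →L[ℝ] E) (extChartAt J (1 : K)).source := by
  intro b hb
  have h1s : (1 : K) ∈ (extChartAt J (1 : K)).source := mem_extChartAt_source (1 : K)
  have hf : ContMDiffAt (J.prod 𝓘(ℝ, E)) 𝓘(ℝ, E) ∞
      (Function.uncurry fun (b : K) (v : E) => inChartOne J (fun x => b * x) v)
      (b, extChartAt J (1 : K) 1) := by
    have h1 : ContMDiffAt 𝓘(ℝ, E) J ∞ (extChartAt J (1 : K)).symm (extChartAt J (1 : K) 1) :=
      (contMDiffOn_extChartAt_symm (I := J) (n := ∞) (1 : K)).contMDiffAt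
        (extChartAt_target_mem_nhds' ((extChartAt J (1 : K)).map_source h1s))
    have h2 : ContMDiffAt (J.prod 𝓘(ℝ, E)) J ∞
        (fun p : K × E => p.1 * (extChartAt J (1 : K)).symm p.2) (b, extChartAt J (1 : K) 1) :=
      contMDiffAt_fst.mul (h1.comp (b, extChartAt J (1 : K) 1) contMDiffAt_snd)
    have h3 : ContMDiffAt J 𝓘(ℝ, E) ∞ (extChartAt J (1 : K))
        (b * (extChartAt J (1 : K)).symm (extChartAt J (1 : K) 1)) := by
      refine contMDiffAt_extChartAt' ?_
      rw [(extChartAt J (1 : K)).left_inv h1s, mul_one]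
      simpa using hb
    exact h3.comp (b, extChartAt J (1 : K) 1) h2
  have h := ContMDiffAt.mfderiv (m := 0) (n := ∞) (x₀ := b)
    (fun (b : K) (v : E) => inChartOne J (fun x => b * x) v)
    (fun _ => extChartAt J (1 : K) 1) hf contMDiffAt_const (by simp)
  have h4 := (congrArg (fun w => ContMDiffAt J 𝓘(ℝ, E →L[ℝ] E) 0 w b)
    (inTangentCoordinates_model_space (I := 𝓘(ℝ, E)) (I' := 𝓘(ℝ, E)) (fun _ : K => extChartAt J (1 : K) 1)
    (fun b => inChartOne J (fun x => b * x) (extChartAt J (1 : K) 1))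
    (fun b => mfderiv 𝓘(ℝ, E) 𝓘(ℝ, E) (inChartOne J (fun x => b * x)) (extChartAt J (1 : K) 1))
    b)).mp h
  have h5 := h4.continuousAt
  simp only [mfderiv_eq_fderiv] at h5
  exact h5.continuousWithinAt

variable (J) in
/-- The density of the left Haar measure in the preferred chart at `1`. -/
def haarDensity (b : K) : ENNReal := ENNReal.ofReal |(leftFrame J b).det|⁻¹

/-- Relative to the density |det `leftFrame`|⁻¹, the chart Jacobian of T is replaced by its
intrinsic Jacobian; this is the pointwise form of the change of variables below. -/
theorem haarDensity_mul {T : K → K} {b : K} (hT : ContMDiffAt J J ∞ T b)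
    (hb : b ∈ (extChartAt J (1 : K)).source) (hTb : T b ∈ (extChartAt J (1 : K)).source) :
    ENNReal.ofReal |(fderiv ℝ (inChartOne J T) (extChartAt J (1 : K) b)).det| *
        haarDensity J (T b) =
      haarDensity J b * ENNReal.ofReal |jac J (fun x => (T b)⁻¹ * T (b * x)) 1| := by
  have h := fderiv_inChartOne_comp_leftFrame hT hb hTb
  have h1 := det_leftFrame_ne_zero (J := J) hb
  have h2 := det_leftFrame_ne_zero (J := J) hTb
  rw [haarDensity, haarDensity, ← ENNReal.ofReal_mul (abs_nonneg _),
    ← ENNReal.ofReal_mul (by positivity)]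
  congr 1
  have h3 := congrArg abs h
  rw [abs_mul, abs_mul] at h3
  have h4 := abs_pos.2 h1
  have h5 := abs_pos.2 h2
  field_simp
  linarith

variable [MeasurableSpace E] [BorelSpace E] [MeasurableSpace K] [BorelSpace K]

variable (J) in
/-- The integral of `F` over a subset `S` of the domain of the preferred chart at `1`, for the left
Haar measure. -/
def localHaar (S : Set K) (F : K → ENNReal) : ENNReal :=
  ∫⁻ v in extChartAt J (1 : K) '' S, haarDensity J ((extChartAt J (1 : K)).symm v) *
    F ((extChartAt J (1 : K)).symm v) ∂Measure.addHaar

theorem measurableSet_extChartAt_image {S : Set K} (hS : MeasurableSet S)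
    (hSs : S ⊆ (extChartAt J (1 : K)).source) : MeasurableSet (extChartAt J (1 : K) '' S) := by
  have h1 : extChartAt J (1 : K) '' S =
      (extChartAt J (1 : K)).target ∩ (extChartAt J (1 : K)).symm ⁻¹' S :=
    (extChartAt J (1 : K)).image_eq_target_inter_inv_preimage hSs
  rw [h1]
  have h2 : Measurable ((extChartAt J (1 : K)).target.domRestrict (extChartAt J (1 : K)).symm) :=
    (continuousOn_iff_continuous_domRestrict.1 (continuousOn_extChartAt_symm (I := J) (1 : K))).measurable
  have h3 := (isOpen_extChartAt_target (I := J) (1 : K)).measurableSet.subtype_image (h2 hS)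
  convert h3 using 1
  ext v
  constructor
  · rintro ⟨h4, h5⟩
    exact ⟨⟨v, h4⟩, h5, rfl⟩
  · rintro ⟨⟨v', h4⟩, h5, rfl⟩
    exact ⟨h4, h5⟩

theorem localHaar_image {T : K → K} (hT : ContMDiff J J ∞ T) (hinj : Function.Injective T)
    {S : Set K} (hS : MeasurableSet S) (hSs : S ⊆ (extChartAt J (1 : K)).source)
    (hTS : T '' S ⊆ (extChartAt J (1 : K)).source) (F : K → ENNReal) :
    localHaar J (T '' S) F = localHaar J S fun b =>
      ENNReal.ofReal |jac J (fun x => (T b)⁻¹ * T (b * x)) 1| * F (T b) := by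
  set φ := extChartAt J (1 : K) with hφ
  have himg : φ '' (T '' S) = inChartOne J T '' (φ '' S) := by
    rw [image_image, image_image]
    refine image_congr fun b hb => ?_
    simp only [inChartOne, ← hφ, φ.left_inv (hSs hb)]
  have hm := measurableSet_extChartAt_image (J := J) hS hSs
  rw [localHaar, localHaar, ← hφ, himg, lintegral_image_eq_lintegral_abs_det_fderiv_mul _ hm
    (f' := fun v => fderiv ℝ (inChartOne J T) v)]
  · refine setLIntegral_congr_fun hm ?_
    rintro _ ⟨b, hb, rfl⟩
    have hb' := hSs hb
    have hTb := hTS ⟨b, hb, rfl⟩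
    have h1 : φ.symm (inChartOne J T (φ b)) = T b := by
      simp only [inChartOne, ← hφ]
      rw [φ.left_inv hb', φ.left_inv hTb]
    beta_reduce
    rw [h1, φ.left_inv hb', ← mul_assoc, ← mul_assoc, haarDensity_mul (hT b) hb' hTb]
  · rintro _ ⟨b, hb, rfl⟩
    exact (hasFDerivAt_inChartOne (hT b) (hSs hb) (hTS ⟨b, hb, rfl⟩)).hasFDerivWithinAt
  · rintro _ ⟨b, hb, rfl⟩ _ ⟨b', hb', rfl⟩ h
    simp only [inChartOne, ← hφ, φ.left_inv (hSs hb), φ.left_inv (hSs hb')] at h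
    rw [hinj (φ.injOn (hTS ⟨b, hb, rfl⟩) (hTS ⟨b', hb', rfl⟩) h)]

end HaarJacobian

end

/-! ### Comparison of the chart measure with Haar measure -/

noncomputable section

section HaarJacobian

variable {E H : Type*} [NormedAddCommGroup E] [NormedSpace ℝ E] [FiniteDimensional ℝ E]
  [TopologicalSpace H] {J : ModelWithCorners ℝ E H} [J.Boundaryless]
  {K : Type*} [TopologicalSpace K] [ChartedSpace H K] [Group K] [LieGroup J ∞ K]
  [MeasurableSpace E] [BorelSpace E] [MeasurableSpace K] [BorelSpace K]

variable (J K) in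
/-- The measure with density `haarDensity` on the domain of the preferred chart at `1`. -/
def localHaarMeasure : Measure K :=
  (((Measure.addHaar : Measure E).restrict (extChartAt J (1 : K)).target).withDensity
    fun v => haarDensity J ((extChartAt J (1 : K)).symm v)).map (extChartAt J (1 : K)).symm

theorem aemeasurable_extChartAt_symm :
    AEMeasurable (extChartAt J (1 : K)).symm
      ((Measure.addHaar : Measure E).restrict (extChartAt J (1 : K)).target) :=
  (continuousOn_extChartAt_symm (I := J) (1 : K)).aemeasurable
    (isOpen_extChartAt_target (1 : K)).measurableSet

theorem continuousOn_haarDensity :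
    ContinuousOn (haarDensity J : K → ENNReal) (extChartAt J (1 : K)).source := by
  refine ENNReal.continuous_ofReal.comp_continuousOn (ContinuousOn.inv₀ ?_ fun b hb =>
    abs_ne_zero.2 (det_leftFrame_ne_zero hb))
  exact (ContinuousLinearMap.continuous_det.comp_continuousOn continuousOn_leftFrame).abs

theorem aemeasurable_haarDensity :
    AEMeasurable (fun v => haarDensity J ((extChartAt J (1 : K)).symm v))
      ((Measure.addHaar : Measure E).restrict (extChartAt J (1 : K)).target) :=
  ContinuousOn.aemeasurable (continuousOn_haarDensity.comp
    (continuousOn_extChartAt_symm (I := J) (1 : K)) fun _ hv =>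
      (extChartAt J (1 : K)).map_target hv) (isOpen_extChartAt_target (1 : K)).measurableSet

theorem setLIntegral_localHaarMeasure {S : Set K} (hS : MeasurableSet S)
    (hSs : S ⊆ (extChartAt J (1 : K)).source) {F : K → ENNReal} (hF : Measurable F) :
    ∫⁻ b in S, F b ∂localHaarMeasure J K = localHaar J S F := by
  have hm := measurableSet_extChartAt_image (J := J) hS hSs
  have h1 : extChartAt J (1 : K) '' S =
      (extChartAt J (1 : K)).symm ⁻¹' S ∩ (extChartAt J (1 : K)).target := by
    rw [inter_comm]
    exact (extChartAt J (1 : K)).image_eq_target_inter_inv_preimage hSs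
  rw [← lintegral_indicator hS, localHaarMeasure, lintegral_map' (hF.indicator hS).aemeasurable
    (aemeasurable_extChartAt_symm.mono_ac (withDensity_absolutelyContinuous _ _))]
  refine (lintegral_withDensity_eq_lintegral_mul₀ aemeasurable_haarDensity
      ((hF.indicator hS).comp_aemeasurable aemeasurable_extChartAt_symm)).trans ?_
  rw [localHaar, ← lintegral_indicator hm,
    ← lintegral_indicator (isOpen_extChartAt_target (1 : K)).measurableSet]
  congr 1
  ext v
  rw [h1]
  by_cases h2 : v ∈ (extChartAt J (1 : K)).target
  · by_cases h3 : (extChartAt J (1 : K)).symm v ∈ S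
    · have h4 : v ∈ (extChartAt J (1 : K)).symm ⁻¹' S ∩ (extChartAt J (1 : K)).target := ⟨h3, h2⟩
      rw [indicator_of_mem h2, indicator_of_mem h4, Pi.mul_apply,
        Function.comp_apply, indicator_of_mem h3]
    · rw [indicator_of_mem h2, indicator_of_notMem fun h => h3 h.1, Pi.mul_apply,
        Function.comp_apply, indicator_of_notMem h3, mul_zero]
  · rw [indicator_of_notMem h2, indicator_of_notMem fun h => h2 h.2]

instance : SFinite (localHaarMeasure J K) := by
  unfold localHaarMeasure
  infer_instance

theorem setLIntegral_localHaarMeasure_image {T : K → K} (hT : ContMDiff J J ∞ T)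
    (hinj : Function.Injective T) {j : K → ENNReal} (hj : Measurable j)
    (hjT : ∀ b, j b = ENNReal.ofReal |jac J (fun x => (T b)⁻¹ * T (b * x)) 1|)
    {S : Set K} (hS : MeasurableSet S) (hSs : S ⊆ (extChartAt J (1 : K)).source)
    (hTm : MeasurableSet (T '' S))
    (hTS : T '' S ⊆ (extChartAt J (1 : K)).source) {F : K → ENNReal} (hF : Measurable F) :
    ∫⁻ b in T '' S, F b ∂localHaarMeasure J K =
      ∫⁻ b in S, j b * F (T b) ∂localHaarMeasure J K := by
  rw [setLIntegral_localHaarMeasure hTm hTS hF, localHaar_image hT hinj hS hSs hTS,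
    setLIntegral_localHaarMeasure hS hSs (F := fun b => j b * F (T b))
      (hj.mul (hF.comp hT.continuous.measurable))]
  simp only [hjT]

variable [IsTopologicalGroup K] [T2Space K] [SecondCountableTopology K] [LocallyCompactSpace K]

theorem jac_left_translation (x b : K) :
    jac J (fun y => (x * b)⁻¹ * (x * (b * y))) 1 = 1 := by
  have h : (fun y : K => (x * b)⁻¹ * (x * (b * y))) = fun y => y := by ext y; group
  rw [h, jac_id]

/-- For a left translation the map x ↦ T(b)⁻¹T(bx) is the identity, so the intrinsic Jacobian is 1.
The invariance is only local: S and its translate must both stay in the chart domain. -/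
theorem setLIntegral_localHaarMeasure_mul_left (x : K) {S : Set K} (hS : MeasurableSet S)
    (hSs : S ⊆ (extChartAt J (1 : K)).source)
    (hTS : (fun b => x * b) '' S ⊆ (extChartAt J (1 : K)).source) {F : K → ENNReal}
    (hF : Measurable F) :
    ∫⁻ b in (fun b => x * b) '' S, F b ∂localHaarMeasure J K =
      ∫⁻ b in S, F (x * b) ∂localHaarMeasure J K := by
  have h := setLIntegral_localHaarMeasure_image (J := J) (T := fun b => x * b) contMDiff_mul_left
    (mul_right_injective x) (j := fun _ => 1) measurable_const
    (fun b => by rw [jac_left_translation]; simp) hS hSs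
    ((Homeomorph.mulLeft x).measurableEmbedding.measurableSet_image.2 hS) hTS hF
  simpa using h

variable (μ : Measure K) [μ.IsHaarMeasure]

theorem lintegral_mul_right_eq (y : K) {F : K → ENNReal} (hF : Measurable F) :
    ∫⁻ x, F (x * y) ∂μ = Measure.modularCharacterFun y * ∫⁻ x, F x ∂μ := by
  rw [← lintegral_map hF (measurable_mul_const y),
    Measure.map_right_mul_eq_modularCharacterFun_smul]
  exact lintegral_smul_measure _ _

theorem localHaarMeasure_pos {S : Set K} (hS : IsOpen S) (hne : S.Nonempty)
    (hSs : S ⊆ (extChartAt J (1 : K)).source) : localHaarMeasure J K S ≠ 0 := by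
  intro h0
  have h1 : ∫⁻ b in S, (1 : K → ENNReal) b ∂localHaarMeasure J K = 0 := by simpa using h0
  rw [setLIntegral_localHaarMeasure hS.measurableSet hSs measurable_one, localHaar] at h1
  set φ := extChartAt J (1 : K) with hφ
  have hm := measurableSet_extChartAt_image (J := J) hS.measurableSet hSs
  have h2 : ∀ v ∈ φ '' S, haarDensity J (φ.symm v) ≠ 0 := by
    rintro _ ⟨b, hb, rfl⟩
    rw [φ.left_inv (hSs hb)]
    exact (ENNReal.ofReal_pos.2 (inv_pos.2 (abs_pos.2 (det_leftFrame_ne_zero (hSs hb))))).ne'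
  have hsub : φ '' S ⊆ φ.target := by
    rintro _ ⟨b, hb, rfl⟩
    exact φ.map_source (hSs hb)
  have h3 : AEMeasurable (fun v => haarDensity J (φ.symm v) * 1)
      ((Measure.addHaar : Measure E).restrict (φ '' S)) := by
    simp only [mul_one]
    exact aemeasurable_haarDensity.mono_measure (Measure.restrict_mono hsub le_rfl)
  have h4 := (lintegral_eq_zero_iff' h3).1 h1
  have h5 : IsOpen (φ '' S) := by
    rw [φ.image_eq_target_inter_inv_preimage hSs]
    exact (continuousOn_extChartAt_symm (I := J) (1 : K)).isOpen_inter_preimage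
      (isOpen_extChartAt_target (1 : K)) hS
  have h6 : (Measure.addHaar : Measure E) (φ '' S) = 0 := by
    rw [Filter.EventuallyEq, ae_restrict_iff' hm] at h4
    refine measure_mono_null (fun v hv => ?_) (ae_iff.1 h4)
    exact fun h7 => h2 v hv (by simpa using h7 hv)
  exact (h5.measure_pos _ (hne.image _)).ne' h6

theorem localHaarMeasure_lt_top {C : Set K} (hC : IsCompact C)
    (hCs : C ⊆ (extChartAt J (1 : K)).source) : localHaarMeasure J K C ≠ ⊤ := by
  have h1 : ∫⁻ b in C, (1 : K → ENNReal) b ∂localHaarMeasure J K = localHaarMeasure J K C := by simp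
  rw [← h1, setLIntegral_localHaarMeasure hC.measurableSet hCs measurable_one, localHaar]
  set φ := extChartAt J (1 : K) with hφ
  have hφC : IsCompact (φ '' C) := hC.image_of_continuousOn
    ((continuousOn_extChartAt (I := J) (1 : K)).mono hCs)
  obtain ⟨M, hM⟩ : ∃ M : NNReal, ∀ v ∈ φ '' C, haarDensity J (φ.symm v) ≤ M := by
    obtain ⟨M, hM⟩ := (hC.image_of_continuousOn ((ContinuousLinearMap.continuous_det.comp_continuousOn
      (continuousOn_leftFrame.mono hCs)).abs.inv₀ fun b hb =>
        abs_ne_zero.2 (det_leftFrame_ne_zero (J := J) (hCs hb)))).bddAbove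
    refine ⟨M.toNNReal, ?_⟩
    rintro _ ⟨b, hb, rfl⟩
    rw [φ.left_inv (hCs hb)]
    exact ENNReal.ofReal_le_ofReal (hM ⟨b, hb, rfl⟩)
  refine ((setLIntegral_mono' hφC.measurableSet (g := fun _ => (M : ENNReal))
    fun v hv => ?_).trans_lt ?_).ne
  · rw [Pi.one_apply, mul_one]; exact hM v hv
  · rw [setLIntegral_const]
    exact ENNReal.mul_lt_top ENNReal.coe_lt_top hφC.measure_lt_top

open Pointwise in
/-- The left Haar measure is proportional to `localHaarMeasure` near `1`. -/
theorem exists_localHaarMeasure_eq : ∃ W : Set K, IsOpen W ∧ (1 : K) ∈ W ∧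
    W ⊆ (extChartAt J (1 : K)).source ∧ ∃ c d : ENNReal, c ≠ 0 ∧ c ≠ ⊤ ∧ d ≠ 0 ∧ d ≠ ⊤ ∧
      ∀ S, MeasurableSet S → S ⊆ W → ∀ F : K → ENNReal, Measurable F →
        c * ∫⁻ b in S, F b ∂localHaarMeasure J K = d * ∫⁻ b in S, F b ∂μ := by
  set U := (extChartAt J (1 : K)).source with hU
  have hUo : IsOpen U := isOpen_extChartAt_source (1 : K)
  have hU1 : (1 : K) ∈ U := mem_extChartAt_source (1 : K)
  set l := localHaarMeasure J K with hl
  have hWo : IsOpen (U ∩ U⁻¹) := hUo.inter hUo.inv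
  have hW1 : (1 : K) ∈ U ∩ U⁻¹ := ⟨hU1, by simpa using hU1⟩
  obtain ⟨C, hC, hC1, hCW⟩ := exists_compact_subset hWo hW1
  have hCm : MeasurableSet C := hC.measurableSet
  have hμC : μ C ≠ ⊤ := hC.measure_lt_top.ne
  have hμC0 : μ C ≠ 0 :=
    (Measure.measure_pos_of_mem_nhds μ (mem_interior_iff_mem_nhds.1 hC1)).ne'
  have hCi : MeasurableSet C⁻¹ := hCm.inv
  have hCiU : C⁻¹ ⊆ U := by
    intro b hb
    have := (hCW hb).2
    simpa using this
  set h : K → ENNReal := C.indicator 1 with hh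
  have hhm : Measurable h := measurable_one.indicator hCm
  -- Measurability of the modular function is obtained by writing it as a ratio of integrals that
  -- depends measurably on y.
  have hΔm : Measurable fun y : K => (Measure.modularCharacterFun y : ENNReal) := by
    have h1 : (fun y : K => (Measure.modularCharacterFun y : ENNReal)) =
        fun y => (∫⁻ x, h (x * y) ∂μ) / μ C := by
      ext y
      rw [lintegral_mul_right_eq μ y hhm, hh, lintegral_indicator_one hCm,
        ENNReal.mul_div_cancel_right hμC0 hμC]
    rw [h1]
    exact (Measurable.lintegral_prod_right'
      (f := fun p : K × K => h (p.2 * p.1)) (by fun_prop)).div_const _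
  -- The uniqueness argument for Haar measure: integrate F(y)h(y⁻¹x), with h the indicator of C, for
  -- l in y ∈ S and for μ in x, in both orders. Left invariance of μ gives μ(C)∫F dl. Substituting y
  -- ↦ xy instead, which is allowed because S and C⁻¹ lie in the chart domain, and using right
  -- quasi-invariance of μ gives a constant times ∫F dμ.
  have key : ∀ S, MeasurableSet S → S ⊆ U ∩ U⁻¹ → ∀ F : K → ENNReal, Measurable F →
      μ C * ∫⁻ b in S, F b ∂l =
        (∫⁻ y in C⁻¹, (Measure.modularCharacterFun y : ENNReal) ∂l) * ∫⁻ b in S, F b ∂μ := by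
    intro S hS hSW F hF
    have e1 : ∫⁻ y in S, ∫⁻ x, F y * h (y⁻¹ * x) ∂μ ∂l = μ C * ∫⁻ b in S, F b ∂l := by
      rw [← lintegral_const_mul _ hF]
      refine lintegral_congr fun y => ?_
      rw [lintegral_const_mul _ (by fun_prop), lintegral_mul_left_eq_self h, hh,
        lintegral_indicator_one hCm, mul_comm]
    have e2 : ∀ x, ∫⁻ y in S, F y * h (y⁻¹ * x) ∂l =
        ∫⁻ y in C⁻¹, S.indicator F (x * y) ∂l := by
      intro x
      set T := (fun y => x * y) ⁻¹' S ∩ C⁻¹ with hT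
      have hTm : MeasurableSet T := (measurable_const_mul x hS).inter hCi
      have h2 : (fun y => x * y) '' T = S ∩ (fun y => y⁻¹ * x) ⁻¹' C := by
        ext y
        constructor
        · rintro ⟨y, ⟨h3, h4⟩, rfl⟩
          exact ⟨h3, by simpa using h4⟩
        · rintro ⟨h3, h4⟩
          exact ⟨x⁻¹ * y, ⟨by simpa using h3, by simpa using h4⟩, by simp⟩
      have h3 : ∫⁻ y in S, F y * h (y⁻¹ * x) ∂l = ∫⁻ y in (fun y => x * y) '' T, F y ∂l := by
        have hCx : MeasurableSet ((fun y => y⁻¹ * x) ⁻¹' C) :=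
          (measurable_inv.mul_const x) hCm
        rw [h2, inter_comm, ← Measure.restrict_restrict hCx, ← lintegral_indicator hCx]
        refine lintegral_congr fun y => ?_
        by_cases hy : y⁻¹ * x ∈ C
        · rw [indicator_of_mem (by exact hy), hh, indicator_of_mem hy, Pi.one_apply, mul_one]
        · rw [indicator_of_notMem (by exact hy), hh, indicator_of_notMem hy, mul_zero]
      rw [h3, setLIntegral_localHaarMeasure_mul_left x hTm (fun y hy => hCiU hy.2) ?_ hF]
      · rw [hT, ← Measure.restrict_restrict (measurable_const_mul x hS),
          ← lintegral_indicator (measurable_const_mul x hS)]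
        rfl
      · rw [h2]
        exact fun y hy => (hSW hy.1).1
    rw [← e1, lintegral_lintegral_swap (by
      refine Measurable.aemeasurable ?_
      change Measurable fun p : K × K => F p.1 * h (p.1⁻¹ * p.2)
      fun_prop)]
    simp only [e2]
    have hFS := hF.indicator hS
    rw [lintegral_lintegral_swap (by
      refine Measurable.aemeasurable ?_
      change Measurable fun p : K × K => S.indicator F (p.1 * p.2)
      fun_prop)]
    rw [← lintegral_mul_const _ hΔm]
    refine lintegral_congr fun y => ?_
    rw [lintegral_mul_right_eq μ y hFS, lintegral_indicator hS]
  -- That the second constant is neither 0 nor infinite follows from `key` with S = C and F = 1,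
  -- since l is positive on nonempty open subsets and finite on compact subsets of the chart domain.
  refine ⟨U ∩ U⁻¹, hWo, hW1, inter_subset_left, μ C, _, hμC0, hμC, ?_, ?_, key⟩
  · intro h0
    have h1 := key C hCm hCW 1 measurable_one
    rw [h0, zero_mul] at h1
    have h2 : l C = 0 := by simpa [hμC0] using h1
    exact localHaarMeasure_pos (J := J) isOpen_interior ⟨1, hC1⟩
      (interior_subset.trans (hCW.trans inter_subset_left))
      (measure_mono_null interior_subset h2)
  · intro h0
    have h1 := key C hCm hCW 1 measurable_one
    rw [h0] at h1
    simp only [Pi.one_apply, lintegral_one, Measure.restrict_apply_univ] at h1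
    rw [ENNReal.top_mul hμC0] at h1
    exact ENNReal.mul_ne_top hμC
      (localHaarMeasure_lt_top (J := J) hC (hCW.trans inter_subset_left)) h1

end HaarJacobian

end

/-! ### Change of variables for the Haar measure of a Lie group -/

noncomputable section

section HaarJacobian

variable {E H : Type*} [NormedAddCommGroup E] [NormedSpace ℝ E] [FiniteDimensional ℝ E]
  [TopologicalSpace H] {J : ModelWithCorners ℝ E H} [J.Boundaryless]
  {K : Type*} [TopologicalSpace K] [ChartedSpace H K] [Group K] [LieGroup J ∞ K]
  [MeasurableSpace K] [BorelSpace K]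
  [IsTopologicalGroup K] [T2Space K] [SecondCountableTopology K] [LocallyCompactSpace K]
  (μ : Measure K) [μ.IsHaarMeasure]

theorem setLIntegral_haar_preimage_mul_left (x : K) {S : Set K} (hS : MeasurableSet S)
    (F : K → ENNReal) :
    ∫⁻ b in (fun b => x * b) ⁻¹' S, F (x * b) ∂μ = ∫⁻ b in S, F b ∂μ := by
  rw [← lintegral_indicator hS, ← lintegral_indicator (measurable_const_mul x hS),
    ← lintegral_mul_left_eq_self (S.indicator F) x]
  rfl

/-- Change of variables for the left Haar measure of a Lie group. -/
theorem lintegral_haar_comp (T : K ≃ₜ K) (hT : ContMDiff J J ∞ T) {j : K → ENNReal}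
    (hj : Measurable j)
    (hjT : ∀ b, j b = ENNReal.ofReal |jac J (fun x => (T b)⁻¹ * T (b * x)) 1|)
    {F : K → ENNReal} (hF : Measurable F) :
    ∫⁻ b, F (T b) * j b ∂μ = ∫⁻ b, F b ∂μ := by
  borelize E
  obtain ⟨W, hWo, hW1, hWs, c, d, hc0, hc, hd0, hd, key⟩ := exists_localHaarMeasure_eq (J := J) μ
  set N : K → Set K := fun b₀ =>
    (fun b => b₀⁻¹ * b) ⁻¹' W ∩ (fun b => (T b₀)⁻¹ * T b) ⁻¹' W with hN
  have hNo : ∀ b₀, IsOpen (N b₀) := fun b₀ =>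
    (hWo.preimage (by fun_prop)).inter (hWo.preimage (by fun_prop))
  have hNb : ∀ b, b ∈ N b := fun b => by simp [hN, hW1]
  -- Near b₀ replace T by T' = T(b₀)⁻¹T(b₀ ·), which fixes 1 and has at b the intrinsic Jacobian of
  -- T at b₀b. For S ⊆ N(b₀) both S' and T'(S') lie in W, where μ is proportional to the chart
  -- measure, and left invariance returns to S and T(S).
  have loc : ∀ b₀ S, MeasurableSet S → S ⊆ N b₀ →
      ∫⁻ b in T '' S, 1 ∂μ = ∫⁻ b in S, j b ∂μ := by
    intro b₀ S hS hSN
    set T' : K → K := fun x => (T b₀)⁻¹ * T (b₀ * x) with hT'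
    set S' := (fun x => b₀ * x) ⁻¹' S with hS'
    have hS'm : MeasurableSet S' := measurable_const_mul b₀ hS
    have hTS : MeasurableSet (T '' S) := T.measurableEmbedding.measurableSet_image.2 hS
    have h1 : T' '' S' = (fun x => T b₀ * x) ⁻¹' (T '' S) := by
      ext y
      constructor
      · rintro ⟨x, hx, rfl⟩
        exact ⟨b₀ * x, hx, by simp [hT']⟩
      · rintro ⟨x, hx, hxy⟩
        refine ⟨b₀⁻¹ * x, by simpa [hS'] using hx, ?_⟩
        simp [hT', hxy]
    have hT'S : MeasurableSet (T' '' S') := by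
      rw [h1]; exact measurable_const_mul _ hTS
    have hS'W : S' ⊆ W := fun x hx => by simpa using (hSN hx).1
    have hT'W : T' '' S' ⊆ W := by
      rintro _ ⟨x, hx, rfl⟩
      exact (hSN hx).2
    have h2 := setLIntegral_localHaarMeasure_image (J := J) (T := T')
      (contMDiff_mul_left.comp (hT.comp contMDiff_mul_left))
      (fun x y hxy => by simpa [hT'] using hxy) (j := fun x => j (b₀ * x))
      (hj.comp (measurable_const_mul b₀))
      (fun b => by
        rw [hjT]
        congr 2
        simp only [hT']
        congr 1
        ext x
        group) hS'm (hS'W.trans hWs) hT'S (hT'W.trans hWs) measurable_one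
    have h3 := congrArg (fun r => c * r) h2
    beta_reduce at h3
    simp only [Pi.one_apply, mul_one] at h3
    have h6 := key _ hS'm hS'W (fun b => j (b₀ * b)) (hj.comp (measurable_const_mul b₀))
    beta_reduce at h6
    rw [h6] at h3
    have h4 := key _ hT'S hT'W 1 measurable_one
    simp only [Pi.one_apply] at h4
    rw [h4] at h3
    have h5 := (ENNReal.mul_right_inj hd0 hd).1 h3
    rw [h1, setLIntegral_haar_preimage_mul_left μ (T b₀) hTS fun _ => 1,
      setLIntegral_haar_preimage_mul_left μ b₀ hS j] at h5
    exact h5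
  -- Countably many of the sets N(b) cover the group, so it suffices to compare the two measures on
  -- each image T(N(b)).
  obtain ⟨s, hs, hsu⟩ := TopologicalSpace.countable_cover_nhds fun b => (hNo b).mem_nhds (hNb b)
  have hμ : μ = (μ.withDensity j).map T := by
    refine (Measure.ext_iff_of_biUnion_eq_univ (s := fun b => T '' N b) hs ?_).2 fun b₀ _ => ?_
    · rw [← image_iUnion₂, hsu, image_univ, T.range_coe]
    · ext V hV
      rw [Measure.restrict_apply hV, Measure.restrict_apply hV, Measure.map_apply
        T.continuous.measurable (hV.inter
          (T.measurableEmbedding.measurableSet_image.2 (hNo b₀).measurableSet)),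
        withDensity_apply _ (T.continuous.measurable (hV.inter
          (T.measurableEmbedding.measurableSet_image.2 (hNo b₀).measurableSet))),
        ← loc b₀ _ (T.continuous.measurable (hV.inter
          (T.measurableEmbedding.measurableSet_image.2 (hNo b₀).measurableSet))) ?_,
        T.image_preimage]
      · simp
      · rintro x ⟨_, y, hy, hyx⟩
        rwa [← T.injective hyx]
  conv_rhs => rw [hμ]
  rw [lintegral_map hF T.continuous.measurable,
    lintegral_withDensity_eq_lintegral_mul (g := fun a => F (T a)) _ hj
      (hF.comp T.continuous.measurable)]
  exact lintegral_congr fun b => mul_comm _ _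

end HaarJacobian

/-! ### Effect of the action of A and of right translations on the Haar measure of B -/

section ActionMeasure

variable {E H : Type*} [NormedAddCommGroup E] [NormedSpace ℝ E] [FiniteDimensional ℝ E]
  [TopologicalSpace H]
  {EA HA : Type*} [NormedAddCommGroup EA] [NormedSpace ℝ EA] [FiniteDimensional ℝ EA]
  [TopologicalSpace HA]
  {EB HB : Type*} [NormedAddCommGroup EB] [NormedSpace ℝ EB] [FiniteDimensional ℝ EB]
  [TopologicalSpace HB]
  {I : ModelWithCorners ℝ E H} [I.Boundaryless]
  {JA : ModelWithCorners ℝ EA HA} [JA.Boundaryless]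
  {JB : ModelWithCorners ℝ EB HB} [JB.Boundaryless]
  {G A B : Type*} [TopologicalSpace G] [ChartedSpace H G] [Group G] [LieGroup I ∞ G]
  [T2Space G] [SecondCountableTopology G]
  [TopologicalSpace A] [ChartedSpace HA A] [Group A] [LieGroup JA ∞ A]
  [TopologicalSpace B] [ChartedSpace HB B] [Group B] [LieGroup JB ∞ B]
  (𝒟 : DoubleLieGroup I JA JB G A B)

namespace DoubleLieGroup

variable [MeasurableSpace B] [BorelSpace B] (μ : Measure B) [μ.IsHaarMeasure]

theorem act_mul_right (a : A) (b b' : B) :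
    𝒟.act a (b * b') = 𝒟.act a b * 𝒟.act (𝒟.coact a b) b' := by
  rw [act, map_mul, ← mul_assoc, iA_mul_iB, mul_assoc, bL_iB_mul]
  rfl

theorem coact_mul_left (a a' : A) (b : B) :
    𝒟.coact (a * a') b = 𝒟.coact a (𝒟.act a' b) * 𝒟.coact a' b := by
  rw [coact, map_mul, mul_assoc, iA_mul_iB, ← mul_assoc, aR_mul_iA]
  rfl

/-- The action of `a` on `B`, as a homeomorphism. -/
def actHomeo (a : A) : B ≃ₜ B where
  toFun := 𝒟.act a
  invFun := 𝒟.act a⁻¹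
  left_inv b := 𝒟.act_inv_act a b
  right_inv b := 𝒟.act_act_inv a b
  continuous_toFun := by
    have h := (contMDiff_act 𝒟).continuous
    exact h.comp (Continuous.prodMk_right a)
  continuous_invFun := by
    have h := (contMDiff_act 𝒟).continuous
    exact h.comp (Continuous.prodMk_right a⁻¹)

/-- By a ▷ (bx) = (a ▷ b)((a ◁ b) ▷ x), the map x ↦ (a ▷ b)⁻¹(a ▷ (bx)) is the action of a ◁ b, so
the intrinsic Jacobian of the action of a at b is ψ_B(a ◁ b). -/
theorem lintegral_act [IsTopologicalGroup B] [LocallyCompactSpace B] (a : A) {F : B → ENNReal}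
    (hF : Measurable F) :
    ∫⁻ b, F (𝒟.act a b) * ENNReal.ofReal |𝒟.psiB (𝒟.coact a b)| ∂μ = ∫⁻ b, F b ∂μ := by
  have := 𝒟.t2Space_B
  have := 𝒟.secondCountable_B
  refine lintegral_haar_comp (J := JB) μ (𝒟.actHomeo a) ?_ ?_ (fun b => ?_) hF
  · exact (contMDiff_act 𝒟).comp (contMDiff_const.prodMk contMDiff_id)
  · refine ENNReal.measurable_ofReal.comp (Continuous.measurable ?_)
    exact ((𝒟.contMDiff_psiB.comp ((contMDiff_coact 𝒟).comp
      (contMDiff_const.prodMk contMDiff_id))).continuous).abs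
  · have h1 : (fun x => (𝒟.act a b)⁻¹ * 𝒟.act a (b * x)) = 𝒟.act (𝒟.coact a b) := by
      ext x
      rw [act_mul_right, inv_mul_cancel_left]
    change _ = ENNReal.ofReal |jac JB (fun x => (𝒟.act a b)⁻¹ * 𝒟.act a (b * x)) 1|
    rw [h1, jac_act]

/-- For right translation by β⁻¹ the map x ↦ T(b)⁻¹T(bx) is conjugation by β, whatever b is, so
|φ_B| plays the role of the modular function of B. -/
theorem lintegral_mul_right_inv [IsTopologicalGroup B] [LocallyCompactSpace B] (β : B)
    {F : B → ENNReal} (hF : Measurable F) :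
    ∫⁻ b, F (b * β⁻¹) * ENNReal.ofReal |𝒟.phiB β| ∂μ = ∫⁻ b, F b ∂μ := by
  have := 𝒟.t2Space_B
  have := 𝒟.secondCountable_B
  refine lintegral_haar_comp (J := JB) μ (Homeomorph.mulRight β⁻¹) contMDiff_mul_right
    measurable_const (fun b => ?_) hF
  have h1 : (fun x => (b * β⁻¹)⁻¹ * (b * x * β⁻¹)) = fun x => β * x * β⁻¹ := by
    ext x
    group
  change _ = ENNReal.ofReal |jac JB (fun x => (b * β⁻¹)⁻¹ * (b * x * β⁻¹)) 1|
  rw [h1, 𝒟.jac_conj]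

end DoubleLieGroup

end ActionMeasure

end

/-! ### Smooth dependence of integrals on parameters -/

noncomputable section

section ParametricIntegral

/-- The integral is the value at 0 of the convolution of the constant function 1 with v ↦ g(p, -v),
so smoothness of convolutions with parameters applies. -/
theorem contDiffOn_integral_param {P V : Type*} [NormedAddCommGroup P] [NormedSpace ℝ P]
    [NormedAddCommGroup V] [NormedSpace ℝ V] [MeasurableSpace V] [BorelSpace V]
    (m : Measure V) [IsFiniteMeasure m] {s : Set P} (hs : IsOpen s) {k : Set V} (hk : IsCompact k)
    {g : P × V → ℂ} (hg : ContDiffOn ℝ ∞ g (s ×ˢ univ))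
    (hgk : ∀ p v, p ∈ s → v ∉ k → g (p, v) = 0) :
    ContDiffOn ℝ ∞ (fun p => ∫ v, g (p, v) ∂m) s := by
  have h1 := contDiffOn_convolution_right_with_param (μ := m) (f := fun _ : V => (1 : ℝ)) (n := ⊤)
    (ContinuousLinearMap.lsmul ℝ ℝ : ℝ →L[ℝ] ℂ →L[ℝ] ℂ) (g := fun p v => g (p, -v)) hs
    (hk.image continuous_neg)
    (fun p v hp hv => hgk p (-v) hp fun h => hv ⟨-v, h, neg_neg v⟩)
    (locallyIntegrable_const 1)
    (hg.comp (contDiff_fst.prodMk contDiff_snd.neg).contDiffOn fun q hq => ⟨hq.1, trivial⟩)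
  have h2 : ContDiffOn ℝ ∞ (fun p : P => (p, (0 : V))) s :=
    (contDiff_id.prodMk contDiff_const).contDiffOn
  refine (h1.comp h2 fun p hp => ⟨hp, trivial⟩).congr fun p hp => ?_
  simp [convolution]

variable {EZ HZ : Type*} [NormedAddCommGroup EZ] [NormedSpace ℝ EZ] [TopologicalSpace HZ]
  {IZ : ModelWithCorners ℝ EZ HZ} [IZ.Boundaryless]
  {Z : Type*} [TopologicalSpace Z] [ChartedSpace HZ Z] [IsManifold IZ ∞ Z]
  {EY HY : Type*} [NormedAddCommGroup EY] [NormedSpace ℝ EY] [FiniteDimensional ℝ EY]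
  [TopologicalSpace HY] {IY : ModelWithCorners ℝ EY HY} [IY.Boundaryless]
  {Y : Type*} [TopologicalSpace Y] [ChartedSpace HY Y] [IsManifold IY ∞ Y] [T2Space Y]
  [MeasurableSpace Y] [BorelSpace Y] (m : Measure Y) [IsFiniteMeasureOnCompacts m]

/-- In a chart around y₀ a bump function, equal to 1 on the ball of half the radius, extends the
integrand by 0 to the whole model space without changing it over C; the measure is transported to
that space and the integral over D becomes an integral there. -/
theorem exists_nhds_contMDiff_setIntegral {g : Z × Y → ℂ}
    (hg : ContMDiff (IZ.prod IY) 𝓘(ℝ, ℂ) ∞ g) (y₀ : Y) :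
    ∃ C ∈ 𝓝 y₀, ∀ D, MeasurableSet D → D ⊆ C →
      ContMDiff IZ 𝓘(ℝ, ℂ) ∞ fun z => ∫ y in D, g (z, y) ∂m := by
  borelize EY
  set φ := extChartAt IY y₀ with hφ
  obtain ⟨r, hr, hrt⟩ := Metric.nhds_basis_closedBall.mem_iff.1 (extChartAt_target_mem_nhds (I := IY) y₀)
  have hr2 : Metric.closedBall (φ y₀) (r / 2) ⊆ φ.target :=
    (Metric.closedBall_subset_closedBall (by linarith)).trans hrt
  set χ : ContDiffBump (φ y₀) := ⟨r / 2, r, by positivity, by linarith⟩ with hχ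
  set C := φ.symm '' Metric.closedBall (φ y₀) (r / 2) with hC
  have hCc : IsCompact C := (isCompact_closedBall _ _).image_of_continuousOn
    ((continuousOn_extChartAt_symm (I := IY) y₀).mono hr2)
  have hCs : C ⊆ φ.source := by
    rintro _ ⟨v, hv, rfl⟩
    exact φ.map_target (hr2 hv)
  refine ⟨C, ?_, fun D hD hDC => ?_⟩
  · have h1 : C = φ.source ∩ φ ⁻¹' Metric.closedBall (φ y₀) (r / 2) :=
      φ.symm_image_eq_source_inter_preimage hr2
    rw [h1]
    exact inter_mem (extChartAt_source_mem_nhds (I := IY) y₀)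
      ((continuousAt_extChartAt (I := IY) y₀).preimage_mem_nhds
        (Metric.closedBall_mem_nhds _ (by positivity)))
  · have hfin : IsFiniteMeasure (m.restrict D) := ⟨by
      rw [Measure.restrict_apply_univ]
      exact (measure_mono hDC).trans_lt hCc.measure_lt_top⟩
    have hφm : AEMeasurable φ (m.restrict D) :=
      ((continuousOn_extChartAt (I := IY) y₀).mono (hDC.trans hCs)).aemeasurable hD
    have hfin' : IsFiniteMeasure ((m.restrict D).map φ) := Measure.isFiniteMeasure_map _ _
    intro z₀
    set ζ := extChartAt IZ z₀ with hζ
    have hG : ContDiffOn ℝ ∞ (fun q : EZ × EY => χ q.2 • g (ζ.symm q.1, φ.symm q.2))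
        (ζ.target ×ˢ univ) := by
      rintro ⟨p, v⟩ ⟨hp, -⟩
      refine ContDiffAt.contDiffWithinAt ?_
      by_cases hv : v ∈ Metric.closedBall (φ y₀) r
      · have h1 : ContMDiffAt 𝓘(ℝ, EZ × EY) (IZ.prod IY) ∞
            (fun q : EZ × EY => (ζ.symm q.1, φ.symm q.2)) (p, v) := by
          have h2 : ContMDiffAt 𝓘(ℝ, EZ) IZ ∞ ζ.symm p :=
            (contMDiffOn_extChartAt_symm (I := IZ) (n := ∞) z₀).contMDiffAt
              ((isOpen_extChartAt_target z₀).mem_nhds hp)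
          have h3 : ContMDiffAt 𝓘(ℝ, EY) IY ∞ φ.symm v :=
            (contMDiffOn_extChartAt_symm (I := IY) (n := ∞) y₀).contMDiffAt
              ((isOpen_extChartAt_target y₀).mem_nhds (hrt hv))
          exact (h2.comp (p, v) contDiff_fst.contMDiff.contMDiffAt).prodMk
            (h3.comp (p, v) contDiff_snd.contMDiff.contMDiffAt)
        have h2 := ((hg _).comp (p, v) h1).contDiffAt
        exact (χ.contDiff.comp contDiff_snd).contDiffAt.smul h2
      · have h1 : (fun q : EZ × EY => χ q.2 • g (ζ.symm q.1, φ.symm q.2)) =ᶠ[𝓝 (p, v)]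
            fun _ => 0 := by
          have h2 : ∀ᶠ q : EZ × EY in 𝓝 (p, v), q.2 ∈ (Metric.closedBall (φ y₀) r)ᶜ :=
            continuousAt_snd.preimage_mem_nhds
              (Metric.isClosed_closedBall.isOpen_compl.mem_nhds hv)
          filter_upwards [h2] with q hq
          rw [χ.zero_of_le_dist (not_le.1 (mem_compl_iff _ _ |>.1 hq)).le, zero_smul]
        exact contDiffAt_const.congr_of_eventuallyEq h1
    have hF := contDiffOn_integral_param ((m.restrict D).map φ)
      (isOpen_extChartAt_target (I := IZ) z₀) (isCompact_closedBall (φ y₀) r) hG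
      fun p v _ hv => by
        rw [χ.zero_of_le_dist (not_le.1 hv).le, zero_smul]
    have hFz : ContMDiffAt IZ 𝓘(ℝ, ℂ) ∞ ((fun p => ∫ v, χ v • g (ζ.symm p, φ.symm v)
        ∂(m.restrict D).map φ) ∘ ζ) z₀ :=
      ((hF.contDiffAt ((isOpen_extChartAt_target z₀).mem_nhds
        (mem_extChartAt_target z₀))).contMDiffAt).comp z₀ contMDiffAt_extChartAt
    refine hFz.congr_of_eventuallyEq ?_
    filter_upwards [extChartAt_source_mem_nhds (I := IZ) z₀] with z hz
    have hGz : Continuous fun v => χ v • g (ζ.symm (ζ z), φ.symm v) := by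
      have h2 : ContDiff ℝ ∞ fun v => χ v • g (ζ.symm (ζ z), φ.symm v) := by
        rw [← contDiffOn_univ]
        exact hG.comp (contDiff_const.prodMk contDiff_id).contDiffOn
          fun v _ => ⟨ζ.map_source hz, trivial⟩
      exact h2.continuous
    rw [Function.comp_apply, integral_map hφm hGz.aestronglyMeasurable]
    refine setIntegral_congr_fun hD fun y hy => ?_
    have hy1 := hCs (hDC hy)
    have hy2 : φ y ∈ Metric.closedBall (φ y₀) (r / 2) := by
      obtain ⟨v, hv, hvy⟩ := hDC hy
      rw [← hvy, φ.right_inv (hr2 hv)]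
      exact hv
    rw [φ.left_inv hy1, ζ.left_inv hz, χ.one_of_mem_closedBall hy2, one_smul]

/-- Integrals of smooth functions over compact sets are smooth in the parameters. -/
theorem contMDiff_integral_param {g : Z × Y → ℂ} (hg : ContMDiff (IZ.prod IY) 𝓘(ℝ, ℂ) ∞ g)
    {k : Set Y} (hk : IsCompact k) (hgk : ∀ z y, y ∉ k → g (z, y) = 0) :
    ContMDiff IZ 𝓘(ℝ, ℂ) ∞ fun z => ∫ y, g (z, y) ∂m := by
  have hint : ∀ z S, IntegrableOn (fun y => g (z, y)) S m := fun z S =>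
    (Continuous.integrable_of_hasCompactSupport
      (hg.continuous.comp (Continuous.prodMk_right z))
      (HasCompactSupport.intro hk fun y hy => hgk z y hy)).integrableOn
  -- Allowing every measurable D ⊆ C makes the property stable under unions, as D ⊆ C ∪ C' splits
  -- into D ∩ C and D \ C ⊆ C'; compact induction then passes from small neighbourhoods to k.
  have key : ∃ C, k ⊆ C ∧ MeasurableSet C ∧ ∀ D, MeasurableSet D → D ⊆ C →
      ContMDiff IZ 𝓘(ℝ, ℂ) ∞ fun z => ∫ y in D, g (z, y) ∂m := by
    refine hk.induction_on (p := fun S => ∃ C, S ⊆ C ∧ MeasurableSet C ∧ ∀ D, MeasurableSet D →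
      D ⊆ C → ContMDiff IZ 𝓘(ℝ, ℂ) ∞ fun z => ∫ y in D, g (z, y) ∂m) ?_ ?_ ?_ ?_
    · refine ⟨∅, le_rfl, MeasurableSet.empty, fun D _ hD => ?_⟩
      rw [subset_empty_iff.1 hD]
      simpa using contMDiff_const
    · rintro S S' hSS ⟨C, hC, h⟩
      exact ⟨C, hSS.trans hC, h⟩
    · rintro S S' ⟨C, hC, hCm, h⟩ ⟨C', hC', hCm', h'⟩
      refine ⟨C ∪ C', union_subset_union hC hC', hCm.union hCm', fun D hD hDC => ?_⟩
      have h1 : (fun z => ∫ y in D, g (z, y) ∂m) =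
          fun z => (∫ y in D ∩ C, g (z, y) ∂m) + ∫ y in D \ C, g (z, y) ∂m := by
        ext z
        exact (integral_inter_add_sdiff hCm (hint z D)).symm
      rw [h1]
      exact (h _ (hD.inter hCm) inter_subset_right).add
        (h' _ (hD.diff hCm) fun y hy => (hDC hy.1).resolve_left hy.2)
    · intro y _
      obtain ⟨C, hC, h⟩ := exists_nhds_contMDiff_setIntegral m hg y
      refine ⟨interior C, mem_nhdsWithin_of_mem_nhds (interior_mem_nhds.2 hC), interior C, le_rfl,
        isOpen_interior.measurableSet, fun D hD hDC => h D hD (hDC.trans interior_subset)⟩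
  obtain ⟨C, hkC, hCm, h⟩ := key
  have h1 : (fun z => ∫ y, g (z, y) ∂m) = fun z => ∫ y in C, g (z, y) ∂m := by
    ext z
    exact (setIntegral_eq_integral_of_forall_compl_eq_zero fun y hy =>
      hgk z y fun h => hy (hkC h)).symm
  rw [h1]
  exact h C hCm le_rfl

end ParametricIntegral

end

/-! ### Test functions in L² -/

noncomputable section

section TestFunctions

variable {EZ HZ : Type*} [NormedAddCommGroup EZ] [NormedSpace ℝ EZ] [TopologicalSpace HZ]
  (IZ : ModelWithCorners ℝ EZ HZ)
  (Z : Type*) [TopologicalSpace Z] [ChartedSpace HZ Z]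

/-- The smooth compactly supported complex functions. -/
def testFunctions : Submodule ℂ (Z → ℂ) where
  carrier := {ψ | ContMDiff IZ 𝓘(ℝ, ℂ) ∞ ψ ∧ HasCompactSupport ψ}
  add_mem' h h' := ⟨h.1.add h'.1, h.2.add h'.2⟩
  zero_mem' := ⟨contMDiff_const, HasCompactSupport.zero⟩
  smul_mem' c ψ h := ⟨((contDiff_const_smul c).comp contDiff_id).contMDiff.comp h.1, by
    have h1 : HasCompactSupport fun z => c * ψ z := h.2.mul_left (f := fun _ => c)
    exact h1⟩

variable {IZ Z}

variable [MeasurableSpace Z] [BorelSpace Z] (ρ : Measure Z) [IsFiniteMeasureOnCompacts ρ]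

theorem memLp_testFunctions {ψ : Z → ℂ} (hψ : ψ ∈ testFunctions IZ Z) : MemLp ψ 2 ρ :=
  hψ.1.continuous.memLp_of_hasCompactSupport hψ.2

/-- The class of a test function in `L²`. -/
def testToL2 : testFunctions IZ Z →ₗ[ℂ] Lp ℂ 2 ρ where
  toFun ψ := (memLp_testFunctions ρ ψ.2).toLp ψ.1
  map_add' _ _ := rfl
  map_smul' _ _ := rfl

theorem coeFn_testToL2 (ψ : testFunctions IZ Z) : testToL2 ρ ψ =ᵐ[ρ] (ψ : Z → ℂ) :=
  MemLp.coeFn_toLp (memLp_testFunctions ρ ψ.2)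

theorem eq_testToL2 (ψ : testFunctions IZ Z) {u : Lp ℂ 2 ρ} (hu : u =ᵐ[ρ] (ψ : Z → ℂ)) :
    u = testToL2 ρ ψ :=
  Lp.ext (hu.trans (coeFn_testToL2 ρ ψ).symm)

theorem inner_testToL2 (χ ψ : testFunctions IZ Z) :
    inner ℂ (testToL2 ρ χ) (testToL2 ρ ψ) = ∫ z, star (χ.1 z) * ψ.1 z ∂ρ := by
  rw [L2.inner_def]
  refine integral_congr_ae ?_
  filter_upwards [coeFn_testToL2 ρ χ, coeFn_testToL2 ρ ψ] with z h1 h2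
  rw [h1, h2, mul_comm]
  rfl

theorem norm_sq_testToL2 (ψ : testFunctions IZ Z) :
    ENNReal.ofReal (‖testToL2 ρ ψ‖ ^ 2) = ∫⁻ z, ENNReal.ofReal (‖ψ.1 z‖ ^ 2) ∂ρ := by
  rw [← ofReal_integral_eq_lintegral_ofReal]
  · congr 1
    have h1 := inner_testToL2 ρ ψ ψ
    rw [inner_self_eq_norm_sq_to_K] at h1
    have h2 : (∫ z, star (ψ.1 z) * ψ.1 z ∂ρ) = ((∫ z, ‖ψ.1 z‖ ^ 2 ∂ρ : ℝ) : ℂ) := by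
      refine Eq.trans ?_ (integral_ofReal (𝕜 := ℂ))
      refine integral_congr_ae (.of_forall fun z => ?_)
      exact (RCLike.conj_mul (ψ.1 z)).trans (by push_cast; rfl)
    rw [h2] at h1
    exact Complex.ofReal_injective ((Complex.ofReal_pow _ _).trans h1)
  · exact (memLp_testFunctions ρ ψ.2).integrable_norm_pow (by norm_num)
  · exact .of_forall fun z => by positivity

variable [FiniteDimensional ℝ EZ] [IZ.Boundaryless] [IsManifold IZ ∞ Z] [T2Space Z]
  [SigmaCompactSpace Z]

/-- A vector orthogonal to all test functions is locally integrable and integrates to 0 against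
every real test function, so it vanishes almost everywhere. -/
theorem denseRange_testToL2 : DenseRange (testToL2 (IZ := IZ) ρ) := by
  have h0 : (LinearMap.range (testToL2 (IZ := IZ) ρ)).topologicalClosure = ⊤ := by
    rw [Submodule.topologicalClosure_eq_top_iff, Submodule.eq_bot_iff]
    intro u hu
    have hloc : LocallyIntegrable u ρ := by
      have := IZ.locallyCompactSpace
      have := ChartedSpace.locallyCompactSpace HZ Z
      exact (Lp.memLp u).locallyIntegrable (by norm_num)
    have h1 := ae_eq_zero_of_integral_contMDiff_smul_eq_zero IZ hloc fun g hg hgc => by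
      have hψ : (fun z => (g z : ℂ)) ∈ testFunctions IZ Z :=
        ⟨Complex.ofRealCLM.contDiff.contMDiff.comp hg, hgc.comp_left (g := fun r : ℝ => (r : ℂ)) rfl⟩
      have h2 := hu _ ⟨⟨_, hψ⟩, rfl⟩
      rw [L2.inner_def] at h2
      rw [← h2]
      refine integral_congr_ae ?_
      filter_upwards [coeFn_testToL2 ρ ⟨_, hψ⟩] with z hz
      rw [hz]
      change g z • u z = u z * star ((g z : ℂ))
      rw [mul_comm]
      simp
    exact (Lp.eq_zero_iff_ae_eq_zero).2 h1
  intro u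
  have h1 : u ∈ (LinearMap.range (testToL2 (IZ := IZ) ρ)).topologicalClosure := by
    rw [h0]; trivial
  simpa using! h1

theorem exists_clm_of_testFunctions (Φ : testFunctions IZ Z →ₗ[ℂ] testFunctions IZ Z) {C : ℝ}
    (hΦ : ∀ ψ, ‖testToL2 ρ (Φ ψ)‖ ≤ C * ‖testToL2 ρ ψ‖) :
    ∃ T : Lp ℂ 2 ρ →L[ℂ] Lp ℂ 2 ρ, ∀ ψ, T (testToL2 ρ ψ) = testToL2 ρ (Φ ψ) :=
  ⟨((testToL2 ρ).comp Φ).extendOfNorm (testToL2 ρ), fun ψ =>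
    LinearMap.extendOfNorm_eq (denseRange_testToL2 ρ) ⟨C, hΦ⟩ ψ⟩

theorem clm_ext_testToL2 {T T' : Lp ℂ 2 ρ →L[ℂ] Lp ℂ 2 ρ}
    (h : ∀ ψ : testFunctions IZ Z, T (testToL2 ρ ψ) = T' (testToL2 ρ ψ)) : T = T' :=
  ContinuousLinearMap.coeFn_injective
    ((denseRange_testToL2 (IZ := IZ) ρ).equalizer T.continuous T'.continuous (funext h))

end TestFunctions

end

/-! ### Integral operators attached to measure-scaling involutions -/

noncomputable section

/-- Cauchy–Schwarz for g and the constant 1 on k. -/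
theorem sq_setLIntegral_le {Y : Type*} [MeasurableSpace Y] (m : Measure Y) (k : Set Y)
    {g : Y → ENNReal} (hg : Measurable g) :
    (∫⁻ y in k, g y ∂m) ^ 2 ≤ m k * ∫⁻ y in k, g y ^ 2 ∂m := by
  have h := ENNReal.lintegral_mul_le_Lp_mul_Lq (m.restrict k)
    (Real.HolderConjugate.two_two) (f := fun _ => 1) (g := g) aemeasurable_const hg.aemeasurable
  simp only [Pi.mul_apply, one_mul, ENNReal.rpow_two, one_pow, lintegral_one,
    Measure.restrict_apply_univ] at h
  refine (pow_le_pow_left' h 2).trans_eq ?_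
  have h2 : ∀ r : ENNReal, (r ^ (1 / 2 : ℝ)) ^ 2 = r := fun r => by
    rw [← ENNReal.rpow_two, ← ENNReal.rpow_mul]
    norm_num
  rw [mul_pow, h2, h2]

section Shift

variable {EZ HZ : Type*} [NormedAddCommGroup EZ] [NormedSpace ℝ EZ] [FiniteDimensional ℝ EZ]
  [TopologicalSpace HZ] {IZ : ModelWithCorners ℝ EZ HZ} [IZ.Boundaryless]
  {Z : Type*} [TopologicalSpace Z] [ChartedSpace HZ Z] [IsManifold IZ ∞ Z] [T2Space Z]
  [SecondCountableTopology Z] [SigmaCompactSpace Z] [MeasurableSpace Z] [BorelSpace Z]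
  {EY HY : Type*} [NormedAddCommGroup EY] [NormedSpace ℝ EY] [FiniteDimensional ℝ EY]
  [TopologicalSpace HY] {IY : ModelWithCorners ℝ EY HY} [IY.Boundaryless]
  {Y : Type*} [TopologicalSpace Y] [ChartedSpace HY Y] [Group Y] [LieGroup IY ∞ Y] [T2Space Y]
  [IsTopologicalGroup Y]
  [SecondCountableTopology Y] [MeasurableSpace Y] [BorelSpace Y]
  {ρ : Measure Z} [IsFiniteMeasureOnCompacts ρ] [SFinite ρ]
  {m : Measure Y} [IsFiniteMeasureOnCompacts m] [SFinite m]

variable (IZ IY ρ m) in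
/-- A family of maps of `Z`, with parameters in `Y`, such that `(z, y) ↦ (θ (z, y), y⁻¹)` is an
involution which multiplies the measure by the inverse square of a multiplicative weight. -/
structure Shift where
  toFun : Z × Y → Z
  weight : Z × Y → ℝ
  contMDiff_toFun : ContMDiff (IZ.prod IY) IZ ∞ toFun
  contMDiff_weight : ContMDiff (IZ.prod IY) 𝓘(ℝ, ℝ) ∞ weight
  weight_pos : ∀ p, 0 < weight p
  apply_apply : ∀ p, toFun (toFun p, p.2⁻¹) = p.1
  weight_mul : ∀ p, weight (toFun p, p.2⁻¹) * weight p = 1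
  lintegral_eq : ∀ H : Z × Y → ENNReal, Measurable H →
    ∫⁻ z, ∫⁻ y, ENNReal.ofReal (weight (z, y)) ^ 2 * H (toFun (z, y), y⁻¹) ∂m ∂ρ =
      ∫⁻ z, ∫⁻ y, H (z, y) ∂m ∂ρ

variable (IZ IY) in
/-- Smooth bounded kernels with uniformly compact support in the parameters. -/
structure IsShiftKernel (q : Z × Y → ℂ) : Prop where
  contMDiff : ContMDiff (IZ.prod IY) 𝓘(ℝ, ℂ) ∞ q
  bounded : ∃ C : ℝ, ∀ p, ‖q p‖ ≤ C
  compact : ∃ k : Set Y, IsCompact k ∧ ∀ z y, y ∉ k → q (z, y) = 0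

namespace Shift

variable (θ : Shift IZ IY ρ m)

/-- The involution of `Z × Y`. -/
def invol (p : Z × Y) : Z × Y := (θ.toFun p, p.2⁻¹)

theorem invol_invol (p : Z × Y) : θ.invol (θ.invol p) = p := by
  rw [invol, invol, inv_inv, θ.apply_apply]

theorem contMDiff_invol : ContMDiff (IZ.prod IY) (IZ.prod IY) ∞ θ.invol :=
  θ.contMDiff_toFun.prodMk ((contMDiff_inv IY ∞).comp contMDiff_snd)

theorem lintegral_invol {H : Z × Y → ENNReal} (hH : Measurable H) :
    ∫⁻ p, ENNReal.ofReal (θ.weight p) ^ 2 * H (θ.invol p) ∂ρ.prod m = ∫⁻ p, H p ∂ρ.prod m := by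
  rw [lintegral_prod _ hH.aemeasurable, lintegral_prod, ← θ.lintegral_eq H hH]
  · rfl
  · exact Measurable.aemeasurable (((ENNReal.measurable_ofReal.comp
      θ.contMDiff_weight.continuous.measurable).pow_const 2).mul
        (hH.comp θ.contMDiff_invol.continuous.measurable))

theorem map_invol : ((ρ.prod m).withDensity fun p => ENNReal.ofReal (θ.weight p) ^ 2).map θ.invol =
    ρ.prod m := by
  have hm := θ.contMDiff_invol.continuous.measurable
  have hw : Measurable fun p => ENNReal.ofReal (θ.weight p) ^ 2 :=
    (ENNReal.measurable_ofReal.comp θ.contMDiff_weight.continuous.measurable).pow_const 2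
  refine Measure.ext_of_lintegral _ fun H hH => ?_
  rw [lintegral_map hH hm, lintegral_withDensity_eq_lintegral_mul (g := fun a => H (θ.invol a)) _ hw
    (hH.comp hm), ← θ.lintegral_invol hH]
  rfl

theorem integral_invol {H : Z × Y → ℂ} (hH : Continuous H) :
    ∫ p, ((θ.weight p ^ 2 : ℝ) : ℂ) * H (θ.invol p) ∂ρ.prod m = ∫ p, H p ∂ρ.prod m := by
  have hm := θ.contMDiff_invol.continuous.measurable
  have hw : Measurable fun p => ENNReal.ofReal (θ.weight p) ^ 2 :=
    (ENNReal.measurable_ofReal.comp θ.contMDiff_weight.continuous.measurable).pow_const 2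
  conv_rhs => rw [← θ.map_invol]
  rw [integral_map hm.aemeasurable hH.aestronglyMeasurable,
    integral_withDensity_eq_integral_toReal_smul hw
      (.of_forall fun p => by simp)]
  refine integral_congr_ae (.of_forall fun p => ?_)
  beta_reduce
  rw [← ENNReal.ofReal_pow (θ.weight_pos p).le, ENNReal.toReal_ofReal (by positivity)]
  exact (Complex.real_smul).symm

/-- The operator with kernel `q`. -/
def op (q : Z × Y → ℂ) (ψ : Z → ℂ) (z : Z) : ℂ :=
  ∫ y, q (z, y) * (θ.weight (z, y) : ℂ) * ψ (θ.toFun (z, y)) ∂m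

/-- The kernel of the adjoint operator. -/
def adj (q : Z × Y → ℂ) (p : Z × Y) : ℂ := star (q (θ.invol p))

variable {θ} {q : Z × Y → ℂ}

theorem isShiftKernel_adj (hq : IsShiftKernel IZ IY q) : IsShiftKernel IZ IY (θ.adj q) where
  contMDiff := (Complex.conjCLE.contDiff.contMDiff (n := ∞)).comp
    (hq.contMDiff.comp θ.contMDiff_invol)
  bounded := by
    obtain ⟨C, hC⟩ := hq.bounded
    exact ⟨C, fun p => (norm_star _).trans_le (hC _)⟩
  compact := by
    obtain ⟨k, hk, h⟩ := hq.compact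
    refine ⟨k⁻¹, hk.inv, fun z y hy => ?_⟩
    rw [adj, invol, h _ _ fun h' => hy h', star_zero]

theorem contMDiff_integrand (hq : IsShiftKernel IZ IY q) {ψ : Z → ℂ}
    (hψ : ψ ∈ testFunctions IZ Z) : ContMDiff (IZ.prod IY) 𝓘(ℝ, ℂ) ∞
      fun p => q p * (θ.weight p : ℂ) * ψ (θ.toFun p) := by
  have h1 := (Complex.ofRealCLM.contDiff.contMDiff (n := ∞)).comp θ.contMDiff_weight
  exact contMDiffOn_univ.1 (DoubleLieGroup.contMDiffOn_complex_mul (DoubleLieGroup.contMDiffOn_complex_mul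
    (contMDiffOn_univ.2 hq.contMDiff) (contMDiffOn_univ.2 h1))
      (contMDiffOn_univ.2 (hψ.1.comp θ.contMDiff_toFun)))

theorem integrable_integrand (hq : IsShiftKernel IZ IY q) {ψ : Z → ℂ}
    (hψ : ψ ∈ testFunctions IZ Z) (z : Z) :
    Integrable (fun y => q (z, y) * (θ.weight (z, y) : ℂ) * ψ (θ.toFun (z, y))) m := by
  obtain ⟨k, hk, h⟩ := hq.compact
  refine Continuous.integrable_of_hasCompactSupport ((contMDiff_integrand hq hψ).continuous.comp
    (Continuous.prodMk_right z)) (HasCompactSupport.intro hk fun y hy => ?_)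
  rw [h z y hy, zero_mul, zero_mul]

theorem op_mem_testFunctions (hq : IsShiftKernel IZ IY q) {ψ : Z → ℂ}
    (hψ : ψ ∈ testFunctions IZ Z) : θ.op q ψ ∈ testFunctions IZ Z := by
  obtain ⟨k, hk, h⟩ := hq.compact
  refine ⟨contMDiff_integral_param m (contMDiff_integrand hq hψ) hk fun z y hy => by
    rw [h z y hy, zero_mul, zero_mul], ?_⟩
  -- If the integrand does not vanish, then y ∈ k and θ(z, y) lies in the support of ψ, and z =
  -- θ(θ(z, y), y⁻¹) is recovered from these.
  have hc : IsCompact (θ.toFun '' (tsupport ψ ×ˢ k⁻¹)) :=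
    (hψ.2.isCompact.prod hk.inv).image θ.contMDiff_toFun.continuous
  refine HasCompactSupport.intro hc fun z hz => ?_
  refine integral_eq_zero_of_ae (.of_forall fun y => ?_)
  by_cases hy : y ∈ k
  · have h1 : ψ (θ.toFun (z, y)) = 0 := by
      by_contra h2
      exact hz ⟨(θ.toFun (z, y), y⁻¹), ⟨subset_tsupport _ h2, by simpa using hy⟩,
        θ.apply_apply (z, y)⟩
    simp only [h1, mul_zero, Pi.zero_apply]
  · simp only [h z y hy, zero_mul, Pi.zero_apply]

variable (θ) in
/-- The operator with kernel `q`, on test functions. -/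
def opLinear (hq : IsShiftKernel IZ IY q) : testFunctions IZ Z →ₗ[ℂ] testFunctions IZ Z where
  toFun ψ := ⟨θ.op q ψ.1, op_mem_testFunctions hq ψ.2⟩
  map_add' ψ ψ' := by
    ext z
    change θ.op q (ψ.1 + ψ'.1) z = θ.op q ψ.1 z + θ.op q ψ'.1 z
    rw [op, op, op, ← integral_add (integrable_integrand hq ψ.2 z)
      (integrable_integrand hq ψ'.2 z)]
    simp only [Pi.add_apply, mul_add]
  map_smul' c ψ := by
    ext z
    change θ.op q (c • ψ.1) z = c * θ.op q ψ.1 z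
    rw [op, op, ← integral_const_mul]
    refine integral_congr_ae (.of_forall fun y => ?_)
    simp only [Pi.smul_apply, smul_eq_mul]
    ring

/-- Cauchy–Schwarz over the compact set k of parameters bounds |op ψ(z)|² by an integral of
w²|ψ(θ)|². Integrated in z, the involution removes w² and turns the domain k into k⁻¹, so the
squared norm is at most C² m(k) m(k⁻¹) times that of ψ. -/
theorem exists_opLinear_bound (hq : IsShiftKernel IZ IY q) : ∃ C : ℝ, ∀ ψ : testFunctions IZ Z,
    ‖testToL2 ρ (θ.opLinear hq ψ)‖ ≤ C * ‖testToL2 ρ ψ‖ := by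
  obtain ⟨C, hC⟩ := hq.bounded
  obtain ⟨k, hk, hqk⟩ := hq.compact
  set M : ENNReal := ENNReal.ofReal C ^ 2 * m k * m k⁻¹ with hM
  have hMt : M ≠ ⊤ := ENNReal.mul_ne_top (ENNReal.mul_ne_top (by simp) hk.measure_lt_top.ne)
    hk.inv.measure_lt_top.ne
  refine ⟨√M.toReal, fun ψ => ?_⟩
  have hw : Measurable fun p => ENNReal.ofReal (θ.weight p) :=
    ENNReal.measurable_ofReal.comp θ.contMDiff_weight.continuous.measurable
  have hψm : Measurable fun z => ‖ψ.1 z‖ₑ := ψ.2.1.continuous.enorm.measurable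
  have hθ := θ.contMDiff_toFun.continuous.measurable
  have h1 : ∀ z, ‖θ.op q ψ.1 z‖ₑ ^ 2 ≤ ENNReal.ofReal C ^ 2 * m k *
      ∫⁻ y in k, ENNReal.ofReal (θ.weight (z, y)) ^ 2 * ‖ψ.1 (θ.toFun (z, y))‖ₑ ^ 2 ∂m := by
    intro z
    set g : Y → ENNReal := fun y =>
      ENNReal.ofReal (θ.weight (z, y)) * ‖ψ.1 (θ.toFun (z, y))‖ₑ with hg
    have hgm : Measurable g := (hw.comp measurable_prodMk_left).mul
      (hψm.comp (hθ.comp measurable_prodMk_left))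
    have h2 : ‖θ.op q ψ.1 z‖ₑ ≤ ENNReal.ofReal C * ∫⁻ y in k, g y ∂m := by
      refine (enorm_integral_le_lintegral_enorm _).trans ?_
      rw [← lintegral_const_mul _ hgm, ← lintegral_indicator hk.measurableSet]
      refine lintegral_mono fun y => ?_
      by_cases hy : y ∈ k
      · rw [indicator_of_mem hy, enorm_mul, enorm_mul, mul_assoc]
        refine mul_le_mul' ?_ (mul_le_mul' (le_of_eq ?_) le_rfl)
        · rw [← ofReal_norm]
          exact ENNReal.ofReal_le_ofReal (hC _)
        · rw [← ofReal_norm, Complex.norm_real, Real.norm_of_nonneg (θ.weight_pos _).le]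
      · rw [hqk z y hy]
        simp
    refine (pow_le_pow_left' h2 2).trans ?_
    rw [mul_pow, mul_assoc]
    refine mul_le_mul' le_rfl ((sq_setLIntegral_le m k hgm).trans_eq ?_)
    simp only [hg, mul_pow]
  have h3 : ∫⁻ z, ‖θ.op q ψ.1 z‖ₑ ^ 2 ∂ρ ≤ M * ∫⁻ z, ‖ψ.1 z‖ₑ ^ 2 ∂ρ := by
    refine (lintegral_mono h1).trans_eq ?_
    have h5 : Measurable fun p : Z × Y => k⁻¹.indicator (fun _ => (1 : ENNReal)) p.2 * ‖ψ.1 p.1‖ₑ ^ 2 :=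
      ((measurable_const.indicator hk.inv.measurableSet).comp measurable_snd).mul
        ((hψm.comp measurable_fst).pow_const 2)
    have h4 := θ.lintegral_eq _ h5
    have h6 : ∀ z, ∫⁻ y in k, ENNReal.ofReal (θ.weight (z, y)) ^ 2 * ‖ψ.1 (θ.toFun (z, y))‖ₑ ^ 2 ∂m =
        ∫⁻ y, ENNReal.ofReal (θ.weight (z, y)) ^ 2 * (k⁻¹.indicator (fun _ => (1 : ENNReal)) y⁻¹ *
          ‖ψ.1 (θ.toFun (z, y))‖ₑ ^ 2) ∂m := by
      intro z
      rw [← lintegral_indicator hk.measurableSet]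
      refine lintegral_congr fun y => ?_
      by_cases hy : y ∈ k
      · rw [indicator_of_mem hy, indicator_of_mem (by simpa using hy), one_mul]
      · rw [indicator_of_notMem hy, indicator_of_notMem (by simpa using hy), zero_mul, mul_zero]
    have h7 : Measurable fun z => ∫⁻ y in k, ENNReal.ofReal (θ.weight (z, y)) ^ 2 *
        ‖ψ.1 (θ.toFun (z, y))‖ₑ ^ 2 ∂m :=
      Measurable.lintegral_prod_right' (f := fun p : Z × Y => ENNReal.ofReal (θ.weight p) ^ 2 *
        ‖ψ.1 (θ.toFun p)‖ₑ ^ 2) ((hw.pow_const 2).mul ((hψm.comp hθ).pow_const 2))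
    rw [lintegral_const_mul _ h7]
    simp only [h6]
    rw [h4, hM, mul_assoc (_ * _)]
    congr 1
    rw [← lintegral_const_mul _ (hψm.pow_const 2)]
    refine lintegral_congr fun z => ?_
    refine (lintegral_mul_const (‖ψ.1 z‖ₑ ^ 2)
      (measurable_const.indicator hk.inv.measurableSet)).trans ?_
    congr 1
    exact lintegral_indicator_one hk.inv.measurableSet
  have h4 : ‖testToL2 ρ (θ.opLinear hq ψ)‖ ^ 2 ≤ M.toReal * ‖testToL2 ρ ψ‖ ^ 2 := by
    have e := norm_sq_testToL2 ρ (θ.opLinear hq ψ)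
    have e' := norm_sq_testToL2 ρ ψ
    have h5 : ∀ c : ℂ, ENNReal.ofReal (‖c‖ ^ 2) = ‖c‖ₑ ^ 2 := fun c => by
      rw [ENNReal.ofReal_pow (norm_nonneg _), ofReal_norm]
    simp only [h5] at e e'
    rw [← ENNReal.ofReal_le_ofReal_iff (by positivity), e,
      ENNReal.ofReal_mul ENNReal.toReal_nonneg, e', ENNReal.ofReal_toReal hMt]
    exact h3
  refine abs_le_of_sq_le_sq' ?_ (by positivity) |>.2
  rw [mul_pow, Real.sq_sqrt ENNReal.toReal_nonneg]
  exact h4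

/-- Both sides are integrals over Z × Y, related by the substitution p ↦ `invol p`. The substitution
brings in w(p)², and w(`invol p`)w(p) = 1 reduces the weights to the single factor w(p). -/
theorem inner_opLinear (hq : IsShiftKernel IZ IY q) (χ ψ : testFunctions IZ Z) :
    inner ℂ (testToL2 ρ χ) (testToL2 ρ (θ.opLinear hq ψ)) =
      inner ℂ (testToL2 ρ (θ.opLinear (isShiftKernel_adj (θ := θ) hq) χ)) (testToL2 ρ ψ) := by
  rw [inner_testToL2, inner_testToL2]
  obtain ⟨k, hk, hqk⟩ := hq.compact
  set H : Z × Y → ℂ := fun p => star (χ.1 (θ.toFun p)) * q (θ.invol p) * (θ.weight p : ℂ) * ψ.1 p.1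
    with hH
  have hHc : Continuous H := (((χ.2.1.continuous.comp θ.contMDiff_toFun.continuous).star.mul
    (hq.contMDiff.continuous.comp θ.contMDiff_invol.continuous)).mul
      (Complex.continuous_ofReal.comp θ.contMDiff_weight.continuous)).mul
        (ψ.2.1.continuous.comp continuous_fst)
  have hHs : HasCompactSupport H := by
    refine HasCompactSupport.intro (ψ.2.2.isCompact.prod hk.inv) fun p hp => ?_
    by_cases h1 : p.2⁻¹ ∈ k
    · have h2 : ψ.1 p.1 = 0 := by
        by_contra h3
        exact hp ⟨subset_tsupport _ h3, h1⟩
      simp only [hH, h2, mul_zero]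
    · simp only [hH, invol, hqk _ _ h1, mul_zero, zero_mul]
  have hHi : Integrable H (ρ.prod m) := hHc.integrable_of_hasCompactSupport hHs
  set H' : Z × Y → ℂ := fun p => star (χ.1 p.1) * (q p * (θ.weight p : ℂ) * ψ.1 (θ.toFun p)) with hH'
  have hH'c : Continuous H' := (χ.2.1.continuous.comp continuous_fst).star.mul
    (contMDiff_integrand hq ψ.2).continuous
  have hH's : HasCompactSupport H' := by
    refine HasCompactSupport.intro (χ.2.2.isCompact.prod hk) fun p hp => ?_
    by_cases h1 : p.2 ∈ k
    · have h2 : χ.1 p.1 = 0 := by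
        by_contra h3
        exact hp ⟨subset_tsupport _ h3, h1⟩
      simp only [hH', h2, star_zero, zero_mul]
    · simp only [hH', show q p = 0 from hqk _ _ h1, mul_zero, zero_mul]
  have hH'i : Integrable H' (ρ.prod m) := hH'c.integrable_of_hasCompactSupport hH's
  have e1 : ∫ z, star (χ.1 z) * (θ.opLinear hq ψ).1 z ∂ρ = ∫ p, H' p ∂ρ.prod m := by
    rw [integral_prod _ hH'i]
    refine integral_congr_ae (.of_forall fun z => ?_)
    exact (integral_const_mul _ _).symm
  have e2 : ∫ z, star ((θ.opLinear (isShiftKernel_adj (θ := θ) hq) χ).1 z) * ψ.1 z ∂ρ =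
      ∫ p, H p ∂ρ.prod m := by
    rw [integral_prod _ hHi]
    refine integral_congr_ae (.of_forall fun z => ?_)
    have h1 : star ((θ.opLinear (isShiftKernel_adj (θ := θ) hq) χ).1 z) = ∫ y,
        star (θ.adj q (z, y) * (θ.weight (z, y) : ℂ) * χ.1 (θ.toFun (z, y))) ∂m := integral_conj.symm
    beta_reduce
    rw [h1, ← integral_mul_const]
    refine integral_congr_ae (.of_forall fun y => ?_)
    have h2 : star ((θ.weight (z, y) : ℂ)) = (θ.weight (z, y) : ℂ) := Complex.conj_ofReal _
    simp only [hH, star_mul', adj, star_star, h2]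
    ring
  rw [e1, e2, ← θ.integral_invol hHc]
  refine integral_congr_ae (.of_forall fun p => ?_)
  have h1 : (θ.weight (θ.invol p) : ℂ) * (θ.weight p : ℂ) = 1 := by
    exact_mod_cast θ.weight_mul p
  have h2 : θ.toFun (θ.invol p) = p.1 := θ.apply_apply p
  simp only [hH, hH', invol_invol, h2]
  push_cast
  have h3 : (θ.invol p).1 = θ.toFun p := rfl
  rw [h3]
  linear_combination (-(star (χ.1 p.1) * q p * (θ.weight p : ℂ) * ψ.1 (θ.toFun p))) * h1

theorem exists_clm_op (hq : IsShiftKernel IZ IY q) : ∃ T : Lp ℂ 2 ρ →L[ℂ] Lp ℂ 2 ρ,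
    ∀ ψ, T (testToL2 ρ ψ) = testToL2 ρ (θ.opLinear hq ψ) := by
  obtain ⟨C, hC⟩ := exists_opLinear_bound (θ := θ) hq
  exact exists_clm_of_testFunctions ρ _ hC

/-- The bounded operator with kernel `q`. -/
def clm (hq : IsShiftKernel IZ IY q) : Lp ℂ 2 ρ →L[ℂ] Lp ℂ 2 ρ :=
  Classical.choose (exists_clm_op (θ := θ) hq)

theorem clm_apply (hq : IsShiftKernel IZ IY q) (ψ : testFunctions IZ Z) :
    clm (θ := θ) hq (testToL2 ρ ψ) = testToL2 ρ (θ.opLinear hq ψ) :=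
  Classical.choose_spec (exists_clm_op (θ := θ) hq) ψ

theorem star_clm (hq : IsShiftKernel IZ IY q) :
    star (clm (θ := θ) hq) = clm (θ := θ) (isShiftKernel_adj (θ := θ) hq) := by
  refine clm_ext_testToL2 (IZ := IZ) ρ fun χ => ?_
  refine (denseRange_testToL2 (IZ := IZ) ρ).eq_of_inner_left (𝕜 := ℂ) fun ψ => ?_
  rw [ContinuousLinearMap.star_eq_adjoint, ContinuousLinearMap.adjoint_inner_left, clm_apply,
    clm_apply, inner_opLinear]

end Shift

end Shift

end

/-! ### The reference measure and its invariance under groupoid translations -/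

noncomputable section

variable {E H : Type*} [NormedAddCommGroup E] [NormedSpace ℝ E] [FiniteDimensional ℝ E]
  [TopologicalSpace H]
  {EA HA : Type*} [NormedAddCommGroup EA] [NormedSpace ℝ EA] [FiniteDimensional ℝ EA]
  [TopologicalSpace HA]
  {EB HB : Type*} [NormedAddCommGroup EB] [NormedSpace ℝ EB] [FiniteDimensional ℝ EB]
  [TopologicalSpace HB]
  {I : ModelWithCorners ℝ E H} [I.Boundaryless]
  {JA : ModelWithCorners ℝ EA HA} [JA.Boundaryless]
  {JB : ModelWithCorners ℝ EB HB} [JB.Boundaryless]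
  {G A B : Type*} [TopologicalSpace G] [ChartedSpace H G] [Group G] [LieGroup I ∞ G]
  [T2Space G] [SecondCountableTopology G]
  [TopologicalSpace A] [ChartedSpace HA A] [Group A] [LieGroup JA ∞ A]
  [TopologicalSpace B] [ChartedSpace HB B] [Group B] [LieGroup JB ∞ B]
  (𝒟 : DoubleLieGroup I JA JB G A B)

  [MeasurableSpace G] [BorelSpace G] [MeasurableSpace A] [BorelSpace A] [MeasurableSpace B]
  [BorelSpace B] [IsTopologicalGroup G] [IsTopologicalGroup A] [IsTopologicalGroup B]
  [LocallyCompactSpace A] [LocallyCompactSpace B]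
  [T2Space A] [T2Space B] [SecondCountableTopology A] [SecondCountableTopology B]
  (μ : Measure B) [μ.IsHaarMeasure] (ν : Measure A) [ν.IsHaarMeasure]

theorem lintegral_inv_mul_prod {R : B × B → ENNReal} (hR : Measurable R) :
    ∫⁻ p, R (p.1⁻¹, p.2 * p.1) ∂μ.prod μ = ∫⁻ p, R p ∂μ.prod μ := by
  have hs : Measurable fun q : B × B => R (q.2, q.1) := hR.comp measurable_swap
  exact ((measurePreserving_mul_prod_inv μ μ).lintegral_comp hs).trans (lintegral_prod_swap _)

namespace DoubleLieGroup

theorem continuous_iA : Continuous 𝒟.iA := 𝒟.smooth_iA.continuous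

theorem continuous_iB : Continuous 𝒟.iB := 𝒟.smooth_iB.continuous

theorem continuous_act_comp {T : Type*} [TopologicalSpace T] {a : T → A} {b : T → B}
    (ha : Continuous a) (hb : Continuous b) : Continuous fun t => 𝒟.act (a t) (b t) :=
  (contMDiff_act 𝒟).continuous.comp (ha.prodMk hb)

/-- The density of the reference measure with respect to the product of Haar measures. -/
def refWeight (g : G) : ENNReal := ENNReal.ofReal |𝒟.psiB (𝒟.aL g)|⁻¹

theorem refWeight_ne_top (g : G) : 𝒟.refWeight g ≠ ⊤ := ENNReal.ofReal_ne_top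

theorem measurable_refWeight : Measurable 𝒟.refWeight :=
  ENNReal.measurable_ofReal.comp (((𝒟.contMDiff_psiB.comp
    𝒟.contMDiff_aL).continuous.abs.inv₀ fun _ => abs_ne_zero.2 (𝒟.psiB_ne_zero _)).measurable)

theorem lintegral_refMeasure {H : G → ENNReal} (hH : Measurable H) :
    ∫⁻ g, H g ∂𝒟.refMeasure μ ν = ∫⁻ a, ∫⁻ c, 𝒟.refWeight ((𝒟.iB c)⁻¹ * 𝒟.iA a) *
      H ((𝒟.iB c)⁻¹ * 𝒟.iA a) ∂μ ∂ν := by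
  have hm : Measurable fun p : B × A => 𝒟.iB p.1 * 𝒟.iA p.2 :=
    ((𝒟.continuous_iB.comp continuous_fst).mul (𝒟.continuous_iA.comp continuous_snd)).measurable
  have hw := 𝒟.measurable_refWeight
  rw [refMeasure]
  refine (lintegral_withDensity_eq_lintegral_mul _ hw hH).trans ?_
  rw [lintegral_map (hw.mul hH) hm]
  refine (lintegral_prod_symm _ ((hw.mul hH).comp hm).aemeasurable).trans ?_
  refine lintegral_congr fun a => ?_
  rw [Measure.inv]
  refine (lintegral_map (((hw.mul hH).comp hm).comp measurable_prodMk_right)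
    measurable_inv).trans (lintegral_congr fun c => ?_)
  simp only [Function.comp_apply, map_inv, Pi.mul_apply]

/-- Substitute β = a_L(z) ▷ b. The Jacobian is ψ_B(a_L(z) ◁ b), and a_L(z) ◁ b = a_L(β⁻¹z), so its
inverse is the density of the reference measure at the translated point β⁻¹z. -/
theorem lintegral_eq_lintegral_act (z : G) {F : B → ENNReal} (hF : Measurable F) :
    ∫⁻ b, F b ∂μ = ∫⁻ β, F (𝒟.act (𝒟.aL z)⁻¹ β) * 𝒟.refWeight ((𝒟.iB β)⁻¹ * z) ∂μ := by
  refine Eq.trans ?_ (lintegral_act 𝒟 μ (𝒟.aL z)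
    (F := fun β => F (𝒟.act (𝒟.aL z)⁻¹ β) * 𝒟.refWeight ((𝒟.iB β)⁻¹ * z)) ?_)
  · refine lintegral_congr fun b => ?_
    rw [act_inv_act, refWeight, aL_inv_act_mul _ _ _ _ rfl, mul_assoc,
      ← ENNReal.ofReal_mul (by positivity),
      inv_mul_cancel₀ (abs_ne_zero.2 (𝒟.psiB_ne_zero _)), ENNReal.ofReal_one, mul_one]
  · exact (hF.comp (𝒟.continuous_act_comp continuous_const continuous_id).measurable).mul
      (𝒟.measurable_refWeight.comp
        ((𝒟.continuous_iB.inv.mul continuous_const).measurable))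

/-- In the coordinate β of the substitution, groupoid inversion is β ↦ β⁻¹ combined with moving the
base point from z to β⁻¹z. -/
theorem act_aL_inv_mul (z : G) (β : B) :
    𝒟.act (𝒟.aL ((𝒟.iB β)⁻¹ * z))⁻¹ β⁻¹ = (𝒟.act (𝒟.aL z)⁻¹ β)⁻¹ := by
  obtain ⟨b, rfl⟩ : ∃ b, β = 𝒟.act (𝒟.aL z) b := ⟨𝒟.act (𝒟.aL z)⁻¹ β, by rw [act_act_inv]⟩
  rw [aL_inv_act_mul _ _ _ _ rfl, act_inv_act, ← act_coact_inv, act_inv_act]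

instance sFinite_refMeasure : SFinite (𝒟.refMeasure μ ν) := by
  unfold refMeasure
  infer_instance

instance isFiniteMeasureOnCompacts_refMeasure : IsFiniteMeasureOnCompacts (𝒟.refMeasure μ ν) where
  lt_top_of_isCompact := by
    intro K hK
    have hw := 𝒟.measurable_refWeight
    have hm : Measurable fun p : B × A => 𝒟.iB p.1 * 𝒟.iA p.2 :=
      ((𝒟.continuous_iB.comp continuous_fst).mul (𝒟.continuous_iA.comp continuous_snd)).measurable
    obtain ⟨M, hM⟩ := (hK.image (((𝒟.contMDiff_psiB.comp
      𝒟.contMDiff_aL).continuous.abs.inv₀ fun _ =>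
        abs_ne_zero.2 (𝒟.psiB_ne_zero _)))).bddAbove
    rw [refMeasure, withDensity_apply _ hK.measurableSet]
    refine (setLIntegral_mono' hK.measurableSet (g := fun _ => ENNReal.ofReal M) fun g hg =>
      ENNReal.ofReal_le_ofReal (hM ⟨g, hg, rfl⟩)).trans_lt ?_
    rw [setLIntegral_const, Measure.map_apply hm hK.measurableSet]
    refine ENNReal.mul_lt_top ENNReal.ofReal_lt_top ?_
    have h1 : (fun p : B × A => 𝒟.iB p.1 * 𝒟.iA p.2) ⁻¹' K ⊆ (𝒟.bL '' K) ×ˢ (𝒟.aR '' K) := by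
      rintro ⟨b, a⟩ h
      exact ⟨⟨_, h, by simp⟩, ⟨_, h, by simp⟩⟩
    refine (measure_mono h1).trans_lt ?_
    exact ((hK.image 𝒟.contMDiff_bL.continuous).prod
      (hK.image 𝒟.contMDiff_aR.continuous)).measure_lt_top

/-- Left translations by `B` along the groupoid, for the reference measure. -/
theorem lintegral_refMeasure_invol {H : G × B → ENNReal} (hH : Measurable H) :
    ∫⁻ z, ∫⁻ b, H ((𝒟.iB (𝒟.act (𝒟.aL z) b))⁻¹ * z, b⁻¹) ∂μ ∂𝒟.refMeasure μ ν =
      ∫⁻ z, ∫⁻ b, H (z, b) ∂μ ∂𝒟.refMeasure μ ν := by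
  have hw := 𝒟.measurable_refWeight
  have haL := 𝒟.contMDiff_aL.continuous
  have c1 : Continuous fun p : G × B => (𝒟.iB (𝒟.act (𝒟.aL p.1) p.2))⁻¹ * p.1 :=
    (𝒟.continuous_iB.comp (𝒟.continuous_act_comp (haL.comp continuous_fst)
      continuous_snd)).inv.mul continuous_fst
  have m1 : Measurable fun p : G × B => H ((𝒟.iB (𝒟.act (𝒟.aL p.1) p.2))⁻¹ * p.1, p.2⁻¹) :=
    hH.comp ((c1.prodMk continuous_snd.inv).measurable)
  have m2 : ∀ z, Measurable fun b => H ((𝒟.iB (𝒟.act (𝒟.aL z) b))⁻¹ * z, b⁻¹) := by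
    intro z
    have h := m1.comp (measurable_prodMk_left (x := z))
    simp only [Function.comp_def] at h
    exact h
  have hact : Continuous fun p : G × B => 𝒟.act (𝒟.aL p.1)⁻¹ p.2 :=
    𝒟.continuous_act_comp (haL.comp continuous_fst).inv continuous_snd
  -- With z = c⁻¹a and β = a_L(z) ▷ b, the weights are those at c⁻¹a and at β⁻¹c⁻¹a. The map (β, c)
  -- ↦ (β⁻¹, cβ) exchanges the two points and preserves μ × μ, and it is exactly the involution (z,
  -- b) ↦ ((a_L(z) ▷ b)⁻¹z, b⁻¹) in these coordinates.
  set R : A → B × B → ENNReal := fun a p => 𝒟.refWeight ((𝒟.iB p.2)⁻¹ * 𝒟.iA a) *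
    (𝒟.refWeight ((𝒟.iB p.1)⁻¹ * ((𝒟.iB p.2)⁻¹ * 𝒟.iA a)) *
      H ((𝒟.iB p.2)⁻¹ * 𝒟.iA a, 𝒟.act (𝒟.aL ((𝒟.iB p.2)⁻¹ * 𝒟.iA a))⁻¹ p.1)) with hR
  have c2 : ∀ a, Continuous fun p : B × B => (𝒟.iB p.2)⁻¹ * 𝒟.iA a := fun a =>
    (𝒟.continuous_iB.comp continuous_snd).inv.mul continuous_const
  have hRm : ∀ a, Measurable (R a) := fun a =>
    (hw.comp (c2 a).measurable).mul ((hw.comp ((𝒟.continuous_iB.comp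
      continuous_fst).inv.mul (c2 a)).measurable).mul (hH.comp ((c2 a).prodMk
        (hact.comp ((c2 a).prodMk continuous_fst))).measurable))
  rw [𝒟.lintegral_refMeasure μ ν m1.lintegral_prod_right',
    𝒟.lintegral_refMeasure μ ν hH.lintegral_prod_right']
  refine lintegral_congr fun a => ?_
  have e1 : ∫⁻ c, 𝒟.refWeight ((𝒟.iB c)⁻¹ * 𝒟.iA a) *
      ∫⁻ b, H ((𝒟.iB c)⁻¹ * 𝒟.iA a, b) ∂μ ∂μ = ∫⁻ p, R a p ∂μ.prod μ := by
    rw [lintegral_prod_symm _ (hRm a).aemeasurable]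
    refine lintegral_congr fun c => ?_
    rw [𝒟.lintegral_eq_lintegral_act μ ((𝒟.iB c)⁻¹ * 𝒟.iA a)
      (F := fun b => H ((𝒟.iB c)⁻¹ * 𝒟.iA a, b)) (hH.comp measurable_prodMk_left)]
    refine (lintegral_const_mul' _ _ (𝒟.refWeight_ne_top _)).symm.trans ?_
    exact lintegral_congr fun β => by simp only [hR, mul_comm]
  have e2 : ∫⁻ c, 𝒟.refWeight ((𝒟.iB c)⁻¹ * 𝒟.iA a) *
      ∫⁻ b, H ((𝒟.iB (𝒟.act (𝒟.aL ((𝒟.iB c)⁻¹ * 𝒟.iA a)) b))⁻¹ * ((𝒟.iB c)⁻¹ * 𝒟.iA a), b⁻¹)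
        ∂μ ∂μ = ∫⁻ p, R a (p.1⁻¹, p.2 * p.1) ∂μ.prod μ := by
    have hm : Measurable fun p : B × B => R a (p.1⁻¹, p.2 * p.1) := (hRm a).comp (by fun_prop)
    rw [lintegral_prod_symm _ hm.aemeasurable]
    refine lintegral_congr fun c => ?_
    rw [𝒟.lintegral_eq_lintegral_act μ ((𝒟.iB c)⁻¹ * 𝒟.iA a) (m2 ((𝒟.iB c)⁻¹ * 𝒟.iA a)),
      ← lintegral_const_mul' _ _ (𝒟.refWeight_ne_top _)]
    refine lintegral_congr fun β => ?_
    have h1 : (𝒟.iB (c * β))⁻¹ * 𝒟.iA a = (𝒟.iB β)⁻¹ * ((𝒟.iB c)⁻¹ * 𝒟.iA a) := by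
      rw [map_mul, mul_inv_rev, mul_assoc]
    have h2 : (𝒟.iB β⁻¹)⁻¹ * ((𝒟.iB β)⁻¹ * ((𝒟.iB c)⁻¹ * 𝒟.iA a)) =
        (𝒟.iB c)⁻¹ * 𝒟.iA a := by
      rw [map_inv, inv_inv, mul_inv_cancel_left]
    simp only [hR, h1, h2, act_aL_inv_mul, act_act_inv]
    ring
  rw [e1, ← lintegral_inv_mul_prod μ (hRm a), ← e2]

end DoubleLieGroup

end

/-! ### The reference measure of the product, and shifts in one variable -/

noncomputable section

variable {E H : Type*} [NormedAddCommGroup E] [NormedSpace ℝ E] [FiniteDimensional ℝ E]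
  [TopologicalSpace H]
  {EA HA : Type*} [NormedAddCommGroup EA] [NormedSpace ℝ EA] [FiniteDimensional ℝ EA]
  [TopologicalSpace HA]
  {EB HB : Type*} [NormedAddCommGroup EB] [NormedSpace ℝ EB] [FiniteDimensional ℝ EB]
  [TopologicalSpace HB]
  {I : ModelWithCorners ℝ E H} [I.Boundaryless]
  {JA : ModelWithCorners ℝ EA HA} [JA.Boundaryless]
  {JB : ModelWithCorners ℝ EB HB} [JB.Boundaryless]
  {G A B : Type*} [TopologicalSpace G] [ChartedSpace H G] [Group G] [LieGroup I ∞ G]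
  [T2Space G] [SecondCountableTopology G]
  [TopologicalSpace A] [ChartedSpace HA A] [Group A] [LieGroup JA ∞ A]
  [TopologicalSpace B] [ChartedSpace HB B] [Group B] [LieGroup JB ∞ B]
  (𝒟 : DoubleLieGroup I JA JB G A B)

  [MeasurableSpace G] [BorelSpace G] [MeasurableSpace A] [BorelSpace A] [MeasurableSpace B]
  [BorelSpace B] [IsTopologicalGroup G] [IsTopologicalGroup A] [IsTopologicalGroup B]
  [LocallyCompactSpace A] [LocallyCompactSpace B]
  [T2Space A] [T2Space B] [SecondCountableTopology A] [SecondCountableTopology B]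
  (μ : Measure B) [μ.IsHaarMeasure] (ν : Measure A) [ν.IsHaarMeasure]
  [LocallyCompactSpace G]

namespace DoubleLieGroup

/-- In the coordinates z = c⁻¹a, left translation by β is c ↦ cβ⁻¹, which scales Haar measure by
|φ_B(β)|. The reference density at z and the explicit weight at βz change places. -/
theorem lintegral_refMeasure_shift (β : B) {R : G → ENNReal} (hR : Measurable R) :
    ENNReal.ofReal |𝒟.phiB β| * ∫⁻ z, 𝒟.refWeight (𝒟.iB β * z) * R (𝒟.iB β * z)
      ∂𝒟.refMeasure μ ν = ∫⁻ z, 𝒟.refWeight ((𝒟.iB β)⁻¹ * z) * R z ∂𝒟.refMeasure μ ν := by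
  have hw := 𝒟.measurable_refWeight
  have h1 : Measurable fun z => 𝒟.refWeight (𝒟.iB β * z) * R (𝒟.iB β * z) :=
    (hw.mul hR).comp (measurable_const_mul _)
  have h2 : Measurable fun z => 𝒟.refWeight ((𝒟.iB β)⁻¹ * z) * R z :=
    (hw.comp (measurable_const_mul _)).mul hR
  rw [𝒟.lintegral_refMeasure μ ν h1, 𝒟.lintegral_refMeasure μ ν h2,
    ← lintegral_const_mul' _ _ ENNReal.ofReal_ne_top]
  refine lintegral_congr fun a => ?_
  have h3 : Measurable fun c : B => 𝒟.refWeight ((𝒟.iB c)⁻¹ * 𝒟.iA a) *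
      (𝒟.refWeight ((𝒟.iB β)⁻¹ * ((𝒟.iB c)⁻¹ * 𝒟.iA a)) * R ((𝒟.iB c)⁻¹ * 𝒟.iA a)) :=
    (hw.mul h2).comp (𝒟.continuous_iB.inv.mul continuous_const).measurable
  rw [← 𝒟.lintegral_mul_right_inv μ β h3, ← lintegral_const_mul' _ _ ENNReal.ofReal_ne_top]
  refine lintegral_congr fun c => ?_
  have h4 : (𝒟.iB (c * β⁻¹))⁻¹ * 𝒟.iA a = 𝒟.iB β * ((𝒟.iB c)⁻¹ * 𝒟.iA a) := by
    rw [map_mul, map_inv, mul_inv_rev, inv_inv, mul_assoc]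
  rw [h4, inv_mul_cancel_left]
  ring

theorem refMeasure_sq : 𝒟.sq.refMeasure (μ.prod μ) (ν.prod ν) =
    (𝒟.refMeasure μ ν).prod (𝒟.refMeasure μ ν) := by
  refine (Measure.prod_eq fun s t hs ht => ?_).symm
  have hw := 𝒟.measurable_refWeight
  have hW : ∀ g : G × G, 𝒟.sq.refWeight g = 𝒟.refWeight g.1 * 𝒟.refWeight g.2 := by
    intro g
    rw [refWeight, sq_aL, sq_psiB, abs_mul, mul_inv, ENNReal.ofReal_mul (by positivity)]
    rfl
  have key : ∀ s, MeasurableSet s → 𝒟.refMeasure μ ν s = ∫⁻ a, ∫⁻ c,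
      𝒟.refWeight ((𝒟.iB c)⁻¹ * 𝒟.iA a) * s.indicator 1 ((𝒟.iB c)⁻¹ * 𝒟.iA a) ∂μ ∂ν := by
    intro s hs
    rw [← 𝒟.lintegral_refMeasure μ ν (measurable_one.indicator hs), lintegral_indicator_one hs]
  have hm : ∀ s, MeasurableSet s → Measurable fun p : A × B =>
      𝒟.refWeight ((𝒟.iB p.2)⁻¹ * 𝒟.iA p.1) * s.indicator 1 ((𝒟.iB p.2)⁻¹ * 𝒟.iA p.1) :=
    fun s hs => (hw.mul (measurable_one.indicator hs)).comp
      ((𝒟.continuous_iB.comp continuous_snd).inv.mul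
        (𝒟.continuous_iA.comp continuous_fst)).measurable
  rw [key s hs, key t ht, ← lintegral_indicator_one (hs.prod ht),
    𝒟.sq.lintegral_refMeasure (μ.prod μ) (ν.prod ν) (measurable_one.indicator (hs.prod ht)),
    ← lintegral_prod_mul (hm s hs).lintegral_prod_right'.aemeasurable
      (hm t ht).lintegral_prod_right'.aemeasurable]
  refine lintegral_congr fun a => ?_
  refine Eq.trans ?_ (lintegral_prod_mul ((hm s hs).comp measurable_prodMk_left).aemeasurable
    ((hm t ht).comp measurable_prodMk_left).aemeasurable)
  refine lintegral_congr fun c => ?_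
  rw [hW]
  have h1 : (s ×ˢ t).indicator (1 : G × G → ENNReal) ((𝒟.sq.iB c)⁻¹ * 𝒟.sq.iA a) =
      s.indicator 1 ((𝒟.iB c.1)⁻¹ * 𝒟.iA a.1) * t.indicator 1 ((𝒟.iB c.2)⁻¹ * 𝒟.iA a.2) :=
    indicator_prod_one
  rw [h1]
  change 𝒟.refWeight ((𝒟.iB c.1)⁻¹ * 𝒟.iA a.1) * 𝒟.refWeight ((𝒟.iB c.2)⁻¹ * 𝒟.iA a.2) * _ =
    _ * s.indicator 1 ((𝒟.iB c.1)⁻¹ * 𝒟.iA a.1) * (_ * t.indicator 1 ((𝒟.iB c.2)⁻¹ * 𝒟.iA a.2))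
  dsimp only
  ring

/-- The maps `z ↦ (a ▷ b)⁻¹ z`, where `a = a_L(z)`. -/
def leftShift : Shift I JB (𝒟.refMeasure μ ν) μ where
  toFun p := (𝒟.iB (𝒟.act (𝒟.aL p.1) p.2))⁻¹ * p.1
  weight _ := 1
  contMDiff_toFun := ((contMDiff_inv I ∞).comp (𝒟.smooth_iB.comp ((contMDiff_act 𝒟).comp
    ((𝒟.contMDiff_aL.comp contMDiff_fst).prodMk contMDiff_snd)))).mul contMDiff_fst
  contMDiff_weight := contMDiff_const
  weight_pos _ := one_pos
  apply_apply p := by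
    rw [aL_inv_act_mul _ _ _ _ rfl, act_coact_inv, map_inv, inv_inv, mul_inv_cancel_left]
  weight_mul _ := one_mul _
  lintegral_eq H hH := by
    simpa using 𝒟.lintegral_refMeasure_invol μ ν hH

theorem leftShift_toFun (p : G × B) :
    (𝒟.leftShift μ ν).toFun p = (𝒟.iB (𝒟.act (𝒟.aL p.1) p.2))⁻¹ * p.1 := rfl

/-- `leftShift` in the first variable. -/
def fstShift : Shift (I.prod I) JB (𝒟.sq.refMeasure (μ.prod μ) (ν.prod ν)) μ where
  toFun p := ((𝒟.leftShift μ ν).toFun (p.1.1, p.2), p.1.2)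
  weight _ := 1
  contMDiff_toFun := ((𝒟.leftShift μ ν).contMDiff_toFun.comp ((contMDiff_fst.comp
    contMDiff_fst).prodMk contMDiff_snd)).prodMk (contMDiff_snd.comp contMDiff_fst)
  contMDiff_weight := contMDiff_const
  weight_pos _ := one_pos
  apply_apply p := Prod.ext ((𝒟.leftShift μ ν).apply_apply (p.1.1, p.2)) rfl
  weight_mul _ := one_mul _
  lintegral_eq H hH := by
    have hc := (𝒟.leftShift μ ν).contMDiff_toFun.continuous.measurable
    have h1 : Measurable fun p : (G × G) × B =>
        H (((𝒟.leftShift μ ν).toFun (p.1.1, p.2), p.1.2), p.2⁻¹) :=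
      hH.comp (((hc.comp ((measurable_fst.comp measurable_fst).prodMk measurable_snd)).prodMk
        (measurable_snd.comp measurable_fst)).prodMk measurable_snd.inv)
    simp only [ENNReal.ofReal_one, one_pow, one_mul]
    rw [refMeasure_sq, lintegral_prod_symm _ h1.lintegral_prod_right'.aemeasurable,
      lintegral_prod_symm _ hH.lintegral_prod_right'.aemeasurable]
    refine lintegral_congr fun z => ?_
    have h2 : Measurable fun p : G × B => H ((p.1, z), p.2) :=
      hH.comp ((measurable_fst.prodMk measurable_const).prodMk measurable_snd)
    exact 𝒟.lintegral_refMeasure_invol μ ν h2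

/-- `leftShift` in the second variable. -/
def sndShift : Shift (I.prod I) JB (𝒟.sq.refMeasure (μ.prod μ) (ν.prod ν)) μ where
  toFun p := (p.1.1, (𝒟.leftShift μ ν).toFun (p.1.2, p.2))
  weight _ := 1
  contMDiff_toFun := (contMDiff_fst.comp contMDiff_fst).prodMk
    ((𝒟.leftShift μ ν).contMDiff_toFun.comp ((contMDiff_snd.comp
      contMDiff_fst).prodMk contMDiff_snd))
  contMDiff_weight := contMDiff_const
  weight_pos _ := one_pos
  apply_apply p := Prod.ext rfl ((𝒟.leftShift μ ν).apply_apply (p.1.2, p.2))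
  weight_mul _ := one_mul _
  lintegral_eq H hH := by
    have hc := (𝒟.leftShift μ ν).contMDiff_toFun.continuous.measurable
    have h1 : Measurable fun p : (G × G) × B =>
        H ((p.1.1, (𝒟.leftShift μ ν).toFun (p.1.2, p.2)), p.2⁻¹) :=
      hH.comp (((measurable_fst.comp measurable_fst).prodMk
        (hc.comp ((measurable_snd.comp measurable_fst).prodMk measurable_snd))).prodMk
          measurable_snd.inv)
    simp only [ENNReal.ofReal_one, one_pow, one_mul]
    rw [refMeasure_sq, lintegral_prod _ h1.lintegral_prod_right'.aemeasurable,
      lintegral_prod _ hH.lintegral_prod_right'.aemeasurable]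
    refine lintegral_congr fun z => ?_
    have h2 : Measurable fun p : G × B => H ((z, p.1), p.2) :=
      hH.comp ((measurable_const.prodMk measurable_fst).prodMk measurable_snd)
    exact 𝒟.lintegral_refMeasure_invol μ ν h2

end DoubleLieGroup

end

/-! ### The shift attached to δ -/

noncomputable section

variable {E H : Type*} [NormedAddCommGroup E] [NormedSpace ℝ E] [FiniteDimensional ℝ E]
  [TopologicalSpace H]
  {EA HA : Type*} [NormedAddCommGroup EA] [NormedSpace ℝ EA] [FiniteDimensional ℝ EA]
  [TopologicalSpace HA]
  {EB HB : Type*} [NormedAddCommGroup EB] [NormedSpace ℝ EB] [FiniteDimensional ℝ EB]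
  [TopologicalSpace HB]
  {I : ModelWithCorners ℝ E H} [I.Boundaryless]
  {JA : ModelWithCorners ℝ EA HA} [JA.Boundaryless]
  {JB : ModelWithCorners ℝ EB HB} [JB.Boundaryless]
  {G A B : Type*} [TopologicalSpace G] [ChartedSpace H G] [Group G] [LieGroup I ∞ G]
  [T2Space G] [SecondCountableTopology G]
  [TopologicalSpace A] [ChartedSpace HA A] [Group A] [LieGroup JA ∞ A]
  [TopologicalSpace B] [ChartedSpace HB B] [Group B] [LieGroup JB ∞ B]
  (𝒟 : DoubleLieGroup I JA JB G A B)

  [MeasurableSpace G] [BorelSpace G] [MeasurableSpace A] [BorelSpace A] [MeasurableSpace B]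
  [BorelSpace B] [IsTopologicalGroup G] [IsTopologicalGroup A] [IsTopologicalGroup B]
  [LocallyCompactSpace A] [LocallyCompactSpace B]
  [T2Space A] [T2Space B] [SecondCountableTopology A] [SecondCountableTopology B]
  (μ : Measure B) [μ.IsHaarMeasure] (ν : Measure A) [ν.IsHaarMeasure]
  [LocallyCompactSpace G]

namespace DoubleLieGroup

theorem continuous_phiB : Continuous 𝒟.phiB := 𝒟.contMDiff_phiB.continuous

/-- For each β translate z₂ by β, which absorbs |φ_B(β)| and moves the weight to β⁻¹z₂; after Fubini
this weight is precisely the Jacobian for undoing β = a_L(z₂) ▷ b. -/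
theorem refWeight_mul_lintegral_phiB (z₁ : G) {H : (G × G) × B → ENNReal} (hH : Measurable H) :
    ∫⁻ β, ∫⁻ z₂, 𝒟.refWeight (𝒟.iB β * z₂) * ENNReal.ofReal |𝒟.phiB β| *
      H ((z₁, 𝒟.iB β * z₂), 𝒟.act (𝒟.aL (𝒟.iB β * z₂))⁻¹ β) ∂𝒟.refMeasure μ ν ∂μ =
    ∫⁻ z₂, ∫⁻ b, H ((z₁, z₂), b) ∂μ ∂𝒟.refMeasure μ ν := by
  have haL := 𝒟.contMDiff_aL.continuous
  have hw := 𝒟.measurable_refWeight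
  have hq : Continuous fun p : G × B => 𝒟.act (𝒟.aL p.1)⁻¹ p.2 :=
    𝒟.continuous_act_comp (haL.comp continuous_fst).inv continuous_snd
  have hm : Measurable fun p : G × B => H ((z₁, p.1), 𝒟.act (𝒟.aL p.1)⁻¹ p.2) :=
    hH.comp ((measurable_const.prodMk measurable_fst).prodMk hq.measurable)
  have hm' : Measurable fun p : G × B => 𝒟.refWeight ((𝒟.iB p.2)⁻¹ * p.1) :=
    hw.comp ((𝒟.continuous_iB.comp continuous_snd).inv.mul continuous_fst).measurable
  have e1 : ∀ β, ∫⁻ z₂, 𝒟.refWeight (𝒟.iB β * z₂) * ENNReal.ofReal |𝒟.phiB β| *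
      H ((z₁, 𝒟.iB β * z₂), 𝒟.act (𝒟.aL (𝒟.iB β * z₂))⁻¹ β) ∂𝒟.refMeasure μ ν =
      ∫⁻ z₂, 𝒟.refWeight ((𝒟.iB β)⁻¹ * z₂) * H ((z₁, z₂), 𝒟.act (𝒟.aL z₂)⁻¹ β)
        ∂𝒟.refMeasure μ ν := by
    intro β
    rw [← 𝒟.lintegral_refMeasure_shift μ ν β (R := fun z₂ => H ((z₁, z₂), 𝒟.act (𝒟.aL z₂)⁻¹ β))
      (hm.comp (measurable_prodMk_right (y := β))),
      ← lintegral_const_mul' _ _ ENNReal.ofReal_ne_top]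
    exact lintegral_congr fun z₂ => by ring
  simp only [e1]
  rw [lintegral_lintegral_swap]
  · refine lintegral_congr fun z₂ => ?_
    rw [𝒟.lintegral_eq_lintegral_act μ z₂ (F := fun b => H ((z₁, z₂), b))
      (hH.comp measurable_prodMk_left)]
    exact lintegral_congr fun β => mul_comm _ _
  · exact ((hm'.mul hm).comp measurable_swap).aemeasurable

/-- With β = a_L(z₂) ▷ b, the second variable is translated by β⁻¹ and the first undergoes the
groupoid translation with parameter β. For fixed z₂ the invariance under `leftShift` treats z₁; for
fixed z₁ the translation of z₂ costs a factor |φ_B|, which the factor |φ_B|⁻¹ under the integral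
compensates. -/
theorem lintegral_delta_invol {H : (G × G) × B → ENNReal} (hH : Measurable H) :
    ∫⁻ z : G × G, ∫⁻ b, ENNReal.ofReal |𝒟.phiB (𝒟.act (𝒟.aL z.2) b)|⁻¹ *
      H (((𝒟.iB (𝒟.act (𝒟.aL z.1) (𝒟.act (𝒟.aL z.2) b)))⁻¹ * z.1,
        (𝒟.iB (𝒟.act (𝒟.aL z.2) b))⁻¹ * z.2), b⁻¹) ∂μ ∂𝒟.sq.refMeasure (μ.prod μ) (ν.prod ν) =
      ∫⁻ z : G × G, ∫⁻ b, H (z, b) ∂μ ∂𝒟.sq.refMeasure (μ.prod μ) (ν.prod ν) := by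
  have haL := 𝒟.contMDiff_aL.continuous
  have hw := 𝒟.measurable_refWeight
  have hφ : Measurable fun b : B => ENNReal.ofReal |𝒟.phiB b| :=
    ENNReal.measurable_ofReal.comp 𝒟.continuous_phiB.abs.measurable
  have hφ' : Measurable fun b : B => ENNReal.ofReal |𝒟.phiB b|⁻¹ :=
    ENNReal.measurable_ofReal.comp (𝒟.continuous_phiB.abs.inv₀ fun b =>
      abs_ne_zero.2 (𝒟.phiB_ne_zero b)).measurable
  have hq : Continuous fun p : G × B => 𝒟.act (𝒟.aL p.1)⁻¹ p.2 :=
    𝒟.continuous_act_comp (haL.comp continuous_fst).inv continuous_snd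
  have hact : Continuous fun p : G × B => 𝒟.act (𝒟.aL p.1) p.2 :=
    𝒟.continuous_act_comp (haL.comp continuous_fst) continuous_snd
  have hθ : Continuous fun p : G × B => (𝒟.iB (𝒟.act (𝒟.aL p.1) p.2))⁻¹ * p.1 :=
    (𝒟.continuous_iB.comp hact).inv.mul continuous_fst
  have c1 : Continuous fun p : (G × G) × B => (p.1.2, p.2) := by fun_prop
  have c2 : Continuous fun p : (G × G) × B => (p.1.1, 𝒟.act (𝒟.aL p.1.2) p.2) :=
    (continuous_fst.comp continuous_fst).prodMk (hact.comp c1)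
  have m1 : Measurable fun p : (G × G) × B =>
      ENNReal.ofReal |𝒟.phiB (𝒟.act (𝒟.aL p.1.2) p.2)|⁻¹ *
      H (((𝒟.iB (𝒟.act (𝒟.aL p.1.1) (𝒟.act (𝒟.aL p.1.2) p.2)))⁻¹ * p.1.1,
        (𝒟.iB (𝒟.act (𝒟.aL p.1.2) p.2))⁻¹ * p.1.2), p.2⁻¹) := by
    have h1 := hφ'.comp (hact.comp c1).measurable
    have h2 := hH.comp (((hθ.comp c2).prodMk (hθ.comp c1)).prodMk continuous_snd.inv).measurable
    have h3 := h1.mul h2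
    simp only [Function.comp_def] at h3
    exact h3
  -- the integrand after the substitution `β = a₂ ▷ b`
  set R : G → G × B → ENNReal := fun z₂ p => 𝒟.refWeight (𝒟.iB p.2 * z₂) *
    ENNReal.ofReal |𝒟.phiB p.2| * H ((p.1, 𝒟.iB p.2 * z₂), 𝒟.act (𝒟.aL (𝒟.iB p.2 * z₂))⁻¹ p.2)
    with hR
  have c3 : Continuous fun p : G × G × B => 𝒟.iB p.2.2 * p.1 :=
    (𝒟.continuous_iB.comp (continuous_snd.comp continuous_snd)).mul continuous_fst
  have m2 : Measurable fun p : G × G × B => R p.1 p.2 := by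
    have h1 := (hw.comp c3.measurable).mul (hφ.comp (measurable_snd.comp measurable_snd))
    have h2 := hH.comp ((((continuous_fst.comp continuous_snd).prodMk c3).prodMk
      (hq.comp (c3.prodMk (continuous_snd.comp continuous_snd)))).measurable)
    have h3 := h1.mul h2
    simp only [Function.comp_def] at h3
    exact h3
  have mR : ∀ z₂, Measurable (R z₂) := by
    intro z₂
    have h := m2.comp (measurable_prodMk_left (x := z₂))
    simp only [Function.comp_def] at h
    exact h
  have e1 : ∀ z₁ z₂, ∫⁻ b, ENNReal.ofReal |𝒟.phiB (𝒟.act (𝒟.aL z₂) b)|⁻¹ *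
      H (((𝒟.iB (𝒟.act (𝒟.aL z₁) (𝒟.act (𝒟.aL z₂) b)))⁻¹ * z₁,
        (𝒟.iB (𝒟.act (𝒟.aL z₂) b))⁻¹ * z₂), b⁻¹) ∂μ =
      ∫⁻ β, R z₂ ((𝒟.iB (𝒟.act (𝒟.aL z₁) β))⁻¹ * z₁, β⁻¹) ∂μ := by
    intro z₁ z₂
    have m3 := m1.comp (measurable_prodMk_left (x := (z₁, z₂)))
    simp only [Function.comp_def] at m3
    rw [𝒟.lintegral_eq_lintegral_act μ z₂ m3]
    refine lintegral_congr fun β => ?_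
    have h1 : ENNReal.ofReal |𝒟.phiB β|⁻¹ = ENNReal.ofReal |𝒟.phiB β⁻¹| := by
      rw [phiB_inv, abs_inv]
    simp only [hR, act_act_inv, map_inv, act_aL_inv_mul, h1]
    ring
  have e2 : ∀ z₂, ∫⁻ z₁, ∫⁻ β, R z₂ ((𝒟.iB (𝒟.act (𝒟.aL z₁) β))⁻¹ * z₁, β⁻¹) ∂μ
      ∂𝒟.refMeasure μ ν = ∫⁻ z₁, ∫⁻ β, R z₂ (z₁, β) ∂μ ∂𝒟.refMeasure μ ν := fun z₂ =>
    𝒟.lintegral_refMeasure_invol μ ν (mR z₂)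
  rw [refMeasure_sq, lintegral_prod_symm _ m1.lintegral_prod_right'.aemeasurable,
    lintegral_prod _ hH.lintegral_prod_right'.aemeasurable]
  simp only [e1, e2]
  have m4 : Measurable fun p : G × G => ∫⁻ β, R p.1 (p.2, β) ∂μ := by
    have h := m2.comp (f := fun p : (G × G) × B => (p.1.1, (p.1.2, p.2)))
      ((measurable_fst.comp measurable_fst).prodMk
        ((measurable_snd.comp measurable_fst).prodMk measurable_snd))
    simp only [Function.comp_def] at h
    exact h.lintegral_prod_right'
  rw [lintegral_lintegral_swap m4.aemeasurable]
  refine lintegral_congr fun z₁ => ?_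
  have m5 : Measurable fun p : G × B => R p.1 (z₁, p.2) := by
    have h := m2.comp (f := fun p : G × B => (p.1, (z₁, p.2)))
      (measurable_fst.prodMk (measurable_const.prodMk measurable_snd))
    simp only [Function.comp_def] at h
    exact h
  rw [lintegral_lintegral_swap m5.aemeasurable]
  exact 𝒟.refWeight_mul_lintegral_phiB μ ν z₁ hH

/-- The maps of `G × G` that correspond to the morphism `δ`. -/
def deltaShift : Shift (I.prod I) JB (𝒟.sq.refMeasure (μ.prod μ) (ν.prod ν)) μ where
  toFun p := ((𝒟.iB (𝒟.act (𝒟.aL p.1.1) (𝒟.act (𝒟.aL p.1.2) p.2)))⁻¹ * p.1.1,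
    (𝒟.iB (𝒟.act (𝒟.aL p.1.2) p.2))⁻¹ * p.1.2)
  weight p := |𝒟.phiB (𝒟.act (𝒟.aL p.1.2) p.2)| ^ (-(1 / 2) : ℝ)
  contMDiff_toFun := by
    have h1 : ContMDiff ((I.prod I).prod JB) JB ∞
        fun p : (G × G) × B => 𝒟.act (𝒟.aL p.1.2) p.2 := (contMDiff_act 𝒟).comp
      ((𝒟.contMDiff_aL.comp (contMDiff_snd.comp contMDiff_fst)).prodMk contMDiff_snd)
    have h2 := (𝒟.leftShift μ ν).contMDiff_toFun
    exact (h2.comp ((contMDiff_fst.comp contMDiff_fst).prodMk h1)).prodMk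
      (h2.comp ((contMDiff_snd.comp contMDiff_fst).prodMk contMDiff_snd))
  contMDiff_weight := (𝒟.contMDiff_abs_phiB_rpow _).comp ((contMDiff_act 𝒟).comp
    ((𝒟.contMDiff_aL.comp (contMDiff_snd.comp contMDiff_fst)).prodMk contMDiff_snd))
  weight_pos p := Real.rpow_pos_of_pos (abs_pos.2 (𝒟.phiB_ne_zero _)) _
  apply_apply p := by
    refine Prod.ext ?_ ((𝒟.leftShift μ ν).apply_apply (p.1.2, p.2))
    dsimp only
    rw [aL_inv_act_mul _ _ _ _ rfl, aL_inv_act_mul _ _ _ _ rfl, act_coact_inv, act_coact_inv,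
      map_inv, inv_inv, mul_inv_cancel_left]
  weight_mul p := by
    dsimp only
    rw [aL_inv_act_mul _ _ _ _ rfl, act_coact_inv, phiB_inv, abs_inv,
      ← Real.mul_rpow (by positivity) (by positivity),
      inv_mul_cancel₀ (abs_ne_zero.2 (𝒟.phiB_ne_zero _)), Real.one_rpow]
  lintegral_eq H hH := by
    rw [← 𝒟.lintegral_delta_invol μ ν hH]
    refine lintegral_congr fun z => lintegral_congr fun b => ?_
    congr 1
    rw [← ENNReal.ofReal_pow (by positivity), ← Real.rpow_natCast, ← Real.rpow_mul (by positivity),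
      ← Real.rpow_neg_one]
    norm_num

end DoubleLieGroup

end

/-! ### Convolutions and δ̂ as operators of shifts, and commutation with right convolutions -/

noncomputable section

variable {E H : Type*} [NormedAddCommGroup E] [NormedSpace ℝ E] [FiniteDimensional ℝ E]
  [TopologicalSpace H]
  {EA HA : Type*} [NormedAddCommGroup EA] [NormedSpace ℝ EA] [FiniteDimensional ℝ EA]
  [TopologicalSpace HA]
  {EB HB : Type*} [NormedAddCommGroup EB] [NormedSpace ℝ EB] [FiniteDimensional ℝ EB]
  [TopologicalSpace HB]
  {I : ModelWithCorners ℝ E H} [I.Boundaryless]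
  {JA : ModelWithCorners ℝ EA HA} [JA.Boundaryless]
  {JB : ModelWithCorners ℝ EB HB} [JB.Boundaryless]
  {G A B : Type*} [TopologicalSpace G] [ChartedSpace H G] [Group G] [LieGroup I ∞ G]
  [T2Space G] [SecondCountableTopology G]
  [TopologicalSpace A] [ChartedSpace HA A] [Group A] [LieGroup JA ∞ A]
  [TopologicalSpace B] [ChartedSpace HB B] [Group B] [LieGroup JB ∞ B]
  (𝒟 : DoubleLieGroup I JA JB G A B)

  [MeasurableSpace G] [BorelSpace G] [MeasurableSpace A] [BorelSpace A] [MeasurableSpace B]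
  [BorelSpace B] [IsTopologicalGroup G] [IsTopologicalGroup A] [IsTopologicalGroup B]
  [LocallyCompactSpace A] [LocallyCompactSpace B]
  [T2Space A] [T2Space B] [SecondCountableTopology A] [SecondCountableTopology B]
  (μ : Measure B) [μ.IsHaarMeasure] (ν : Measure A) [ν.IsHaarMeasure]
  [LocallyCompactSpace G]

namespace DoubleLieGroup

theorem integral_fiberMeasure (a : A) (F : G → ℂ) :
    ∫ x, F x ∂𝒟.fiberMeasure μ (𝒟.iA a) = ∫ b, F (𝒟.iA a * 𝒟.iB b) ∂μ :=
  (((Homeomorph.mulLeft (𝒟.iA a)).isClosedEmbedding.comp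
    𝒟.closedEmbedding_iB).measurableEmbedding).integral_map F

theorem conv_apply (f ψ : G → ℂ) (z : G) : 𝒟.conv μ f ψ z =
    ∫ b, f (𝒟.iA (𝒟.aL z) * 𝒟.iB b) * ψ ((𝒟.iB (𝒟.act (𝒟.aL z) b))⁻¹ * z) ∂μ := by
  rw [conv, eL, integral_fiberMeasure]
  refine integral_congr_ae (.of_forall fun b => ?_)
  beta_reduce
  rw [gmul_gInv 𝒟 (by rw [aL_iA_mul_iB])]
  rfl

/-- The left fiber over a₁a₂ consists of the points x = a₁a₂b. For the corresponding y one has x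
a_L(y₂)⁻¹ = a₁(a₂ ▷ b), so the element of B that enters t_δ is a₂ ▷ b. -/
theorem deltaHat_apply {ι : Type*} [Fintype ι] [DecidableEq ι]
    (X : Module.Basis ι ℝ (TangentSpace JB (1 : B))) (f : G → ℂ) (F : G × G → ℂ) (z : G × G) :
    𝒟.deltaHat μ X f F z = ∫ b, f (𝒟.iA (𝒟.aL z.1 * 𝒟.aL z.2) * 𝒟.iB b) *
      ((|𝒟.phiB (𝒟.act (𝒟.aL z.2) b)| ^ (-(1 / 2) : ℝ) : ℝ) : ℂ) *
      F ((𝒟.iB (𝒟.act (𝒟.aL z.1) (𝒟.act (𝒟.aL z.2) b)))⁻¹ * z.1,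
        (𝒟.iB (𝒟.act (𝒟.aL z.2) b))⁻¹ * z.2) ∂μ := by
  rw [deltaHat, hatAction, baseMap_delta_eL, integral_fiberMeasure]
  refine integral_congr_ae (.of_forall fun b => ?_)
  beta_reduce
  set x := 𝒟.iA (𝒟.aL z.1 * 𝒟.aL z.2) * 𝒟.iB b with hx
  have h0 : 𝒟.aL x = 𝒟.aL z.1 * 𝒟.aL z.2 := by rw [hx, aL_iA_mul_iB]
  have h1 : 𝒟.translInv 𝒟.sq 𝒟.delta x z =
      ((𝒟.iB (𝒟.act (𝒟.aL z.1) (𝒟.act (𝒟.aL z.2) b)))⁻¹ * z.1,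
        (𝒟.iB (𝒟.act (𝒟.aL z.2) b))⁻¹ * z.2) := by
    have h2 : 𝒟.bL x = 𝒟.act (𝒟.aL z.1) (𝒟.act (𝒟.aL z.2) b) := by
      rw [← act_mul]
      rfl
    have h3 : (𝒟.iA (𝒟.aL z.1))⁻¹ * x = 𝒟.iA (𝒟.aL z.2) * 𝒟.iB b := by
      rw [hx, map_mul, mul_assoc, inv_mul_cancel_left]
    rw [translInv_delta 𝒟 h0, h2, h3]
    rfl
  have h4 : 𝒟.densityRatio 𝒟.sq 𝒟.delta X (sqBasis X) x (𝒟.translInv 𝒟.sq 𝒟.delta x z) =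
      |𝒟.phiB (𝒟.act (𝒟.aL z.2) b)| ^ (-(1 / 2) : ℝ) := by
    rw [h1, densityRatio_delta 𝒟 X]
    · dsimp only
      have h5 : x * (𝒟.iA (𝒟.aL ((𝒟.iB (𝒟.act (𝒟.aL z.2) b))⁻¹ * z.2)))⁻¹ =
          𝒟.iA (𝒟.aL z.1) * 𝒟.iB (𝒟.act (𝒟.aL z.2) b) := by
        rw [aL_inv_act_mul _ _ _ _ rfl, mul_inv_eq_iff_eq_mul, mul_assoc, ← iA_mul_iB, hx, map_mul,
          mul_assoc]
      rw [h5, bR_iA_mul_iB]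
    · dsimp only
      rw [aL_inv_act_mul _ _ _ _ rfl, aL_inv_act_mul _ _ _ _ rfl, ← coact_mul_left]
      rfl
  rw [h4, h1]

/-- The kernel of the operator defined by the coefficient `f`, for a base map `α`. -/
def pullKernel {Z : Type*} (α : Z → A) (f : G → ℂ) (p : Z × B) : ℂ :=
  f (𝒟.iA (α p.1) * 𝒟.iB p.2)

theorem isShiftKernel_pullKernel {EZ HZ : Type*} [NormedAddCommGroup EZ] [NormedSpace ℝ EZ]
    [TopologicalSpace HZ] {IZ : ModelWithCorners ℝ EZ HZ}
    {Z : Type*} [TopologicalSpace Z] [ChartedSpace HZ Z] {α : Z → A} (hα : ContMDiff IZ JA ∞ α)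
    {f : G → ℂ} (hf : f ∈ testFunctions I G) : IsShiftKernel IZ JB (𝒟.pullKernel α f) where
  contMDiff := hf.1.comp ((𝒟.smooth_iA.comp (hα.comp contMDiff_fst)).mul
    (𝒟.smooth_iB.comp contMDiff_snd))
  bounded := by
    obtain ⟨C, hC⟩ := hf.2.exists_bound_of_continuous hf.1.continuous
    exact ⟨C, fun p => hC _⟩
  compact := by
    refine ⟨𝒟.bR '' tsupport f, hf.2.isCompact.image 𝒟.contMDiff_bR.continuous, fun z b hb => ?_⟩
    by_contra h
    exact hb ⟨_, subset_tsupport _ h, 𝒟.bR_iA_mul_iB _ _⟩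

theorem conv_eq_op (f ψ : G → ℂ) :
    𝒟.conv μ f ψ = (𝒟.leftShift μ ν).op (𝒟.pullKernel 𝒟.aL f) ψ := by
  ext z
  rw [conv_apply, Shift.op]
  simp [leftShift, pullKernel]

theorem tensorOne_eq_op (f : G → ℂ) (F : G × G → ℂ) :
    𝒟.tensorOne μ f F = (𝒟.fstShift μ ν).op (𝒟.pullKernel (fun z => 𝒟.aL z.1) f) F := by
  ext z
  rw [tensorOne, conv_apply, Shift.op]
  simp [fstShift, leftShift, pullKernel]

theorem oneTensor_eq_op (f : G → ℂ) (F : G × G → ℂ) :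
    𝒟.oneTensor μ f F = (𝒟.sndShift μ ν).op (𝒟.pullKernel (fun z => 𝒟.aL z.2) f) F := by
  ext z
  rw [oneTensor, conv_apply, Shift.op]
  simp [sndShift, leftShift, pullKernel]

theorem deltaHat_eq_op {ι : Type*} [Fintype ι] [DecidableEq ι]
    (X : Module.Basis ι ℝ (TangentSpace JB (1 : B))) (f : G → ℂ) (F : G × G → ℂ) :
    𝒟.deltaHat μ X f F =
      (𝒟.deltaShift μ ν).op (𝒟.pullKernel (fun z => 𝒟.aL z.1 * 𝒟.aL z.2) f) F := by
  ext z
  rw [deltaHat_apply]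
  rfl

/-- The involution of the convolution algebra. -/
def convStar (f : G → ℂ) (g : G) : ℂ := star (f (𝒟.gInv g))

theorem convStar_mem {f : G → ℂ} (hf : f ∈ testFunctions I G) :
    𝒟.convStar f ∈ testFunctions I G := by
  refine ⟨(Complex.conjCLE.contDiff.contMDiff (n := ∞)).comp (hf.1.comp 𝒟.contMDiff_gInv), ?_⟩
  refine HasCompactSupport.intro (hf.2.isCompact.image 𝒟.contMDiff_gInv.continuous) fun g hg => ?_
  rw [convStar, star_eq_zero]
  by_contra h
  exact hg ⟨_, subset_tsupport _ h, 𝒟.gInv_gInv g⟩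

theorem adj_pullKernel_aL (f : G → ℂ) : (𝒟.leftShift μ ν).adj (𝒟.pullKernel 𝒟.aL f) =
    𝒟.pullKernel 𝒟.aL (𝒟.convStar f) := by
  ext ⟨z, b⟩
  simp only [Shift.adj, Shift.invol, pullKernel, convStar, leftShift]
  rw [aL_inv_act_mul _ _ _ _ rfl, gInv, bR_iA_mul_iB, map_inv]
  rfl

section Equivariant

variable {EY HY : Type*} [NormedAddCommGroup EY] [NormedSpace ℝ EY] [FiniteDimensional ℝ EY]
  [TopologicalSpace HY] {IY : ModelWithCorners ℝ EY HY} [IY.Boundaryless]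
  {Y : Type*} [TopologicalSpace Y] [ChartedSpace HY Y] [Group Y] [LieGroup IY ∞ Y] [T2Space Y]
  [IsTopologicalGroup Y] [SecondCountableTopology Y] [MeasurableSpace Y] [BorelSpace Y]
  {m : Measure Y} [IsFiniteMeasureOnCompacts m] [SFinite m] {μ ν}

/-- The shift moves along the right fibers, and commutes with right translations by `B`. -/
structure IsEquivariantShift (θ : Shift I IY (𝒟.refMeasure μ ν) m) : Prop where
  exists_eq : ∀ p, ∃ b, θ.toFun p = 𝒟.iB b * p.1
  toFun_mul : ∀ z b y, θ.toFun (z * 𝒟.iB b, y) = θ.toFun (z, y) * 𝒟.iB b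
  weight_mul : ∀ z b y, θ.weight (z * 𝒟.iB b, y) = θ.weight (z, y)

variable {𝒟} {θ : Shift I IY (𝒟.refMeasure μ ν) m} (hθ : 𝒟.IsEquivariantShift θ)
  {q : G × Y → ℂ} (hq : IsShiftKernel I IY q) (hqB : ∀ z b y, q (z * 𝒟.iB b, y) = q (z, y))

include hθ hqB in
theorem adj_mul_iB (z : G) (b : B) (y : Y) : θ.adj q (z * 𝒟.iB b, y) = θ.adj q (z, y) := by
  simp only [Shift.adj, Shift.invol, hθ.toFun_mul, hqB]

include hθ in
-- By equivariance, b ↦ θ(a_L(z)b, y) = tb runs through the left fiber of θ(z, y). Its standard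
-- parametrization by B differs from this one by the left translation by b_R(t), which preserves μ.
theorem conv_shift (F ψ : G → ℂ) (z : G) (y : Y) : 𝒟.conv μ F ψ (θ.toFun (z, y)) =
    ∫ b, F (θ.toFun (𝒟.iA (𝒟.aL z) * 𝒟.iB b, y)) * ψ ((𝒟.iB (𝒟.act (𝒟.aL z) b))⁻¹ * z) ∂μ := by
  obtain ⟨β, hβ⟩ := hθ.exists_eq (𝒟.iA (𝒟.aL z), y)
  dsimp only at hβ
  set t := θ.toFun (𝒟.iA (𝒟.aL z), y) with ht
  have h1 : ∀ b, θ.toFun (𝒟.iA (𝒟.aL z) * 𝒟.iB b, y) = t * 𝒟.iB b := fun b => hθ.toFun_mul _ _ _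
  have h2 : θ.toFun (z, y) = t * 𝒟.iB (𝒟.bR z) := by rw [← h1, aL_mul_bR]
  have h3 : θ.toFun (z, y) = 𝒟.iB β * z := by rw [h2, hβ, mul_assoc, aL_mul_bR]
  rw [conv_apply, ← integral_mul_left_eq_self _ (𝒟.bR t)]
  refine integral_congr_ae (.of_forall fun b => ?_)
  have h4 : 𝒟.aL (θ.toFun (z, y)) = 𝒟.aL t := by rw [h2, aL_mul_iB]
  have h5 : 𝒟.iA (𝒟.aL t) * 𝒟.iB (𝒟.bR t * b) = t * 𝒟.iB b := by
    rw [map_mul, ← mul_assoc, aL_mul_bR]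
  have h6 : 𝒟.act (𝒟.aL t) (𝒟.bR t * b) = β * 𝒟.act (𝒟.aL z) b := by
    rw [act, h5, hβ, mul_assoc, bL_iB_mul]
    rfl
  beta_reduce
  rw [h4, h5, h1, h6, h3, map_mul, mul_inv_rev, mul_assoc, inv_mul_cancel_left]

include hθ hq hqB in
/-- Equivariant operators commute with right convolutions. -/
theorem op_conv {F ψ : G → ℂ} (hF : F ∈ testFunctions I G) (hψ : ψ ∈ testFunctions I G) :
    θ.op q (𝒟.conv μ F ψ) = 𝒟.conv μ (θ.op q F) ψ := by
  ext z
  obtain ⟨k, hk, hqk⟩ := hq.compact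
  have hθc := θ.contMDiff_toFun.continuous
  set x : B → G := fun b => 𝒟.iA (𝒟.aL z) * 𝒟.iB b with hx
  have hxc : Continuous x := continuous_const.mul 𝒟.continuous_iB
  set g : Y → B → ℂ := fun y b => q (x b, y) * (θ.weight (x b, y) : ℂ) * F (θ.toFun (x b, y)) *
    ψ ((𝒟.iB (𝒟.act (𝒟.aL z) b))⁻¹ * z) with hg
  have hxy : Continuous fun p : Y × B => (x p.2, p.1) :=
    (hxc.comp continuous_snd).prodMk continuous_fst
  have hgc : Continuous g.uncurry :=
    ((Shift.contMDiff_integrand hq hF).continuous.comp hxy).mul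
      (hψ.1.continuous.comp ((𝒟.continuous_iB.comp
        (𝒟.continuous_act_comp continuous_const continuous_snd)).inv.mul continuous_const))
  have hgs : HasCompactSupport g.uncurry := by
    refine HasCompactSupport.intro (hk.prod (((hF.2.isCompact.prod hk.inv).image hθc).image
      𝒟.contMDiff_bR.continuous)) ?_
    rintro ⟨y, b⟩ hp
    change q (x b, y) * (θ.weight (x b, y) : ℂ) * F (θ.toFun (x b, y)) * _ = 0
    by_cases hy : y ∈ k
    · have h1 : F (θ.toFun (x b, y)) = 0 := by
        by_contra h2
        refine hp ⟨hy, x b, ⟨(θ.toFun (x b, y), y⁻¹), ⟨subset_tsupport _ h2, by simpa using hy⟩,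
          θ.apply_apply (x b, y)⟩, 𝒟.bR_iA_mul_iB _ _⟩
      rw [h1, mul_zero, zero_mul]
    · rw [hqk _ _ hy, zero_mul, zero_mul, zero_mul]
  -- The kernel and the weight are invariant under right translation by B, hence constant on the
  -- left fiber of z, and may be evaluated at x(b) instead of z. They then join F under the inner
  -- integral to form `op q F`.
  have e1 : θ.op q (𝒟.conv μ F ψ) z = ∫ y, ∫ b, g y b ∂μ ∂m := by
    refine integral_congr_ae (.of_forall fun y => ?_)
    have hz : ∀ b, x b = z * 𝒟.iB ((𝒟.bR z)⁻¹ * b) := fun b => by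
      rw [map_mul, map_inv, ← mul_assoc, mul_inv_eq_of_eq_mul (𝒟.aL_mul_bR z).symm]
    beta_reduce
    rw [conv_shift hθ, ← integral_const_mul]
    refine integral_congr_ae (.of_forall fun b => ?_)
    simp only [hg]
    have h1 : q (x b, y) = q (z, y) := by rw [hz, hqB]
    have h2 : θ.weight (x b, y) = θ.weight (z, y) := by rw [hz, hθ.weight_mul]
    rw [h1, h2]
    ring
  rw [e1, integral_integral_swap_of_hasCompactSupport hgc hgs, conv_apply]
  refine integral_congr_ae (.of_forall fun b => ?_)
  beta_reduce
  rw [Shift.op, ← integral_mul_const]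

end Equivariant

end DoubleLieGroup

end

/-! ### The reduced algebra and its multipliers -/

noncomputable section

section Multiplier

variable {R : Type*} [NonUnitalNormedRing R] [NormedSpace ℂ R] [IsScalarTower ℂ R R]
  [SMulCommClass ℂ R R] [StarRing R] [StarModule ℂ R]

/-- The multiplier of a subalgebra defined by an element of the ambient algebra. -/
def multiplierOfMul (𝒜 : NonUnitalStarSubalgebra ℂ R) (T : R) (hl : ∀ s ∈ 𝒜, T * s ∈ 𝒜)
    (hr : ∀ s ∈ 𝒜, s * T ∈ 𝒜) : 𝓜(ℂ, 𝒜) where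
  fst := LinearMap.mkContinuous
    { toFun := fun s => ⟨T * s, hl s s.2⟩
      map_add' := fun s s' => Subtype.ext (mul_add T (s : R) s')
      map_smul' := fun c s => Subtype.ext (mul_smul_comm c T (s : R)) } ‖T‖
    fun s => norm_mul_le T (s : R)
  snd := LinearMap.mkContinuous
    { toFun := fun s => ⟨s * T, hr s s.2⟩
      map_add' := fun s s' => Subtype.ext (add_mul (s : R) s' T)
      map_smul' := fun c s => Subtype.ext (smul_mul_assoc c (s : R) T) } ‖T‖
    fun s => (norm_mul_le (s : R) T).trans_eq (mul_comm _ _)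
  central x y := Subtype.ext (mul_assoc (x : R) T y)

variable {A : Type*} [NonUnitalNormedRing A] [NormedSpace ℂ A] [IsScalarTower ℂ A A]
  [SMulCommClass ℂ A A]

theorem doubleCentralizer_mul_fst_eq {D L : 𝓜(ℂ, A)} {a x y z : A} (hL : L.fst x = y)
    (hD : D.fst y = z) (h : z = a * x) : (D * L).fst x = (a : 𝓜(ℂ, A)).fst x := by
  rw [DoubleCentralizer.mul_fst, mul_apply_eq_comp, hL, hD, h, DoubleCentralizer.coe_fst]
  rfl

/-- Over a C*-ring the norm of a double centralizer is the norm of its left component, so the left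
component determines it, and a continuous left component is determined on a dense set. -/
theorem doubleCentralizer_eq_of_dense [StarRing A] [CStarRing A] {M M' : 𝓜(ℂ, A)} {S : Set A}
    (hS : Dense S) (h : ∀ s ∈ S, M.fst s = M'.fst s) : M = M' := by
  have h1 : M.fst = M'.fst := ContinuousLinearMap.ext fun s =>
    congrFun (Continuous.ext_on hS M.fst.continuous M'.fst.continuous h) s
  have h2 : ‖(M - M').fst‖ = 0 := by
    rw [DoubleCentralizer.sub_fst, h1, sub_self, norm_zero]
  rw [DoubleCentralizer.norm_fst, norm_eq_zero, sub_eq_zero] at h2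
  exact h2

end Multiplier

variable {E H : Type*} [NormedAddCommGroup E] [NormedSpace ℝ E] [FiniteDimensional ℝ E]
  [TopologicalSpace H]
  {EA HA : Type*} [NormedAddCommGroup EA] [NormedSpace ℝ EA] [FiniteDimensional ℝ EA]
  [TopologicalSpace HA]
  {EB HB : Type*} [NormedAddCommGroup EB] [NormedSpace ℝ EB] [FiniteDimensional ℝ EB]
  [TopologicalSpace HB]
  {I : ModelWithCorners ℝ E H} [I.Boundaryless]
  {JA : ModelWithCorners ℝ EA HA} [JA.Boundaryless]
  {JB : ModelWithCorners ℝ EB HB} [JB.Boundaryless]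
  {G A B : Type*} [TopologicalSpace G] [ChartedSpace H G] [Group G] [LieGroup I ∞ G]
  [T2Space G] [SecondCountableTopology G]
  [TopologicalSpace A] [ChartedSpace HA A] [Group A] [LieGroup JA ∞ A]
  [TopologicalSpace B] [ChartedSpace HB B] [Group B] [LieGroup JB ∞ B]
  (𝒟 : DoubleLieGroup I JA JB G A B)

  [MeasurableSpace G] [BorelSpace G] [MeasurableSpace A] [BorelSpace A] [MeasurableSpace B]
  [BorelSpace B] [IsTopologicalGroup G] [IsTopologicalGroup A] [IsTopologicalGroup B]
  [LocallyCompactSpace A] [LocallyCompactSpace B]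
  [T2Space A] [T2Space B] [SecondCountableTopology A] [SecondCountableTopology B]
  (μ : Measure B) [μ.IsHaarMeasure] (ν : Measure A) [ν.IsHaarMeasure]
  [LocallyCompactSpace G] {ι : Type*} [Fintype ι] [DecidableEq ι]
  (X : Module.Basis ι ℝ (TangentSpace JB (1 : B)))

namespace DoubleLieGroup

theorem mulOmega0_mem_iff (f : G → ℂ) :
    𝒟.mulOmega0 X f ∈ 𝒟.smoothBidensities ι ↔ f ∈ testFunctions I G :=
  𝒟.mulOmega0_mem_smoothBidensities_iff X f

/-- The operator of left convolution by a test function, in the regular representation. -/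
def regRep {f : G → ℂ} (hf : f ∈ testFunctions I G) : 𝒟.L2 μ ν →L[ℂ] 𝒟.L2 μ ν :=
  Shift.clm (θ := 𝒟.leftShift μ ν) (𝒟.isShiftKernel_pullKernel 𝒟.contMDiff_aL hf)

theorem conv_mem {f ψ : G → ℂ} (hf : f ∈ testFunctions I G) (hψ : ψ ∈ testFunctions I G) :
    𝒟.conv μ f ψ ∈ testFunctions I G := by
  rw [conv_eq_op 𝒟 μ Measure.haar]
  exact Shift.op_mem_testFunctions (𝒟.isShiftKernel_pullKernel 𝒟.contMDiff_aL hf) hψ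

theorem regRep_apply {f : G → ℂ} (hf : f ∈ testFunctions I G) (ψ : testFunctions I G) :
    𝒟.regRep μ ν hf (testToL2 _ ψ) = testToL2 _ ⟨𝒟.conv μ f ψ.1, 𝒟.conv_mem μ hf ψ.2⟩ := by
  rw [regRep, Shift.clm_apply]
  congr 1
  exact Subtype.ext (𝒟.conv_eq_op μ ν f ψ.1).symm

theorem isRegRep_regRep {f : G → ℂ} (hf : f ∈ testFunctions I G) :
    𝒟.IsRegRep μ ν f (𝒟.regRep μ ν hf) := by
  intro ψ hψ hψc u hu
  rw [eq_testToL2 (IZ := I) _ ⟨ψ, hψ, hψc⟩ hu, regRep_apply]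
  exact coeFn_testToL2 _ _

variable {𝒟 μ ν} in
theorem IsRegRep.eq_regRep {f : G → ℂ} (hf : f ∈ testFunctions I G)
    {T : 𝒟.L2 μ ν →L[ℂ] 𝒟.L2 μ ν} (hT : 𝒟.IsRegRep μ ν f T) : T = 𝒟.regRep μ ν hf := by
  refine clm_ext_testToL2 (IZ := I) _ fun ψ => ?_
  rw [regRep_apply]
  exact eq_testToL2 _ ⟨_, 𝒟.conv_mem μ hf ψ.2⟩ (hT ψ.1 ψ.2.1 ψ.2.2 _ (coeFn_testToL2 _ ψ))

theorem star_regRep {f : G → ℂ} (hf : f ∈ testFunctions I G) :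
    star (𝒟.regRep μ ν hf) = 𝒟.regRep μ ν (𝒟.convStar_mem hf) := by
  rw [regRep, Shift.star_clm, regRep]
  congr 1
  exact 𝒟.adj_pullKernel_aL μ ν f

theorem conv_add {f f' ψ : G → ℂ} (hf : f ∈ testFunctions I G) (hf' : f' ∈ testFunctions I G)
    (hψ : ψ ∈ testFunctions I G) :
    𝒟.conv μ (f + f') ψ = 𝒟.conv μ f ψ + 𝒟.conv μ f' ψ := by
  ext z
  have h := fun f (hf : f ∈ testFunctions I G) =>
    Shift.integrable_integrand (θ := 𝒟.leftShift μ Measure.haar)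
      (𝒟.isShiftKernel_pullKernel 𝒟.contMDiff_aL hf) hψ z
  rw [Pi.add_apply, conv_eq_op 𝒟 μ Measure.haar, conv_eq_op 𝒟 μ Measure.haar,
    conv_eq_op 𝒟 μ Measure.haar, Shift.op, Shift.op, Shift.op, ← integral_add (h f hf) (h f' hf')]
  refine integral_congr_ae (.of_forall fun b => ?_)
  simp only [pullKernel, Pi.add_apply]
  ring

theorem conv_smul (c : ℂ) (f ψ : G → ℂ) : 𝒟.conv μ (c • f) ψ = c • 𝒟.conv μ f ψ := by
  ext z
  rw [Pi.smul_apply, conv, conv, ← integral_smul]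
  refine integral_congr_ae (.of_forall fun b => ?_)
  simp only [Pi.smul_apply, smul_eq_mul]
  ring

theorem isEquivariantShift_leftShift : 𝒟.IsEquivariantShift (𝒟.leftShift μ ν) where
  exists_eq p := ⟨(𝒟.act (𝒟.aL p.1) p.2)⁻¹, by rw [map_inv, leftShift_toFun]⟩
  toFun_mul z b y := by
    simp only [leftShift_toFun, aL_mul_iB, mul_assoc]
  weight_mul _ _ _ := rfl

section

variable {EY HY : Type*} [NormedAddCommGroup EY] [NormedSpace ℝ EY] [FiniteDimensional ℝ EY]
  [TopologicalSpace HY] {IY : ModelWithCorners ℝ EY HY} [IY.Boundaryless]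
  {Y : Type*} [TopologicalSpace Y] [ChartedSpace HY Y] [Group Y] [LieGroup IY ∞ Y] [T2Space Y]
  [IsTopologicalGroup Y] [SecondCountableTopology Y] [MeasurableSpace Y] [BorelSpace Y]
  {m : Measure Y} [IsFiniteMeasureOnCompacts m] [SFinite m] {μ ν}

variable {𝒟} {θ : Shift I IY (𝒟.refMeasure μ ν) m} (hθ : 𝒟.IsEquivariantShift θ)
  {q : G × Y → ℂ} (hq : IsShiftKernel I IY q) (hqB : ∀ z b y, q (z * 𝒟.iB b, y) = q (z, y))

include hθ hqB in
theorem clm_mul_regRep {F : G → ℂ} (hF : F ∈ testFunctions I G) :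
    Shift.clm (θ := θ) hq * 𝒟.regRep μ ν hF =
      𝒟.regRep μ ν (Shift.op_mem_testFunctions (θ := θ) hq hF) := by
  refine clm_ext_testToL2 (IZ := I) _ fun ψ => ?_
  rw [mul_apply_eq_comp, regRep_apply, regRep_apply, Shift.clm_apply]
  congr 1
  exact Subtype.ext (op_conv hθ hq hqB hF ψ.2)

end

theorem regRep_mul {f f' : G → ℂ} (hf : f ∈ testFunctions I G) (hf' : f' ∈ testFunctions I G) :
    𝒟.regRep μ ν hf * 𝒟.regRep μ ν hf' = 𝒟.regRep μ ν (𝒟.conv_mem μ hf hf') := by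
  rw [regRep, clm_mul_regRep (𝒟.isEquivariantShift_leftShift μ ν) _
    (fun z b y => by simp only [pullKernel, aL_mul_iB])]
  congr 1
  exact (𝒟.conv_eq_op μ ν f f').symm

/-- The operators of left convolution by test functions. -/
def regRepAlgebra : NonUnitalStarSubalgebra ℂ (𝒟.L2 μ ν →L[ℂ] 𝒟.L2 μ ν) where
  carrier := {T | ∃ (f : G → ℂ) (hf : f ∈ testFunctions I G), 𝒟.regRep μ ν hf = T}
  add_mem' := by
    rintro _ _ ⟨f, hf, rfl⟩ ⟨f', hf', rfl⟩
    refine ⟨f + f', add_mem hf hf', clm_ext_testToL2 (IZ := I) _ fun ψ => ?_⟩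
    rw [_root_.add_apply, regRep_apply, regRep_apply, regRep_apply, ← map_add]
    congr 1
    exact Subtype.ext (𝒟.conv_add μ hf hf' ψ.2)
  zero_mem' := by
    refine ⟨0, zero_mem _, clm_ext_testToL2 (IZ := I) _ fun ψ => ?_⟩
    rw [_root_.zero_apply, regRep_apply, ← map_zero (testToL2 (IZ := I) _)]
    congr 1
    refine Subtype.ext ?_
    have h := 𝒟.conv_smul μ 0 0 ψ.1
    rwa [zero_smul, zero_smul] at h
  mul_mem' := by
    rintro _ _ ⟨f, hf, rfl⟩ ⟨f', hf', rfl⟩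
    exact ⟨_, _, (𝒟.regRep_mul μ ν hf hf').symm⟩
  smul_mem' := by
    rintro c _ ⟨f, hf, rfl⟩
    refine ⟨c • f, Submodule.smul_mem _ c hf, clm_ext_testToL2 (IZ := I) _ fun ψ => ?_⟩
    rw [_root_.smul_apply, regRep_apply, regRep_apply, ← map_smul]
    congr 1
    exact Subtype.ext (𝒟.conv_smul μ c f ψ.1)
  star_mem' := by
    rintro _ ⟨f, hf, rfl⟩
    exact ⟨_, _, (𝒟.star_regRep μ ν hf).symm⟩

/-- Convolution operators by test functions are already closed under sums, products and adjoints, so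
the generated algebra adds nothing and only the closure remains. -/
theorem reducedAlgebra_eq : 𝒟.reducedAlgebra X μ ν = (𝒟.regRepAlgebra μ ν).topologicalClosure := by
  have h : {T | ∃ f : G → ℂ, 𝒟.mulOmega0 X f ∈ 𝒟.smoothBidensities ι ∧ 𝒟.IsRegRep μ ν f T} =
      (𝒟.regRepAlgebra μ ν : Set (𝒟.L2 μ ν →L[ℂ] 𝒟.L2 μ ν)) := by
    ext T
    constructor
    · rintro ⟨f, hf, hT⟩
      have hf' := (𝒟.mulOmega0_mem_iff X f).1 hf
      exact ⟨f, hf', (hT.eq_regRep hf').symm⟩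
    · rintro ⟨f, hf, rfl⟩
      exact ⟨f, (𝒟.mulOmega0_mem_iff X f).2 hf, 𝒟.isRegRep_regRep μ ν hf⟩
  rw [reducedAlgebra, h, NonUnitalStarAlgebra.adjoin_eq]

theorem regRep_mem {f : G → ℂ} (hf : f ∈ testFunctions I G) :
    𝒟.regRep μ ν hf ∈ 𝒟.reducedAlgebra X μ ν := by
  rw [reducedAlgebra_eq]
  exact NonUnitalStarSubalgebra.le_topologicalClosure _ ⟨f, hf, rfl⟩

/-- The element of the reduced algebra defined by a test function. -/
def toReduced {f : G → ℂ} (hf : f ∈ testFunctions I G) : 𝒟.reducedAlgebra X μ ν :=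
  ⟨𝒟.regRep μ ν hf, 𝒟.regRep_mem μ ν X hf⟩

variable {𝒟 μ ν X} in
theorem toReduced_congr {f f' : G → ℂ} (hf : f ∈ testFunctions I G) (hf' : f' ∈ testFunctions I G)
    (h : f = f') : 𝒟.toReduced μ ν X hf = 𝒟.toReduced μ ν X hf' := by
  subst h
  rfl

theorem toReduced_mul {f f' : G → ℂ} (hf : f ∈ testFunctions I G)
    (hf' : f' ∈ testFunctions I G) : 𝒟.toReduced μ ν X hf * 𝒟.toReduced μ ν X hf' =
      𝒟.toReduced μ ν X (𝒟.conv_mem μ hf hf') :=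
  Subtype.ext (𝒟.regRep_mul μ ν hf hf')

variable {𝒟 μ ν X} in
theorem eq_toReduced {f : G → ℂ} (hf : f ∈ testFunctions I G) {S : 𝒟.reducedAlgebra X μ ν}
    (hS : 𝒟.IsRegRep μ ν f S) : S = 𝒟.toReduced μ ν X hf :=
  Subtype.ext (hS.eq_regRep hf)

theorem mul_mem_reducedAlgebra {T : 𝒟.L2 μ ν →L[ℂ] 𝒟.L2 μ ν}
    (hT : ∀ (f : G → ℂ) (hf : f ∈ testFunctions I G),
      T * 𝒟.regRep μ ν hf ∈ 𝒟.reducedAlgebra X μ ν) :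
    ∀ s ∈ 𝒟.reducedAlgebra X μ ν, T * s ∈ 𝒟.reducedAlgebra X μ ν := by
  have hcl : IsClosed (𝒟.reducedAlgebra X μ ν : Set (𝒟.L2 μ ν →L[ℂ] 𝒟.L2 μ ν)) :=
    NonUnitalStarSubalgebra.isClosed_topologicalClosure _
  intro s hs
  have h1 : s ∈ closure (𝒟.regRepAlgebra μ ν : Set (𝒟.L2 μ ν →L[ℂ] 𝒟.L2 μ ν)) := by
    rw [reducedAlgebra_eq] at hs
    exact hs
  refine closure_minimal (t := (fun s => T * s) ⁻¹' (𝒟.reducedAlgebra X μ ν : Set _)) ?_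
    (hcl.preimage (continuous_const_mul T)) h1
  rintro _ ⟨f, hf, rfl⟩
  exact hT f hf

instance cstarRing_reducedAlgebra : CStarRing (𝒟.reducedAlgebra X μ ν) where
  norm_mul_self_le x := CStarRing.norm_mul_self_le (x : 𝒟.L2 μ ν →L[ℂ] 𝒟.L2 μ ν)

theorem dense_regRepAlgebra : Dense {s : 𝒟.reducedAlgebra X μ ν |
    (s : 𝒟.L2 μ ν →L[ℂ] 𝒟.L2 μ ν) ∈ 𝒟.regRepAlgebra μ ν} := by
  intro s
  rw [closure_subtype]
  have hs := (SetLike.ext_iff.1 (𝒟.reducedAlgebra_eq μ ν X) _).1 s.2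
  have h2 : (s : 𝒟.L2 μ ν →L[ℂ] 𝒟.L2 μ ν) ∈
    closure (𝒟.regRepAlgebra μ ν : Set (𝒟.L2 μ ν →L[ℂ] 𝒟.L2 μ ν)) := hs
  refine closure_mono ?_ h2
  rintro _ ⟨f, hf, rfl⟩
  exact ⟨𝒟.toReduced μ ν X hf, ⟨f, hf, rfl⟩, rfl⟩

variable {𝒟 μ ν X} in
theorem multiplier_ext {M M' : 𝓜(ℂ, 𝒟.reducedAlgebra X μ ν)}
    (h : ∀ (f : G → ℂ) (hf : f ∈ testFunctions I G),
      M.fst (𝒟.toReduced μ ν X hf) = M'.fst (𝒟.toReduced μ ν X hf)) : M = M' := by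
  refine doubleCentralizer_eq_of_dense (𝒟.dense_regRepAlgebra μ ν X) ?_
  rintro s ⟨f, hf, hs⟩
  have h2 : s = 𝒟.toReduced μ ν X hf := Subtype.ext hs.symm
  rw [h2]
  exact h f hf

variable {𝒟 μ ν X} in
theorem IsMultiplierOf.fst_toReduced {Φ : (G → ℂ) → G → ℂ} {M : 𝓜(ℂ, 𝒟.reducedAlgebra X μ ν)}
    (hM : 𝒟.IsMultiplierOf X μ ν Φ M) {f : G → ℂ} (hf : f ∈ testFunctions I G) :
    ∃ hΦ : Φ f ∈ testFunctions I G,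
      M.fst (𝒟.toReduced μ ν X hf) = 𝒟.toReduced μ ν X hΦ := by
  obtain ⟨h1, S, S', hS, hS', h⟩ := hM f ((𝒟.mulOmega0_mem_iff X f).2 hf)
  have hΦ := (𝒟.mulOmega0_mem_iff X _).1 h1
  refine ⟨hΦ, ?_⟩
  rw [← eq_toReduced hf hS, ← eq_toReduced hΦ hS', h]

variable {𝒟 μ ν X} in
theorem IsMultiplierOf.unique {Φ : (G → ℂ) → G → ℂ} {M M' : 𝓜(ℂ, 𝒟.reducedAlgebra X μ ν)}
    (hM : 𝒟.IsMultiplierOf X μ ν Φ M) (hM' : 𝒟.IsMultiplierOf X μ ν Φ M') : M = M' := by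
  refine multiplier_ext fun f hf => ?_
  obtain ⟨_, h⟩ := hM.fst_toReduced hf
  obtain ⟨_, h'⟩ := hM'.fst_toReduced hf
  rw [h, h']

variable {𝒟 μ ν X} in
-- A multiplier is determined by its left action on test functions, and there the action of the
-- element K is convolution by K; thus an identity between the defining maps suffices.
theorem IsMultiplierOf.mul_eq {Φ Λ : (G → ℂ) → G → ℂ} {D L : 𝓜(ℂ, 𝒟.reducedAlgebra X μ ν)}
    (hD : 𝒟.IsMultiplierOf X μ ν Φ D) (hL : 𝒟.IsMultiplierOf X μ ν Λ L) {K : G → ℂ}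
    (hK : K ∈ testFunctions I G)
    (h : ∀ F ∈ testFunctions I G, Φ (Λ F) = 𝒟.conv μ K F) :
    ∃ S : 𝒟.reducedAlgebra X μ ν, 𝒟.IsRegRep μ ν K S ∧ D * L = S := by
  refine ⟨𝒟.toReduced μ ν X hK, 𝒟.isRegRep_regRep μ ν hK, multiplier_ext fun F hF => ?_⟩
  obtain ⟨hΛ, h1⟩ := hL.fst_toReduced hF
  obtain ⟨hΦ, h2⟩ := hD.fst_toReduced hΛ
  exact doubleCentralizer_mul_fst_eq h1 h2 ((toReduced_congr _ _ (h F hF)).trans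
    (𝒟.toReduced_mul μ ν X hK hF).symm)

section

variable {EY HY : Type*} [NormedAddCommGroup EY] [NormedSpace ℝ EY] [FiniteDimensional ℝ EY]
  [TopologicalSpace HY] {IY : ModelWithCorners ℝ EY HY} [IY.Boundaryless]
  {Y : Type*} [TopologicalSpace Y] [ChartedSpace HY Y] [Group Y] [LieGroup IY ∞ Y] [T2Space Y]
  [IsTopologicalGroup Y] [SecondCountableTopology Y] [MeasurableSpace Y] [BorelSpace Y]
  {m : Measure Y} [IsFiniteMeasureOnCompacts m] [SFinite m] {μ ν}

variable {𝒟} {θ : Shift I IY (𝒟.refMeasure μ ν) m} (hθ : 𝒟.IsEquivariantShift θ)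
  {q : G × Y → ℂ} (hq : IsShiftKernel I IY q) (hqB : ∀ z b y, q (z * 𝒟.iB b, y) = q (z, y))

include hθ hq hqB in
/-- Equivariant operators with smooth kernels define unique multipliers. -/
theorem existsUnique_isMultiplierOf : ∃! M, 𝒟.IsMultiplierOf X μ ν (θ.op q) M := by
  set T := Shift.clm (θ := θ) hq with hT
  have hl := 𝒟.mul_mem_reducedAlgebra μ ν X (T := T) fun f hf => by
    rw [hT, clm_mul_regRep hθ hq hqB]
    exact 𝒟.regRep_mem μ ν X _
  -- Right multiplication by T is obtained from left multiplication by its adjoint. The adjoint is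
  -- again the operator of an invariant kernel for the same equivariant shift, and the algebra is
  -- closed under star.
  have hl' := 𝒟.mul_mem_reducedAlgebra μ ν X (T := star T) fun f hf => by
    rw [hT, Shift.star_clm, clm_mul_regRep hθ _ (adj_mul_iB hθ hqB)]
    exact 𝒟.regRep_mem μ ν X _
  have hr : ∀ s ∈ 𝒟.reducedAlgebra X μ ν, s * T ∈ 𝒟.reducedAlgebra X μ ν := by
    intro s hs
    have h := star_mem (hl' _ (star_mem hs))
    rwa [star_mul, star_star, star_star] at h
  refine existsUnique_of_exists_of_unique
    ⟨multiplierOfMul (𝒟.reducedAlgebra X μ ν) T hl hr, fun f hf => ?_⟩ fun _ _ => IsMultiplierOf.unique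
  have hf' := (𝒟.mulOmega0_mem_iff X f).1 hf
  have hΦ := Shift.op_mem_testFunctions (θ := θ) hq hf'
  refine ⟨(𝒟.mulOmega0_mem_iff X _).2 hΦ, 𝒟.toReduced μ ν X hf', 𝒟.toReduced μ ν X hΦ,
    𝒟.isRegRep_regRep μ ν hf', 𝒟.isRegRep_regRep μ ν hΦ, Subtype.ext ?_⟩
  exact clm_mul_regRep hθ hq hqB hf'

end

end DoubleLieGroup

end

/-! ### Identification of the two kernels -/

noncomputable section

variable {E H : Type*} [NormedAddCommGroup E] [NormedSpace ℝ E] [FiniteDimensional ℝ E]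
  [TopologicalSpace H]
  {EA HA : Type*} [NormedAddCommGroup EA] [NormedSpace ℝ EA] [FiniteDimensional ℝ EA]
  [TopologicalSpace HA]
  {EB HB : Type*} [NormedAddCommGroup EB] [NormedSpace ℝ EB] [FiniteDimensional ℝ EB]
  [TopologicalSpace HB]
  {I : ModelWithCorners ℝ E H} [I.Boundaryless]
  {JA : ModelWithCorners ℝ EA HA} [JA.Boundaryless]
  {JB : ModelWithCorners ℝ EB HB} [JB.Boundaryless]
  {G A B : Type*} [TopologicalSpace G] [ChartedSpace H G] [Group G] [LieGroup I ∞ G]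
  [T2Space G] [SecondCountableTopology G]
  [TopologicalSpace A] [ChartedSpace HA A] [Group A] [LieGroup JA ∞ A]
  [TopologicalSpace B] [ChartedSpace HB B] [Group B] [LieGroup JB ∞ B]
  (𝒟 : DoubleLieGroup I JA JB G A B)

  [MeasurableSpace G] [BorelSpace G] [MeasurableSpace A] [BorelSpace A] [MeasurableSpace B]
  [BorelSpace B] [IsTopologicalGroup G] [IsTopologicalGroup A] [IsTopologicalGroup B]
  [LocallyCompactSpace A] [LocallyCompactSpace B]
  [T2Space A] [T2Space B] [SecondCountableTopology A] [SecondCountableTopology B]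
  (μ : Measure B) [μ.IsHaarMeasure] (ν : Measure A) [ν.IsHaarMeasure]
  [LocallyCompactSpace G] {ι : Type*} [Fintype ι] [DecidableEq ι]
  (X : Module.Basis ι ℝ (TangentSpace JB (1 : B)))

namespace DoubleLieGroup

theorem integral_eq_integral_act (z : G) (F : B → ℂ) :
    ∫ b, F b ∂μ = ∫ β, ((|𝒟.psiB (𝒟.aL ((𝒟.iB β)⁻¹ * z))|⁻¹ : ℝ) : ℂ) *
      F (𝒟.act (𝒟.aL z)⁻¹ β) ∂μ := by
  have hw : Measurable fun β => 𝒟.refWeight ((𝒟.iB β)⁻¹ * z) :=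
    𝒟.measurable_refWeight.comp (𝒟.continuous_iB.inv.mul continuous_const).measurable
  have hh := (𝒟.actHomeo (𝒟.aL z)⁻¹).measurableEmbedding
  have h1 : (μ.withDensity fun β => 𝒟.refWeight ((𝒟.iB β)⁻¹ * z)).map
      (𝒟.actHomeo (𝒟.aL z)⁻¹) = μ := by
    refine Measure.ext_of_lintegral _ fun H hH => ?_
    rw [lintegral_map hH hh.measurable, lintegral_withDensity_eq_lintegral_mul
      (g := fun β => H (𝒟.actHomeo (𝒟.aL z)⁻¹ β)) _ hw (hH.comp hh.measurable),
      𝒟.lintegral_eq_lintegral_act μ z hH]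
    exact lintegral_congr fun β => mul_comm _ _
  conv_lhs => rw [← h1]
  rw [hh.integral_map, integral_withDensity_eq_integral_toReal_smul hw
    (.of_forall fun β => (𝒟.refWeight_ne_top _).lt_top)]
  refine integral_congr_ae (.of_forall fun β => ?_)
  beta_reduce
  rw [refWeight, ENNReal.toReal_ofReal (by positivity), Complex.real_smul]
  rfl

/-- A translation of z by γ⁻¹ is compensated by a left translation in the integration variable. It
reappears only in the argument of f, while ψ is evaluated at the same points as in the convolution
at z. -/
theorem conv_inv_mul (f ψ : G → ℂ) (z : G) (γ : B) : 𝒟.conv μ f ψ ((𝒟.iB γ)⁻¹ * z) =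
    ∫ b, f ((𝒟.iB γ)⁻¹ * (𝒟.iA (𝒟.aL z) * 𝒟.iB b)) *
      ψ ((𝒟.iB (𝒟.act (𝒟.aL z) b))⁻¹ * z) ∂μ := by
  set t := (𝒟.iB γ)⁻¹ * 𝒟.iA (𝒟.aL z) with ht
  have h1 : (𝒟.iB γ)⁻¹ * z = t * 𝒟.iB (𝒟.bR z) := by rw [ht, mul_assoc, aL_mul_bR]
  have h2 : 𝒟.aL ((𝒟.iB γ)⁻¹ * z) = 𝒟.aL t := by rw [h1, aL_mul_iB]
  rw [conv_apply, ← integral_mul_left_eq_self _ (𝒟.bR t)]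
  refine integral_congr_ae (.of_forall fun b => ?_)
  have h3 : 𝒟.iA (𝒟.aL t) * 𝒟.iB (𝒟.bR t * b) = t * 𝒟.iB b := by
    rw [map_mul, ← mul_assoc, aL_mul_bR]
  have h4 : 𝒟.act (𝒟.aL t) (𝒟.bR t * b) = γ⁻¹ * 𝒟.act (𝒟.aL z) b := by
    rw [act, h3, ht, ← map_inv, mul_assoc, bL_iB_mul]
    rfl
  beta_reduce
  rw [h2, h3, h4, ht, mul_assoc, map_mul, map_inv, mul_inv_rev, inv_inv, mul_assoc,
    mul_inv_cancel_left]

/-- The coefficient of `δ̂(f ω₀)(I ⊗ f₁ ω₀)`. -/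
def coeffOneTensor (f f₁ : G → ℂ) (g : G × G) : ℂ :=
  ((|𝒟.psiB (𝒟.aL ((𝒟.iB (𝒟.bR g.1))⁻¹ * g.2))|⁻¹ *
    |𝒟.phiB (𝒟.bR g.1)| ^ (-(1 / 2) : ℝ) : ℝ) : ℂ) *
  f (g.1 * 𝒟.iA (𝒟.aL ((𝒟.iB (𝒟.bR g.1))⁻¹ * g.2))) *
  f₁ ((𝒟.iB (𝒟.bR g.1))⁻¹ * g.2)

/-- The coefficient of `δ̂(f ω₀)(f₁ ω₀ ⊗ I)`. -/
def coeffTensorOne (f f₁ : G → ℂ) (g : G × G) : ℂ :=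
  ((|𝒟.phiB (𝒟.bL g.2)| ^ (-(1 / 2) : ℝ) : ℝ) : ℂ) *
  f (𝒟.iA (𝒟.aL g.1) * g.2) *
  f₁ ((𝒟.iB (𝒟.bL (𝒟.iA (𝒟.aL g.1) * g.2)))⁻¹ * g.1)

variable {f f₁ : G → ℂ} (hf : f ∈ testFunctions I G) (hf₁ : f₁ ∈ testFunctions I G)

theorem contMDiff_ofReal_mul_mul {EZ HZ : Type*} [NormedAddCommGroup EZ] [NormedSpace ℝ EZ]
    [TopologicalSpace HZ] {IZ : ModelWithCorners ℝ EZ HZ}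
    {Z : Type*} [TopologicalSpace Z] [ChartedSpace HZ Z] {w : Z → ℝ} {u v : Z → ℂ}
    (hw : ContMDiff IZ 𝓘(ℝ, ℝ) ∞ w) (hu : ContMDiff IZ 𝓘(ℝ, ℂ) ∞ u)
    (hv : ContMDiff IZ 𝓘(ℝ, ℂ) ∞ v) : ContMDiff IZ 𝓘(ℝ, ℂ) ∞ fun z => (w z : ℂ) * u z * v z :=
  contMDiffOn_univ.1 (contMDiffOn_complex_mul (contMDiffOn_complex_mul
    (contMDiff_ofReal (contMDiffOn_univ.2 hw)) (contMDiffOn_univ.2 hu)) (contMDiffOn_univ.2 hv))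

include hf hf₁

theorem coeffOneTensor_mem : 𝒟.coeffOneTensor f f₁ ∈ testFunctions (I.prod I) (G × G) := by
  have h1 : ContMDiff (I.prod I) I ∞ fun g : G × G => (𝒟.iB (𝒟.bR g.1))⁻¹ * g.2 :=
    ((contMDiff_inv I ∞).comp (𝒟.smooth_iB.comp
      (𝒟.contMDiff_bR.comp contMDiff_fst))).mul contMDiff_snd
  have h2 : ContMDiff (I.prod I) JA ∞ fun g : G × G => 𝒟.aL ((𝒟.iB (𝒟.bR g.1))⁻¹ * g.2) :=
    𝒟.contMDiff_aL.comp h1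
  constructor
  · have h3 : ContMDiff (I.prod I) 𝓘(ℝ, ℝ) ∞ fun g : G × G =>
        |𝒟.psiB (𝒟.aL ((𝒟.iB (𝒟.bR g.1))⁻¹ * g.2))|⁻¹ *
          |𝒟.phiB (𝒟.bR g.1)| ^ (-(1 / 2) : ℝ) := by
      simp only [← Real.rpow_neg_one]
      exact ((𝒟.contMDiff_abs_psiB_rpow (-1)).comp h2).mul
        ((𝒟.contMDiff_abs_phiB_rpow _).comp (𝒟.contMDiff_bR.comp contMDiff_fst))
    exact contMDiff_ofReal_mul_mul h3 (hf.1.comp (contMDiff_fst.mul (𝒟.smooth_iA.comp h2)))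
      (hf₁.1.comp h1)
  -- The arguments p₁ of f and p₂ of f₁ determine (g₁, g₂) continuously: g₁ = p₁a_L(p₂)⁻¹ and g₂ =
  -- b_R(g₁)p₂. The support is therefore inside the image of a compact set.
  · have hc1 : Continuous fun p : G × G => p.1 * (𝒟.iA (𝒟.aL p.2))⁻¹ :=
      continuous_fst.mul (𝒟.continuous_iA.comp
        (𝒟.contMDiff_aL.continuous.comp continuous_snd)).inv
    have hc : Continuous fun p : G × G => (p.1 * (𝒟.iA (𝒟.aL p.2))⁻¹,
        𝒟.iB (𝒟.bR (p.1 * (𝒟.iA (𝒟.aL p.2))⁻¹)) * p.2) :=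
      hc1.prodMk ((𝒟.continuous_iB.comp (𝒟.contMDiff_bR.continuous.comp hc1)).mul continuous_snd)
    refine HasCompactSupport.intro ((hf.2.isCompact.prod hf₁.2.isCompact).image hc) fun g hg => ?_
    by_contra h
    have h4 : f (g.1 * 𝒟.iA (𝒟.aL ((𝒟.iB (𝒟.bR g.1))⁻¹ * g.2))) ≠ 0 := fun h0 => h (by
      rw [coeffOneTensor, h0, mul_zero, zero_mul])
    have h5 : f₁ ((𝒟.iB (𝒟.bR g.1))⁻¹ * g.2) ≠ 0 := fun h0 => h (by
      rw [coeffOneTensor, h0, mul_zero])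
    exact hg ⟨(_, _), ⟨subset_tsupport _ h4, subset_tsupport _ h5⟩, by simp⟩

theorem coeffTensorOne_mem : 𝒟.coeffTensorOne f f₁ ∈ testFunctions (I.prod I) (G × G) := by
  have h1 : ContMDiff (I.prod I) I ∞ fun g : G × G => 𝒟.iA (𝒟.aL g.1) * g.2 :=
    (𝒟.smooth_iA.comp (𝒟.contMDiff_aL.comp contMDiff_fst)).mul contMDiff_snd
  constructor
  · exact contMDiff_ofReal_mul_mul
      ((𝒟.contMDiff_abs_phiB_rpow _).comp (𝒟.contMDiff_bL.comp contMDiff_snd)) (hf.1.comp h1)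
      (hf₁.1.comp (((contMDiff_inv I ∞).comp (𝒟.smooth_iB.comp
        (𝒟.contMDiff_bL.comp h1))).mul contMDiff_fst))
  -- Here too the arguments p₁ of f and p₂ of f₁ determine the point: g₁ = b_L(p₁)p₂ and g₂ =
  -- a_L(g₁)⁻¹p₁.
  · have hc1 : Continuous fun p : G × G => 𝒟.iB (𝒟.bL p.1) * p.2 :=
      (𝒟.continuous_iB.comp (𝒟.contMDiff_bL.continuous.comp continuous_fst)).mul continuous_snd
    have hc : Continuous fun p : G × G => (𝒟.iB (𝒟.bL p.1) * p.2,
        (𝒟.iA (𝒟.aL (𝒟.iB (𝒟.bL p.1) * p.2)))⁻¹ * p.1) :=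
      hc1.prodMk ((𝒟.continuous_iA.comp
        (𝒟.contMDiff_aL.continuous.comp hc1)).inv.mul continuous_fst)
    refine HasCompactSupport.intro ((hf.2.isCompact.prod hf₁.2.isCompact).image hc) fun g hg => ?_
    by_contra h
    have h4 : f (𝒟.iA (𝒟.aL g.1) * g.2) ≠ 0 := fun h0 => h (by
      rw [coeffTensorOne, h0, mul_zero, zero_mul])
    have h5 : f₁ ((𝒟.iB (𝒟.bL (𝒟.iA (𝒟.aL g.1) * g.2)))⁻¹ * g.1) ≠ 0 := fun h0 => h (by
      rw [coeffTensorOne, h0, mul_zero])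
    exact hg ⟨(_, _), ⟨subset_tsupport _ h4, subset_tsupport _ h5⟩, by simp⟩

theorem conv_sq_apply {K F : G × G → ℂ} (hK : K ∈ testFunctions (I.prod I) (G × G))
    (hF : F ∈ testFunctions (I.prod I) (G × G)) (z : G × G) :
    Integrable (fun b : B × B => K (𝒟.iA (𝒟.aL z.1) * 𝒟.iB b.1, 𝒟.iA (𝒟.aL z.2) * 𝒟.iB b.2) *
      F ((𝒟.iB (𝒟.act (𝒟.aL z.1) b.1))⁻¹ * z.1, (𝒟.iB (𝒟.act (𝒟.aL z.2) b.2))⁻¹ * z.2))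
      (μ.prod μ) ∧
    𝒟.sq.conv (μ.prod μ) K F z = ∫ b : B × B,
      K (𝒟.iA (𝒟.aL z.1) * 𝒟.iB b.1, 𝒟.iA (𝒟.aL z.2) * 𝒟.iB b.2) *
      F ((𝒟.iB (𝒟.act (𝒟.aL z.1) b.1))⁻¹ * z.1, (𝒟.iB (𝒟.act (𝒟.aL z.2) b.2))⁻¹ * z.2)
      ∂μ.prod μ := by
  have e : ∀ b : B × B, K (𝒟.sq.iA (𝒟.sq.aL z) * 𝒟.sq.iB b) *
      F ((𝒟.sq.iB (𝒟.sq.act (𝒟.sq.aL z) b))⁻¹ * z) =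
      K (𝒟.iA (𝒟.aL z.1) * 𝒟.iB b.1, 𝒟.iA (𝒟.aL z.2) * 𝒟.iB b.2) *
      F ((𝒟.iB (𝒟.act (𝒟.aL z.1) b.1))⁻¹ * z.1,
        (𝒟.iB (𝒟.act (𝒟.aL z.2) b.2))⁻¹ * z.2) := fun b => by
    rw [sq_aL, sq_act]
    rfl
  constructor
  · have h := Shift.integrable_integrand (θ := 𝒟.sq.leftShift (μ.prod μ) Measure.haar)
      (𝒟.sq.isShiftKernel_pullKernel 𝒟.sq.contMDiff_aL hK) hF z
    refine h.congr (.of_forall fun b => ?_)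
    refine Eq.trans ?_ (e b)
    simp [leftShift, pullKernel]
  · rw [conv_apply]
    exact integral_congr_ae (.of_forall e)

/-- Substituting β = a₂ ▷ b in the outer integral makes the translation of z₁ that of the point g₁ =
a₁β of its left fiber, at the cost of |ψ_B(a_L(β⁻¹z₂))|⁻¹. The inner integral, shifted back to z₂ by
left invariance, runs over g₂ = a₂b. Since a_L(β⁻¹g₂) does not depend on b, the factor is a function
of (g₁, g₂). -/
theorem deltaHat_oneTensor {F : G × G → ℂ} (hF : F ∈ testFunctions (I.prod I) (G × G)) :
    𝒟.deltaHat μ X f (𝒟.oneTensor μ f₁ F) =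
      𝒟.sq.conv (μ.prod μ) (𝒟.coeffOneTensor f f₁) F := by
  ext z
  obtain ⟨h1, h2⟩ := 𝒟.conv_sq_apply μ hf hf₁ (𝒟.coeffOneTensor_mem hf hf₁) hF z
  rw [h2, integral_prod _ h1, deltaHat_apply, 𝒟.integral_eq_integral_act μ z.2]
  refine integral_congr_ae (.of_forall fun β => ?_)
  beta_reduce
  rw [act_act_inv, oneTensor, conv_inv_mul]
  have h3 : 𝒟.iA (𝒟.aL z.1 * 𝒟.aL z.2) * 𝒟.iB (𝒟.act (𝒟.aL z.2)⁻¹ β) =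
      𝒟.iA (𝒟.aL z.1) * 𝒟.iB β * 𝒟.iA (𝒟.aL ((𝒟.iB β)⁻¹ * z.2)) := by
    obtain ⟨b, rfl⟩ : ∃ b, β = 𝒟.act (𝒟.aL z.2) b :=
      ⟨𝒟.act (𝒟.aL z.2)⁻¹ β, by rw [act_act_inv]⟩
    rw [aL_inv_act_mul _ _ _ _ rfl, act_inv_act, map_mul, mul_assoc, mul_assoc, ← iA_mul_iB]
  have h4 : ∀ b, 𝒟.aL ((𝒟.iB β)⁻¹ * (𝒟.iA (𝒟.aL z.2) * 𝒟.iB b)) =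
      𝒟.aL ((𝒟.iB β)⁻¹ * z.2) := fun b => by
    conv_rhs => rw [← 𝒟.aL_mul_bR z.2]
    rw [← mul_assoc, ← mul_assoc, aL_mul_iB, aL_mul_iB]
  rw [h3, ← integral_const_mul, ← integral_const_mul]
  refine integral_congr_ae (.of_forall fun b => ?_)
  simp only [coeffOneTensor, bR_iA_mul_iB, h4]
  push_cast
  ring

/-- No substitution is needed: the outer variable b already parametrizes g₂ = a₂b, with b_L(g₂) = a₂
▷ b, and left invariance moves the inner convolution back to the fiber g₁ = a₁b' of z₁. -/
theorem deltaHat_tensorOne {F : G × G → ℂ} (hF : F ∈ testFunctions (I.prod I) (G × G)) :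
    𝒟.deltaHat μ X f (𝒟.tensorOne μ f₁ F) =
      𝒟.sq.conv (μ.prod μ) (𝒟.coeffTensorOne f f₁) F := by
  ext z
  obtain ⟨h1, h2⟩ := 𝒟.conv_sq_apply μ hf hf₁ (𝒟.coeffTensorOne_mem hf hf₁) hF z
  rw [h2, integral_prod_symm _ h1, deltaHat_apply]
  refine integral_congr_ae (.of_forall fun b => ?_)
  beta_reduce
  rw [tensorOne, conv_inv_mul, ← integral_const_mul]
  refine integral_congr_ae (.of_forall fun b' => ?_)
  have h3 : 𝒟.iA (𝒟.aL z.1) * (𝒟.iA (𝒟.aL z.2) * 𝒟.iB b) =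
      𝒟.iA (𝒟.aL z.1 * 𝒟.aL z.2) * 𝒟.iB b := by rw [map_mul, mul_assoc]
  have h4 : ∀ a b, 𝒟.bL (𝒟.iA a * 𝒟.iB b) = 𝒟.act a b := fun _ _ => rfl
  simp only [coeffTensorOne, aL_iA_mul_iB, h3, h4, act_mul]
  ring

end DoubleLieGroup

end

/-! ### Equivariance of the three shifts and the proposition -/

noncomputable section

variable {E H : Type*} [NormedAddCommGroup E] [NormedSpace ℝ E] [FiniteDimensional ℝ E]
  [TopologicalSpace H]
  {EA HA : Type*} [NormedAddCommGroup EA] [NormedSpace ℝ EA] [FiniteDimensional ℝ EA]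
  [TopologicalSpace HA]
  {EB HB : Type*} [NormedAddCommGroup EB] [NormedSpace ℝ EB] [FiniteDimensional ℝ EB]
  [TopologicalSpace HB]
  {I : ModelWithCorners ℝ E H} [I.Boundaryless]
  {JA : ModelWithCorners ℝ EA HA} [JA.Boundaryless]
  {JB : ModelWithCorners ℝ EB HB} [JB.Boundaryless]
  {G A B : Type*} [TopologicalSpace G] [ChartedSpace H G] [Group G] [LieGroup I ∞ G]
  [T2Space G] [SecondCountableTopology G]
  [TopologicalSpace A] [ChartedSpace HA A] [Group A] [LieGroup JA ∞ A]
  [TopologicalSpace B] [ChartedSpace HB B] [Group B] [LieGroup JB ∞ B]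
  (𝒟 : DoubleLieGroup I JA JB G A B)

  [MeasurableSpace G] [BorelSpace G] [MeasurableSpace A] [BorelSpace A] [MeasurableSpace B]
  [BorelSpace B] [IsTopologicalGroup G] [IsTopologicalGroup A] [IsTopologicalGroup B]
  [LocallyCompactSpace A] [LocallyCompactSpace B]
  [T2Space A] [T2Space B] [SecondCountableTopology A] [SecondCountableTopology B]
  (μ : Measure B) [μ.IsHaarMeasure] (ν : Measure A) [ν.IsHaarMeasure]
  [LocallyCompactSpace G] {ι : Type*} [Fintype ι] [DecidableEq ι]
  (X : Module.Basis ι ℝ (TangentSpace JB (1 : B)))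

namespace DoubleLieGroup

theorem mul_sq_iB (z : G × G) (b : B × B) :
    z * 𝒟.sq.iB b = (z.1 * 𝒟.iB b.1, z.2 * 𝒟.iB b.2) := rfl

theorem isEquivariantShift_fstShift : 𝒟.sq.IsEquivariantShift (𝒟.fstShift μ ν) where
  exists_eq p := ⟨((𝒟.act (𝒟.aL p.1.1) p.2)⁻¹, 1), by
    rw [sq_iB, map_inv, map_one]
    exact Prod.ext rfl (one_mul _).symm⟩
  toFun_mul z b y := by
    simp only [fstShift, leftShift_toFun, mul_sq_iB, aL_mul_iB, mul_assoc]
  weight_mul _ _ _ := rfl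

theorem isEquivariantShift_sndShift : 𝒟.sq.IsEquivariantShift (𝒟.sndShift μ ν) where
  exists_eq p := ⟨(1, (𝒟.act (𝒟.aL p.1.2) p.2)⁻¹), by
    rw [sq_iB, map_inv, map_one]
    exact Prod.ext (one_mul _).symm rfl⟩
  toFun_mul z b y := by
    simp only [sndShift, leftShift_toFun, mul_sq_iB, aL_mul_iB, mul_assoc]
  weight_mul _ _ _ := rfl

theorem isEquivariantShift_deltaShift : 𝒟.sq.IsEquivariantShift (𝒟.deltaShift μ ν) where
  exists_eq p := ⟨((𝒟.act (𝒟.aL p.1.1) (𝒟.act (𝒟.aL p.1.2) p.2))⁻¹,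
    (𝒟.act (𝒟.aL p.1.2) p.2)⁻¹), by
    rw [sq_iB, map_inv, map_inv]
    rfl⟩
  toFun_mul z b y := by
    simp only [deltaShift, mul_sq_iB, aL_mul_iB, mul_assoc]
  weight_mul z b y := by
    simp only [deltaShift, mul_sq_iB, aL_mul_iB]

variable {f f₁ : G → ℂ} (hf : f ∈ testFunctions I G) (hf₁ : f₁ ∈ testFunctions I G)

include hf in
theorem existsUnique_deltaHat : ∃! D, 𝒟.sq.IsMultiplierOf (sqBasis X) (μ.prod μ) (ν.prod ν)
    (𝒟.deltaHat μ X f) D := by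
  have h := existsUnique_isMultiplierOf (sqBasis X) (𝒟.isEquivariantShift_deltaShift μ ν)
    (𝒟.isShiftKernel_pullKernel (α := fun z : G × G => 𝒟.aL z.1 * 𝒟.aL z.2)
      ((𝒟.contMDiff_aL.comp contMDiff_fst).mul (𝒟.contMDiff_aL.comp contMDiff_snd)) hf)
    fun z b y => by simp only [pullKernel, mul_sq_iB, aL_mul_iB]
  rwa [← funext (𝒟.deltaHat_eq_op μ ν X f)] at h

include hf in
theorem existsUnique_oneTensor : ∃! L, 𝒟.sq.IsMultiplierOf (sqBasis X) (μ.prod μ) (ν.prod ν)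
    (𝒟.oneTensor μ f) L := by
  have h := existsUnique_isMultiplierOf (sqBasis X) (𝒟.isEquivariantShift_sndShift μ ν)
    (𝒟.isShiftKernel_pullKernel (α := fun z : G × G => 𝒟.aL z.2)
      (𝒟.contMDiff_aL.comp contMDiff_snd) hf)
    fun z b y => by simp only [pullKernel, mul_sq_iB, aL_mul_iB]
  rwa [← funext (𝒟.oneTensor_eq_op μ ν f)] at h

include hf in
theorem existsUnique_tensorOne : ∃! R, 𝒟.sq.IsMultiplierOf (sqBasis X) (μ.prod μ) (ν.prod ν)
    (𝒟.tensorOne μ f) R := by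
  have h := existsUnique_isMultiplierOf (sqBasis X) (𝒟.isEquivariantShift_fstShift μ ν)
    (𝒟.isShiftKernel_pullKernel (α := fun z : G × G => 𝒟.aL z.1)
      (𝒟.contMDiff_aL.comp contMDiff_fst) hf)
    fun z b y => by simp only [pullKernel, mul_sq_iB, aL_mul_iB]
  rwa [← funext (𝒟.tensorOne_eq_op μ ν f)] at h

end DoubleLieGroup

end

theorem proposition4p10
    {E EA EB : Type*}
    [NormedAddCommGroup E] [NormedSpace ℝ E] [FiniteDimensional ℝ E]
    [NormedAddCommGroup EA] [NormedSpace ℝ EA] [FiniteDimensional ℝ EA]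
    [NormedAddCommGroup EB] [NormedSpace ℝ EB] [FiniteDimensional ℝ EB]
    {G A B : Type*}
    [TopologicalSpace G] [ChartedSpace E G] [Group G] [LieGroup 𝓘(ℝ, E) ∞ G]
    [T2Space G] [SecondCountableTopology G] [MeasurableSpace G] [BorelSpace G]
    [TopologicalSpace A] [ChartedSpace EA A] [Group A] [LieGroup 𝓘(ℝ, EA) ∞ A]
    [MeasurableSpace A] [BorelSpace A]
    [TopologicalSpace B] [ChartedSpace EB B] [Group B] [LieGroup 𝓘(ℝ, EB) ∞ B]
    [MeasurableSpace B] [BorelSpace B]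
    (𝒟 : DoubleLieGroup 𝓘(ℝ, E) 𝓘(ℝ, EA) 𝓘(ℝ, EB) G A B)
    {ι : Type*} [Fintype ι] [DecidableEq ι]
    (X : Module.Basis ι ℝ (TangentSpace 𝓘(ℝ, EB) (1 : B)))
    (μ : Measure B) [μ.IsHaarMeasure] (ν : Measure A) [ν.IsHaarMeasure]
    (f f₁ : G → ℂ)
    (hf : 𝒟.mulOmega0 X f ∈ 𝒟.smoothBidensities ι)
    (hf₁ : 𝒟.mulOmega0 X f₁ ∈ 𝒟.smoothBidensities ι)
    (K₁ K₂ : G × G → ℂ)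
    (hK₁ : ∀ g₁ g₂ : G, K₁ (g₁, g₂) =
      ((|𝒟.psiB (𝒟.aL ((𝒟.iB (𝒟.bR g₁))⁻¹ * g₂))|⁻¹ *
        |𝒟.phiB (𝒟.bR g₁)| ^ (-(1 / 2) : ℝ) : ℝ) : ℂ) *
      f (g₁ * 𝒟.iA (𝒟.aL ((𝒟.iB (𝒟.bR g₁))⁻¹ * g₂))) *
      f₁ ((𝒟.iB (𝒟.bR g₁))⁻¹ * g₂))
    (hK₂ : ∀ g₁ g₂ : G, K₂ (g₁, g₂) =
      ((|𝒟.phiB (𝒟.bL g₂)| ^ (-(1 / 2) : ℝ) : ℝ) : ℂ) *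
      f (𝒟.iA (𝒟.aL g₁) * g₂) *
      f₁ ((𝒟.iB (𝒟.bL (𝒟.iA (𝒟.aL g₁) * g₂)))⁻¹ * g₁)) :
    -- the two candidates are smooth compactly supported bidensities on `G_A × G_A`
    𝒟.sq.mulOmega0 (DoubleLieGroup.sqBasis X) K₁ ∈ 𝒟.sq.smoothBidensities (ι ⊕ ι) ∧
    𝒟.sq.mulOmega0 (DoubleLieGroup.sqBasis X) K₂ ∈ 𝒟.sq.smoothBidensities (ι ⊕ ι) ∧
    -- `δ̂(f ω₀)`, `I ⊗ f₁ ω₀`, `f₁ ω₀ ⊗ I` are well defined multipliers of `C_r^*(G_A × G_A)`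
    (∃! D, 𝒟.sq.IsMultiplierOf (DoubleLieGroup.sqBasis X) (μ.prod μ) (ν.prod ν)
      (𝒟.deltaHat μ X f) D) ∧
    (∃! L, 𝒟.sq.IsMultiplierOf (DoubleLieGroup.sqBasis X) (μ.prod μ) (ν.prod ν)
      (𝒟.oneTensor μ f₁) L) ∧
    (∃! R, 𝒟.sq.IsMultiplierOf (DoubleLieGroup.sqBasis X) (μ.prod μ) (ν.prod ν)
      (𝒟.tensorOne μ f₁) R) ∧
    -- and their products in the multiplier algebra are the elements `K₁ (ω₀ ⊗ ω₀)`,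
    -- `K₂ (ω₀ ⊗ ω₀)` of `C_r^*(G_A × G_A)`
    ∀ D L R : 𝓜(ℂ, 𝒟.sq.reducedAlgebra (DoubleLieGroup.sqBasis X) (μ.prod μ) (ν.prod ν)),
      𝒟.sq.IsMultiplierOf (DoubleLieGroup.sqBasis X) (μ.prod μ) (ν.prod ν)
        (𝒟.deltaHat μ X f) D →
      𝒟.sq.IsMultiplierOf (DoubleLieGroup.sqBasis X) (μ.prod μ) (ν.prod ν)
        (𝒟.oneTensor μ f₁) L →
      𝒟.sq.IsMultiplierOf (DoubleLieGroup.sqBasis X) (μ.prod μ) (ν.prod ν)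
        (𝒟.tensorOne μ f₁) R →
      (∃ S : 𝒟.sq.reducedAlgebra (DoubleLieGroup.sqBasis X) (μ.prod μ) (ν.prod ν),
        𝒟.sq.IsRegRep (μ.prod μ) (ν.prod ν) K₁ S ∧ D * L = S) ∧
      ∃ S : 𝒟.sq.reducedAlgebra (DoubleLieGroup.sqBasis X) (μ.prod μ) (ν.prod ν),
        𝒟.sq.IsRegRep (μ.prod μ) (ν.prod ν) K₂ S ∧ D * R = S := by
  have : IsTopologicalGroup G := topologicalGroup_of_lieGroup 𝓘(ℝ, E) ∞
  have : IsTopologicalGroup A := topologicalGroup_of_lieGroup 𝓘(ℝ, EA) ∞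
  have : IsTopologicalGroup B := topologicalGroup_of_lieGroup 𝓘(ℝ, EB) ∞
  have : LocallyCompactSpace G := Manifold.locallyCompact_of_finiteDimensional 𝓘(ℝ, E)
  have : LocallyCompactSpace A := Manifold.locallyCompact_of_finiteDimensional 𝓘(ℝ, EA)
  have : LocallyCompactSpace B := Manifold.locallyCompact_of_finiteDimensional 𝓘(ℝ, EB)
  have := 𝒟.t2Space_A
  have := 𝒟.t2Space_B
  have := 𝒟.secondCountable_A
  have := 𝒟.secondCountable_B
  have hf' := (𝒟.mulOmega0_mem_iff X f).1 hf
  have hf₁' := (𝒟.mulOmega0_mem_iff X f₁).1 hf₁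
  have e₁ : K₁ = 𝒟.coeffOneTensor f f₁ := funext fun g => hK₁ g.1 g.2
  have e₂ : K₂ = 𝒟.coeffTensorOne f f₁ := funext fun g => hK₂ g.1 g.2
  have h₁ := 𝒟.coeffOneTensor_mem hf' hf₁'
  have h₂ := 𝒟.coeffTensorOne_mem hf' hf₁'
  rw [← e₁] at h₁
  rw [← e₂] at h₂
  refine ⟨(𝒟.sq.mulOmega0_mem_iff _ _).2 h₁, (𝒟.sq.mulOmega0_mem_iff _ _).2 h₂,
    𝒟.existsUnique_deltaHat μ ν X hf', 𝒟.existsUnique_oneTensor μ ν X hf₁',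
    𝒟.existsUnique_tensorOne μ ν X hf₁', fun D L R hD hL hR => ⟨?_, ?_⟩⟩
  · exact hD.mul_eq hL h₁ fun F hF => e₁ ▸ 𝒟.deltaHat_oneTensor μ X hf' hf₁' hF
  · exact hD.mul_eq hR h₂ fun F hF => e₂ ▸ 𝒟.deltaHat_tensorOne μ X hf' hf₁' hF
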